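/- **Setting.** Let $G$ be a maximal outerplanar graph with $n\ge 3$ vertices. An edge $(u,v)$ of a graph $H$ is a *cutting edge* of $H$ if $H-\{u,v\}$ is disconnected, and a *non-cutting edge* otherwise. For a cutting edge $(a,b)$ of a maximal outerplanar graph $H$, the two cut-components of $H$ at $(a,b)$ are the subgraphs induced by $\{a,b\}$ together with one component of $H-\{a,b\}$. An *outerplanar path* $P$ is a maximal outerplanar graph whose dual tree is a path; it *connects* the edges $e,e'$ if $e$ is incident to the first and $e'$ to the last face of this path. An *umbrella* of $H$ with cap a non-cutting edge $(u,v)$ is a subgraph $U=P\cup F_1\cup F_2$ of $H$ such that 1. $P$ (the *handle*) is an outerplanar path connecting $(u,v)$ to some other non-cutting edge of $H$; 2. $F_1$ (the fan at $u$) is empty or an outerplanar path containing only $u$ and neighbours of $u$; $F_2$ (the fan at $v$) is empty or an outerplanar path containing only $v$ and neighbours of $v$; 3. $F_1,F_2$ are edge-disjoint; each non-empty fan has exactly one edge in common with $P$, and this edge is incident to $u$ for $F_1$ and to $v$ for $F_2$; 4. all neighbours of $u$ and $v$ in $H$ belong to $U$. A *bonnet* is defined in the same way, except that 1 is replaced by: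 $P$ (the *ribbon*) is an outerplanar path that connects two distinct non-cutting edges of $H$ and contains $u$, $v$ and their common neighbour. An *anchor-edge* of $U$ in $H$ is an edge of $U$ that is a cutting edge of $H$ but not of $U$; its *hanging subgraph* is the cut-component of $H$ at it that does not contain $(u,v)$. An *umbrella (bonnet) system* on $H$ with root-edge $(u,v)$ is a collection of subgraphs consisting of an umbrella (bonnet) $U_0$ of $H$ with cap $(u,v)$ and, for each anchor-edge $(u_i,v_i)$ of $U_0$, the members of an umbrella (bonnet) system $\mathcal U_i$ with root-edge $(u_i,v_i)$ on the hanging subgraph at $(u_i,v_i)$. Its *depth* is $1+\max_i d(\mathcal U_i)$ (with $\max\emptyset=0$). The *rooted umbrella depth* $ud(H;u,v)$ and the *rooted bonnet depth* $bd(H;u,v)$ are the minimum depths of an umbrella system and of a bonnet system, respectively, on $H$ with root-edge $(u,v)$. **Depth variants.** Fix a non-cutting edge $(u,v)$ of $G$. For an edge $(a,b)$ of $G$ let $S_{a,b}$ be the cut-component of $G$ at $(a,b)$ that does not contain $(u,v)$ if $(a,b)$ is a cutting edge, the single edge $(a,b)$ if $(a,b)\ne(u,v)$ is a non-cutting edge,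 and $G$ if $(a,b)=(u,v)$. Let $bd(a,b):=bd(S_{a,b};a,b)$, and $bd(a,b):=0$ if $S_{a,b}$ is a single edge. For a family $\mathcal Q$ of subgraphs of $S_{a,b}$ consider $$1+\min_{U\in\mathcal Q}\ \max_{(x,y)}\ bd(x,y),$$ where $(x,y)\neq(a,b)$ ranges over the non-cutting edges of $U$. If $S_{a,b}$ is not a single edge, this expression defines * $bd^h(a,b)$, where $\mathcal Q$ consists of the handles, that is, the outerplanar paths in $S_{a,b}$ that connect $(a,b)$ to some other non-cutting edge of $S_{a,b}$; * $bd^{f_a}(a,b)$, where $\mathcal Q$ consists of the full fan at $a$ only, that is, the subgraph of $S_{a,b}$ induced by $a$ and its neighbours; similarly $bd^{f_b}(a,b)$; * $bd^{p_a}(a,b)$, where $\mathcal Q$ consists of the partial-$a$ umbrellas, that is, the unions of a handle $P$ and a (possibly empty) fan at $a$ as in 2 and 3 that contain all neighbours of $a$ in $S_{a,b}$; similarly $bd^{p_b}(a,b)$. If $S_{a,b}$ is a single edge, let $bd^t(a,b):=1$ for $t\in\{h,f_a,f_b,p_a,p_b\}$. **Theorem.** (A) *Recurrences.* We have $bd(u,v)=bd(G;u,v)$.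 For every edge $(a,b)$ of $G$ for which $S_{a,b}$ is not a single edge, $a$ and $b$ have exactly one common neighbour $c$ in $S_{a,b}$, and 1. $bd(a,b)=\max\{bd^{p_a}(a,c),\,bd^{p_b}(c,b)\}$, 2. $bd^h(a,b)=\min\left[\max\{bd^h(a,c),\,1+bd(c,b)\},\ \max\{1+bd(a,c),\,bd^h(c,b)\}\right]$, 3. $bd^{f_a}(a,b)=\max\{bd^{f_a}(a,c),\,1+bd(c,b)\}$, 4. $bd^{f_b}(a,b)=\max\{1+bd(a,c),\,bd^{f_b}(c,b)\}$, 5. $bd^{p_a}(a,b)=\min\left[\max\{bd^{p_a}(a,c),\,1+bd(c,b)\},\ \max\{bd^{f_a}(a,c),\,bd^h(c,b)\}\right]$, 6. $bd^{p_b}(a,b)=\min\left[\max\{1+bd(a,c),\,bd^{p_b}(c,b)\},\ \max\{bd^h(a,c),\,bd^{f_b}(c,b)\}\right]$. (B) *Algorithms.* There is an $O(n)$-time algorithm which, given a maximal outerplanar graph $G$ on the vertices $0,\dots,n-1$ by its adjacency lists (in arbitrary order) and a non-cutting edge $(u,v)$ of $G$, computes $ud(G;u,v)$ together with an umbrella system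 on $G$ with root-edge $(u,v)$ of this depth (each of its members being given by a list of its edges). Likewise, there is an $O(n)$-time algorithm which computes $bd(G;u,v)$ together with a bonnet system of this depth. Here the machine is a random access machine with addition and truncated subtraction at unit cost, and all of its words, in values and addresses, are bounded by $O(n)$. -/

import Mathlib

universe u

/-! ### Maximal outerplanar graphs -/

/-- `G` is outerplanar: its vertices can be placed on a circle (in the order given by `f`) so that
no two edges, drawn as chords, cross. -/
def IsOuterplanar {V : Type u} (G : SimpleGraph V) : Prop :=
  ∃ f : V → ℕ, Function.Injective f ∧
    ∀ a b c d, G.Adj a c → G.Adj b d → ¬ (f a < f b ∧ f b < f c ∧ f c < f d)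

/-- `G` is a maximal outerplanar graph with at least three (and finitely many) vertices: no edge
can be added without destroying outerplanarity. -/
def IsMaximalOuterplanar {V : Type u} (G : SimpleGraph V) : Prop :=
  3 ≤ Nat.card V ∧ Maximal IsOuterplanar G

section Graphs

variable {V : Type u} {G : SimpleGraph V}

/-- `(a, b)` is a cutting edge of `H`: an edge for which `H - {a, b}` is disconnected. -/
def IsCutting (H : G.Subgraph) (a b : V) : Prop :=
  H.Adj a b ∧ ¬ (H.deleteVerts {a, b}).Preconnected

/-- `(a, b)` is a non-cutting edge of `H`. -/
def IsNonCutting (H : G.Subgraph) (a b : V) : Prop :=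
  H.Adj a b ∧ (H.deleteVerts {a, b}).Preconnected

/-- The weak dual of a maximal outerplanar graph `H`. In the standard embedding the interior faces
are exactly the triangles of `H`; two of them are adjacent if they share an edge. -/
def dualTree (H : G.Subgraph) :
    SimpleGraph {t : Finset V // H.spanningCoe.IsNClique 3 t} where
  Adj s t := s ≠ t ∧ ∃ x y, x ≠ y ∧ x ∈ s.1 ∧ y ∈ s.1 ∧ x ∈ t.1 ∧ y ∈ t.1
  symm := ⟨by
    rintro s t ⟨h, x, y, hxy, h1, h2, h3, h4⟩
    exact ⟨h.symm, x, y, hxy, h3, h4, h1, h2⟩⟩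
  loopless := ⟨fun _ h => h.1 rfl⟩

/-- An outerplanar path: a maximal outerplanar graph whose dual tree is a path. -/
def IsOuterplanarPath (P : G.Subgraph) : Prop :=
  IsMaximalOuterplanar P.coe ∧ ∃ k, Nonempty (SimpleGraph.pathGraph k ≃g dualTree P)

/-- `P` is an outerplanar path that connects the edges `e` and `e'`: they are incident to the first
and to the last face, respectively, of the path that is the dual tree of `P`. -/
def ConnectsEdges (P : G.Subgraph) (e e' : Sym2 V) : Prop :=
  IsMaximalOuterplanar P.coe ∧
    ∃ (k : ℕ) (φ : SimpleGraph.pathGraph (k + 1) ≃g dualTree P),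
      (∀ x ∈ e, x ∈ (φ 0).1) ∧ ∀ x ∈ e', x ∈ (φ (Fin.last k)).1

/-! ### Umbrellas and bonnets -/

/-- `P` is an outerplanar path in `H` connecting `(u, v)` to some other non-cutting edge of `H`. -/
def IsHandle (H : G.Subgraph) (u v : V) (P : G.Subgraph) : Prop :=
  P ≤ H ∧ ∃ x y, IsNonCutting H x y ∧ s(x, y) ≠ s(u, v) ∧ ConnectsEdges P s(u, v) s(x, y)

/-- `P` is an outerplanar path in `H` that connects two non-cutting edges of `H` and contains
`u`, `v` and their common neighbour. -/
def IsRibbon (H : G.Subgraph) (u v : V) (P : G.Subgraph) : Prop :=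
  P ≤ H ∧
    (∃ x y x' y', IsNonCutting H x y ∧ IsNonCutting H x' y' ∧ s(x, y) ≠ s(x', y') ∧
      ConnectsEdges P s(x, y) s(x', y')) ∧
    u ∈ P.verts ∧ v ∈ P.verts ∧ ∃ c ∈ P.verts, H.Adj u c ∧ H.Adj c v

/-- `F` is a (possibly empty) fan at `w` for the handle or ribbon `P`: an outerplanar path
containing only `w` and neighbours of `w`, which has exactly one edge, incident to `w`, in common
with `P`. -/
def IsFan (H P : G.Subgraph) (w : V) (F : G.Subgraph) : Prop :=
  F = ⊥ ∨ (F ≤ H ∧ IsOuterplanarPath F ∧ F.verts ⊆ insert w (H.neighborSet w) ∧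
    ∃ x, F.edgeSet ∩ P.edgeSet = {s(w, x)})

/-- `U` is the union of `P` with a fan at `u` and a fan at `v`, and contains all neighbours of `u`
and `v`. -/
def IsUnionWithFans (H : G.Subgraph) (u v : V) (P U : G.Subgraph) : Prop :=
  ∃ F₁ F₂ : G.Subgraph, IsFan H P u F₁ ∧ IsFan H P v F₂ ∧ Disjoint F₁.edgeSet F₂.edgeSet ∧
    U = P ⊔ F₁ ⊔ F₂ ∧ H.neighborSet u ⊆ U.verts ∧ H.neighborSet v ⊆ U.verts

/-- `U` is an umbrella of `H` with cap `(u, v)`. -/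
def IsUmbrella (H : G.Subgraph) (u v : V) (U : G.Subgraph) : Prop :=
  IsNonCutting H u v ∧ ∃ P, IsHandle H u v P ∧ IsUnionWithFans H u v P U

/-- `U` is a bonnet of `H` with cap `(u, v)`. -/
def IsBonnet (H : G.Subgraph) (u v : V) (U : G.Subgraph) : Prop :=
  IsNonCutting H u v ∧ ∃ P, IsRibbon H u v P ∧ IsUnionWithFans H u v P U

/-- The anchor-edges of `U` in `H`: edges of `U` that are cutting edges of `H` but not of `U`. -/
def anchorEdges (H U : G.Subgraph) : Set (Sym2 V) :=
  {e | ∃ a b, e = s(a, b) ∧ U.Adj a b ∧ IsCutting H a b ∧ ¬ IsCutting U a b}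

/-- The subgraph `S_{a,b}` of `H` with respect to `(u, v)`, induced by `a`, `b` and all vertices
that `H - {a, b}` does not connect to `u` or to `v` (if `r ∈ {a, b}`, then nothing but `r` itself
is reachable from `r` below). For a cutting edge `(a, b)` of `H` this is the cut-component that
does not contain the edge `(u, v)`, for a non-cutting edge `(a, b) ≠ (u, v)` it is the single edge
`(a, b)`, and for `(a, b) = (u, v)` it is `H`. -/
def hanging (H : G.Subgraph) (u v a b : V) : G.Subgraph :=
  H.induce {x | x ∈ H.verts ∧ (x = a ∨ x = b ∨
    (¬ (H.deleteVerts {a, b}).spanningCoe.Reachable u x ∧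
     ¬ (H.deleteVerts {a, b}).spanningCoe.Reachable v x))}

end Graphs

/-- The two kinds of systems. -/
inductive SystemKind
  | umbrella
  | bonnet

section Systems

variable {V : Type u} {G : SimpleGraph V}

/-- `U` is an umbrella (a bonnet) of `H` with cap `(u, v)`. -/
def IsRoot (κ : SystemKind) (H : G.Subgraph) (u v : V) (U : G.Subgraph) : Prop :=
  match κ with
  | .umbrella => IsUmbrella H u v U
  | .bonnet => IsBonnet H u v U

/-- `IsSystem κ H u v 𝒰 d`: the collection `𝒰` of subgraphs is an umbrella (bonnet) system on `H`
with root-edge `(u, v)`, and its depth is `d`. It consists of a root umbrella (bonnet) `U` with cap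
`(u, v)` and, for every anchor-edge `(a, b)` of `U`, of a system on the hanging subgraph at `(a, b)`
with root-edge `(a, b)`. The depth is one more than the maximum depth of these systems (the maximum
is `0` if there is none of them). -/
inductive IsSystem (κ : SystemKind) : G.Subgraph → V → V → Set G.Subgraph → ℕ → Prop
  | mk (H : G.Subgraph) (u v : V) (U : G.Subgraph) (hU : IsRoot κ H u v U)
      (𝒰 : Sym2 V → Set G.Subgraph) (d : Sym2 V → ℕ) (m : ℕ)
      (h : ∀ a b, s(a, b) ∈ anchorEdges H U →
        IsSystem κ (hanging H u v a b) a b (𝒰 s(a, b)) (d s(a, b)))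
      (hm : IsLUB (d '' anchorEdges H U) m) :
      IsSystem κ H u v ({U} ∪ ⋃ e ∈ anchorEdges H U, 𝒰 e) (1 + m)

/-- The rooted umbrella (bonnet) depth of `H` with root-edge `(u, v)`: the minimum depth of an
umbrella (bonnet) system on `H` with this root-edge. -/
noncomputable def rootedDepth (κ : SystemKind) (H : G.Subgraph) (u v : V) : ℕ :=
  sInf {d | ∃ 𝒰, IsSystem κ H u v 𝒰 d}

end Systems

/-! ### The variants of the bonnet depth

In the following `(u, v)` is the root-edge of `G`, and `S_{a,b}` is `hanging ⊤ u v a b`. -/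

section Variants

variable {V : Type u}

/-- `S_{a,b}` consists of the single edge `(a, b)`. -/
def IsSingleEdge (G : SimpleGraph V) (u v a b : V) : Prop :=
  (hanging (⊤ : G.Subgraph) u v a b).edgeSet = {s(a, b)}

open Classical in
/-- The bonnet depth `bd(a, b)` of `S_{a,b}` with root-edge `(a, b)`; it is `0` if `S_{a,b}` is a
single edge. -/
noncomputable def bd (G : SimpleGraph V) (u v a b : V) : ℕ :=
  if IsSingleEdge G u v a b then 0
  else rootedDepth .bonnet (hanging (⊤ : G.Subgraph) u v a b) a b

open Classical in
/-- `1 + min_U max_{(x,y)} bd(x, y)`, where `U` ranges over the subgraphs of `S_{a,b}` with the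
property `Q` and `(x, y) ≠ (a, b)` over the non-cutting edges of `U`; it is `1` if `S_{a,b}` is a
single edge. -/
noncomputable def bdVariant (G : SimpleGraph V) (u v a b : V)
    (Q : G.Subgraph → G.Subgraph → Prop) : ℕ :=
  if IsSingleEdge G u v a b then 1
  else 1 + sInf {m | ∃ U, Q (hanging (⊤ : G.Subgraph) u v a b) U ∧
    IsGreatest {d | ∃ x y, IsNonCutting U x y ∧ s(x, y) ≠ s(a, b) ∧ d = bd G u v x y} m}

/-- The full fan of `S` at `w`: the vertex `w` and all its neighbours. -/
def IsFullFan {G : SimpleGraph V} (w : V) (S U : G.Subgraph) : Prop :=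
  U = S.induce (insert w (S.neighborSet w))

/-- A partial-`w` umbrella of `S` with cap `(a, b)`, where `w` is `a` or `b`: a handle and a fan at
`w`, containing all neighbours of `w`; the fan at the other end of the cap is empty. -/
def IsPartialUmbrella {G : SimpleGraph V} (a b w : V) (S U : G.Subgraph) : Prop :=
  ∃ P F : G.Subgraph, IsHandle S a b P ∧ IsFan S P w F ∧ U = P ⊔ F ∧ S.neighborSet w ⊆ U.verts

/-- `bd^h(a, b)` -/
noncomputable def bdHandle (G : SimpleGraph V) (u v a b : V) : ℕ :=
  bdVariant G u v a b (fun S U => IsHandle S a b U)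

/-- `bd^{f_a}(a, b)` -/
noncomputable def bdFanLeft (G : SimpleGraph V) (u v a b : V) : ℕ :=
  bdVariant G u v a b (IsFullFan a)

/-- `bd^{f_b}(a, b)` -/
noncomputable def bdFanRight (G : SimpleGraph V) (u v a b : V) : ℕ :=
  bdVariant G u v a b (IsFullFan b)

/-- `bd^{p_a}(a, b)` -/
noncomputable def bdPartialLeft (G : SimpleGraph V) (u v a b : V) : ℕ :=
  bdVariant G u v a b (IsPartialUmbrella a b a)

/-- `bd^{p_b}(a, b)` -/
noncomputable def bdPartialRight (G : SimpleGraph V) (u v a b : V) : ℕ :=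
  bdVariant G u v a b (IsPartialUmbrella a b b)

end Variants

/-! ### A random access machine with step count

Programs act on registers `reg 0, reg 1, …` and arrays `mem 0, mem 1, …` of words. A program
mentions finitely many of the registers and arrays only. -/

namespace RAM

/-- The contents of registers and arrays. -/
structure State where
  reg : ℕ → ℕ
  mem : ℕ → ℕ → ℕ

/-- Constants, registers, array cells, sums, and truncated differences. -/
inductive Expr
  | const (k : ℕ)
  | reg (i : ℕ)
  | cell (k : ℕ) (e : Expr)
  | add (e₁ e₂ : Expr)
  | sub (e₁ e₂ : Expr)

/-- The value of an expression. -/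
def Expr.eval (s : State) : Expr → ℕ
  | .const k => k
  | .reg i => s.reg i
  | .cell k e => s.mem k (e.eval s)
  | .add e₁ e₂ => e₁.eval s + e₂.eval s
  | .sub e₁ e₂ => e₁.eval s - e₂.eval s

/-- The number of operations for evaluating an expression. -/
def Expr.cost : Expr → ℕ
  | .const _ => 1
  | .reg _ => 1
  | .cell _ e => e.cost + 1
  | .add e₁ e₂ => e₁.cost + e₂.cost + 1
  | .sub e₁ e₂ => e₁.cost + e₂.cost + 1

/-- All words that occur in the evaluation of an expression are at most `W`. -/
def Expr.Fits (W : ℕ) (s : State) : Expr → Prop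
  | .const k => k ≤ W
  | .reg i => s.reg i ≤ W
  | .cell k e => e.Fits W s ∧ s.mem k (e.eval s) ≤ W
  | .add e₁ e₂ => e₁.Fits W s ∧ e₂.Fits W s ∧ e₁.eval s + e₂.eval s ≤ W
  | .sub e₁ e₂ => e₁.Fits W s ∧ e₂.Fits W s

/-- Programs. -/
inductive Program
  | skip
  | set (i : ℕ) (e : Expr)
  | store (k : ℕ) (e₁ e₂ : Expr)
  | seq (p q : Program)
  | ite (e : Expr) (p q : Program)
  | loop (e : Expr) (p : Program)

/-- `reg i := x` -/
def State.setReg (s : State) (i x : ℕ) : State :=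
  { s with reg := Function.update s.reg i x }

/-- `mem k [j] := x` -/
def State.setMem (s : State) (k j x : ℕ) : State :=
  { s with mem := Function.update s.mem k (Function.update (s.mem k) j x) }

/-- `Exec W p s t s'`: started in state `s`, the program `p` halts in state `s'` after `t` steps,
and all words that occur on the way (values as well as addresses) are at most `W`. Conditions of
`ite` and `loop` hold if the value of the expression is not zero. -/
inductive Exec (W : ℕ) : Program → State → ℕ → State → Prop
  | skip (s : State) : Exec W .skip s 1 s
  | set (i : ℕ) (e : Expr) (s : State) (h : e.Fits W s) :
      Exec W (.set i e) s (e.cost + 1) (s.setReg i (e.eval s))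
  | store (k : ℕ) (e₁ e₂ : Expr) (s : State) (h₁ : e₁.Fits W s) (h₂ : e₂.Fits W s) :
      Exec W (.store k e₁ e₂) s (e₁.cost + e₂.cost + 1) (s.setMem k (e₁.eval s) (e₂.eval s))
  | seq (p q : Program) (s s' s'' : State) (t t' : ℕ) (hp : Exec W p s t s')
      (hq : Exec W q s' t' s'') : Exec W (.seq p q) s (t + t') s''
  | ite_true (e : Expr) (p q : Program) (s s' : State) (t : ℕ) (h : e.Fits W s)
      (he : e.eval s ≠ 0) (hp : Exec W p s t s') : Exec W (.ite e p q) s (e.cost + 1 + t) s'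
  | ite_false (e : Expr) (p q : Program) (s s' : State) (t : ℕ) (h : e.Fits W s)
      (he : e.eval s = 0) (hq : Exec W q s t s') : Exec W (.ite e p q) s (e.cost + 1 + t) s'
  | loop_done (e : Expr) (p : Program) (s : State) (h : e.Fits W s) (he : e.eval s = 0) :
      Exec W (.loop e p) s (e.cost + 1) s
  | loop_step (e : Expr) (p : Program) (s s' s'' : State) (t t' : ℕ) (h : e.Fits W s)
      (he : e.eval s ≠ 0) (hp : Exec W p s t s') (hl : Exec W (.loop e p) s' t' s'') :
      Exec W (.loop e p) s (e.cost + 1 + t + t') s''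

/-- The initial state `s` holds the graph `G` on the vertices `0, …, n - 1` by its adjacency lists,
together with the edge `(u, v)`: `n`, `u`, `v` are in registers `0`, `1`, `2`, and the neighbours of
a vertex `x` are listed, without repetition and in an arbitrary order, in the cells of array `1`
from position `mem 0 [x]` up to, and excluding, position `mem 0 [x + 1]`. Everything else is `0`. -/
structure IsInput {n : ℕ} (G : SimpleGraph (Fin n)) (u v : Fin n) (s : State) : Prop where
  reg_zero : s.reg 0 = n
  reg_one : s.reg 1 = u
  reg_two : s.reg 2 = v
  reg_else : ∀ i, 3 ≤ i → s.reg i = 0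
  offset_zero : s.mem 0 0 = 0
  offset_le : ∀ x < n, s.mem 0 x ≤ s.mem 0 (x + 1)
  neighbors : ∀ x : Fin n, Set.BijOn (s.mem 1) (Set.Ico (s.mem 0 x) (s.mem 0 (x + 1)))
    ((fun y : Fin n => (y : ℕ)) '' G.neighborSet x)
  offset_else : ∀ i, n < i → s.mem 0 i = 0
  neighbors_else : ∀ i, s.mem 0 n ≤ i → s.mem 1 i = 0
  mem_else : ∀ k, 2 ≤ k → ∀ i, s.mem k i = 0

/-- The final state `s` holds the family `U 0, …, U (K - 1)` of subgraphs, given by lists of their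
edges: `K` is in register `1`, and for `i` less than register `2`, the cells `i` of the arrays
`2`, `3`, `4` hold an index `k < K` and the two ends of an edge of `U k`. -/
def HoldsFamily {n K : ℕ} {G : SimpleGraph (Fin n)} (s : State) (U : Fin K → G.Subgraph) : Prop :=
  s.reg 1 = K ∧
    (fun i => (s.mem 2 i, s(s.mem 3 i, s.mem 4 i))) '' Set.Iio (s.reg 2) =
      {q | ∃ (k : Fin K) (x y : Fin n), (U k).Adj x y ∧ q = ((k : ℕ), s((x : ℕ), (y : ℕ)))}

end RAM

/-! ### Triangulated polygons as binary trees -/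

/-! A maximal outerplanar graph with a non-cutting edge (u,v) is a triangulated polygon with outer
edge (u,v), and such a polygon is a binary tree: a node is the triangle at the base edge, with its
apex and the two triangulations at its other sides, and a leaf is an outer edge. The tree comes from
`exists_tri` and `exists_good_of_nonCutting`. A position function f on the vertices, increasing
along the polygon, turns nearly all of the planar geometry into inequalities.

The notions of the theorem then become statements about trees. The parts S_{a,b} are the subtrees
(`Good.hanging`), the cutting edges are the inner edges (`Good.cutting_iff`), the maximal
outerplanar subgraphs are the prunings of subtrees (`Good.exists_of_le`), the triangles are the
nodes (`Good.isNClique_iff`), and two triangles are adjacent in the dual tree if and only if they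
are parent and child. The anchor-edges of a root umbrella or bonnet are the leaves of its pruning at
which something nontrivial has been cut off (`Good.mem_anchorEdges`).

The central point is that handles, fans, partial umbrellas, umbrellas and bonnets are generated
locally. Every edge of such a subgraph has a mode, and the mode of an edge allows at most two pairs
of modes for the two sides of the triangle below it. For instance, a handle goes left or right; a
partial umbrella at a either goes on along the side at a, or its handle turns away from a and all
neighbours of a left behind must be covered by a full fan. `Shape` is the resulting class of
prunings. That it agrees with the definitions is the content of `Good.isHandle_iff`,
`Good.isRibbon_iff`, `fanUnion_handle_iff`, `Good.isFullFan_iff`, `Good.isUmbrella_iff` and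
`Good.isBonnet_iff`. Statements about the right end of a base edge are mostly obtained from those
about the left end by reflection.

Since the rules are local, the smallest possible maximum depth of what is cut off satisfies a
min-max recursion over the tree, `val`. Induction on systems gives the lower bound
(`Good.val_le_of_isSystem`), and taking the better rule everywhere gives a system that attains it
(`Good.isSystem_system`). Each variant of bd at an edge is 1 + `val` of the corresponding mode, so
the recurrences of (A) are one unfolding of `val`.

For (B), the tree is recovered by eliminating vertices of degree two and inserting them again in the
reverse order; thus the sides of a triangle get larger numbers than its base. A downward pass over
the numbers computes `val` for all modes, and an upward pass chooses modes and lists the edges of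
the subgraphs. The scans of adjacency lists are charged to the degrees, whose sum is linear. The
bound on the words follows from the bound on the time, because the program only ever adds constants
(`ExecF.exec`). -/

/-- A triangulation of a polygon with a distinguished base edge: either the base edge alone, or the
triangle at the base edge, with apex `c`, and triangulations at its two other sides. -/
inductive Tri (V : Type u)
  | leaf
  | node (c : V) (l r : Tri V)

namespace Tri

variable {V : Type u} {f : V → ℕ} {a b c x y z p q : V} {t t' l r s s' : Tri V}

/-- The vertices off the base edge, in the order of the polygon. -/
def inner : Tri V → List V
  | leaf => []
  | node c l r => inner l ++ c :: inner r

/-- `x` is a vertex of the triangulation `t` with base edge `(a, b)`. -/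
def Vert (a b : V) (t : Tri V) (x : V) : Prop := x = a ∨ x = b ∨ x ∈ t.inner

/-- `Sub a b t x y s`: in the triangulation `t` with base edge `(a, b)`, the part cut off by the
edge `(x, y)` is the triangulation `s`. -/
inductive Sub : V → V → Tri V → V → V → Tri V → Prop
  | refl (a b : V) (t : Tri V) : Sub a b t a b t
  | left {a b c x y : V} {l r s : Tri V} (h : Sub a c l x y s) : Sub a b (node c l r) x y s
  | right {a b c x y : V} {l r s : Tri V} (h : Sub c b r x y s) : Sub a b (node c l r) x y s

/-- The edges of a triangulation, oriented along the polygon. -/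
def Edge (a b : V) (t : Tri V) (x y : V) : Prop := ∃ s, Sub a b t x y s

/-- The positions `f` increase along the polygon from `a` to `b`. -/
def Sorted (f : V → ℕ) : V → V → Tri V → Prop
  | a, b, leaf => f a < f b
  | a, b, node c l r => Sorted f a c l ∧ Sorted f c b r

theorem sub_leaf : Sub a b leaf x y s ↔ x = a ∧ y = b ∧ s = leaf := by
  constructor
  · intro h; cases h; simp
  · rintro ⟨rfl, rfl, rfl⟩; exact .refl _ _ _

theorem sub_node : Sub a b (node c l r) x y s ↔
    (x = a ∧ y = b ∧ s = node c l r) ∨ Sub a c l x y s ∨ Sub c b r x y s := by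
  constructor
  · intro h
    cases h with
    | refl => simp
    | left h => exact .inr (.inl h)
    | right h => exact .inr (.inr h)
  · rintro (⟨rfl, rfl, rfl⟩ | h | h)
    · exact .refl _ _ _
    · exact .left h
    · exact .right h

theorem edge_leaf : Edge a b leaf x y ↔ x = a ∧ y = b := by simp [Edge, sub_leaf]

theorem edge_node : Edge a b (node c l r) x y ↔
    (x = a ∧ y = b) ∨ Edge a c l x y ∨ Edge c b r x y := by
  simp only [Edge, sub_node, exists_or]
  simp

theorem edge_base (a b : V) (t : Tri V) : Edge a b t a b := ⟨t, .refl _ _ _⟩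

theorem vert_leaf : Vert a b leaf x ↔ x = a ∨ x = b := by simp [Vert, inner]

theorem vert_node : Vert a b (node c l r) x ↔ Vert a c l x ∨ Vert c b r x := by
  simp only [Vert, inner, List.mem_append, List.mem_cons]; tauto

theorem vert_fst : Vert a b t a := .inl rfl

theorem vert_snd : Vert a b t b := .inr (.inl rfl)

theorem Sub.trans (h : Sub a b t x y s) (h' : Sub x y s p q s') : Sub a b t p q s' := by
  induction h with
  | refl => exact h'
  | left _ ih => exact .left (ih h')
  | right _ ih => exact .right (ih h')

theorem Sub.edge (h : Sub a b t x y s) : Edge a b t x y := ⟨s, h⟩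

theorem Sub.edge_of (h : Sub a b t x y s) (h' : Edge x y s p q) : Edge a b t p q := by
  obtain ⟨s', h'⟩ := h'
  exact ⟨s', h.trans h'⟩

theorem Sub.vert (h : Sub a b t x y s) (hz : Vert x y s z) : Vert a b t z := by
  induction h with
  | refl => exact hz
  | left _ ih => exact vert_node.2 (.inl (ih hz))
  | right _ ih => exact vert_node.2 (.inr (ih hz))

theorem Edge.vert (h : Edge a b t x y) : Vert a b t x ∧ Vert a b t y :=
  ⟨h.choose_spec.vert vert_fst, h.choose_spec.vert vert_snd⟩

theorem Sorted.lt (h : Sorted f a b t) : f a < f b := by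
  induction t generalizing a b with
  | leaf => exact h
  | node c l r ihl ihr => exact (ihl h.1).trans (ihr h.2)

theorem Sorted.inner (h : Sorted f a b t) (hx : x ∈ t.inner) : f a < f x ∧ f x < f b := by
  induction t generalizing a b with
  | leaf => simp [Tri.inner] at hx
  | node c l r ihl ihr =>
    have h1 := h.1.lt
    have h2 := h.2.lt
    simp only [Tri.inner, List.mem_append, List.mem_cons] at hx
    rcases hx with hx | rfl | hx
    · have := ihl h.1 hx; omega
    · omega
    · have := ihr h.2 hx; omega

theorem Sorted.vert (h : Sorted f a b t) (hx : Vert a b t x) : f a ≤ f x ∧ f x ≤ f b := by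
  have h0 := h.lt
  rcases hx with rfl | rfl | hx
  · omega
  · omega
  · have := h.inner hx; omega

theorem Sub.sorted (h : Sub a b t x y s) (hs : Sorted f a b t) :
    Sorted f x y s ∧ f a ≤ f x ∧ f y ≤ f b := by
  induction h with
  | refl => exact ⟨hs, le_rfl, le_rfl⟩
  | left _ ih => have := ih hs.1; have := hs.2.lt; exact ⟨(ih hs.1).1, by omega, by omega⟩
  | right _ ih => have := ih hs.2; have := hs.1.lt; exact ⟨(ih hs.2).1, by omega, by omega⟩

theorem Edge.lt (h : Edge a b t x y) (hs : Sorted f a b t) :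
    f a ≤ f x ∧ f x < f y ∧ f y ≤ f b := by
  obtain ⟨s, h⟩ := h
  have := h.sorted hs
  exact ⟨this.2.1, this.1.lt, this.2.2⟩

/-- The position of the apex separates the edges of the left part from those of the right part, and
the base edge spans everything; so a crossing would already occur inside one of the two parts. -/
theorem Edge.noncross (h : Edge a b t x y) (h' : Edge a b t p q) (hs : Sorted f a b t) :
    ¬ (f x < f p ∧ f p < f y ∧ f y < f q) := by
  induction t generalizing a b with
  | leaf =>
    rw [edge_leaf] at h h'
    obtain ⟨rfl, rfl⟩ := h
    obtain ⟨rfl, rfl⟩ := h'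
    omega
  | node c l r ihl ihr =>
    have b1 := h.lt hs
    have b2 := h'.lt hs
    rw [edge_node] at h h'
    rcases h with ⟨rfl, rfl⟩ | h | h
    · omega
    · rcases h' with ⟨rfl, rfl⟩ | h' | h'
      · omega
      · exact ihl h h' hs.1
      · have := h.lt hs.1; have := h'.lt hs.2; omega
    · rcases h' with ⟨rfl, rfl⟩ | h' | h'
      · omega
      · have := h.lt hs.2; have := h'.lt hs.1; omega
      · exact ihr h h' hs.2

/-- Positions alone decide to which part an edge belongs. This is how edges of the whole
triangulation are moved into a subtree. -/
theorem Edge.inside (h' : Edge a b t p q) (h : Sub a b t x y s) (hs : Sorted f a b t)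
    (hp : f x ≤ f p) (hq : f q ≤ f y) : Edge x y s p q := by
  have b0 := h'.lt hs
  induction h with
  | refl => exact h'
  | left h ih =>
    have b1 := hs.1.lt; have b2 := hs.2.lt; have b3 := h.sorted hs.1
    rcases edge_node.1 h' with ⟨rfl, rfl⟩ | h' | h'
    · omega
    · exact ih h' hs.1 hp hq (h'.lt hs.1)
    · have := h'.lt hs.2; omega
  | right h ih =>
    have b1 := hs.1.lt; have b2 := hs.2.lt; have b3 := h.sorted hs.2
    rcases edge_node.1 h' with ⟨rfl, rfl⟩ | h' | h'
    · omega
    · have := h'.lt hs.1; omega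
    · exact ih h' hs.2 hp hq (h'.lt hs.2)

theorem Vert.inside (hf : f.Injective) (h' : Vert a b t z) (h : Sub a b t x y s)
    (hs : Sorted f a b t) (hp : f x ≤ f z) (hq : f z ≤ f y) : Vert x y s z := by
  induction h with
  | refl => exact h'
  | left h ih =>
    have b3 := h.sorted hs.1
    rcases vert_node.1 h' with h' | h'
    · exact ih h' hs.1 hp hq
    · have := hs.2.vert h'
      obtain rfl := hf (le_antisymm this.1 (by omega))
      exact ih vert_snd hs.1 hp hq
  | right h ih =>
    have b3 := h.sorted hs.2
    rcases vert_node.1 h' with h' | h'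
    · have := hs.1.vert h'
      obtain rfl := hf (le_antisymm (by omega) this.2)
      exact ih vert_fst hs.2 hp hq
    · exact ih h' hs.2 hp hq

theorem Sub.eq_self (h : Sub a b t a b s) (hs : Sorted f a b t) : s = t := by
  cases h with
  | refl => rfl
  | left h => have := h.sorted hs.1; have := hs.2.lt; omega
  | right h => have := h.sorted hs.2; have := hs.1.lt; omega

/-- The two sides of a node occupy position intervals that meet only in the apex, so an edge occurs
at a single place of the tree. -/
theorem Sub.unique (h : Sub a b t x y s) (h' : Sub a b t x y s') (hs : Sorted f a b t) :
    s = s' := by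
  induction h with
  | refl => exact (h'.eq_self hs).symm
  | left h ih =>
    have b1 := hs.1.lt; have b2 := hs.2.lt; have b3 := h.sorted hs.1; have b4 := b3.1.lt
    rcases sub_node.1 h' with ⟨rfl, rfl, rfl⟩ | h' | h'
    · omega
    · exact ih h' hs.1
    · have := h'.sorted hs.2; omega
  | right h ih =>
    have b1 := hs.1.lt; have b2 := hs.2.lt; have b3 := h.sorted hs.2; have b4 := b3.1.lt
    rcases sub_node.1 h' with ⟨rfl, rfl, rfl⟩ | h' | h'
    · omega
    · have := h'.sorted hs.1; omega
    · exact ih h' hs.2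

theorem Sub.inside (h : Sub a b t x y s) (h' : Sub a b t p q s') (hs : Sorted f a b t)
    (hp : f x ≤ f p) (hq : f q ≤ f y) : Sub x y s p q s' := by
  obtain ⟨s'', h''⟩ := h'.edge.inside h hs hp hq
  rwa [(h.trans h'').unique h' hs] at h''

/-- Three pairwise adjacent vertices form one of the triangles. -/
theorem Sub.triangle (hf : f.Injective) (h : Sub a b t x y s) (h1 : Edge a b t x z)
    (h2 : Edge a b t z y) (hs : Sorted f a b t) : ∃ l r, s = node z l r := by
  have b1 := h1.lt hs; have b2 := h2.lt hs; have b3 := (h.sorted hs).1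
  have e1 := h1.inside h hs le_rfl (by omega)
  have e2 := h2.inside h hs (by omega) le_rfl
  cases s with
  | leaf => rw [edge_leaf] at e1; obtain ⟨-, rfl⟩ := e1; omega
  | node c l r =>
    -- The edge from x to z must lie in the left part and the edge from z to y in the right part, so
    -- z is neither after nor before the apex c.
    have : f z = f c := by
      rcases edge_node.1 e1 with ⟨-, rfl⟩ | e1 | e1
      · omega
      · have u1 := e1.lt b3.1
        rcases edge_node.1 e2 with ⟨rfl, -⟩ | e2 | e2
        · omega
        · have := e2.lt b3.1; have := b3.2.lt; omega
        · have := e2.lt b3.2; omega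
      · have := e1.lt b3.2; have := b3.1.lt; omega
    exact ⟨l, r, by rw [hf this]⟩

theorem Sub.apex_edges (h : Sub a b t x y (node c l r)) : Edge a b t x c ∧ Edge a b t c y :=
  ⟨⟨l, h.trans (.left (.refl _ _ _))⟩, ⟨r, h.trans (.right (.refl _ _ _))⟩⟩

/-- A vertex between the ends of an edge has no neighbour outside. -/
theorem Edge.noncross_left (h : Edge a b t x y) (h' : Edge a b t p q) (hs : Sorted f a b t)
    (h1 : f x < f q) (h2 : f q < f y) : f x ≤ f p := by
  by_contra h0
  exact h'.noncross h hs ⟨by omega, h1, h2⟩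

theorem Edge.noncross_right (h : Edge a b t x y) (h' : Edge a b t p q) (hs : Sorted f a b t)
    (h1 : f x < f p) (h2 : f p < f y) : f q ≤ f y := by
  by_contra h0
  exact h.noncross h' hs ⟨h1, h2, by omega⟩

/-- `t'` is obtained from `t` by cutting off parts. -/
inductive Prune : Tri V → Tri V → Prop
  | leaf (t : Tri V) : Prune leaf t
  | node {c : V} {l' l r' r : Tri V} (hl : Prune l' l) (hr : Prune r' r) :
      Prune (node c l' r') (node c l r)

theorem Prune.sorted (h : Prune t' t) (hs : Sorted f a b t) : Sorted f a b t' := by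
  induction h generalizing a b with
  | leaf t => exact hs.lt
  | node _ _ ihl ihr => exact ⟨ihl hs.1, ihr hs.2⟩

theorem Prune.sub (h : Prune t' t) (h' : Sub a b t' x y s') : ∃ s, Sub a b t x y s ∧ Prune s' s := by
  induction h generalizing a b with
  | leaf t => obtain ⟨rfl, rfl, rfl⟩ := sub_leaf.1 h'; exact ⟨t, .refl _ _ _, .leaf _⟩
  | node hl hr ihl ihr =>
    rcases sub_node.1 h' with ⟨rfl, rfl, rfl⟩ | h' | h'
    · exact ⟨_, .refl _ _ _, .node hl hr⟩
    · obtain ⟨s, h1, h2⟩ := ihl h'; exact ⟨s, .left h1, h2⟩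
    · obtain ⟨s, h1, h2⟩ := ihr h'; exact ⟨s, .right h1, h2⟩

theorem Prune.edge (h : Prune t' t) (h' : Edge a b t' x y) : Edge a b t x y := by
  obtain ⟨s, h'⟩ := h'
  obtain ⟨s, h', -⟩ := h.sub h'
  exact h'.edge

theorem Prune.vert (h : Prune t' t) (h' : Vert a b t' x) : Vert a b t x := by
  induction h generalizing a b with
  | leaf t => rcases vert_leaf.1 h' with rfl | rfl; exacts [vert_fst, vert_snd]
  | node hl hr ihl ihr =>
    rcases vert_node.1 h' with h' | h'
    · exact vert_node.2 (.inl (ihl h'))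
    · exact vert_node.2 (.inr (ihr h'))

/-- The apex of the smaller triangulation spans a triangle with the base edge in the larger one,
hence by `Sub.triangle` it is the apex there as well; then recurse at both sides. -/
theorem prune_of_edges (hf : f.Injective) (hs' : Sorted f a b t') (hs : Sorted f a b t)
    (h : ∀ x y, Edge a b t' x y → Edge a b t x y) : Prune t' t := by
  induction t' generalizing a b t with
  | leaf => exact .leaf _
  | node c l' r' ihl ihr =>
    obtain ⟨l, r, rfl⟩ := (Sub.refl a b t).triangle hf (h _ _ (Sub.refl a b _).apex_edges.1)
      (h _ _ (Sub.refl a b _).apex_edges.2) hs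
    refine .node (ihl hs'.1 hs.1 fun x y he => ?_) (ihr hs'.2 hs.2 fun x y he => ?_)
    · exact (h _ _ (edge_node.2 (.inr (.inl he)))).inside (.left (.refl _ _ _)) hs
        (he.lt hs'.1).1 (he.lt hs'.1).2.2
    · exact (h _ _ (edge_node.2 (.inr (.inr he)))).inside (.right (.refl _ _ _)) hs
        (he.lt hs'.2).1 (he.lt hs'.2).2.2

/-! ### Mirror images -/

/-- The mirror image. -/
def mirror : Tri V → Tri V
  | leaf => leaf
  | node c l r => node c r.mirror l.mirror

@[simp] theorem mirror_mirror (t : Tri V) : t.mirror.mirror = t := by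
  induction t with
  | leaf => rfl
  | node c l r ihl ihr => simp [mirror, ihl, ihr]

theorem Sub.mirror (h : Sub a b t x y s) : Sub b a t.mirror y x s.mirror := by
  induction h with
  | refl => exact .refl _ _ _
  | left _ ih => exact .right ih
  | right _ ih => exact .left ih

theorem edge_mirror : Edge b a t.mirror y x ↔ Edge a b t x y := by
  constructor
  · rintro ⟨s, h⟩; have := h.mirror; rw [mirror_mirror] at this; exact this.edge
  · rintro ⟨s, h⟩; exact h.mirror.edge

theorem vert_mirror : Vert b a t.mirror x ↔ Vert a b t x := by
  induction t generalizing a b with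
  | leaf => simp [Tri.mirror, vert_leaf, or_comm]
  | node c l r ihl ihr => rw [Tri.mirror, vert_node, vert_node, ihl, ihr, or_comm]

theorem Sorted.mirror {g : V → ℕ} (hs : Sorted f a b t) (hg : ∀ x y, f x < f y → g y < g x) :
    Sorted g b a t.mirror := by
  induction t generalizing a b with
  | leaf => exact hg _ _ hs
  | node c l r ihl ihr => exact ⟨ihr hs.2, ihl hs.1⟩

theorem Prune.mirror (h : Prune t' t) : Prune t'.mirror t.mirror := by
  induction h with
  | leaf t => exact .leaf _
  | node _ _ ihl ihr => exact .node ihr ihl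

end Tri

/-! ### Maximal outerplanar graphs are triangulated polygons -/

theorem exists_min_of_exists {α : Type*} (g : α → ℕ) {p : α → Prop} (h : ∃ z, p z) :
    ∃ z, p z ∧ ∀ z', p z' → g z ≤ g z' := by
  classical
  have h' : ∃ n, ∃ z, p z ∧ g z = n := by
    obtain ⟨z, hz⟩ := h
    exact ⟨_, z, hz, rfl⟩
  obtain ⟨z, hz, e⟩ := Nat.find_spec h'
  exact ⟨z, hz, fun z' hz' => e ▸ Nat.find_min' h' ⟨z', hz', rfl⟩⟩

/-- No two of the chords given by `R` cross if the vertices are placed according to `f`. -/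
def NonCrossing {V : Type u} (f : V → ℕ) (R : V → V → Prop) : Prop :=
  ∀ a b c d, R a c → R b d → ¬ (f a < f b ∧ f b < f c ∧ f c < f d)

/-- If some vertex lies between a and b, the chord from a to the nearest one crosses nothing, so a
has a neighbour in between. Let c be the last such neighbour before b. A chord crossing cb would
cross ab or ac, or be an edge from a to a later neighbour; so cb is an edge too, and one recurses on
ac and cb. The relation R lives on an arbitrary vertex set W so that subgraphs are covered as well.
-/
theorem exists_tri {V : Type u} {f : V → ℕ} (hf : f.Injective) {R : V → V → Prop} {W : Set V}
    (hsymm : ∀ x y, R x y → R y x) (hW : ∀ x y, R x y → x ∈ W) (hnc : NonCrossing f R)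
    (hmax : ∀ x y, x ∈ W → y ∈ W → f x < f y → (∀ p q, R p q →
      ¬ (f x < f p ∧ f p < f y ∧ f y < f q) ∧ ¬ (f p < f x ∧ f x < f q ∧ f q < f y)) → R x y)
    {a b : V} (hab : R a b) (hlt : f a < f b) :
    ∃ t, Tri.Sorted f a b t ∧
      (∀ x y, f a ≤ f x → f x < f y → f y ≤ f b → (R x y ↔ Tri.Edge a b t x y)) ∧
      ∀ x, f a ≤ f x → f x ≤ f b → (x ∈ W ↔ Tri.Vert a b t x) := by
  induction hn : f b - f a using Nat.strong_induction_on generalizing a b with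
  | _ n ih =>
  subst hn
  have ha := hW _ _ hab
  have hb := hW _ _ (hsymm _ _ hab)
  by_cases hw : ∃ w, w ∈ W ∧ f a < f w ∧ f w < f b
  · obtain ⟨w, ⟨hw, hw1, hw2⟩, hwm⟩ := exists_min_of_exists f hw
    have haw : R a w := by
      refine hmax _ _ ha hw hw1 fun p q hpq => ⟨fun h => ?_, fun h => ?_⟩
      · have := hwm p ⟨hW _ _ hpq, by omega, by omega⟩; omega
      · have := hwm q ⟨hW _ _ (hsymm _ _ hpq), by omega, by omega⟩; omega
    obtain ⟨c, ⟨hac, hc1, hc2⟩, hcm⟩ := exists_min_of_exists (fun z => f b - f z)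
      (p := fun z => R a z ∧ f a < f z ∧ f z < f b) ⟨w, haw, hw1, hw2⟩
    have hcm' : ∀ z, R a z → f c < f z → f z < f b → False := fun z h1 h2 h3 => by
      have := hcm z ⟨h1, by omega, h3⟩; omega
    have hcb : R c b := by
      refine hmax _ _ (hW _ _ (hsymm _ _ hac)) hb hc2 fun p q hpq => ⟨fun h => ?_, fun h => ?_⟩
      · exact hnc a p b q hab hpq (by omega)
      · rcases lt_trichotomy (f p) (f a) with h1 | h1 | h1
        · exact hnc p a q b hpq hab (by omega)
        · obtain rfl := hf h1
          exact hcm' q hpq (by omega) (by omega)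
        · exact hnc a p c q hac hpq (by omega)
    obtain ⟨l, l1, l2, l3⟩ := ih _ (by omega) hac hc1 rfl
    obtain ⟨r, r1, r2, r3⟩ := ih _ (by omega) hcb hc2 rfl
    refine ⟨.node c l r, ⟨l1, r1⟩, fun x y h1 h2 h3 => ?_, fun x h1 h2 => ?_⟩
    · rw [Tri.edge_node]
      constructor
      · intro h
        rcases le_or_gt (f y) (f c) with h4 | h4
        · exact .inr (.inl ((l2 x y h1 h2 h4).1 h))
        · rcases le_or_gt (f c) (f x) with h5 | h5
          · exact .inr (.inr ((r2 x y h5 h2 h3).1 h))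
          · rcases h1.eq_or_lt with h6 | h6
            · obtain rfl := hf h6
              rcases h3.eq_or_lt with h7 | h7
              · exact .inl ⟨rfl, hf h7⟩
              · exact (hcm' y h h4 h7).elim
            · exact (hnc a x c y hac h (by omega)).elim
      · rintro (⟨rfl, rfl⟩ | h | h)
        · exact hab
        · have := h.lt l1
          exact (l2 x y h1 h2 this.2.2).2 h
        · have := h.lt r1
          exact (r2 x y this.1 h2 h3).2 h
    · rw [Tri.vert_node]
      constructor
      · intro h
        rcases le_total (f x) (f c) with h4 | h4
        · exact .inl ((l3 x h1 h4).1 h)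
        · exact .inr ((r3 x h4 h2).1 h)
      · rintro (h | h)
        · exact (l3 x h1 (l1.vert h).2).2 h
        · exact (r3 x (r1.vert h).1 h2).2 h
  · have key : ∀ x ∈ W, f a ≤ f x → f x ≤ f b → x = a ∨ x = b := fun x hx h1 h2 => by
      by_contra h0
      push Not at h0
      have h3 := hf.ne h0.1
      have h4 := hf.ne h0.2
      exact hw ⟨x, hx, by omega, by omega⟩
    refine ⟨.leaf, hlt, fun x y h1 h2 h3 => ?_, fun x h1 h2 => ?_⟩
    · rw [Tri.edge_leaf]
      constructor
      · intro h
        have hx := key x (hW _ _ h) h1 (by omega)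
        have hy := key y (hW _ _ (hsymm _ _ h)) (by omega) h3
        rcases hx with rfl | rfl
        · rcases hy with rfl | rfl
          · omega
          · simp
        · omega
      · rintro ⟨rfl, rfl⟩; exact hab
    · rw [Tri.vert_leaf]
      exact ⟨fun h => key x h h1 h2, by rintro (rfl | rfl) <;> assumption⟩

/-- A chord that crosses no edge of a maximal outerplanar graph is an edge. -/
theorem adj_of_maximal {U : Type u} {X : SimpleGraph U} (hX : Maximal IsOuterplanar X) {f : U → ℕ}
    (hf : f.Injective) (hnc : NonCrossing f X.Adj) {x y : U} (hxy : f x < f y)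
    (h : ∀ p q, X.Adj p q →
      ¬ (f x < f p ∧ f p < f y ∧ f y < f q) ∧ ¬ (f p < f x ∧ f x < f q ∧ f q < f y)) :
    X.Adj x y := by
  have hne : x ≠ y := fun e => by subst e; omega
  have : IsOuterplanar (X ⊔ SimpleGraph.edge x y) := by
    refine ⟨f, hf, fun a b c d h1 h2 h3 => ?_⟩
    rw [SimpleGraph.sup_adj, SimpleGraph.edge_adj] at h1 h2
    rcases h1 with h1 | ⟨⟨rfl, rfl⟩ | ⟨rfl, rfl⟩, -⟩
    · rcases h2 with h2 | ⟨⟨rfl, rfl⟩ | ⟨rfl, rfl⟩, -⟩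
      · exact hnc a b c d h1 h2 h3
      · exact (h a c h1).2 h3
      · omega
    · rcases h2 with h2 | ⟨⟨rfl, rfl⟩ | ⟨rfl, rfl⟩, -⟩
      · exact (h b d h2).1 h3
      · omega
      · omega
    · omega
  refine hX.2 this le_sup_left ?_
  rw [SimpleGraph.sup_adj, SimpleGraph.edge_adj]
  exact .inr ⟨.inl ⟨rfl, rfl⟩, hne⟩

/-! ### Counting: k inner vertices give k + 2 vertices and 2k + 1 edges -/

namespace Tri
variable {V : Type u} {f : V → ℕ} {a b c x y z p q : V} {t t' l r s s' : Tri V}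

theorem edge_finite_ncard (hs : Sorted f a b t) :
    {e : V × V | Edge a b t e.1 e.2}.Finite ∧
    {e : V × V | Edge a b t e.1 e.2}.ncard = 2 * t.inner.length + 1 := by
  induction t generalizing a b with
  | leaf =>
    have : {e : V × V | Edge a b leaf e.1 e.2} = {(a, b)} := by
      ext ⟨x, y⟩; simp [edge_leaf]
    rw [this]
    simp [inner]
  | node c l r ihl ihr =>
    have : {e : V × V | Edge a b (node c l r) e.1 e.2} = insert (a, b)
        ({e : V × V | Edge a c l e.1 e.2} ∪ {e : V × V | Edge c b r e.1 e.2}) := by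
      ext ⟨x, y⟩; simp [edge_node]
    obtain ⟨l1, l2⟩ := ihl hs.1
    obtain ⟨r1, r2⟩ := ihr hs.2
    have hl := hs.1.lt
    have hr := hs.2.lt
    rw [this]
    refine ⟨(l1.union r1).insert _, ?_⟩
    rw [Set.ncard_insert_of_notMem _ (l1.union r1), Set.ncard_union_eq _ l1 r1, l2, r2]
    · simp [inner]; ring
    · rw [Set.disjoint_left]
      rintro ⟨x, y⟩ h1 h2
      have := Edge.lt h1 hs.1
      have := Edge.lt h2 hs.2
      simp only at *
      omega
    · rintro (h | h)
      · have := Edge.lt h hs.1; simp only at *; omega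
      · have := Edge.lt h hs.2; simp only at *; omega

theorem Sorted.inner_nodup (hs : Sorted f a b t) : t.inner.Nodup := by
  induction t generalizing a b with
  | leaf => simp [Tri.inner]
  | node c l r ihl ihr =>
    rw [Tri.inner, List.nodup_append, List.nodup_cons]
    refine ⟨ihl hs.1, ⟨fun h => ?_, ihr hs.2⟩, fun x hx y hy e => ?_⟩
    · have := hs.2.inner h; omega
    · subst e
      have h1 := hs.1.inner hx
      rcases List.mem_cons.1 hy with rfl | hy
      · omega
      · have := hs.2.inner hy; omega

theorem vert_finite_ncard (hs : Sorted f a b t) :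
    {x | Vert a b t x}.Finite ∧ {x | Vert a b t x}.ncard = t.inner.length + 2 := by
  classical
  have h0 := hs.lt
  have : {x | Vert a b t x} = ((a :: b :: t.inner).toFinset : Set V) := by
    ext x; simp [Vert]
  rw [this]
  refine ⟨Finset.finite_toSet _, ?_⟩
  rw [Set.ncard_coe_finset, List.toFinset_card_of_nodup]
  · simp
  · simp only [List.nodup_cons, List.mem_cons, not_or]
    refine ⟨⟨fun e => by subst e; omega, fun h => ?_⟩, fun h => ?_, hs.inner_nodup⟩
    · have := hs.inner h; omega
    · have := hs.inner h; omega

end Tri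

theorem ncard_edgeSet_eq {U : Type u} (X : SimpleGraph U) {f : U → ℕ} (hf : f.Injective) :
    X.edgeSet.ncard = {e : U × U | f e.1 < f e.2 ∧ X.Adj e.1 e.2}.ncard := by
  rw [← Set.InjOn.ncard_image (f := fun e : U × U => s(e.1, e.2))]
  · congr 1
    ext e
    induction e with | _ x y
    simp only [SimpleGraph.mem_edgeSet, Set.mem_image, Set.mem_ofPred_eq, Prod.exists]
    constructor
    · intro h
      rcases lt_or_gt_of_ne (hf.ne h.ne) with h1 | h1
      · exact ⟨x, y, ⟨h1, h⟩, rfl⟩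
      · exact ⟨y, x, ⟨h1, h.symm⟩, Sym2.eq_swap⟩
    · rintro ⟨x', y', ⟨-, h⟩, e⟩
      rw [← SimpleGraph.mem_edgeSet, ← e]
      exact h
  · rintro ⟨x, y⟩ ⟨h1, -⟩ ⟨x', y'⟩ ⟨h2, -⟩ e
    simp only [Sym2.eq_iff] at *
    rcases e with ⟨rfl, rfl⟩ | ⟨rfl, rfl⟩
    · rfl
    · omega

/-- The tree structure of a maximal outerplanar graph with respect to some base edge. -/
theorem exists_tri_of_maximal {U : Type u} [Finite U] {X : SimpleGraph U} (h2 : 2 ≤ Nat.card U)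
    (hX : Maximal IsOuterplanar X) {f : U → ℕ} (hf : f.Injective) (hnc : NonCrossing f X.Adj) :
    ∃ a b t, Tri.Sorted f a b t ∧ (∀ x y, f x < f y → (X.Adj x y ↔ Tri.Edge a b t x y)) ∧
      ∀ x, Tri.Vert a b t x := by
  have := Fintype.ofFinite U
  rw [Nat.card_eq_fintype_card] at h2
  have hne : Nonempty U := Fintype.card_pos_iff.1 (by omega)
  obtain ⟨a, ha⟩ := Finite.exists_min f
  obtain ⟨b, hb⟩ := Finite.exists_max f
  have hab : f a < f b := by
    refine lt_of_le_of_ne (ha b) fun e => ?_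
    have : Fintype.card U ≤ 1 := Fintype.card_le_one_iff.2 fun x y => hf (by
      have := ha x; have := ha y; have := hb x; have := hb y; omega)
    omega
  have hmax := fun x y (h : f x < f y) => adj_of_maximal hX hf hnc (x := x) (y := y) h
  have hR : X.Adj a b := hmax a b hab fun p q _ => by
    have := hb q; have := ha p; omega
  obtain ⟨t, t1, t2, t3⟩ := exists_tri hf (R := X.Adj) (W := Set.univ) (fun _ _ h => h.symm)
    (fun _ _ _ => trivial) hnc (fun x y _ _ h => hmax x y h) hR hab
  exact ⟨a, b, t, t1, fun x y h => t2 x y (ha x) h (hb y), fun x => (t3 x (ha x) (hb x)).1 trivial⟩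

theorem ncard_edgeSet_of_maximal {U : Type u} [Finite U] {X : SimpleGraph U} (h2 : 2 ≤ Nat.card U)
    (hX : Maximal IsOuterplanar X) : X.edgeSet.ncard + 3 = 2 * Nat.card U := by
  obtain ⟨f, hf, hnc⟩ := hX.1
  obtain ⟨a, b, t, t1, t2, t3⟩ := exists_tri_of_maximal h2 hX hf hnc
  have h1 := (Tri.edge_finite_ncard t1).2
  have h3 := (Tri.vert_finite_ncard t1).2
  have : {x | Tri.Vert a b t x} = Set.univ := Set.eq_univ_of_forall t3
  rw [this, Set.ncard_univ] at h3
  rw [ncard_edgeSet_eq X hf, h3]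
  have : {e : U × U | f e.1 < f e.2 ∧ X.Adj e.1 e.2} = {e : U × U | Tri.Edge a b t e.1 e.2} := by
    ext ⟨x, y⟩
    exact ⟨fun h => (t2 x y h.1).1 h.2, fun h => ⟨(h.lt t1).2.1, (t2 x y (h.lt t1).2.1).2 h⟩⟩
  rw [this, h1]
  ring

/-- Outerplanar graphs with `2 n - 3` edges are maximal. -/
theorem maximal_of_ncard {U : Type u} [Finite U] {X : SimpleGraph U} (h2 : 2 ≤ Nat.card U)
    (hX : IsOuterplanar X) (hc : X.edgeSet.ncard + 3 = 2 * Nat.card U) :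
    Maximal IsOuterplanar X := by
  -- Extend X to a maximal outerplanar graph Y. It has 2n - 3 edges as well, so nothing was added.
  obtain ⟨Y, hXY, hY⟩ := (Set.toFinite {Y : SimpleGraph U | IsOuterplanar Y}).exists_le_maximal hX
  have h1 := ncard_edgeSet_of_maximal h2 hY
  have : X.edgeSet = Y.edgeSet :=
    Set.eq_of_subset_of_ncard_le (SimpleGraph.edgeSet_mono hXY) (by omega) (Set.toFinite _)
  rw [SimpleGraph.edgeSet_inj] at this
  rw [this]
  exact hY

/-! ### Triangulations as subgraphs of G -/

namespace Tri
variable {V : Type u} {G : SimpleGraph V} {f : V → ℕ} {a b c x y z p q u v : V}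
  {t t' l r s s' : Tri V}

/-- The subgraph of `G` formed by a triangulation. -/
def toSub (G : SimpleGraph V) (a b : V) (t : Tri V) : G.Subgraph where
  verts := {x | Vert a b t x}
  Adj x y := G.Adj x y ∧ (Edge a b t x y ∨ Edge a b t y x)
  adj_sub h := h.1
  edge_vert h := by
    rcases h.2 with h | h
    · exact h.vert.1
    · exact h.vert.2
  symm := ⟨fun _ _ h => ⟨h.1.symm, h.2.symm⟩⟩

/-- `t` is a triangulation in `G` with base edge `(a, b)`, sorted according to `f`. -/
structure Good (G : SimpleGraph V) (f : V → ℕ) (a b : V) (t : Tri V) : Prop where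
  inj : f.Injective
  sorted : Sorted f a b t
  adj : ∀ x y, Edge a b t x y → G.Adj x y

theorem Good.sub (h : Good G f a b t) (h' : Sub a b t x y s) : Good G f x y s :=
  ⟨h.inj, (h'.sorted h.sorted).1, fun _ _ he => h.adj _ _ (h'.edge_of he)⟩

theorem Good.left (h : Good G f a b (node c l r)) : Good G f a c l := h.sub (.left (.refl _ _ _))

theorem Good.right (h : Good G f a b (node c l r)) : Good G f c b r := h.sub (.right (.refl _ _ _))

theorem Good.prune (h : Good G f a b t) (h' : Prune t' t) : Good G f a b t' :=
  ⟨h.inj, h'.sorted h.sorted, fun _ _ he => h.adj _ _ (h'.edge he)⟩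

theorem Good.lt (h : Good G f a b t) : f a < f b := h.sorted.lt

/-- Finiteness provides a largest position, in which the positions are reflected. All statements
about the right end b are transferred to the left end in this way. -/
theorem Good.mirror [Finite V] (h : Good G f a b t) : ∃ g, Good G g b a t.mirror := by
  have : Nonempty V := ⟨a⟩
  obtain ⟨m, hm⟩ := Finite.exists_max f
  refine ⟨fun x => f m - f x, fun x y e => h.inj ?_, h.sorted.mirror fun x y e => ?_,
    fun x y e => (h.adj _ _ (edge_mirror.1 e)).symm⟩
  · have := hm x; have := hm y; omega
  · have := hm x; have := hm y; omega

theorem toSub_mirror : toSub G b a t.mirror = toSub G a b t := by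
  ext x y
  · exact vert_mirror
  · simp only [toSub, edge_mirror]
    rw [or_comm]

theorem Good.toSub_adj (h : Good G f a b t) :
    (toSub G a b t).Adj x y ↔ Edge a b t x y ∨ Edge a b t y x := by
  refine ⟨fun h' => h'.2, fun h' => ⟨?_, h'⟩⟩
  rcases h' with h' | h'
  · exact h.adj _ _ h'
  · exact (h.adj _ _ h').symm

theorem Good.toSub_adj_lt (h : Good G f a b t) (hxy : f x < f y) :
    (toSub G a b t).Adj x y ↔ Edge a b t x y := by
  rw [h.toSub_adj]
  refine ⟨fun h' => h'.resolve_right fun h' => ?_, .inl⟩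
  have := h'.lt h.sorted
  omega

theorem mem_verts_toSub : x ∈ (toSub G a b t).verts ↔ Vert a b t x := Iff.rfl

theorem Good.noncrossing (h : Good G f a b t) : NonCrossing f (toSub G a b t).Adj := by
  intro x y z w h1 h2 h3
  rw [h.toSub_adj_lt (by omega)] at h1 h2
  exact h1.noncross h2 h.sorted h3

/-- A triangulated polygon is maximal outerplanar. -/
theorem Good.maximal (h : Good G f a b t) (ht : t ≠ leaf) :
    IsMaximalOuterplanar (toSub G a b t).coe := by
  have hv := vert_finite_ncard h.sorted
  have he := edge_finite_ncard h.sorted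
  have hfin : Finite (toSub G a b t).verts := hv.1
  have hcard : Nat.card (toSub G a b t).verts = t.inner.length + 2 := hv.2
  have hinj : Function.Injective fun x : (toSub G a b t).verts => f x :=
    fun x y e => Subtype.ext (h.inj e)
  have hpos : 1 ≤ t.inner.length := by
    cases t with
    | leaf => exact absurd rfl ht
    | node c l r => simp [inner]; omega
  refine ⟨by omega, maximal_of_ncard (by omega) ⟨_, hinj, fun x y z w h1 h2 h3 =>
    h.noncrossing x y z w h1 h2 h3⟩ ?_⟩
  rw [ncard_edgeSet_eq _ hinj, hcard, ← Set.ncard_image_of_injective _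
    (Subtype.val_injective.prodMap Subtype.val_injective)]
  rw [show (Prod.map Subtype.val Subtype.val '' _) = {e : V × V | Edge a b t e.1 e.2} from ?_, he.2]
  · ring
  · ext ⟨x, y⟩
    constructor
    · rintro ⟨⟨x', y'⟩, ⟨h1, h2⟩, e⟩
      simp only [Prod.map_apply, Prod.mk.injEq] at e
      obtain ⟨rfl, rfl⟩ := e
      exact (h.toSub_adj_lt h1).1 h2
    · intro e
      have h1 := (h.toSub_adj_lt (e.lt h.sorted).2.1).2 e
      exact ⟨(⟨x, e.vert.1⟩, ⟨y, e.vert.2⟩), ⟨(e.lt h.sorted).2.1, h1⟩, rfl⟩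

end Tri

/-- The base edge spans all vertices of P, so the tree found by `exists_tri` accounts for the whole
of P. -/
theorem exists_toSub_of_base {V : Type u} {G : SimpleGraph V} {P : G.Subgraph} {f : V → ℕ}
    (hf : f.Injective) (hP : Maximal IsOuterplanar P.coe) (hnc : NonCrossing f P.Adj) {a b : V}
    (hab : P.Adj a b) (hlt : f a < f b) (hb : ∀ x ∈ P.verts, f a ≤ f x ∧ f x ≤ f b) :
    ∃ p, Tri.Good G f a b p ∧ P = Tri.toSub G a b p := by
  obtain ⟨p, p1, p2, p3⟩ := exists_tri hf (R := P.Adj) (W := P.verts) (fun _ _ h => h.symm)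
    (fun _ _ h => h.fst_mem) hnc (fun x y hx hy h hc =>
      adj_of_maximal hP (f := fun z => f z) (x := ⟨x, hx⟩) (y := ⟨y, hy⟩)
        (fun x y e => Subtype.ext (hf e)) (fun x y z w h1 h2 h3 => hnc x y z w h1 h2 h3) h
        fun p q hpq => hc p q hpq) hab hlt
  have key : ∀ x y, f x < f y → (P.Adj x y ↔ Tri.Edge a b p x y) := fun x y h => by
    constructor
    · intro h'
      exact (p2 x y (hb _ h'.fst_mem).1 h (hb _ h'.snd_mem).2).1 h'
    · intro h'
      have := h'.lt p1
      exact (p2 x y this.1 h this.2.2).2 h'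
  have good : Tri.Good G f a b p :=
    ⟨hf, p1, fun x y h => P.adj_sub ((key x y (h.lt p1).2.1).2 h)⟩
  refine ⟨p, good, ?_⟩
  ext x y
  · rw [Tri.mem_verts_toSub]
    constructor
    · intro h; exact (p3 x (hb x h).1 (hb x h).2).1 h
    · intro h; exact (p3 x (p1.vert h).1 (p1.vert h).2).2 h
  · rcases lt_trichotomy (f x) (f y) with h | h | h
    · rw [key x y h, good.toSub_adj_lt h]
    · obtain rfl := hf h
      exact ⟨fun h => (h.ne rfl).elim, fun h => (h.ne rfl).elim⟩
    · rw [P.adj_comm, key y x h, (Tri.toSub G a b p).adj_comm, good.toSub_adj_lt h]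

/-! ### Maximal outerplanar subgraphs are prunings of subtrees -/

namespace Tri
variable {V : Type u} {G : SimpleGraph V} {f : V → ℕ} {a b c x y z p q u v : V}
  {t t' l r s s' : Tri V}

theorem toSub_le (h : Prune t' t) : toSub G a b t' ≤ toSub G a b t :=
  ⟨fun _ hx => h.vert hx, fun _ _ hx => ⟨hx.1, hx.2.imp h.edge h.edge⟩⟩

theorem toSub_le_of_sub (h : Sub a b t x y s) : toSub G x y s ≤ toSub G a b t :=
  ⟨fun _ hx => h.vert hx, fun _ _ hx => ⟨hx.1, hx.2.imp h.edge_of h.edge_of⟩⟩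

/-- The maximal outerplanar subgraphs of a triangulation. -/
theorem Good.exists_of_le (h : Good G f a b t) {P : G.Subgraph} (hP : P ≤ toSub G a b t)
    (hm : IsMaximalOuterplanar P.coe) : ∃ x y p s, P = toSub G x y p ∧ Good G f x y p ∧
      p ≠ leaf ∧ Sub a b t x y s ∧ Prune p s := by
  have hfin : Finite P.verts := Nat.finite_of_card_ne_zero (by have := hm.1; omega)
  have hnc : NonCrossing f P.Adj := fun x y z w h1 h2 => h.noncrossing x y z w (hP.2 h1) (hP.2 h2)
  have hinj : Function.Injective fun x : P.verts => f x := fun x y e => Subtype.ext (h.inj e)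
  -- The first and the last vertex of P are joined by an edge of P, which serves as its base.
  obtain ⟨x, y, hxy, hlt, hb⟩ : ∃ x y : V, P.Adj x y ∧ f x < f y ∧
      ∀ z ∈ P.verts, f x ≤ f z ∧ f z ≤ f y := by
    obtain ⟨x, y, p, h1, h2, h3⟩ := exists_tri_of_maximal (by have := hm.1; omega) hm.2 hinj
      (fun x y z w h1 h2 h3 => hnc x y z w h1 h2 h3)
    exact ⟨x, y, (h2 x y h1.lt).2 (edge_base _ _ _), h1.lt, fun z hz => h1.vert (h3 ⟨z, hz⟩)⟩
  obtain ⟨p, p1, rfl⟩ := exists_toSub_of_base h.inj hm.2 hnc hxy hlt hb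
  have hadj : ∀ z w, Edge x y p z w → Edge a b t z w := fun z w e =>
    (h.toSub_adj_lt (e.lt p1.sorted).2.1).1 (hP.2 ((p1.toSub_adj_lt (e.lt p1.sorted).2.1).2 e))
  obtain ⟨s, hs⟩ := hadj _ _ (edge_base _ _ _)
  have hs' := hs.sorted h.sorted
  refine ⟨x, y, p, s, rfl, p1, ?_, hs, prune_of_edges h.inj p1.sorted hs'.1 fun z w e => ?_⟩
  · rintro rfl
    have h4 := hm.1
    have h5 : Nat.card (toSub G (x : V) y leaf).verts = 2 := (vert_finite_ncard p1.sorted).2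
    omega
  · exact (hadj z w e).inside hs h.sorted (e.lt p1.sorted).1 (e.lt p1.sorted).2.2

end Tri

/-! ### Connectivity -/

theorem mem_of_reflTransGen {α : Type*} {R : α → α → Prop} {S : Set α} {x y : α}
    (h : Relation.ReflTransGen R x y) (hS : ∀ p q, R p q → p ∈ S → q ∈ S) (hx : x ∈ S) : y ∈ S := by
  induction h with
  | refl => exact hx
  | tail _ h ih => exact hS _ _ h ih

theorem preconnected_iff {V : Type u} {G : SimpleGraph V} (H : G.Subgraph) :
    H.Preconnected ↔ ∀ x y, x ∈ H.verts → y ∈ H.verts → Relation.ReflTransGen H.Adj x y := by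
  rw [SimpleGraph.Subgraph.preconnected_iff]
  constructor
  · intro h x y hx hy
    have := (SimpleGraph.reachable_iff_reflTransGen _ _).1 (h ⟨x, hx⟩ ⟨y, hy⟩)
    exact this.lift Subtype.val fun _ _ h => h
  · intro h x y
    rw [SimpleGraph.reachable_iff_reflTransGen]
    have := h x y x.2 y.2
    obtain ⟨x, hx⟩ := x
    obtain ⟨y, hy⟩ := y
    simp only at this
    clear h
    induction this with
    | refl => exact .refl
    | tail _ h ih => exact (ih h.fst_mem).tail h

/-- No edge crosses uv and the graph without u and v is connected, so all other vertices lie on the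
same side of uv on the circle. If this is the side outside the interval from u to v, the circle is
cut open elsewhere, so that u becomes first and v last. -/
theorem exists_good_of_nonCutting_of_lt {V : Type u} {G : SimpleGraph V} {u v : V}
    (hG : Maximal IsOuterplanar G) [Finite V] {f : V → ℕ} (hf : f.Injective)
    (hnc : NonCrossing f G.Adj) (huv : IsNonCutting (⊤ : G.Subgraph) u v) (hlt : f u < f v) :
    ∃ f t, Tri.Good G f u v t ∧ Tri.toSub G u v t = ⊤ := by
  have hadj : G.Adj u v := huv.1
  -- Maximality is carried over along the isomorphism between G and its full subgraph.
  have hmax : Maximal IsOuterplanar (⊤ : G.Subgraph).coe := by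
    let φ := SimpleGraph.Subgraph.topIso (G := G)
    have tr : ∀ {A B : Type u} {X : SimpleGraph A} {Y : SimpleGraph B}, X ≃g Y →
        IsOuterplanar Y → IsOuterplanar X := by
      rintro A B X Y e ⟨g, g1, g2⟩
      exact ⟨g ∘ e, g1.comp e.injective, fun a b c d h1 h2 =>
        g2 _ _ _ _ (e.map_adj_iff.2 h1) (e.map_adj_iff.2 h2)⟩
    refine ⟨tr φ hG.1, fun Y hY hle => ?_⟩
    have h1 := hG.2 (y := Y.map φ.toEquiv.toEmbedding)
      (tr (SimpleGraph.Iso.map φ.toEquiv Y).symm hY) (by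
        intro x y hxy
        rw [SimpleGraph.map_adj]
        exact ⟨φ.symm x, φ.symm y, hle (φ.symm.map_adj_iff.2 hxy), by simp, by simp⟩)
    intro x y hxy
    exact φ.map_adj_iff.1 (h1 ((SimpleGraph.map_adj_apply).2 hxy))
  have hor : (∀ x, f u ≤ f x ∧ f x ≤ f v) ∨ (∀ x, f x ≤ f u ∨ f v ≤ f x) := by
    by_contra h0
    push Not at h0
    obtain ⟨⟨y, hy⟩, x, hx⟩ := h0
    have h1 := (preconnected_iff _).1 huv.2 x y (by
      simp only [SimpleGraph.Subgraph.deleteVerts_verts, SimpleGraph.Subgraph.verts_top, Set.mem_sdiff, Set.mem_univ,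
        Set.mem_insert_iff, Set.mem_singleton_iff, true_and, not_or]
      constructor <;> rintro rfl <;> omega) (by
      simp only [SimpleGraph.Subgraph.deleteVerts_verts, SimpleGraph.Subgraph.verts_top, Set.mem_sdiff, Set.mem_univ,
        Set.mem_insert_iff, Set.mem_singleton_iff, true_and, not_or]
      constructor <;> rintro rfl
      · have := hy le_rfl; omega
      · have := hy hlt.le; omega)
    have h2 := mem_of_reflTransGen (S := {z | f u < f z ∧ f z < f v}) h1 (by
      intro p q hpq hp
      simp only [SimpleGraph.Subgraph.deleteVerts_adj, Set.mem_insert_iff, Set.mem_singleton_iff,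
        not_or] at hpq
      obtain ⟨-, -, -, ⟨h3, h4⟩, h5⟩ := hpq
      replace h3 := hf.ne h3
      replace h4 := hf.ne h4
      have h6 := hnc u p v q hadj h5
      have h7 := hnc q u p v (h5.symm) hadj
      simp only [Set.mem_ofPred_eq] at hp ⊢
      omega) hx
    have := hy h2.1.le
    have := h2.2
    omega
  rcases hor with hor | hor
  · obtain ⟨t, t1, t2⟩ := exists_toSub_of_base (P := ⊤) hf hmax hnc hadj hlt fun x _ => hor x
    exact ⟨f, t, t1, t2.symm⟩
  · have : Nonempty V := ⟨u⟩
    obtain ⟨m, hm⟩ := Finite.exists_max f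
    -- These positions run backwards from u to the first vertex, then jump to the last vertex and
    -- run backwards to v: u gets 0 and v the largest value.
    let g : V → ℕ := fun x => if f x ≤ f u then f u - f x else f m - f x + (f u + 1)
    have hg : ∀ x, (f x ≤ f u ∧ g x = f u - f x) ∨ (f v ≤ f x ∧ f u < f x ∧
        g x = f m - f x + (f u + 1)) := fun x => by
      have := hor x
      simp only [g]
      split_ifs
      · left; omega
      · right; omega
    obtain ⟨t, t1, t2⟩ := exists_toSub_of_base (P := ⊤) (f := g) (a := u) (b := v)
      (fun x y e => hf (by
        have := hg x; have := hg y; have := hm x; have := hm y; omega)) hmax (fun a b c d h1 h2 h3 => by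
        have e1 := hg a; have e2 := hg b; have e3 := hg c; have e4 := hg d
        have m1 := hm a; have m2 := hm b; have m3 := hm c; have m4 := hm d
        -- Reversing and rotating the circle keeps crossings; the four instances account for the
        -- place at which the circle is cut open.
        have c1 := hnc d c b a h2.symm h1.symm
        have c2 := hnc c b a d h1.symm h2
        have c3 := hnc b a d c h2 h1
        have c4 := hnc a d c b h1 h2.symm
        omega) hadj (by
        have := hg u; have := hg v; have := hm v; omega) fun x _ => by
          have := hg u; have := hg v; have := hg x; have := hm v; have := hm x; omega
    exact ⟨g, t, t1, t2.symm⟩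

theorem isNonCutting_comm {V : Type u} {G : SimpleGraph V} {H : G.Subgraph} {u v : V} :
    IsNonCutting H u v ↔ IsNonCutting H v u := by
  rw [IsNonCutting, IsNonCutting, H.adj_comm, Set.pair_comm]

theorem IsMaximalOuterplanar.finite {V : Type u} {G : SimpleGraph V}
    (hG : IsMaximalOuterplanar G) : Finite V :=
  Nat.finite_of_card_ne_zero (by have := hG.1; omega)

/-- A maximal outerplanar graph with a non-cutting edge `(u, v)` is a triangulated polygon with
base edge `(u, v)`. -/
theorem exists_good_of_nonCutting {V : Type u} {G : SimpleGraph V} {u v : V}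
    (hG : IsMaximalOuterplanar G) (huv : IsNonCutting (⊤ : G.Subgraph) u v) :
    ∃ f t, Tri.Good G f u v t ∧ Tri.toSub G u v t = ⊤ := by
  have := hG.finite
  obtain ⟨f, hf, hnc⟩ := hG.2.1
  rcases lt_or_gt_of_ne (hf.ne huv.1.ne) with h | h
  · exact exists_good_of_nonCutting_of_lt hG.2 hf hnc huv h
  · obtain ⟨g, t, h1, h2⟩ :=
      exists_good_of_nonCutting_of_lt hG.2 hf hnc (isNonCutting_comm.1 huv) h
    obtain ⟨g', h3⟩ := h1.mirror
    exact ⟨g', t.mirror, h3, by rw [Tri.toSub_mirror, h2]⟩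

/-! ### Cutting edges and hanging parts in a triangulation -/

namespace Tri
variable {V : Type u} {G : SimpleGraph V} {f : V → ℕ} {a b c x y z p q u v : V}
  {t t' l r s s' : Tri V}

/-- Vertices of a triangulated polygon are connected along the polygon. -/
theorem Sorted.connected (hf : f.Injective) (hs : Sorted f a b t) {K : V → V → Prop}
    (hx : Vert a b t x) (hy : Vert a b t y) (hxy : f x ≤ f y)
    (hK : ∀ p q, Edge a b t p q → f x ≤ f p → f q ≤ f y → K p q) :
    Relation.ReflTransGen K x y := by
  induction t generalizing a b x y with
  | leaf =>
    have h0 := hs.lt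
    rcases vert_leaf.1 hx with rfl | rfl <;> rcases vert_leaf.1 hy with rfl | rfl
    · exact .refl
    · exact .single (hK _ _ (edge_base _ _ _) le_rfl le_rfl)
    · omega
    · exact .refl
  | node c l r ihl ihr =>
    have hl : ∀ p q, Edge a c l p q → f x ≤ f p → f q ≤ f y → K p q :=
      fun p q h => hK p q (edge_node.2 (.inr (.inl h)))
    have hr : ∀ p q, Edge c b r p q → f x ≤ f p → f q ≤ f y → K p q :=
      fun p q h => hK p q (edge_node.2 (.inr (.inr h)))
    rcases vert_node.1 hx with hx | hx <;> rcases vert_node.1 hy with hy | hy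
    · exact ihl hs.1 hx hy hxy hl
    · have h1 := (hs.1.vert hx).2
      have h2 := (hs.2.vert hy).1
      exact (ihl hs.1 hx vert_snd h1 fun p q h h3 h4 => hl p q h h3 (h4.trans h2)).trans
        (ihr hs.2 vert_fst hy h2 fun p q h h3 h4 => hr p q h (h1.trans h3) h4)
    · have h1 := (hs.2.vert hx).1
      have h2 := (hs.1.vert hy).2
      obtain rfl := hf (le_antisymm hxy (by omega))
      exact .refl
    · exact ihr hs.2 hx hy hxy hr

theorem toSub_deleteVerts_adj : ((toSub G a b t).deleteVerts {x, y}).Adj p q ↔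
    (toSub G a b t).Adj p q ∧ p ≠ x ∧ p ≠ y ∧ q ≠ x ∧ q ≠ y := by
  simp only [SimpleGraph.Subgraph.deleteVerts_adj, Set.mem_insert_iff, Set.mem_singleton_iff,
    not_or]
  exact ⟨fun h => ⟨h.2.2.2.2, h.2.1.1, h.2.1.2, h.2.2.2.1⟩, fun h => ⟨h.1.fst_mem, ⟨h.2.1, h.2.2.1⟩,
    h.1.snd_mem, h.2.2.2, h.1⟩⟩

theorem mem_toSub_deleteVerts : z ∈ ((toSub G a b t).deleteVerts {x, y}).verts ↔
    Vert a b t z ∧ z ≠ x ∧ z ≠ y := by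
  simp [mem_verts_toSub]

theorem reflTransGen_comm {H : G.Subgraph} (h : Relation.ReflTransGen H.Adj x y) :
    Relation.ReflTransGen H.Adj y x := by
  have := H.symm
  have := Relation.ReflTransGen.stdSymm (r := H.Adj)
  exact this.symm _ _ h

/-- The edge `(x, y)` separates the vertices between its ends from the others. -/
theorem Good.closed (h : Good G f a b t) (hxy : Edge a b t x y) {p q : V}
    (hpq : ((toSub G a b t).deleteVerts {x, y}).Adj p q) :
    f x < f p ∧ f p < f y → f x < f q ∧ f q < f y := by
  intro hp
  rw [toSub_deleteVerts_adj, h.toSub_adj] at hpq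
  obtain ⟨h1, -, -, h2, h3⟩ := hpq
  have h2 := h.inj.ne h2
  have h3 := h.inj.ne h3
  rcases h1 with h1 | h1
  · have := hxy.noncross_right h1 h.sorted hp.1 hp.2; have := h1.lt h.sorted; omega
  · have := hxy.noncross_left h1 h.sorted hp.1 hp.2; have := h1.lt h.sorted; omega

/-- An edge with a triangle below it, other than the base, separates the apex of this triangle from
an end of the base. Conversely, the deletion of the ends of an outer edge leaves arcs of the
polygon, which are joined by the base edge if there are two of them. -/
theorem Good.nonCutting_iff (h : Good G f a b t) (hxy : f x < f y) :
    IsNonCutting (toSub G a b t) x y ↔ (x = a ∧ y = b) ∨ Sub a b t x y leaf := by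
  constructor
  · rintro ⟨h1, h2⟩
    by_contra h0
    push Not at h0
    rw [h.toSub_adj_lt hxy] at h1
    obtain ⟨s, hs⟩ := h1
    cases s with
    | leaf => exact h0.2 hs
    | node c l r =>
      have b1 := hs.sorted h.sorted
      have b2 := b1.1.1.lt
      have b3 := b1.1.2.lt
      have hc : Vert a b t c := hs.vert (vert_node.2 (.inl vert_snd))
      have hcx : c ≠ x := fun e => by subst e; omega
      have hcy : c ≠ y := fun e => by subst e; omega
      rw [preconnected_iff] at h2
      by_cases hx : x = a
      · subst hx
        have h4 : f y ≠ f b := h.inj.ne (h0.1 rfl)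
        have := mem_of_reflTransGen (S := {z | f x < f z ∧ f z < f y})
          (h2 c b (mem_toSub_deleteVerts.2 ⟨hc, hcx, hcy⟩) (mem_toSub_deleteVerts.2 ⟨vert_snd,
            fun e => by subst e; omega, fun e => by subst e; omega⟩))
          (fun p q hpq => h.closed hs.edge hpq) ⟨b2, b3⟩
        have := this.2
        omega
      · have h4 := h.inj.ne hx
        have := mem_of_reflTransGen (S := {z | f x < f z ∧ f z < f y})
          (h2 c a (mem_toSub_deleteVerts.2 ⟨hc, hcx, hcy⟩) (mem_toSub_deleteVerts.2 ⟨vert_fst,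
            fun e => by subst e; omega, fun e => by subst e; omega⟩))
          (fun p q hpq => h.closed hs.edge hpq) ⟨b2, b3⟩
        have := this.1
        omega
  · intro h0
    have hadj : Edge a b t x y := by
      rcases h0 with ⟨rfl, rfl⟩ | h0
      · exact edge_base _ _ _
      · exact h0.edge
    refine ⟨(h.toSub_adj_lt hxy).2 hadj, ?_⟩
    rw [preconnected_iff]
    have seg : ∀ p q, Vert a b t p → Vert a b t q → f p ≤ f q → (∀ z, f p ≤ f z → f z ≤ f q →
        z ≠ x ∧ z ≠ y) → Relation.ReflTransGen ((toSub G a b t).deleteVerts {x, y}).Adj p q := by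
      intro p q hp hq hpq hz
      refine h.sorted.connected h.inj hp hq hpq fun z w hzw h1 h2 => ?_
      have := hzw.lt h.sorted
      rw [toSub_deleteVerts_adj, h.toSub_adj]
      have h3 := hz z h1 (by omega)
      have h4 := hz w (by omega) h2
      exact ⟨.inl hzw, h3.1, h3.2, h4.1, h4.2⟩
    have key : ∀ p q, p ∈ ((toSub G a b t).deleteVerts {x, y}).verts →
        q ∈ ((toSub G a b t).deleteVerts {x, y}).verts → f p ≤ f q →
        Relation.ReflTransGen ((toSub G a b t).deleteVerts {x, y}).Adj p q := by
      intro p q hp hq hpq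
      rw [mem_toSub_deleteVerts] at hp hq
      obtain ⟨hp, hp1, hp2⟩ := hp
      obtain ⟨hq, hq1, hq2⟩ := hq
      have np1 := h.inj.ne hp1
      have np2 := h.inj.ne hp2
      have nq1 := h.inj.ne hq1
      have nq2 := h.inj.ne hq2
      have bp := h.sorted.vert hp
      have bq := h.sorted.vert hq
      by_cases hb : f p ≤ f x ∧ f y ≤ f q
      -- The vertices p and q are on different sides of the deleted edge: go back from p to a, use
      -- the base edge, and go back from b to q.
      · refine ((reflTransGen_comm (seg a p vert_fst hp bp.1 fun z h1 h2 => ?_)).tail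
          (c := b) ?_).trans (reflTransGen_comm (seg q b hq vert_snd bq.2 fun z h1 h2 => ?_))
        · exact ⟨fun e => by subst e; omega, fun e => by subst e; omega⟩
        · rw [toSub_deleteVerts_adj, h.toSub_adj]
          exact ⟨.inl (edge_base _ _ _), fun e => by subst e; omega, fun e => by subst e; omega,
            fun e => by subst e; omega, fun e => by subst e; omega⟩
        · exact ⟨fun e => by subst e; omega, fun e => by subst e; omega⟩
      · refine seg p q hp hq hpq fun z h1 h2 => ?_
        rcases h0 with ⟨rfl, rfl⟩ | h0
        · exact ⟨fun e => by subst e; omega, fun e => by subst e; omega⟩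
        · have out : ∀ w, Vert a b t w → ¬ (f x < f w ∧ f w < f y) := fun w hw h1 => by
            rcases vert_leaf.1 (hw.inside h.inj h0 h.sorted h1.1.le h1.2.le) with rfl | rfl <;> omega
          have := out p hp
          have := out q hq
          exact ⟨fun e => by subst e; omega, fun e => by subst e; omega⟩
    intro p q hp hq
    rcases le_total (f p) (f q) with h1 | h1
    · exact key p q hp hq h1
    · exact reflTransGen_comm (key q p hq hp h1)

theorem Good.cutting_iff (h : Good G f a b t) (hxy : f x < f y) :
    IsCutting (toSub G a b t) x y ↔ ¬ (x = a ∧ y = b) ∧ ∃ s, s ≠ leaf ∧ Sub a b t x y s := by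
  have h1 : IsCutting (toSub G a b t) x y ↔ (toSub G a b t).Adj x y ∧
      ¬ IsNonCutting (toSub G a b t) x y := by
    rw [IsCutting, IsNonCutting]; tauto
  rw [h1, h.nonCutting_iff hxy, h.toSub_adj_lt hxy]
  constructor
  · rintro ⟨⟨s, hs⟩, h2⟩
    push Not at h2
    exact ⟨fun h3 => h2.1 h3.1 h3.2, s, fun e => h2.2 (e ▸ hs), hs⟩
  · rintro ⟨h2, s, h3, hs⟩
    refine ⟨hs.edge, ?_⟩
    rintro (h4 | h4)
    · exact h2 h4
    · exact h3 (hs.unique h4 h.sorted)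

theorem isCutting_comm {H : G.Subgraph} : IsCutting H u v ↔ IsCutting H v u := by
  rw [IsCutting, IsCutting, H.adj_comm, Set.pair_comm]

theorem hanging_comm (H : G.Subgraph) : hanging H u v b a = hanging H u v a b := by
  rw [hanging, hanging, Set.pair_comm]
  congr 1
  ext x
  simp only [Set.mem_ofPred_eq]
  tauto

theorem hanging_comm_root (H : G.Subgraph) : hanging H v u a b = hanging H u v a b := by
  rw [hanging, hanging]
  congr 1
  ext x
  simp only [Set.mem_ofPred_eq]
  tauto

/-- The part of a triangulated polygon hanging at an edge. -/
theorem Good.hanging (h : Good G f u v t) (hs : Sub u v t a b s) :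
    hanging (toSub G u v t) u v a b = toSub G a b s := by
  have b1 := hs.sorted h.sorted
  have b2 := b1.1.lt
  have hset : {x | x ∈ (toSub G u v t).verts ∧ (x = a ∨ x = b ∨
      (¬ ((toSub G u v t).deleteVerts {a, b}).spanningCoe.Reachable u x ∧
       ¬ ((toSub G u v t).deleteVerts {a, b}).spanningCoe.Reachable v x))} =
      {x | Vert a b s x} := by
    ext x
    simp only [SimpleGraph.reachable_iff_reflTransGen, Set.mem_ofPred_eq, mem_verts_toSub]
    constructor
    · rintro ⟨hx, rfl | rfl | ⟨h1, h2⟩⟩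
      · exact vert_fst
      · exact vert_snd
      · have bx := h.sorted.vert hx
        -- A vertex before a is reached from u, and a vertex after b from v, along the polygon
        -- without meeting a or b.
        refine hx.inside h.inj hs h.sorted ?_ ?_
        · by_contra h3
          refine h1 (h.sorted.connected h.inj vert_fst hx bx.1 fun p q hpq h4 h5 => ?_)
          have := hpq.lt h.sorted
          rw [SimpleGraph.Subgraph.spanningCoe_adj, toSub_deleteVerts_adj, h.toSub_adj]
          exact ⟨.inl hpq, fun e => by subst e; omega, fun e => by subst e; omega,
            fun e => by subst e; omega, fun e => by subst e; omega⟩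
        · by_contra h3
          refine h2 (reflTransGen_comm (H := (toSub G u v t).deleteVerts {a, b})
            (h.sorted.connected h.inj hx vert_snd bx.2 fun p q hpq h4 h5 => ?_))
          have := hpq.lt h.sorted
          rw [toSub_deleteVerts_adj, h.toSub_adj]
          exact ⟨.inl hpq, fun e => by subst e; omega, fun e => by subst e; omega,
            fun e => by subst e; omega, fun e => by subst e; omega⟩
    · intro hx
      refine ⟨hs.vert hx, ?_⟩
      rcases hx with rfl | rfl | hx
      · exact .inl rfl
      · exact .inr (.inl rfl)
      · have bx := b1.1.inner hx
        have key : ∀ w, (f w ≤ f a ∨ f b ≤ f w) → ¬ Relation.ReflTransGen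
            ((toSub G u v t).deleteVerts {a, b}).Adj w x := by
          intro w hw hr
          have := mem_of_reflTransGen (S := {z | f a < f z ∧ f z < f b}) (reflTransGen_comm hr)
            (fun p q hpq => h.closed hs.edge hpq) bx
          have h1 := this.1
          have h2 := this.2
          omega
        exact .inr (.inr ⟨key u (.inl b1.2.1), key v (.inr b1.2.2)⟩)
  rw [_root_.hanging, hset]
  ext x y
  · rfl
  · simp only [SimpleGraph.Subgraph.induce_adj]
    constructor
    · rintro ⟨hx, hy, hxy⟩
      refine ⟨hxy.1, hxy.2.imp (fun e => ?_) (fun e => ?_)⟩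
      · exact e.inside hs h.sorted (b1.1.vert hx).1 (b1.1.vert hy).2
      · exact e.inside hs h.sorted (b1.1.vert hy).1 (b1.1.vert hx).2
    · intro hxy
      exact ⟨hxy.fst_mem, hxy.snd_mem, hxy.1, hxy.2.imp hs.edge_of hs.edge_of⟩

theorem edgeSet_toSub_leaf (h : Good G f a b leaf) : (toSub G a b leaf).edgeSet = {s(a, b)} := by
  ext e
  induction e with | _ x y
  rw [SimpleGraph.Subgraph.mem_edgeSet, h.toSub_adj, edge_leaf, edge_leaf, Set.mem_singleton_iff,
    Sym2.eq_iff]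
  tauto

theorem Good.isSingleEdge_iff (h : Good G f u v t) (htop : toSub G u v t = ⊤)
    (hs : Sub u v t a b s) : IsSingleEdge G u v a b ↔ s = leaf := by
  rw [IsSingleEdge, ← htop, h.hanging hs]
  constructor
  · intro he
    cases s with
    | leaf => rfl
    | node c l r =>
      have hg := h.sub hs
      have h1 : s(a, c) ∈ (toSub G a b (node c l r)).edgeSet :=
        hg.toSub_adj.2 (.inl (Sub.refl _ _ _).apex_edges.1)
      rw [he, Set.mem_singleton_iff, Sym2.eq_iff] at h1
      have := hg.left.lt
      have := hg.right.lt
      rcases h1 with ⟨-, rfl⟩ | ⟨rfl, rfl⟩ <;> omega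
  · rintro rfl
    exact edgeSet_toSub_leaf (h.sub hs)

end Tri

/-! ### Modes of covering -/

/-- The ways in which a part of the graph, hanging at an edge `(a, b)`, is covered by an umbrella or
a bonnet: not at all (`cut`), by a handle, by a fan at `a` or `b`, by a partial umbrella at `a` or
`b`, or by a complete umbrella or bonnet with cap `(a, b)` (`root`). -/
inductive Mode
  | cut
  | handle
  | fanLeft
  | fanRight
  | partLeft
  | partRight
  | root

namespace Mode

/-- The first way of continuing at the two other sides of the triangle at `(a, b)`; for `cut` this
is the first way of starting a new umbrella or bonnet. -/
def fst (κ : SystemKind) : Mode → Mode × Mode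
  | cut => match κ with
    -- The handle enters one side of the cap triangle, where it comes with the fan at the end of the
    -- cap on this side; the other end can only have a full fan. A ribbon may enter both sides,
    -- hence the two partial umbrellas for bonnets.
    | .umbrella => (partLeft, fanRight)
    | .bonnet => (partLeft, partRight)
  | handle => (handle, cut)
  | fanLeft => (fanLeft, cut)
  | fanRight => (cut, fanRight)
  | partLeft => (partLeft, cut)
  | partRight => (cut, partRight)
  | root => match κ with
    | .umbrella => (partLeft, fanRight)
    | .bonnet => (partLeft, partRight)

/-- The second way of continuing. -/
def snd (κ : SystemKind) : Mode → Mode × Mode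
  | cut => match κ with
    | .umbrella => (fanLeft, partRight)
    | .bonnet => (partLeft, partRight)
  | handle => (cut, handle)
  | fanLeft => (fanLeft, cut)
  | fanRight => (cut, fanRight)
  -- The handle turns to the side away from a, so the neighbours of a behind the other side have to
  -- be covered by a full fan.
  | partLeft => (fanLeft, handle)
  | partRight => (handle, fanRight)
  | root => match κ with
    | .umbrella => (fanLeft, partRight)
    | .bonnet => (partLeft, partRight)

/-- The number of umbrellas or bonnets that are started. -/
def bump : Mode → ℕ
  | cut => 1
  | _ => 0

/-- The mirror image. -/
def mirror : Mode → Mode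
  | cut => cut
  | handle => handle
  | fanLeft => fanRight
  | fanRight => fanLeft
  | partLeft => partRight
  | partRight => partLeft
  | root => root

theorem bump_ne_zero {m : Mode} : m.bump ≠ 0 ↔ m = cut := by cases m <;> simp [bump]

/-- `(m₁, m₂)` is one of the ways of continuing. -/
def Rule (κ : SystemKind) (m m₁ m₂ : Mode) : Prop :=
  (m₁, m₂) = m.fst κ ∨ (m₁, m₂) = m.snd κ

theorem Rule.mirror {κ : SystemKind} {m m₁ m₂ : Mode} (h : Rule κ m m₁ m₂) :
    Rule κ m.mirror m₂.mirror m₁.mirror := by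
  cases κ <;> cases m <;> simp_all [Rule, fst, snd, Mode.mirror] <;>
    rcases h with ⟨rfl, rfl⟩ | ⟨rfl, rfl⟩ <;> simp

end Mode

namespace Tri
variable {V : Type u} {G : SimpleGraph V} {f : V → ℕ} {a b c x y z p q u v : V}
  {t t' l r s s' l' r' : Tri V} {κ : SystemKind} {m : Mode}

open Mode

/-- `t'` is a part of `t` that covers `t` in the given mode. -/
def Shape (κ : SystemKind) : Mode → Tri V → Tri V → Prop
  | _, t', leaf => t' = leaf
  | m, t', node c l r => (m = cut ∧ t' = leaf) ∨ (m ≠ cut ∧ ∃ m₁ m₂ l' r', Rule κ m m₁ m₂ ∧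
      t' = node c l' r' ∧ Shape κ m₁ l' l ∧ Shape κ m₂ r' r)

@[simp] theorem shape_leaf : Shape κ m t' leaf ↔ t' = leaf := Iff.rfl

@[simp] theorem shape_cut : Shape κ cut t' t ↔ t' = leaf := by
  cases t <;> simp [Shape]

theorem shape_node (hm : m ≠ cut) : Shape κ m t' (node c l r) ↔
    ∃ m₁ m₂ l' r', Rule κ m m₁ m₂ ∧ t' = node c l' r' ∧ Shape κ m₁ l' l ∧ Shape κ m₂ r' r := by
  rw [Shape]
  simp [hm]

theorem Shape.prune (h : Shape κ m t' t) : Prune t' t := by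
  induction t generalizing m t' with
  | leaf => obtain rfl := h; exact .leaf _
  | node c l r ihl ihr =>
    rcases h with ⟨-, rfl⟩ | ⟨-, m1, m2, l', r', -, rfl, h1, h2⟩
    · exact .leaf _
    · exact .node (ihl h1) (ihr h2)

theorem Shape.mirror (h : Shape κ m t' t) : Shape κ m.mirror t'.mirror t.mirror := by
  induction t generalizing m t' with
  | leaf => obtain rfl := h; rfl
  | node c l r ihl ihr =>
    rcases h with ⟨rfl, rfl⟩ | ⟨hm, m1, m2, l', r', hr, rfl, h1, h2⟩
    · exact shape_cut.2 rfl
    · refine (shape_node (by cases m <;> simp_all [Mode.mirror])).2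
        ⟨_, _, _, _, hr.mirror, rfl, ihr h2, ihl h1⟩

theorem shape_handle_node : Shape κ handle t' (node c l r) ↔
    (∃ l', t' = node c l' leaf ∧ Shape κ handle l' l) ∨
    (∃ r', t' = node c leaf r' ∧ Shape κ handle r' r) := by
  rw [shape_node (by simp)]
  constructor
  · rintro ⟨m1, m2, l', r', h1 | h1, rfl, h2, h3⟩ <;> simp only [Mode.fst, Mode.snd, Prod.mk.injEq] at h1 <;>
      obtain ⟨rfl, rfl⟩ := h1
    · obtain rfl := shape_cut.1 h3; exact .inl ⟨l', rfl, h2⟩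
    · obtain rfl := shape_cut.1 h2; exact .inr ⟨r', rfl, h3⟩
  · rintro (⟨l', rfl, h⟩ | ⟨r', rfl, h⟩)
    · exact ⟨_, _, _, _, .inl rfl, rfl, h, shape_cut.2 rfl⟩
    · exact ⟨_, _, _, _, .inr rfl, rfl, shape_cut.2 rfl, h⟩

theorem shape_fanLeft_node : Shape κ fanLeft t' (node c l r) ↔
    ∃ l', t' = node c l' leaf ∧ Shape κ fanLeft l' l := by
  rw [shape_node (by simp)]
  constructor
  · rintro ⟨m1, m2, l', r', h1 | h1, rfl, h2, h3⟩ <;> simp only [Mode.fst, Mode.snd, Prod.mk.injEq] at h1 <;>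
      obtain ⟨rfl, rfl⟩ := h1 <;> obtain rfl := shape_cut.1 h3 <;> exact ⟨l', rfl, h2⟩
  · rintro ⟨l', rfl, h⟩
    exact ⟨_, _, _, _, .inl rfl, rfl, h, shape_cut.2 rfl⟩

theorem shape_partLeft_node : Shape κ partLeft t' (node c l r) ↔
    (∃ l', t' = node c l' leaf ∧ Shape κ partLeft l' l) ∨
    (∃ l' r', t' = node c l' r' ∧ Shape κ fanLeft l' l ∧ Shape κ handle r' r) := by
  rw [shape_node (by simp)]
  constructor
  · rintro ⟨m1, m2, l', r', h1 | h1, rfl, h2, h3⟩ <;> simp only [Mode.fst, Mode.snd, Prod.mk.injEq] at h1 <;>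
      obtain ⟨rfl, rfl⟩ := h1
    · obtain rfl := shape_cut.1 h3; exact .inl ⟨l', rfl, h2⟩
    · exact .inr ⟨l', r', rfl, h2, h3⟩
  · rintro (⟨l', rfl, h⟩ | ⟨l', r', rfl, h, h'⟩)
    · exact ⟨_, _, _, _, .inl rfl, rfl, h, shape_cut.2 rfl⟩
    · exact ⟨_, _, _, _, .inr rfl, rfl, h, h'⟩

theorem shape_root_bonnet_node : Shape .bonnet root t' (node c l r) ↔
    ∃ l' r', t' = node c l' r' ∧ Shape .bonnet partLeft l' l ∧ Shape .bonnet partRight r' r := by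
  rw [shape_node (by simp)]
  constructor
  · rintro ⟨m1, m2, l', r', h1 | h1, rfl, h2, h3⟩ <;> simp only [Mode.fst, Mode.snd, Prod.mk.injEq] at h1 <;>
      obtain ⟨rfl, rfl⟩ := h1 <;> exact ⟨l', r', rfl, h2, h3⟩
  · rintro ⟨l', r', rfl, h, h'⟩
    exact ⟨_, _, _, _, .inl rfl, rfl, h, h'⟩

theorem shape_root_umbrella_node : Shape .umbrella root t' (node c l r) ↔
    ∃ l' r', t' = node c l' r' ∧
      ((Shape .umbrella partLeft l' l ∧ Shape .umbrella fanRight r' r) ∨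
       (Shape .umbrella fanLeft l' l ∧ Shape .umbrella partRight r' r)) := by
  rw [shape_node (by simp)]
  constructor
  · rintro ⟨m1, m2, l', r', h1 | h1, rfl, h2, h3⟩ <;> simp only [Mode.fst, Mode.snd, Prod.mk.injEq] at h1 <;>
      obtain ⟨rfl, rfl⟩ := h1
    · exact ⟨l', r', rfl, .inl ⟨h2, h3⟩⟩
    · exact ⟨l', r', rfl, .inr ⟨h2, h3⟩⟩
  · rintro ⟨l', r', rfl, ⟨h, h'⟩ | ⟨h, h'⟩⟩
    · exact ⟨_, _, _, _, .inl rfl, rfl, h, h'⟩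
    · exact ⟨_, _, _, _, .inr rfl, rfl, h, h'⟩

/-- A full fan is the handle that always continues at the side containing a. -/
theorem Shape.handle_of_fanLeft (h : Shape κ fanLeft t' t) : Shape κ handle t' t := by
  induction t generalizing t' with
  | leaf => exact h
  | node c l r ihl _ =>
    obtain ⟨l', rfl, h'⟩ := shape_fanLeft_node.1 h
    exact shape_handle_node.2 (.inl ⟨l', rfl, ihl h'⟩)

theorem Shape.partLeft_of_fanLeft (h : Shape κ fanLeft t' t) : Shape κ partLeft t' t := by
  induction t generalizing t' with
  | leaf => exact h
  | node c l r ihl _ =>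
    obtain ⟨l', rfl, h'⟩ := shape_fanLeft_node.1 h
    exact shape_partLeft_node.2 (.inl ⟨l', rfl, ihl h'⟩)

/-! ### The optimal value -/

/-- The minimum, over the parts of `t` that cover it in the given mode, of the maximum depth of what
remains; for `cut` the depth of `t`. -/
def val (κ : SystemKind) : Mode → Tri V → ℕ
  | _, leaf => 0
  | m, node _ l r => m.bump + min (max (val κ (m.fst κ).1 l) (val κ (m.fst κ).2 r))
      (max (val κ (m.snd κ).1 l) (val κ (m.snd κ).2 r))

/-- The better one of the two ways of continuing. -/
def choice (κ : SystemKind) (m : Mode) (l r : Tri V) : Mode × Mode :=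
  if max (val κ (m.fst κ).1 l) (val κ (m.fst κ).2 r) ≤
    max (val κ (m.snd κ).1 l) (val κ (m.snd κ).2 r) then m.fst κ else m.snd κ

/-- An optimal part of `t` that covers it in the given mode. -/
def best (κ : SystemKind) : Mode → Tri V → Tri V
  | _, leaf => leaf
  | cut, node _ _ _ => leaf
  | m, node c l r => node c (best κ (choice κ m l r).1 l) (best κ (choice κ m l r).2 r)

/-- The maximum of `D` over the parts of `t` that are cut off in order to obtain `t'`. -/
def cost (D : Tri V → ℕ) : Tri V → Tri V → ℕ
  | leaf, t => D t
  | node _ l' r', node _ l r => max (cost D l' l) (cost D r' r)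
  -- This value is irrelevant, since the case does not occur for a pruning.
  | node _ _ _, leaf => 0

theorem rule_choice : Rule κ m (choice κ m l r).1 (choice κ m l r).2 := by
  rw [choice]
  split_ifs
  · exact .inl rfl
  · exact .inr rfl

theorem val_node : val κ m (node c l r) =
    m.bump + max (val κ (choice κ m l r).1 l) (val κ (choice κ m l r).2 r) := by
  rw [val, choice]
  split_ifs with h
  · rw [min_eq_left h]
  · rw [min_eq_right (le_of_not_ge h)]

@[simp] theorem best_leaf : best κ m (leaf : Tri V) = leaf := by cases m <;> rfl

@[simp] theorem best_cut : best κ cut t = leaf := by cases t <;> rfl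

theorem best_node (hm : m ≠ cut) : best κ m (node c l r) =
    node c (best κ (choice κ m l r).1 l) (best κ (choice κ m l r).2 r) := by
  cases m <;> simp_all [best]

theorem shape_best (κ : SystemKind) (m : Mode) (t : Tri V) : Shape κ m (best κ m t) t := by
  induction t generalizing m with
  | leaf => simp
  | node c l r ihl ihr =>
    by_cases hm : m = cut
    · subst hm; simp
    · rw [best_node hm, shape_node hm]
      exact ⟨_, _, _, _, rule_choice, rfl, ihl _, ihr _⟩

theorem bump_of_ne (hm : m ≠ cut) : m.bump = 0 := by
  by_contra h
  exact hm (bump_ne_zero.1 h)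

/-- `choice` attains the minimum in `val` at every node. -/
theorem cost_best (κ : SystemKind) (m : Mode) (t : Tri V) :
    cost (val κ cut) (best κ m t) t = val κ m t := by
  induction t generalizing m with
  | leaf => simp [cost, val]
  | node c l r ihl ihr =>
    by_cases hm : m = cut
    · subst hm; simp [cost]
    · rw [best_node hm, cost, ihl, ihr, val_node, bump_of_ne hm, zero_add]

/-- At each node a shape obeys one of the two rules, and `val` takes the minimum over both. -/
theorem Shape.val_le_cost (h : Shape κ m t' t) : val κ m t ≤ cost (val κ cut) t' t := by
  induction t generalizing m t' with
  | leaf => simp [val]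
  | node c l r ihl ihr =>
    rcases h with ⟨rfl, rfl⟩ | ⟨hm, m1, m2, l', r', hr, rfl, h1, h2⟩
    · rfl
    · rw [cost, val, bump_of_ne hm, zero_add]
      refine le_trans ?_ (max_le_max (ihl h1) (ihr h2))
      rcases hr with hr | hr <;> rw [← hr]
      · exact min_le_left _ _
      · exact min_le_right _ _

/-- The modes `cut` and `root` continue alike; they differ only by the umbrella or bonnet that is
started. -/
theorem val_cut_node : val κ cut (node c l r) = 1 + val κ root (node c l r) := by
  rw [val, val]
  cases κ <;> simp [Mode.fst, Mode.snd, bump]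

/-- The parts of `t` that are cut off in order to obtain `t'`. -/
theorem Prune.isGreatest_cost (h : Prune t' t) (hs : Sorted f a b t) (D : Tri V → ℕ) :
    IsGreatest {d | ∃ x y s, Sub a b t' x y .leaf ∧ Sub a b t x y s ∧ d = D s} (cost D t' t) := by
  induction h generalizing a b with
  | leaf t =>
    refine ⟨⟨a, b, t, .refl _ _ _, .refl _ _ _, rfl⟩, ?_⟩
    rintro d ⟨x, y, s, h1, h2, rfl⟩
    obtain ⟨rfl, rfl, -⟩ := sub_leaf.1 h1
    rw [h2.eq_self hs]
    rfl
  | @node c l' l r' r hl hr ihl ihr =>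
    have ihl := ihl hs.1
    have ihr := ihr hs.2
    constructor
    · rw [cost]
      rcases le_total (cost D l' l) (cost D r' r) with h | h
      · rw [max_eq_right h]
        obtain ⟨x, y, s, h1, h2, h3⟩ := ihr.1
        exact ⟨x, y, s, .right h1, .right h2, h3⟩
      · rw [max_eq_left h]
        obtain ⟨x, y, s, h1, h2, h3⟩ := ihl.1
        exact ⟨x, y, s, .left h1, .left h2, h3⟩
    · rintro d ⟨x, y, s, h1, h2, rfl⟩
      rw [cost]
      rcases sub_node.1 h1 with ⟨-, -, h1⟩ | h1 | h1
      · cases h1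
      · obtain ⟨s', h3, -⟩ := hl.sub h1
        rw [h2.unique (.left h3) hs]
        exact le_max_of_le_left (ihl.2 ⟨x, y, s', h1, h3, rfl⟩)
      · obtain ⟨s', h3, -⟩ := hr.sub h1
        rw [h2.unique (.right h3) hs]
        exact le_max_of_le_right (ihr.2 ⟨x, y, s', h1, h3, rfl⟩)

end Tri

/-! ### Lists that are paths -/

/-- `L` is an induced path with respect to the adjacency relation `R`. -/
inductive PathList {α : Type*} (R : α → α → Prop) : List α → Prop
  | single (x : α) : PathList R [x]
  | cons (x y : α) (L : List α) (hR : R x y) (hx : x ∉ y :: L) (hL : ∀ z ∈ L, ¬ R x z)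
      (h : PathList R (y :: L)) : PathList R (x :: y :: L)

namespace PathList
variable {α : Type*} {R : α → α → Prop} {L L₁ L₂ : List α} {x y : α}

theorem nodup (h : PathList R L) : L.Nodup := by
  induction h with
  | single => simp
  | cons x y L hR hx hL h ih => exact List.nodup_cons.2 ⟨hx, ih⟩

theorem ne_nil (h : PathList R L) : L ≠ [] := by
  cases h <;> simp

theorem rel_iff (h : PathList R L) {i j : ℕ} (hi : i < L.length) (hj : j < L.length) (hij : i < j) :
    R L[i] L[j] ↔ i + 1 = j := by
  induction h generalizing i j with
  | single => simp at hi hj; omega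
  | cons x y L hR hx hL h ih =>
    obtain ⟨j, rfl⟩ : ∃ k, j = k + 1 := ⟨j - 1, by omega⟩
    cases i with
    | zero =>
      cases j with
      | zero => simpa using hR
      | succ j =>
        simp only [List.length_cons] at hj
        simpa using hL L[j] (List.getElem_mem _)
    | succ i =>
      have := @ih i j (by simpa using hi) (by simpa using hj) (by omega)
      simp only [List.getElem_cons_succ]
      rw [this]
      omega

/-- Two induced paths are joined by an edge between their heads. The induction moves the head of the
first list to the second. A ribbon that enters both sides of the root triangle has such a dual path.
-/
theorem reverse_append (hR : ∀ x y, R x y → R y x) (h₁ : PathList R (x :: L₁))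
    (h₂ : PathList R (y :: L₂)) (hxy : R x y)
    (h : ∀ p ∈ x :: L₁, ∀ q ∈ y :: L₂, p ≠ q ∧ (R p q → p = x ∧ q = y)) :
    PathList R ((x :: L₁).reverse ++ y :: L₂) := by
  induction L₁ generalizing x y L₂ with
  | nil =>
    refine .cons x y L₂ hxy (fun hx => (h x (by simp) x hx).1 rfl) (fun z hz hxz => ?_) h₂
    obtain rfl := ((h x (by simp) z (List.mem_cons_of_mem _ hz)).2 hxz).2
    exact (List.nodup_cons.1 h₂.nodup).1 hz
  | cons x' L₁ ih =>
    rw [List.reverse_cons, List.append_assoc]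
    cases h₁ with
    | cons _ _ _ hR' hx hL h₁ =>
      have h3 : PathList R (x :: y :: L₂) := by
        refine .cons x y L₂ hxy (fun hx => (h x (by simp) x hx).1 rfl) (fun z hz hxz => ?_) h₂
        obtain rfl := ((h x (by simp) z (List.mem_cons_of_mem _ hz)).2 hxz).2
        exact (List.nodup_cons.1 h₂.nodup).1 hz
      refine ih h₁ h3 (hR _ _ hR') fun p hp q hq => ?_
      rcases List.mem_cons.1 hq with rfl | hq
      · refine ⟨fun e => hx (e ▸ hp), fun hpq => ⟨?_, rfl⟩⟩
        rcases List.mem_cons.1 hp with rfl | hp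
        · rfl
        · exact absurd (hR _ _ hpq) (hL p hp)
      · have h4 := h p (List.mem_cons_of_mem _ hp) q hq
        exact ⟨h4.1, fun hpq => absurd hp ((h4.2 hpq).1 ▸ hx)⟩

/-- A list that contains all vertices and is an induced path yields an isomorphism. -/
theorem exists_iso {β : Type*} {D : SimpleGraph β} {g : β → α} (hg : g.Injective)
    (hD : ∀ s t, D.Adj s t ↔ R (g s) (g t)) (h : PathList R L) (hL : ∀ z, z ∈ L ↔ ∃ s, g s = z) :
    ∃ (k : ℕ) (φ : SimpleGraph.pathGraph (k + 1) ≃g D), g (φ 0) = L.head h.ne_nil ∧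
      g (φ (Fin.last k)) = L.getLast h.ne_nil := by
  have hlen : 0 < L.length := List.length_pos_iff.2 h.ne_nil
  obtain ⟨k, hk⟩ : ∃ k, L.length = k + 1 := ⟨L.length - 1, by omega⟩
  have hex : ∀ i : Fin (k + 1), ∃ s, g s = L[(i : ℕ)] := fun i => (hL _).1 (List.getElem_mem _)
  choose φ hφ using hex
  have hbij : Function.Bijective φ := by
    refine ⟨fun i j e => ?_, fun s => ?_⟩
    · have : L[(i : ℕ)] = L[(j : ℕ)] := by rw [← hφ, ← hφ, e]
      exact Fin.ext ((h.nodup.getElem_inj_iff).1 this)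
    · obtain ⟨i, hi, e⟩ := List.getElem_of_mem ((hL (g s)).2 ⟨s, rfl⟩)
      exact ⟨⟨i, by omega⟩, hg (by rw [hφ, ← e])⟩
  refine ⟨k, ⟨Equiv.ofBijective φ hbij, ?_⟩, ?_, ?_⟩
  · intro i j
    simp only [Equiv.ofBijective_apply, SimpleGraph.pathGraph_adj]
    rcases lt_trichotomy i j with hij | rfl | hij
    · rw [hD, hφ, hφ, h.rel_iff (by omega) (by omega) hij]
      omega
    · simp
    · rw [D.adj_comm, hD, hφ, hφ, h.rel_iff (by omega) (by omega) hij]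
      omega
  · change g (φ 0) = _
    rw [hφ, List.head_eq_getElem]
    rfl
  · change g (φ (Fin.last k)) = _
    rw [hφ, List.getLast_eq_getElem]
    simp [hk]

end PathList

/-! ### The dual tree -/

namespace Tri
variable {V : Type u} {G : SimpleGraph V} {f : V → ℕ} {a b c d x y z p q u v x' y' c' : V}
  {t t' l r s s' l' r' : Tri V} {κ : SystemKind}

open Classical in
/-- The triangle with the vertices `x`, `c`, `y`. -/
noncomputable def face (x c y : V) : Finset V := {x, c, y}

/-- `T` is one of the triangles of the triangulation. -/
def IsFace (a b : V) (t : Tri V) (T : Finset V) : Prop :=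
  ∃ x y c l r, Sub a b t x y (node c l r) ∧ T = face x c y

/-- The two triangles have an edge in common. -/
def Share (S T : Finset V) : Prop := S ≠ T ∧ ∃ x y, x ≠ y ∧ x ∈ S ∧ y ∈ S ∧ x ∈ T ∧ y ∈ T

theorem mem_face : z ∈ face x c y ↔ z = x ∨ z = c ∨ z = y := by
  classical simp [face]

theorem Share.symm {S T : Finset V} (h : Share S T) : Share T S := by
  obtain ⟨h, x, y, h1, h2, h3, h4, h5⟩ := h
  exact ⟨h.symm, x, y, h1, h4, h5, h2, h3⟩

theorem Sub.node_lt (h : Sub a b t x y (node c l r)) (hs : Sorted f a b t) :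
    f a ≤ f x ∧ f x < f c ∧ f c < f y ∧ f y ≤ f b := by
  have := h.sorted hs
  exact ⟨this.2.1, this.1.1.lt, this.1.2.lt, this.2.2⟩

/-- The apex is the middle one of the three vertices by position, so the set determines the roles.
-/
theorem face_inj (hf : f.Injective) (h1 : f x < f c) (h2 : f c < f y) (h3 : f x' < f c')
    (h4 : f c' < f y') (h : face x c y = face x' c' y') : x = x' ∧ c = c' ∧ y = y' := by
  have key : ∀ z, (z = x ∨ z = c ∨ z = y) ↔ (z = x' ∨ z = c' ∨ z = y') := fun z => by
    rw [← mem_face, h, mem_face]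
  have e : ∀ {p q : V}, p = q ↔ f p = f q := fun {p q} => hf.eq_iff.symm
  have a1 := (key x).1 (.inl rfl)
  have a2 := (key c).1 (.inr (.inl rfl))
  have a3 := (key y).1 (.inr (.inr rfl))
  simp only [e] at a1 a2 a3 ⊢
  omega

theorem Good.isNClique_iff (h : Good G f a b t) {T : Finset V} :
    (toSub G a b t).spanningCoe.IsNClique 3 T ↔ IsFace a b t T := by
  classical
  rw [SimpleGraph.is3Clique_iff]
  simp only [SimpleGraph.Subgraph.spanningCoe_adj]
  constructor
  · have key : ∀ x c y, f x < f c → f c < f y → (toSub G a b t).Adj x c →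
        (toSub G a b t).Adj c y → (toSub G a b t).Adj x y → IsFace a b t (face x c y) := by
      intro x c y h1 h2 h3 h4 h5
      rw [h.toSub_adj_lt (by omega)] at h3 h4 h5
      obtain ⟨s, hs⟩ := h5
      obtain ⟨l, r, rfl⟩ := hs.triangle h.inj h3 h4 h.sorted
      exact ⟨x, y, c, l, r, hs, rfl⟩
    rintro ⟨x, y, z, hxy, hxz, hyz, rfl⟩
    have n1 := h.inj.ne hxy.ne
    have n2 := h.inj.ne hxz.ne
    have n3 := h.inj.ne hyz.ne
    have e : ∀ p q w, (∀ v, v ∈ ({x, y, z} : Finset V) ↔ v = p ∨ v = q ∨ v = w) →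
        ({x, y, z} : Finset V) = face p q w := fun p q w hv => by
      ext v; rw [hv, mem_face]
    rcases lt_or_gt_of_ne n1 with g1 | g1 <;> rcases lt_or_gt_of_ne n2 with g2 | g2 <;>
      rcases lt_or_gt_of_ne n3 with g3 | g3
    · rw [e x y z (by simp)]; exact key x y z g1 g3 hxy hyz hxz
    · rw [e x z y (by simp; tauto)]; exact key x z y g2 g3 hxz hyz.symm hxy
    · omega
    · rw [e z x y (by simp; tauto)]; exact key z x y g2 g1 hxz.symm hxy hyz.symm
    · rw [e y x z (by simp; tauto)]; exact key y x z g1 g2 hxy.symm hxz hyz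
    · omega
    · rw [e y z x (by simp; tauto)]; exact key y z x g3 g2 hyz hxz.symm hxy.symm
    · rw [e z y x (by simp; tauto)]; exact key z y x g3 g1 hyz.symm hxy.symm hxz.symm
  · rintro ⟨x, y, c, l, r, hs, rfl⟩
    have b1 := hs.node_lt h.sorted
    have e := hs.apex_edges
    refine ⟨x, c, y, ?_, ?_, ?_, rfl⟩
    · exact (h.toSub_adj_lt b1.2.1).2 e.1
    · exact (h.toSub_adj_lt (by omega)).2 hs.edge
    · exact (h.toSub_adj_lt b1.2.2.1).2 e.2

theorem Sub.eq_or_parent (h : Sub a b t x y s) : (x = a ∧ y = b ∧ s = t) ∨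
    ∃ p q d l r, Sub a b t p q (node d l r) ∧ ((x = p ∧ y = d ∧ s = l) ∨ (x = d ∧ y = q ∧ s = r)) := by
  induction h with
  | refl => exact .inl ⟨rfl, rfl, rfl⟩
  | left h ih =>
    right
    rcases ih with ⟨rfl, rfl, rfl⟩ | ⟨p, q, d, l, r, h1, h2⟩
    · exact ⟨_, _, _, _, _, .refl _ _ _, .inl ⟨rfl, rfl, rfl⟩⟩
    · exact ⟨p, q, d, l, r, .left h1, h2⟩
  | right h ih =>
    right
    rcases ih with ⟨rfl, rfl, rfl⟩ | ⟨p, q, d, l, r, h1, h2⟩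
    · exact ⟨_, _, _, _, _, .refl _ _ _, .inr ⟨rfl, rfl, rfl⟩⟩
    · exact ⟨p, q, d, l, r, .right h1, h2⟩

/-- An edge is a lower side of at most one triangle. -/
theorem parent_unique {p' q' d' : V} {l₁ r₁ l₂ r₂ : Tri V} (hf : f.Injective) (hs : Sorted f a b t)
    (h1 : Sub a b t p q (node d l₁ r₁)) (h2 : Sub a b t p' q' (node d' l₂ r₂))
    (e1 : (x = p ∧ y = d) ∨ (x = d ∧ y = q)) (e2 : (x = p' ∧ y = d') ∨ (x = d' ∧ y = q')) :
    p = p' ∧ d = d' ∧ q = q' := by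
  have b1 := h1.node_lt hs
  have b2 := h2.node_lt hs
  have c1 := h1.edge.noncross h2.apex_edges.2 hs
  have c2 := h2.edge.noncross h1.apex_edges.2 hs
  have c3 := h1.apex_edges.1.noncross h2.edge hs
  have c4 := h2.apex_edges.1.noncross h1.edge hs
  have c5 := h1.edge.noncross h2.edge hs
  have c6 := h2.edge.noncross h1.edge hs
  rcases e1 with ⟨rfl, rfl⟩ | ⟨rfl, rfl⟩ <;> rcases e2 with ⟨rfl, rfl⟩ | ⟨rfl, rfl⟩
  · exact ⟨rfl, rfl, hf (by omega)⟩
  · omega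
  · omega
  · exact ⟨hf (by omega), rfl, rfl⟩

/-- Two triangles with a common edge are parent and child. -/
theorem Share.parent {l₁ r₁ l₂ r₂ : Tri V} (hf : f.Injective) (hs : Sorted f a b t)
    (h1 : Sub a b t x y (node c l₁ r₁)) (h2 : Sub a b t x' y' (node c' l₂ r₂))
    (h : Share (face x c y) (face x' c' y')) :
    ((x = x' ∧ y = c') ∨ (x = c' ∧ y = y')) ∨ ((x' = x ∧ y' = c) ∨ (x' = c ∧ y' = y)) := by
  have b1 := h1.node_lt hs
  have b2 := h2.node_lt hs
  by_contra hc
  refine h.1 ?_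
  obtain ⟨p, q, hpq, m1, m2, m3, m4⟩ : ∃ p q, f p < f q ∧ p ∈ face x c y ∧ q ∈ face x c y ∧
      p ∈ face x' c' y' ∧ q ∈ face x' c' y' := by
    obtain ⟨-, p, q, hpq, m1, m2, m3, m4⟩ := h
    rcases lt_or_gt_of_ne (hf.ne hpq) with g | g
    · exact ⟨p, q, g, m1, m2, m3, m4⟩
    · exact ⟨q, p, g, m2, m1, m4, m3⟩
  rw [mem_face] at m1 m2 m3 m4
  have side : ∀ {x c y : V}, f x < f c → f c < f y → (p = x ∨ p = c ∨ p = y) →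
      (q = x ∨ q = c ∨ q = y) → (p = x ∧ q = y) ∨ ((p = x ∧ q = c) ∨ (p = c ∧ q = y)) := by
    intro x c y h1 h2 h3 h4
    rcases h3 with rfl | rfl | rfl <;> rcases h4 with rfl | rfl | rfl <;> first | omega | simp
  have s1 := side b1.2.1 b1.2.2.1 m1 m2
  have s2 := side b2.2.1 b2.2.2.1 m3 m4
  rcases s1 with ⟨rfl, rfl⟩ | s1
  · rcases s2 with ⟨rfl, rfl⟩ | s2
    · have := h1.unique h2 hs
      simp only [node.injEq] at this
      rw [this.1]
    · exact absurd (.inl s2) hc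
  · rcases s2 with ⟨rfl, rfl⟩ | s2
    · exact absurd (.inr s1) hc
    · obtain ⟨rfl, rfl, rfl⟩ := parent_unique hf hs h1 h2 s1 s2
      rfl

theorem share_left {l₁ r₁ : Tri V} (hf : f.Injective) (hs : Sorted f a b t)
    (h : Sub a b t x y (node c (node d l₁ r₁) r)) :
    Share (face x c y) (face x d c) := by
  have b1 := h.node_lt hs
  have b2 := (h.trans (.left (.refl _ _ _))).node_lt hs
  refine ⟨fun e => ?_, x, c, fun e => by subst e; omega, ?_, ?_, ?_, ?_⟩
  · have := (face_inj hf b1.2.1 b1.2.2.1 b2.2.1 b2.2.2.1 e).2.1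
    subst this; omega
  all_goals simp [mem_face]

theorem share_right {l₁ r₁ : Tri V} (hf : f.Injective) (hs : Sorted f a b t)
    (h : Sub a b t x y (node c l (node d l₁ r₁))) :
    Share (face x c y) (face c d y) := by
  have b1 := h.node_lt hs
  have b2 := (h.trans (.right (.refl _ _ _))).node_lt hs
  refine ⟨fun e => ?_, c, y, fun e => by subst e; omega, ?_, ?_, ?_, ?_⟩
  · have := (face_inj hf b1.2.1 b1.2.2.1 b2.2.1 b2.2.2.1 e).2.1
    subst this; omega
  all_goals simp [mem_face]

theorem isFace_node {T : Finset V} : IsFace a b (node c l r) T ↔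
    T = face a c b ∨ IsFace a c l T ∨ IsFace c b r T := by
  constructor
  · rintro ⟨x, y, d, l', r', h, rfl⟩
    rcases sub_node.1 h with ⟨rfl, rfl, e⟩ | h | h
    · simp only [node.injEq] at e; rw [e.1]; exact .inl rfl
    · exact .inr (.inl ⟨x, y, d, l', r', h, rfl⟩)
    · exact .inr (.inr ⟨x, y, d, l', r', h, rfl⟩)
  · rintro (rfl | ⟨x, y, d, l', r', h, rfl⟩ | ⟨x, y, d, l', r', h, rfl⟩)
    · exact ⟨_, _, _, _, _, .refl _ _ _, rfl⟩
    · exact ⟨x, y, d, l', r', .left h, rfl⟩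
    · exact ⟨x, y, d, l', r', .right h, rfl⟩

theorem not_isFace_leaf {T : Finset V} : ¬ IsFace a b leaf T := by
  rintro ⟨x, y, d, l', r', h, rfl⟩
  have := (sub_leaf.1 h).2.2
  cases this

end Tri

/-! ### Triangles along a path, and the recognition of handles -/

namespace Tri
variable {V : Type u} {G : SimpleGraph V} {f : V → ℕ} {a b c d x y z p q u v x' y' c' : V}
  {t t' l r s s' l' r' p₁ p₂ : Tri V} {κ : SystemKind} {S T : Finset V}

open Mode

theorem IsFace.mem (h : IsFace a b t T) (hs : Sorted f a b t) (hz : z ∈ T) :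
    f a ≤ f z ∧ f z ≤ f b := by
  obtain ⟨x, y, c, l, r, h, rfl⟩ := h
  have := h.node_lt hs
  rcases mem_face.1 hz with rfl | rfl | rfl <;> omega

theorem share_root_left (hf : f.Injective) (hs : Sorted f a b (node c l r)) (hT : IsFace a c l T)
    (h : Share (face a c b) T) : ∃ d l' r', l = node d l' r' ∧ T = face a d c := by
  obtain ⟨x, y, d, l', r', h1, rfl⟩ := hT
  have b1 := h1.node_lt hs.1
  have b2 := hs.1.lt
  have b3 := hs.2.lt
  rcases h.parent hf hs (.refl _ _ _) (.left h1) with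
    (⟨rfl, rfl⟩ | ⟨rfl, rfl⟩) | (⟨rfl, rfl⟩ | ⟨rfl, rfl⟩)
  · omega
  · omega
  · exact ⟨d, l', r', (h1.eq_self hs.1).symm, rfl⟩
  · omega

theorem share_root_right (hf : f.Injective) (hs : Sorted f a b (node c l r)) (hT : IsFace c b r T)
    (h : Share (face a c b) T) : ∃ d l' r', r = node d l' r' ∧ T = face c d b := by
  obtain ⟨x, y, d, l', r', h1, rfl⟩ := hT
  have b1 := h1.node_lt hs.2
  have b2 := hs.1.lt
  have b3 := hs.2.lt
  rcases h.parent hf hs (.refl _ _ _) (.right h1) with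
    (⟨rfl, rfl⟩ | ⟨rfl, rfl⟩) | (⟨rfl, rfl⟩ | ⟨rfl, rfl⟩)
  · omega
  · omega
  · omega
  · exact ⟨d, l', r', (h1.eq_self hs.2).symm, rfl⟩

theorem ne_root_left (hs : Sorted f a b (node c l r)) (hT : IsFace a c l T) : face a c b ≠ T := by
  rintro rfl
  have := hT.mem hs.1 (z := b) (by simp [mem_face])
  have := hs.2.lt
  omega

theorem ne_root_right (hs : Sorted f a b (node c l r)) (hT : IsFace c b r T) : face a c b ≠ T := by
  rintro rfl
  have := hT.mem hs.2 (z := a) (by simp [mem_face])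
  have := hs.1.lt
  omega

/-- The two sides have only the apex in common, whereas adjacent triangles share two vertices. -/
theorem not_share_left_right (hf : f.Injective) (hs : Sorted f a b (node c l r))
    (hS : IsFace a c l S) (hT : IsFace c b r T) : S ≠ T ∧ ¬ Share S T := by
  constructor
  · rintro rfl
    obtain ⟨x, y, d, l', r', h, rfl⟩ := hS
    have b1 := h.node_lt hs.1
    have := hT.mem hs.2 (z := x) (by simp [mem_face])
    omega
  · rintro ⟨-, p, q, hpq, h1, h2, h3, h4⟩
    have := hf.ne hpq
    have := hS.mem hs.1 h1
    have := hS.mem hs.1 h2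
    have := hT.mem hs.2 h3
    have := hT.mem hs.2 h4
    omega

theorem Shape.eq_leaf {m : Mode} (hm : m ≠ cut) (h : Shape κ m leaf t) : t = leaf := by
  cases t with
  | leaf => rfl
  | node c l r =>
    obtain ⟨_, _, _, _, -, h, -⟩ := (shape_node hm).1 h
    cases h

/-- The triangles of a handle form a path. -/
theorem Shape.exists_pathList (h : Shape κ handle (node c p₁ p₂) t) (hf : f.Injective)
    (hs : Sorted f a b (node c p₁ p₂)) :
    ∃ L, PathList Share (face a c b :: L) ∧
      (∀ T, T ∈ face a c b :: L ↔ IsFace a b (node c p₁ p₂) T) ∧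
      ∃ x y, Sub a b t x y leaf ∧ x ∈ (face a c b :: L).getLast (by simp) ∧
        y ∈ (face a c b :: L).getLast (by simp) := by
  induction t generalizing a b c p₁ p₂ with
  | leaf => cases h
  | node c' l r ihl ihr =>
    rcases shape_handle_node.1 h with ⟨l', e, h1⟩ | ⟨r', e, h1⟩
    · simp only [node.injEq] at e
      obtain ⟨rfl, rfl, rfl⟩ := e
      cases p₁ with
      | leaf =>
        obtain rfl := h1.eq_leaf (by simp)
        refine ⟨[], .single _, fun T => ?_, a, c, .left (.refl _ _ _), ?_, ?_⟩
        · simp [isFace_node, not_isFace_leaf]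
        · simp [mem_face]
        · simp [mem_face]
      | node d q₁ q₂ =>
        obtain ⟨L, hL, hT, x, y, hxy, hx, hy⟩ := ihl h1 hs.1
        refine ⟨face a d c :: L, .cons _ _ _ (share_left hf hs (.refl _ _ _)) (fun hm => ?_)
          (fun z hz hz' => ?_) hL, fun T => ?_, x, y, .left hxy, ?_, ?_⟩
        · exact ne_root_left hs ((hT _).1 hm) rfl
        · obtain ⟨d', _, _, e, rfl⟩ :=
            share_root_left hf hs ((hT z).1 (List.mem_cons_of_mem _ hz)) hz'
          simp only [node.injEq] at e
          obtain ⟨rfl, -⟩ := e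
          exact (List.nodup_cons.1 hL.nodup).1 hz
        · rw [List.mem_cons, hT, isFace_node (c := c)]
          simp [not_isFace_leaf]
        · rwa [List.getLast_cons (by simp)]
        · rwa [List.getLast_cons (by simp)]
    · simp only [node.injEq] at e
      obtain ⟨rfl, rfl, rfl⟩ := e
      cases p₂ with
      | leaf =>
        obtain rfl := h1.eq_leaf (by simp)
        refine ⟨[], .single _, fun T => ?_, c, b, .right (.refl _ _ _), ?_, ?_⟩
        · simp [isFace_node, not_isFace_leaf]
        · simp [mem_face]
        · simp [mem_face]
      | node d q₁ q₂ =>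
        obtain ⟨L, hL, hT, x, y, hxy, hx, hy⟩ := ihr h1 hs.2
        refine ⟨face c d b :: L, .cons _ _ _ (share_right hf hs (.refl _ _ _)) (fun hm => ?_)
          (fun z hz hz' => ?_) hL, fun T => ?_, x, y, .right hxy, ?_, ?_⟩
        · exact ne_root_right hs ((hT _).1 hm) rfl
        · obtain ⟨d', _, _, e, rfl⟩ :=
            share_root_right hf hs ((hT z).1 (List.mem_cons_of_mem _ hz)) hz'
          simp only [node.injEq] at e
          obtain ⟨rfl, -⟩ := e
          exact (List.nodup_cons.1 hL.nodup).1 hz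
        · rw [List.mem_cons, hT, isFace_node (c := c)]
          simp [not_isFace_leaf]
        · rwa [List.getLast_cons (by simp)]
        · rwa [List.getLast_cons (by simp)]

theorem Good.connectsEdges (h : Good G f a b t) (ht : t ≠ leaf) {L : List (Finset V)}
    (hL : PathList Share L) (hT : ∀ T, T ∈ L ↔ IsFace a b t T)
    (hx : x ∈ L.head hL.ne_nil) (hy : y ∈ L.head hL.ne_nil)
    (hx' : x' ∈ L.getLast hL.ne_nil) (hy' : y' ∈ L.getLast hL.ne_nil) :
    ConnectsEdges (toSub G a b t) s(x, y) s(x', y') := by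
  refine ⟨h.maximal ht, ?_⟩
  obtain ⟨k, φ, h1, h2⟩ := hL.exists_iso (D := dualTree (toSub G a b t))
    (g := Subtype.val) Subtype.val_injective
    (fun s t => by
      simp only [dualTree, Share, ne_eq, Subtype.ext_iff])
    (fun T => by
      rw [hT]
      constructor
      · intro hT; exact ⟨⟨T, h.isNClique_iff.2 hT⟩, rfl⟩
      · rintro ⟨s, rfl⟩; exact h.isNClique_iff.1 s.2)
  refine ⟨k, φ, fun w hw => ?_, fun w hw => ?_⟩
  · rw [h1]; rcases Sym2.mem_iff.1 hw with rfl | rfl <;> assumption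
  · rw [h2]; rcases Sym2.mem_iff.1 hw with rfl | rfl <;> assumption

/-- What the faces of an outerplanar path look like. -/
theorem Good.of_connectsEdges (h : Good G f a b t) {e e' : Sym2 V}
    (hc : ConnectsEdges (toSub G a b t) e e') : ∃ T₁ T₂, IsFace a b t T₁ ∧ IsFace a b t T₂ ∧
      (∀ z ∈ e, z ∈ T₁) ∧ (∀ z ∈ e', z ∈ T₂) ∧
      (∀ S A B C, IsFace a b t S → IsFace a b t A → IsFace a b t B → IsFace a b t C →
        Share S A → Share S B → Share S C → A = B ∨ A = C ∨ B = C) ∧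
      (∀ A B, IsFace a b t A → IsFace a b t B → Share T₁ A → Share T₁ B → A = B) ∧
      (∀ S, IsFace a b t S → (∀ A B, IsFace a b t A → IsFace a b t B → Share S A → Share S B →
        A = B) → S = T₁ ∨ S = T₂) := by
  obtain ⟨-, k, φ, h1, h2⟩ := hc
  -- The claims are facts about path graphs: there are at most two neighbours, the first vertex has
  -- at most one, and only the end vertices have at most one. The isomorphism translates adjacency
  -- into consecutive indices.
  have hφ : ∀ T, IsFace a b t T → ∃ i, (φ i).1 = T := fun T hT =>
    ⟨φ.symm ⟨T, h.isNClique_iff.2 hT⟩, by simp⟩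
  have hface : ∀ i, IsFace a b t (φ i).1 := fun i => h.isNClique_iff.1 (φ i).2
  have hshare : ∀ i j, Share (φ i).1 (φ j).1 ↔ (i : ℕ) + 1 = j ∨ (j : ℕ) + 1 = i := fun i j => by
    rw [← SimpleGraph.pathGraph_adj, ← φ.map_adj_iff]
    simp only [dualTree, Share, ne_eq, Subtype.ext_iff]
  have hinj : ∀ i j : Fin (k + 1), (i : ℕ) = j → (φ i).1 = (φ j).1 := fun i j e => by
    rw [Fin.ext e]
  have hinj' : ∀ i j : Fin (k + 1), (φ i).1 = (φ j).1 → (i : ℕ) = j := fun i j e => by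
    rw [φ.injective (Subtype.ext e)]
  refine ⟨_, _, hface _, hface _, h1, h2, ?_, ?_, ?_⟩
  · intro S A B C hS hA hB hC
    obtain ⟨i, rfl⟩ := hφ S hS
    obtain ⟨j, rfl⟩ := hφ A hA
    obtain ⟨j', rfl⟩ := hφ B hB
    obtain ⟨j'', rfl⟩ := hφ C hC
    rw [hshare, hshare, hshare]
    intro e1 e2 e3
    have : (j : ℕ) = j' ∨ (j : ℕ) = j'' ∨ (j' : ℕ) = j'' := by omega
    exact this.imp (hinj _ _) (Or.imp (hinj _ _) (hinj _ _))
  · intro A B hA hB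
    obtain ⟨j, rfl⟩ := hφ A hA
    obtain ⟨j', rfl⟩ := hφ B hB
    rw [hshare, hshare]
    intro e1 e2
    refine hinj _ _ ?_
    simp only [Fin.val_zero] at e1 e2
    omega
  · intro S hS hd
    obtain ⟨i, rfl⟩ := hφ S hS
    by_contra h0
    push Not at h0
    have i0 : (i : ℕ) ≠ 0 := fun e => h0.1 (hinj _ _ e)
    have ik : (i : ℕ) ≠ k := fun e => h0.2 (hinj _ _ e)
    have hi := i.isLt
    obtain ⟨j, hj⟩ : ∃ j : Fin (k + 1), (j : ℕ) = i - 1 := ⟨⟨i - 1, by omega⟩, rfl⟩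
    obtain ⟨j', hj'⟩ : ∃ j : Fin (k + 1), (j : ℕ) = i + 1 := ⟨⟨i + 1, by omega⟩, rfl⟩
    have := hinj' _ _ (hd (φ j).1 (φ j').1 (hface _) (hface _)
      ((hshare _ _).2 (by omega)) ((hshare _ _).2 (by omega)))
    omega

/-- Recognizing handles. -/
theorem shape_handle_of (h : Prune t' t) (ht' : t' ≠ leaf) (hs : Sorted f a b t)
    (h1 : ∀ x y c l r, Sub a b t' x y (node c l r) → l = leaf ∨ r = leaf)
    (h2 : ∀ x y c, Sub a b t' x y (node c leaf leaf) →
      Sub a b t x c leaf ∨ Sub a b t c y leaf) : Shape κ handle t' t := by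
  induction h generalizing a b with
  | leaf => exact absurd rfl ht'
  | @node c l' l r' r hl hr ihl ihr =>
    rw [shape_handle_node]
    have sl : ∀ {x y s}, Sub a b (.node c l r) x y s → ∀ {z w s'}, Sub a c l' z w s' →
        (x = z ∧ y = w) → Sub a c l x y s := by
      rintro x y s h z w s' h' ⟨rfl, rfl⟩
      obtain ⟨s'', h3, -⟩ := hl.sub h'
      rwa [h.unique (.left h3) hs]
    have sr : ∀ {x y s}, Sub a b (.node c l r) x y s → ∀ {z w s'}, Sub c b r' z w s' →
        (x = z ∧ y = w) → Sub c b r x y s := by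
      rintro x y s h z w s' h' ⟨rfl, rfl⟩
      obtain ⟨s'', h3, -⟩ := hr.sub h'
      rwa [h.unique (.right h3) hs]
    by_cases el : l' = .leaf
    · by_cases er : r' = .leaf
      -- The path ends at this triangle. By the second hypothesis one of its lower sides is an outer
      -- edge, so the rule for handles applies in that direction, with nothing cut off there.
      · subst el er
        rcases h2 _ _ _ (.refl _ _ _) with h3 | h3
        · left
          exact ⟨.leaf, rfl, by rw [← h3.unique (.left (.refl _ _ _)) hs]; rfl⟩
        · right
          exact ⟨.leaf, rfl, by rw [← h3.unique (.right (.refl _ _ _)) hs]; rfl⟩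
      · subst el
        refine .inr ⟨r', rfl, ihr er hs.2 (fun x y d q₁ q₂ h => h1 x y d q₁ q₂ (.right h))
          fun x y d h => ?_⟩
        exact (h2 x y d (.right h)).imp (fun h3 => sr h3 (h.trans (.left (.refl _ _ _))) ⟨rfl, rfl⟩)
          (fun h3 => sr h3 (h.trans (.right (.refl _ _ _))) ⟨rfl, rfl⟩)
    · obtain rfl := (h1 _ _ _ _ _ (.refl _ _ _)).resolve_left el
      refine .inl ⟨l', rfl, ihl el hs.1 (fun x y d q₁ q₂ h => h1 x y d q₁ q₂ (.left h))
        fun x y d h => ?_⟩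
      exact (h2 x y d (.left h)).imp (fun h3 => sl h3 (h.trans (.left (.refl _ _ _))) ⟨rfl, rfl⟩)
        (fun h3 => sl h3 (h.trans (.right (.refl _ _ _))) ⟨rfl, rfl⟩)

theorem Sub.isFace (h : Sub a b t x y (node c l r)) : IsFace a b t (face x c y) :=
  ⟨x, y, c, l, r, h, rfl⟩

/-- In an outerplanar path, no triangle has two children, except possibly for the root. -/
theorem leaf_or_leaf (hf : f.Injective) (hs : Sorted f a b t)
    (h3 : ∀ S A B C, IsFace a b t S → IsFace a b t A → IsFace a b t B → IsFace a b t C →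
        Share S A → Share S B → Share S C → A = B ∨ A = C ∨ B = C)
    (h : Sub a b t x y (node c l r)) (hxy : ¬ (x = a ∧ y = b)) : l = leaf ∨ r = leaf := by
  rcases l with _ | ⟨d, l₁, l₂⟩
  · exact .inl rfl
  rcases r with _ | ⟨d', r₁, r₂⟩
  · exact .inr rfl
  exfalso
  have b1 := h.node_lt hs
  have hl := h.trans (.left (.refl _ _ _))
  have hr := h.trans (.right (.refl _ _ _))
  have b2 := hl.node_lt hs
  have b3 := hr.node_lt hs
  have key : face x d c ≠ face c d' y := fun e => by
    obtain ⟨rfl, -⟩ := face_inj hf b2.2.1 b2.2.2.1 b3.2.1 b3.2.2.1 e; omega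
  obtain ⟨p, q, e, q₁, q₂, hp, hpq⟩ := h.eq_or_parent.resolve_left fun e => hxy ⟨e.1, e.2.1⟩
  have b4 := hp.node_lt hs
  have hsh : Share (face x c y) (face p e q) := by
    rcases hpq with ⟨rfl, rfl, rfl⟩ | ⟨rfl, rfl, rfl⟩
    · exact (share_left hf hs hp).symm
    · exact (share_right hf hs hp).symm
  have n1 : face p e q ≠ face x d c := fun e' => by
    obtain ⟨rfl, rfl, rfl⟩ := face_inj hf b4.2.1 b4.2.2.1 b2.2.1 b2.2.2.1 e'
    rcases hpq with ⟨-, rfl, -⟩ | ⟨rfl, -, -⟩ <;> omega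
  have n2 : face p e q ≠ face c d' y := fun e' => by
    obtain ⟨rfl, rfl, rfl⟩ := face_inj hf b4.2.1 b4.2.2.1 b3.2.1 b3.2.2.1 e'
    rcases hpq with ⟨rfl, rfl, -⟩ | ⟨rfl, -, -⟩ <;> omega
  rcases h3 _ _ _ _ h.isFace hp.isFace hl.isFace hr.isFace hsh (share_left hf hs h)
    (share_right hf hs h) with h4 | h4 | h4
  · exact n1 h4
  · exact n2 h4
  · exact key h4

/-- A triangle without children has at most one neighbour in the dual tree. -/
theorem share_unique_of_bottom (hf : f.Injective) (hs : Sorted f a b t)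
    (h : Sub a b t x y (node c leaf leaf)) {A B : Finset V} (hA : IsFace a b t A)
    (hB : IsFace a b t B) (h1 : Share (face x c y) A) (h2 : Share (face x c y) B) : A = B := by
  have key : ∀ {p q d l r}, Sub a b t p q (node d l r) → Share (face x c y) (face p d q) →
      (x = p ∧ y = d) ∨ (x = d ∧ y = q) := by
    intro p q d l r h3 h4
    rcases h4.parent hf hs h h3 with h5 | ⟨rfl, rfl⟩ | ⟨rfl, rfl⟩
    · exact h5
    · cases h3.unique (h.trans (.left (.refl _ _ _))) hs
    · cases h3.unique (h.trans (.right (.refl _ _ _))) hs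
  obtain ⟨p, q, d, l, r, h3, rfl⟩ := hA
  obtain ⟨p', q', d', l', r', h4, rfl⟩ := hB
  obtain ⟨rfl, rfl, rfl⟩ := parent_unique hf hs h3 h4 (key h3 h1) (key h4 h2)
  rfl

/-- Non-cutting edges at a triangle. -/
theorem Good.nonCutting_face (h : Good G f a b t) (hs : Sub a b t x y (node c l r))
    (hc : IsNonCutting (toSub G a b t) p q) (hpq : s(p, q) ≠ s(a, b)) (hp : p ∈ face x c y)
    (hq : q ∈ face x c y) : Sub a b t x c leaf ∨ Sub a b t c y leaf := by
  have b1 := hs.node_lt h.sorted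
  have key : ∀ {p q}, f p < f q → IsNonCutting (toSub G a b t) p q → s(p, q) ≠ s(a, b) →
      p ∈ face x c y → q ∈ face x c y → Sub a b t x c leaf ∨ Sub a b t c y leaf := by
    intro p q hlt hc hpq hp hq
    rcases (h.nonCutting_iff hlt).1 hc with ⟨rfl, rfl⟩ | h1
    · exact absurd rfl hpq
    · rw [mem_face] at hp hq
      rcases hp with rfl | rfl | rfl <;> rcases hq with rfl | rfl | rfl <;> try omega
      · exact .inl h1
      · cases h1.unique hs h.sorted
      · exact .inr h1
  rcases lt_or_gt_of_ne (h.inj.ne hc.1.ne) with g | g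
  · exact key g hc hpq hp hq
  · exact key g (isNonCutting_comm.1 hc) (by rwa [Sym2.eq_swap]) hq hp

end Tri

/-! ### Handles and ribbons as shapes -/

namespace Tri
variable {V : Type u} {G : SimpleGraph V} {f : V → ℕ} {a b c d x y z p q u v x' y' c' : V}
  {t t' l r s s' l' r' p₁ p₂ : Tri V} {κ : SystemKind} {S T : Finset V}

open Mode

theorem Edge.not_of_eq (h : Good G f a b t) (ht : t ≠ leaf) (h' : Sub a b t x y leaf) :
    s(x, y) ≠ s(a, b) := by
  intro e
  have b1 := h'.edge.lt h.sorted
  rcases Sym2.eq_iff.1 e with ⟨rfl, rfl⟩ | ⟨rfl, rfl⟩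
  · exact ht (h'.eq_self h.sorted).symm
  · omega

/-- The handles. -/
theorem Good.isHandle_iff (h : Good G f a b t) (ht : t ≠ leaf) {P : G.Subgraph} :
    IsHandle (toSub G a b t) a b P ↔ ∃ p, P = toSub G a b p ∧ Shape κ handle p t := by
  constructor
  · rintro ⟨hP, x, y, hxy, hne, hc⟩
    obtain ⟨a', b', p, s, rfl, hp, hpl, hsub, hpr⟩ := h.exists_of_le hP hc.1
    obtain ⟨T₁, T₂, f1, f2, e1, e2, d1, d2, d3⟩ := hp.of_connectsEdges hc
    have bs := hsub.sorted h.sorted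
    -- The first triangle contains a and b, which are extreme in position; so the subtree that was
    -- pruned to P has base (a,b) and is all of t.
    have ba := f1.mem hp.sorted (e1 a (by simp))
    have bb := f1.mem hp.sorted (e1 b (by simp))
    obtain rfl : a' = a := h.inj (by omega)
    obtain rfl : b' = b := h.inj (by omega)
    obtain rfl := hsub.eq_self h.sorted
    refine ⟨p, rfl, ?_⟩
    have hroot : ∀ x y c l r, Sub a' b' p x y (node c l r) → face x c y = T₁ → x = a' ∧ y = b' := by
      rintro x y c l r hs rfl
      have := hs.node_lt hp.sorted
      have m1 := e1 a' (by simp)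
      have m2 := e1 b' (by simp)
      rw [mem_face] at m1 m2
      constructor
      · rcases m1 with rfl | rfl | rfl
        · rfl
        · omega
        · omega
      · rcases m2 with rfl | rfl | rfl
        · omega
        · omega
        · rfl
    have hT₁ : ∀ c l r, p = node c l r → T₁ = face a' c b' := by
      rintro c l r rfl
      obtain ⟨x, y, d, l', r', hs, hT⟩ := f1
      obtain ⟨rfl, rfl⟩ := hroot _ _ _ _ _ hs hT.symm
      have := hs.eq_self hp.sorted
      simp only [node.injEq] at this
      rw [hT, this.1]
    refine shape_handle_of hpr hpl h.sorted (fun x y c l r hs => ?_) fun x' y' c hs => ?_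
    · by_cases hr : x = a' ∧ y = b'
      · obtain ⟨rfl, rfl⟩ := hr
        obtain rfl := hs.eq_self hp.sorted
        have := hT₁ _ _ _ rfl
        subst this
        rcases l with _ | ⟨d, l₁, l₂⟩
        · exact .inl rfl
        rcases r with _ | ⟨d', r₁, r₂⟩
        · exact .inr rfl
        have hl := Sub.left (b := y) (r := node d' r₁ r₂) (.refl x c (node d l₁ l₂))
        have hr := Sub.right (a := x) (l := node d l₁ l₂) (.refl c y (node d' r₁ r₂))
        have b2 := hl.node_lt hp.sorted
        have b3 := hr.node_lt hp.sorted
        obtain ⟨rfl, -⟩ := face_inj h.inj b2.2.1 b2.2.2.1 b3.2.1 b3.2.2.1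
          (d2 _ _ hl.isFace hr.isFace (share_left h.inj hp.sorted (.refl _ _ _))
          (share_right h.inj hp.sorted (.refl _ _ _)))
        omega
      · exact leaf_or_leaf h.inj hp.sorted d1 hs hr
    -- A triangle without children has at most one neighbour, so it is an end of the path; if it is
    -- the first triangle, it is the only one. Either way it is the last triangle, which contains
    -- the prescribed non-cutting edge.
    · have h2 : face x' c y' = T₂ := by
        rcases d3 _ hs.isFace (fun A B hA hB =>
          share_unique_of_bottom h.inj hp.sorted hs hA hB) with h3 | h3
        · obtain ⟨rfl, rfl⟩ := hroot _ _ _ _ _ hs h3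
          obtain rfl := hs.eq_self hp.sorted
          rcases isFace_node.1 f2 with h4 | h4 | h4
          · exact h4.symm
          · exact absurd h4 not_isFace_leaf
          · exact absurd h4 not_isFace_leaf
        · exact h3
      subst h2
      obtain ⟨s', hs', hpr'⟩ := hpr.sub hs
      cases hpr' with
      | node h4 h5 => exact h.nonCutting_face hs' hxy hne (e2 _ (by simp)) (e2 _ (by simp))
  · rintro ⟨p, rfl, hp⟩
    refine ⟨toSub_le hp.prune, ?_⟩
    have hg := h.prune hp.prune
    rcases p with _ | ⟨c, p₁, p₂⟩
    · exact absurd (hp.eq_leaf (by simp)) ht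
    obtain ⟨L, hL, hT, x, y, hxy, hx, hy⟩ := hp.exists_pathList h.inj hg.sorted
    have b1 := hxy.edge.lt h.sorted
    exact ⟨x, y, (h.nonCutting_iff b1.2.1).2 (.inr hxy), Edge.not_of_eq h ht hxy,
      hg.connectsEdges (by simp) hL hT (by simp [mem_face]) (by simp [mem_face]) hx hy⟩

theorem Good.nonCutting_base (h : Good G f a b t) : IsNonCutting (toSub G a b t) a b :=
  (h.nonCutting_iff h.lt).2 (.inl ⟨rfl, rfl⟩)

/-- A handle is a ribbon one of whose two end edges is the cap itself. This settles the ribbons that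
enter only one side of the root triangle. -/
theorem Good.isRibbon_of_isHandle (h : Good G f a b (node c l r)) {P : G.Subgraph}
    (hP : IsHandle (toSub G a b (node c l r)) a b P) :
    IsRibbon (toSub G a b (node c l r)) a b P := by
  obtain ⟨p, rfl, hp⟩ := (h.isHandle_iff (κ := .bonnet) (by simp)).1 hP
  obtain ⟨hle, x, y, hxy, hne, hc⟩ := hP
  refine ⟨hle, ⟨a, b, x, y, h.nonCutting_base, hxy, hne.symm, hc⟩, vert_fst, vert_snd, c, ?_, ?_, ?_⟩
  · rcases shape_handle_node.1 hp with ⟨l', rfl, -⟩ | ⟨l', rfl, -⟩ <;>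
      exact vert_node.2 (.inl vert_snd)
  · exact h.toSub_adj.2 (.inl (Sub.refl _ _ _).apex_edges.1)
  · exact h.toSub_adj.2 (.inl (Sub.refl _ _ _).apex_edges.2)

/-- The ribbons. -/
theorem Good.isRibbon_iff (h : Good G f a b (node c l r)) {P : G.Subgraph} :
    IsRibbon (toSub G a b (node c l r)) a b P ↔ ∃ p₁ p₂, P = toSub G a b (node c p₁ p₂) ∧
      (Shape κ handle p₁ l ∨ (p₁ = leaf ∧ Shape κ handle p₂ r)) ∧
      (Shape κ handle p₂ r ∨ (p₂ = leaf ∧ Shape κ handle p₁ l)) := by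
  have hf := h.inj
  constructor
  · rintro ⟨hP, ⟨x, y, x', y', hxy, hxy', hne, hc⟩, ha, hb, -⟩
    obtain ⟨a', b', p, s, rfl, hp, hpl, hsub, hpr⟩ := h.exists_of_le hP hc.1
    obtain ⟨T₁, T₂, f1, f2, e1, e2, d1, d2, d3⟩ := hp.of_connectsEdges hc
    have bs := hsub.sorted h.sorted
    have ba := hp.sorted.vert ha
    have bb := hp.sorted.vert hb
    obtain rfl : a' = a := hf (by omega)
    obtain rfl : b' = b := hf (by omega)
    obtain rfl := hsub.eq_self h.sorted
    cases hpr with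
    | leaf => exact absurd rfl hpl
    | @node _ p₁ _ p₂ _ hl hr =>
    refine ⟨p₁, p₂, rfl, ?_⟩
    have bl := h.left.lt
    have br := h.right.lt
    -- A triangle without children is an end of the dual path, and hence contains one of the two
    -- given non-cutting edges.
    have bottom : ∀ x₀ y₀ d, Sub a' b' (node c p₁ p₂) x₀ y₀ (node d leaf leaf) →
        face x₀ d y₀ = T₁ ∨ face x₀ d y₀ = T₂ := fun x₀ y₀ d hs =>
      d3 _ hs.isFace fun A B hA hB => share_unique_of_bottom hf hp.sorted hs hA hB
    have hl' : p₁ ≠ leaf → Shape κ handle p₁ l := fun hne => by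
      refine shape_handle_of hl hne h.sorted.1 (fun x₀ y₀ d l' r' hs =>
        leaf_or_leaf hf hp.sorted d1 (.left hs) fun e => ?_) fun x₀ y₀ d hs => ?_
      · have := hs.edge.lt hp.sorted.1; rw [e.2] at this; omega
      · obtain ⟨s', hs', hpr'⟩ := hl.sub hs
        have bd : ∀ z, z ∈ face x₀ d y₀ → f z ≤ f c := fun z hz => (hs.isFace.mem hp.sorted.1 hz).2
        have key : ∀ {x y}, IsNonCutting (toSub G a' b' (node c l r)) x y → x ∈ face x₀ d y₀ →
            y ∈ face x₀ d y₀ → Sub a' c l x₀ d leaf ∨ Sub a' c l d y₀ leaf := by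
          intro x y hxy hx hy
          cases hpr' with
          | @node _ _ l₁ _ l₂ h4 h5 =>
            have h6 := h.nonCutting_face (.left hs') hxy (fun e => by
              have := bd _ hx; have := bd _ hy
              rcases Sym2.eq_iff.1 e with ⟨rfl, rfl⟩ | ⟨rfl, rfl⟩ <;> omega) hx hy
            refine h6.imp (fun h7 => ?_) fun h7 => ?_
            · rw [h7.unique (Sub.left (hs'.trans (.left (.refl _ _ _)))) h.sorted]
              exact hs'.trans (.left (.refl _ _ _))
            · rw [h7.unique (Sub.left (hs'.trans (.right (.refl _ _ _)))) h.sorted]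
              exact hs'.trans (.right (.refl _ _ _))
        rcases bottom _ _ _ (.left hs) with rfl | rfl
        · exact key hxy (e1 _ (by simp)) (e1 _ (by simp))
        · exact key hxy' (e2 _ (by simp)) (e2 _ (by simp))
    have hr' : p₂ ≠ leaf → Shape κ handle p₂ r := fun hne => by
      refine shape_handle_of hr hne h.sorted.2 (fun x₀ y₀ d l' r' hs =>
        leaf_or_leaf hf hp.sorted d1 (.right hs) fun e => ?_) fun x₀ y₀ d hs => ?_
      · have := hs.edge.lt hp.sorted.2; rw [e.1] at this; omega
      · obtain ⟨s', hs', hpr'⟩ := hr.sub hs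
        have bd : ∀ z, z ∈ face x₀ d y₀ → f c ≤ f z := fun z hz => (hs.isFace.mem hp.sorted.2 hz).1
        have key : ∀ {x y}, IsNonCutting (toSub G a' b' (node c l r)) x y → x ∈ face x₀ d y₀ →
            y ∈ face x₀ d y₀ → Sub c b' r x₀ d leaf ∨ Sub c b' r d y₀ leaf := by
          intro x y hxy hx hy
          cases hpr' with
          | @node _ _ l₁ _ l₂ h4 h5 =>
            have h6 := h.nonCutting_face (.right hs') hxy (fun e => by
              have := bd _ hx; have := bd _ hy
              rcases Sym2.eq_iff.1 e with ⟨rfl, rfl⟩ | ⟨rfl, rfl⟩ <;> omega) hx hy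
            refine h6.imp (fun h7 => ?_) fun h7 => ?_
            · rw [h7.unique (Sub.right (hs'.trans (.left (.refl _ _ _)))) h.sorted]
              exact hs'.trans (.left (.refl _ _ _))
            · rw [h7.unique (Sub.right (hs'.trans (.right (.refl _ _ _)))) h.sorted]
              exact hs'.trans (.right (.refl _ _ _))
        rcases bottom _ _ _ (.right hs) with rfl | rfl
        · exact key hxy (e1 _ (by simp)) (e1 _ (by simp))
        · exact key hxy' (e2 _ (by simp)) (e2 _ (by simp))
    by_cases n1 : p₁ = leaf
    · by_cases n2 : p₂ = leaf
      -- The ribbon is the root triangle alone. One of its two distinct non-cutting edges differs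
      -- from (a,b), so a lower side of this triangle is an outer edge.
      · subst n1 n2
        have hface : ∀ T, IsFace a' b' (node c leaf leaf) T → T = face a' c b' := fun T hT => by
          simpa [isFace_node, not_isFace_leaf] using hT
        have hlr : l = leaf ∨ r = leaf := by
          have hself := Sub.refl a' b' (node c l r)
          have h6 : Sub a' b' (node c l r) a' c leaf ∨ Sub a' b' (node c l r) c b' leaf := by
            rcases eq_or_ne s(x, y) s(a', b') with e | e
            · exact h.nonCutting_face hself hxy' (fun e' => hne (e.trans e'.symm))
                (hface _ f2 ▸ e2 _ (by simp)) (hface _ f2 ▸ e2 _ (by simp))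
            · exact h.nonCutting_face hself hxy e
                (hface _ f1 ▸ e1 _ (by simp)) (hface _ f1 ▸ e1 _ (by simp))
          exact h6.imp (fun h7 => (h7.unique (.left (.refl _ _ _)) h.sorted).symm)
            (fun h7 => (h7.unique (.right (.refl _ _ _)) h.sorted).symm)
        rcases hlr with rfl | rfl
        · exact ⟨.inl rfl, .inr ⟨rfl, rfl⟩⟩
        · exact ⟨.inr ⟨rfl, rfl⟩, .inl rfl⟩
      · exact ⟨.inr ⟨n1, hr' n2⟩, .inl (hr' n2)⟩
    · refine ⟨.inl (hl' n1), ?_⟩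
      by_cases n2 : p₂ = leaf
      · exact .inr ⟨n2, hl' n1⟩
      · exact .inl (hr' n2)
  · rintro ⟨p₁, p₂, rfl, h1, h2⟩
    have handle_left : Shape κ handle p₁ l → p₂ = leaf →
        IsRibbon (toSub G a b (node c l r)) a b (toSub G a b (node c p₁ p₂)) := by
      rintro h3 rfl
      exact h.isRibbon_of_isHandle
        ((h.isHandle_iff (by simp)).2 ⟨_, rfl, shape_handle_node.2 (.inl ⟨_, rfl, h3⟩)⟩)
    have handle_right : Shape κ handle p₂ r → p₁ = leaf →
        IsRibbon (toSub G a b (node c l r)) a b (toSub G a b (node c p₁ p₂)) := by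
      rintro h3 rfl
      exact h.isRibbon_of_isHandle
        ((h.isHandle_iff (by simp)).2 ⟨_, rfl, shape_handle_node.2 (.inr ⟨_, rfl, h3⟩)⟩)
    rcases h1 with h1 | ⟨e1, h1⟩
    swap
    · exact handle_right h1 e1
    rcases h2 with h2 | ⟨e2, h2⟩
    swap
    · exact handle_left h2 e2
    rcases p₁ with _ | ⟨d, q₁, q₂⟩
    · exact handle_right h2 rfl
    rcases p₂ with _ | ⟨d', r₁, r₂⟩
    · exact handle_left h1 rfl
    have hpr : Prune (node c (node d q₁ q₂) (node d' r₁ r₂)) (node c l r) := .node h1.prune h2.prune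
    have hg := h.prune hpr
    have h2' : Shape κ handle (node c leaf (node d' r₁ r₂)) (node c l r) :=
      shape_handle_node.2 (.inr ⟨_, rfl, h2⟩)
    obtain ⟨L₁, hL₁, hT₁, x, y, hxy, hx, hy⟩ := h1.exists_pathList hf hg.sorted.1
    obtain ⟨L₂, hL₂, hT₂, x', y', hxy', hx', hy'⟩ :=
      h2'.exists_pathList hf (h2'.prune.sorted h.sorted)
    -- The dual path of the left handle, read backwards, continues with the root triangle and the
    -- dual path of the right handle.
    have hL := hL₁.reverse_append (fun _ _ => Share.symm) hL₂
      (share_left hf hg.sorted (.refl _ _ _)).symm (fun S hS T hT => by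
        rw [hT₁] at hS
        rw [hT₂, isFace_node] at hT
        rcases hT with rfl | hT | hT
        · refine ⟨(ne_root_left hg.sorted hS).symm, fun hsh => ⟨?_, rfl⟩⟩
          obtain ⟨_, _, _, e, rfl⟩ := share_root_left hf hg.sorted hS hsh.symm
          simp only [node.injEq] at e
          rw [e.1]
        · exact absurd hT not_isFace_leaf
        · have := not_share_left_right hf hg.sorted hS hT
          exact ⟨this.1, fun h => absurd h this.2⟩)
    have hc : ConnectsEdges (toSub G a b (node c (node d q₁ q₂) (node d' r₁ r₂)))
        s(x, y) s(x', y') := by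
      refine hg.connectsEdges (by simp) hL (fun T => ?_) ?_ ?_ ?_ ?_
      · rw [List.mem_append, List.mem_reverse, hT₁, hT₂, isFace_node (c := c), isFace_node (c := c)]
        simp only [not_isFace_leaf]
        tauto
      all_goals first
        | rw [List.head_append_of_ne_nil (by simp), List.head_reverse]; assumption
        | rw [List.getLast_append_of_ne_nil _ (by simp)]; assumption
    have hxr : Sub a b (node c l r) x' y' leaf := hxy'
    have b1 := hxy.edge.lt h.sorted.1
    have b2 := hxr.edge.lt h.sorted
    -- The end edge of the second handle lies in the right part. This makes it different from the
    -- end edge of the first one.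
    have bx : f c ≤ f x' := by
      rcases sub_node.1 hxr with ⟨-, -, e⟩ | hxl | hxr
      · cases e
      · exfalso
        have m := List.getLast_mem (l := face a c b :: L₂) (by simp)
        have b3 := hxl.edge.lt h.sorted.1
        rw [hT₂, isFace_node] at m
        rcases m with m | m | m
        · rw [m, mem_face] at hx' hy'
          have bl := h.left.lt
          have br := h.right.lt
          have e : x' = a ∧ y' = c := by
            constructor
            · rcases hx' with rfl | rfl | rfl
              · rfl
              · omega
              · omega
            · rcases hy' with rfl | rfl | rfl
              · omega
              · rfl
              · omega
          rw [e.1, e.2] at hxl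
          rw [← hxl.eq_self h.sorted.1] at h1
          cases h1
        · exact not_isFace_leaf m
        · have := m.mem hg.sorted.2 hx'
          omega
      · exact (hxr.edge.lt h.sorted.2).1
    exact ⟨toSub_le hpr, ⟨x, y, x', y', (h.nonCutting_iff b1.2.1).2 (.inr (.left hxy)),
      (h.nonCutting_iff b2.2.1).2 (.inr hxr), fun e => by
        rcases Sym2.eq_iff.1 e with ⟨rfl, rfl⟩ | ⟨rfl, rfl⟩ <;> omega, hc⟩,
      vert_fst, vert_snd, c, vert_node.2 (.inl vert_snd),
      h.toSub_adj.2 (.inl (Sub.refl _ _ _).apex_edges.1),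
      h.toSub_adj.2 (.inl (Sub.refl _ _ _).apex_edges.2)⟩

end Tri

/-! ### Fans, partial umbrellas and full fans as shapes -/

namespace Tri
variable {V : Type u} {G : SimpleGraph V} {f : V → ℕ} {a b c d x y z p q u v x' y' c' : V}
  {t t' l r s s' l' r' p₁ p₂ : Tri V} {κ : SystemKind} {P F F₁ F₂ U T : G.Subgraph}

open Mode

theorem toSub_node : toSub G a b (node c l r) =
    toSub G a b leaf ⊔ (toSub G a c l ⊔ toSub G c b r) := by
  ext x y
  · simp only [SimpleGraph.Subgraph.verts_sup, Set.mem_union, mem_verts_toSub, vert_node, vert_leaf]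
    constructor
    · exact .inr
    · rintro ((rfl | rfl) | h)
      · exact .inl vert_fst
      · exact .inr vert_snd
      · exact h
  · simp only [SimpleGraph.Subgraph.sup_adj, toSub, edge_node, edge_leaf]
    tauto

/-- `F` is a fan at `a` for `P`, as a triangulation. -/
def FanData (G : SimpleGraph V) (a b : V) (t : Tri V) (P F : G.Subgraph) : Prop :=
  F = ⊥ ∨ ∃ y q s x, F = toSub G a y q ∧ q ≠ leaf ∧ Sub a b t a y s ∧ Prune q s ∧
    Shape .bonnet fanLeft q q ∧ F.edgeSet ∩ P.edgeSet = {s(a, x)}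

/-- If a triangle had another one with apex d below its side (c,w) away from a, then the edge from a
to d would cross (c,w). -/
theorem shape_fanLeft_of_edges (hs : Sorted f a b t) {w : V} {q : Tri V} (hq : Sorted f a w q)
    (h1 : ∀ x y, Edge a w q x y → Edge a b t x y)
    (h2 : ∀ z, Vert a w q z → z = a ∨ Edge a b t a z) : Shape .bonnet fanLeft q q := by
  induction q generalizing w with
  | leaf => rfl
  | node c l r ihl _ =>
    have hr : r = leaf := by
      rcases r with _ | ⟨d, r₁, r₂⟩
      · rfl
      exfalso
      have hd := Sub.right (a := a) (l := l) (.refl c w (node d r₁ r₂))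
      have b1 := hd.node_lt hq
      have bl := hq.1.lt
      rcases h2 d (hd.vert (vert_node.2 (.inl vert_snd))) with rfl | h3
      · omega
      · exact h3.noncross (h1 _ _ hd.edge) hs (by omega)
    subst hr
    exact shape_fanLeft_node.2 ⟨l, rfl, ihl hq.1
      (fun x y h => h1 x y (edge_node.2 (.inr (.inl h)))) fun z h => h2 z (vert_node.2 (.inl h))⟩

theorem Shape.fanLeft_edge {q : Tri V} (h : Shape κ fanLeft q t) (hz : Vert a b q z) :
    z = a ∨ Edge a b q a z := by
  induction t generalizing a b q with
  | leaf =>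
    obtain rfl := h
    rcases vert_leaf.1 hz with rfl | rfl
    · exact .inl rfl
    · exact .inr (edge_base _ _ _)
  | node c l r ihl _ =>
    obtain ⟨q', rfl, h'⟩ := shape_fanLeft_node.1 h
    rcases vert_node.1 hz with hz | hz
    · exact (ihl h' hz).imp_right fun h => edge_node.2 (.inr (.inl h))
    · rcases vert_leaf.1 hz with rfl | rfl
      · exact .inr (edge_node.2 (.inr (.inl (edge_base _ _ _))))
      · exact .inr (edge_base _ _ _)

theorem mem_neighborSet_toSub (h : Good G f a b t) : z ∈ (toSub G a b t).neighborSet a ↔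
    Edge a b t a z := by
  rw [SimpleGraph.Subgraph.mem_neighborSet, h.toSub_adj]
  refine ⟨fun h' => h'.resolve_right fun h' => ?_, .inl⟩
  have := h'.lt h.sorted
  omega

/-- If the base of a fan did not start at a, its apex would be joined to a by an edge that crosses
the base. For the converse, a tree shaped like a full fan is a handle in itself, so its dual tree is
a path. -/
theorem isFan_iff (h : Good G f a b t) : IsFan (toSub G a b t) P a F ↔ FanData G a b t P F := by
  have hf := h.inj
  constructor
  · rintro (rfl | ⟨hF, ⟨hm, -⟩, hv, x, hx⟩)
    · exact .inl rfl
    · obtain ⟨x', y, q, s, rfl, hq, hql, hsub, hpr⟩ := h.exists_of_le hF hm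
      have hv' : ∀ z, Vert x' y q z → z = a ∨ Edge a b t a z := fun z hz => by
        rcases hv hz with h1 | h1
        · exact .inl h1
        · exact .inr ((mem_neighborSet_toSub h).1 h1)
      have hxa : x' = a := by
        by_contra hne
        rcases q with _ | ⟨c, q₁, q₂⟩
        · exact hql rfl
        have bc := (Sub.refl x' y (node c q₁ q₂)).node_lt hq.sorted
        have bx := hsub.edge.lt h.sorted
        have := hf.ne hne
        rcases hv' c (vert_node.2 (.inl vert_snd)) with rfl | h1
        · omega
        · exact h1.noncross hsub.edge h.sorted (by omega)
      subst hxa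
      exact .inr ⟨y, q, s, x, rfl, hql, hsub, hpr, shape_fanLeft_of_edges h.sorted hq.sorted
        (fun x y h => hsub.edge_of (hpr.edge h)) hv', hx⟩
  · rintro (rfl | ⟨y, q, s, x, rfl, hq, hsub, hpr, hsh, hx⟩)
    · exact .inl rfl
    · have hg := (h.sub hsub).prune hpr
      refine .inr ⟨(toSub_le hpr).trans (toSub_le_of_sub hsub), ?_, fun z hz => ?_, x, hx⟩
      · obtain ⟨-, x', y', -, -, h2, k, φ, -⟩ := (hg.isHandle_iff hq).2 ⟨q, rfl, hsh.handle_of_fanLeft⟩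
        exact ⟨h2, k + 1, ⟨φ⟩⟩
      · rcases hsh.fanLeft_edge hz with rfl | h1
        · exact .inl rfl
        · exact .inr ((mem_neighborSet_toSub h).2 (hsub.edge_of (hpr.edge h1)))

theorem FanData.bounds (h : FanData G a b t P F) (hg : Good G f a b t) (hz : z ∈ F.verts) :
    f a ≤ f z ∧ f z ≤ f b := by
  rcases h with rfl | ⟨y, q, s, x, rfl, hq, hsub, hpr, hsh, hx⟩
  · exact absurd hz (by simp)
  · exact hg.sorted.vert (hsub.vert (hpr.vert hz))

theorem Good.adj_left (h : Good G f a b (node c l r)) (hxy : (toSub G a b (node c l r)).Adj x y)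
    (hx : f x ≤ f c) (hy : f y ≤ f c) : (toSub G a c l).Adj x y := by
  have e : Sub a b (node c l r) a c l := .left (.refl _ _ _)
  refine ⟨hxy.1, hxy.2.imp (fun h' => ?_) (fun h' => ?_)⟩
  · exact h'.inside e h.sorted (h'.lt h.sorted).1 hy
  · exact h'.inside e h.sorted (h'.lt h.sorted).1 hx

/-- Once the triangle abc belongs to P, a nonempty fan with base (a,b) would share both (a,b) and
(a,c) with P; so every nonempty fan at a lies beyond the side (a,c). -/
theorem fanData_node (h : Good G f a b (node c l r)) (h1 : Prune p₁ l) (h2 : Prune p₂ r) :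
    FanData G a b (node c l r) (toSub G a b (node c p₁ p₂)) F ↔
      FanData G a c l (toSub G a c p₁) F := by
  have hp := h.prune (.node h1 h2)
  have bl := h.left.lt
  have br := h.right.lt
  have key : ∀ {y q s}, Sub a c l a y s → Prune q s →
      (toSub G a y q).edgeSet ∩ (toSub G a b (node c p₁ p₂)).edgeSet =
      (toSub G a y q).edgeSet ∩ (toSub G a c p₁).edgeSet := by
    intro y q s hsub hpr
    have bd : ∀ z, Vert a y q z → f z ≤ f c := fun z hz =>
      (h.sorted.1.vert (hsub.vert (hpr.vert hz))).2
    ext e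
    induction e with | _ x x'
    simp only [Set.mem_inter_iff, SimpleGraph.Subgraph.mem_edgeSet]
    constructor
    · rintro ⟨e1, e2⟩
      exact ⟨e1, hp.adj_left e2 (bd _ e1.fst_mem) (bd _ e1.snd_mem)⟩
    · rintro ⟨e1, e2⟩
      exact ⟨e1, e2.1, e2.2.imp (fun e => edge_node.2 (.inr (.inl e)))
        (fun e => edge_node.2 (.inr (.inl e)))⟩
  constructor
  · rintro (rfl | ⟨y, q, s, x, rfl, hq, hsub, hpr, hsh, hx⟩)
    · exact .inl rfl
    · rcases sub_node.1 hsub with ⟨-, rfl, rfl⟩ | hsub' | hsub'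
      · exfalso
        cases hpr with
        | leaf => exact hq rfl
        | @node _ q₁ _ q₂ _ hq₁ hq₂ =>
          have m1 : s(a, y) ∈ (toSub G a y (node c q₁ q₂)).edgeSet ∩
              (toSub G a y (node c p₁ p₂)).edgeSet :=
            ⟨(h.prune (.node hq₁ hq₂)).toSub_adj.2 (.inl (edge_base _ _ _)),
              hp.toSub_adj.2 (.inl (edge_base _ _ _))⟩
          have m2 : s(a, c) ∈ (toSub G a y (node c q₁ q₂)).edgeSet ∩
              (toSub G a y (node c p₁ p₂)).edgeSet :=
            ⟨(h.prune (.node hq₁ hq₂)).toSub_adj.2 (.inl (Sub.refl _ _ _).apex_edges.1),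
              hp.toSub_adj.2 (.inl (Sub.refl _ _ _).apex_edges.1)⟩
          rw [hx, Set.mem_singleton_iff] at m1 m2
          have := Sym2.congr_right.1 (m1.trans m2.symm)
          subst this
          omega
      · exact .inr ⟨y, q, s, x, rfl, hq, hsub', hpr, hsh, by rw [← key hsub' hpr, hx]⟩
      · have := hsub'.edge.lt h.sorted.2
        omega
  · rintro (rfl | ⟨y, q, s, x, rfl, hq, hsub, hpr, hsh, hx⟩)
    · exact .inl rfl
    · exact .inr ⟨y, q, s, x, rfl, hq, .left hsub, hpr, hsh, by rw [key hsub hpr, hx]⟩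

/-- `T` is the union of the part `p` of `t` and a fan at `a`, and contains all neighbours of `a`. -/
def FanUnion (G : SimpleGraph V) (a b : V) (t p : Tri V) (T : G.Subgraph) : Prop :=
  ∃ F, FanData G a b t (toSub G a b p) F ∧
    (∀ z, Edge a b t a z → z ∈ (toSub G a b p).verts ∨ z ∈ F.verts) ∧ T = toSub G a b p ⊔ F

theorem Good.edge_fst_node (h : Good G f a b (node c l r)) :
    Edge a b (node c l r) a z ↔ z = b ∨ Edge a c l a z := by
  rw [edge_node]
  have bl := h.left.lt
  constructor
  · rintro (⟨-, rfl⟩ | h' | h')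
    · exact .inl rfl
    · exact .inr h'
    · have := h'.lt h.sorted.2; omega
  · rintro (rfl | h')
    · exact .inl ⟨rfl, rfl⟩
    · exact .inr (.inl h')

theorem vert_node_fst (h : Good G f a b (node c p₁ p₂)) (hz : Vert a b (node c p₁ p₂) z)
    (hzc : f z ≤ f c) : Vert a c p₁ z :=
  hz.inside h.inj (.left (.refl _ _ _)) h.sorted (h.sorted.vert hz).1 hzc

/-- Apart from b, all neighbours of a lie in the left part, and so does the fan; hence only the left
part has to be analysed further. -/
theorem fanUnion_node (h : Good G f a b (node c l r)) (h1 : Prune p₁ l) (h2 : Prune p₂ r) :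
    FanUnion G a b (node c l r) (node c p₁ p₂) T ↔ ∃ T', FanUnion G a c l p₁ T' ∧
      T = toSub G a b leaf ⊔ (T' ⊔ toSub G c b p₂) := by
  have hp := h.prune (.node h1 h2)
  constructor
  · rintro ⟨F, hF, hz, rfl⟩
    refine ⟨_, ⟨F, (fanData_node h h1 h2).1 hF, fun z hz' => ?_, rfl⟩, ?_⟩
    · refine (hz z (h.edge_fst_node.2 (.inr hz'))).imp_left fun h3 => ?_
      exact vert_node_fst hp h3 (hz'.lt h.sorted.1).2.2
    · rw [toSub_node]; ac_rfl
  · rintro ⟨T', ⟨F, hF, hz, rfl⟩, rfl⟩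
    refine ⟨F, (fanData_node h h1 h2).2 hF, fun z hz' => ?_, ?_⟩
    · rcases h.edge_fst_node.1 hz' with rfl | hz'
      · exact .inl vert_snd
      · exact (hz z hz').imp_left fun h3 => vert_node.2 (.inl h3)
    · rw [toSub_node]; ac_rfl

theorem Shape.fanLeft_of_self {q : Tri V} (hg : Good G f a b t) (hpr : Prune q t)
    (h : Shape .bonnet fanLeft q q) (hz : ∀ z, Edge a b t a z → Vert a b q z) :
    Shape κ fanLeft q t := by
  induction t generalizing a b q with
  | leaf => cases hpr; rfl
  | node c l r ihl _ =>
    have e1 := (Sub.refl a b (node c l r)).node_lt hg.sorted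
    cases hpr with
    | leaf =>
      exfalso
      rcases vert_leaf.1 (hz c (Sub.refl _ _ _).apex_edges.1) with rfl | rfl <;> omega
    | @node _ q₁ _ q₂ _ h1 h2 =>
      obtain ⟨q', e, h'⟩ := shape_fanLeft_node.1 h
      simp only [node.injEq, true_and] at e
      obtain ⟨rfl, rfl⟩ := e
      exact shape_fanLeft_node.2 ⟨_, rfl, ihl hg.left h1 h' fun z hz' =>
        vert_node_fst (hg.prune (.node h1 (.leaf _)))
          (hz z (edge_node.2 (.inr (.inl hz')))) (hz'.lt hg.sorted.1).2.2⟩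

theorem Shape.fanLeft_vert {q : Tri V} (h : Shape κ fanLeft q t) (hg : Good G f a b t)
    (hz : Edge a b t a z) : Vert a b q z := by
  induction t generalizing a b q with
  | leaf => obtain rfl := h; exact hz.vert.2
  | node c l r ihl _ =>
    obtain ⟨q', rfl, h'⟩ := shape_fanLeft_node.1 h
    rcases hg.edge_fst_node.1 hz with rfl | hz
    · exact vert_snd
    · exact vert_node.2 (.inl (ihl h' hg.left hz))

theorem toSub_leaf_le : toSub G a b leaf ≤ toSub G a b t := toSub_le (.leaf _)

/-- If P has only the edge (a,b) here, this is the edge shared with the fan. The fan then starts at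
the base and has to contain all neighbours of a; it can be empty only if there is no triangle. -/
theorem fanUnion_leaf_iff (h : Good G f a b t) : FanUnion G a b t leaf T ↔
    ∃ q, Shape κ fanLeft q t ∧ T = toSub G a b q := by
  constructor
  · rintro ⟨F, hF, hz, rfl⟩
    rcases hF with rfl | ⟨y, q, s, x, rfl, hq, hsub, hpr, hsh, hx⟩
    · refine ⟨leaf, ?_, by simp⟩
      rcases t with _ | ⟨c, l, r⟩
      · rfl
      exfalso
      have e1 := (Sub.refl a b (node c l r)).node_lt h.sorted
      rcases hz c (Sub.refl _ _ _).apex_edges.1 with hz | hz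
      · rcases vert_leaf.1 hz with rfl | rfl <;> omega
      · exact absurd hz (by simp)
    · have hg := (h.sub hsub).prune hpr
      have m : s(a, x) ∈ (toSub G a y q).edgeSet ∩ (toSub G a b leaf).edgeSet := by rw [hx]; rfl
      have hxb : b ∈ (toSub G a y q).verts := by
        have m2 := m.2
        rw [edgeSet_toSub_leaf (h.prune (.leaf _)), Set.mem_singleton_iff] at m2
        have := Sym2.congr_right.1 m2
        subst this
        exact SimpleGraph.Subgraph.Adj.snd_mem m.1
      have b1 := hg.sorted.vert hxb
      have b2 := hsub.edge.lt h.sorted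
      obtain rfl : y = b := h.inj (by omega)
      obtain rfl := hsub.eq_self h.sorted
      refine ⟨q, hsh.fanLeft_of_self h hpr fun z hz' => ?_, ?_⟩
      · rcases hz z hz' with hz | hz
        · rcases vert_leaf.1 hz with rfl | rfl
          · exact vert_fst
          · exact vert_snd
        · exact hz
      · rw [sup_eq_right]; exact toSub_leaf_le
  · rintro ⟨q, hq, rfl⟩
    rcases q with _ | ⟨c, q₁, q₂⟩
    · refine ⟨⊥, .inl rfl, fun z hz => .inl (hq.fanLeft_vert h hz), by simp⟩
    · have hg := h.prune hq.prune
      refine ⟨_, .inr ⟨b, _, t, b, rfl, by simp, .refl _ _ _, hq.prune, ?_, ?_⟩,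
        fun z hz => .inr (hq.fanLeft_vert h hz), ?_⟩
      · exact shape_fanLeft_of_edges hg.sorted hg.sorted (fun _ _ h => h)
          (fun z hz => hq.fanLeft_edge hz)
      · rw [edgeSet_toSub_leaf (h.prune (.leaf _)), Set.inter_eq_right, Set.singleton_subset_iff]
        exact hg.toSub_adj.2 (.inl (edge_base _ _ _))
      · exact (sup_eq_right.2 toSub_leaf_le).symm

/-- A handle that goes left leaves the same problem for the left part; a handle that goes right
leaves only the edge (a,c) there, which requires the full fan. These are the two rules for
`partLeft`. -/
theorem fanUnion_handle_iff (h : Good G f a b t) :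
    (∃ p, Shape κ handle p t ∧ FanUnion G a b t p T) ↔
      ∃ q, Shape κ partLeft q t ∧ T = toSub G a b q := by
  induction t generalizing a b T with
  | leaf =>
    have := fanUnion_leaf_iff (κ := κ) (T := T) h
    simpa using this
  | node c l r ihl _ =>
    constructor
    · rintro ⟨p, hp, hT⟩
      rcases shape_handle_node.1 hp with ⟨p₁, rfl, h1⟩ | ⟨p₂, rfl, h1⟩
      · obtain ⟨T', h2, rfl⟩ := (fanUnion_node h h1.prune (.leaf _)).1 hT
        obtain ⟨q, hq, rfl⟩ := (ihl h.left).1 ⟨p₁, h1, h2⟩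
        exact ⟨node c q leaf, shape_partLeft_node.2 (.inl ⟨q, rfl, hq⟩), by rw [toSub_node]⟩
      · obtain ⟨T', h2, rfl⟩ := (fanUnion_node h (.leaf _) h1.prune).1 hT
        obtain ⟨q, hq, rfl⟩ := (fanUnion_leaf_iff (κ := κ) h.left).1 h2
        exact ⟨node c q p₂, shape_partLeft_node.2 (.inr ⟨q, p₂, rfl, hq, h1⟩), by rw [toSub_node]⟩
    · rintro ⟨q, hq, rfl⟩
      rcases shape_partLeft_node.1 hq with ⟨l', rfl, h1⟩ | ⟨l', r', rfl, h1, h2⟩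
      · obtain ⟨p, hp, hT⟩ := (ihl h.left).2 ⟨l', h1, rfl⟩
        exact ⟨node c p leaf, shape_handle_node.2 (.inl ⟨p, rfl, hp⟩),
          (fanUnion_node h hp.prune (.leaf _)).2 ⟨_, hT, by rw [toSub_node]⟩⟩
      · exact ⟨node c leaf r', shape_handle_node.2 (.inr ⟨r', rfl, h2⟩),
          (fanUnion_node h (.leaf _) h2.prune).2
            ⟨_, (fanUnion_leaf_iff (κ := κ) h.left).2 ⟨l', h1, rfl⟩, by rw [toSub_node]⟩⟩

theorem Good.isPartialUmbrella_iff (h : Good G f a b t) (ht : t ≠ leaf) :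
    IsPartialUmbrella a b a (toSub G a b t) U ↔
      ∃ q, Shape κ partLeft q t ∧ U = toSub G a b q := by
  rw [← fanUnion_handle_iff h]
  constructor
  · rintro ⟨P, F, hP, hF, rfl, hN⟩
    obtain ⟨p, rfl, hp⟩ := (h.isHandle_iff (κ := κ) ht).1 hP
    exact ⟨p, hp, F, (isFan_iff h).1 hF, fun z hz => hN ((mem_neighborSet_toSub h).2 hz), rfl⟩
  · rintro ⟨p, hp, F, hF, hz, rfl⟩
    exact ⟨_, F, (h.isHandle_iff ht).2 ⟨p, rfl, hp⟩, (isFan_iff h).2 hF, rfl,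
      fun z hz' => hz z ((mem_neighborSet_toSub h).1 hz')⟩

/-- Pruned triangulations are induced subgraphs, because a cut-off part loses all vertices other
than the ends of its base. This is needed because the full fan is defined as an induced subgraph. -/
theorem Prune.edge_of_vert {q : Tri V} (hpr : Prune q t) (h : Good G f a b t) (hxy : Edge a b t x y)
    (hx : Vert a b q x) (hy : Vert a b q y) : Edge a b q x y := by
  have b0 := hxy.lt h.sorted
  have b1 := h.lt
  induction hpr generalizing a b with
  | leaf =>
    rw [edge_leaf]
    rcases vert_leaf.1 hx with rfl | rfl <;> rcases vert_leaf.1 hy with rfl | rfl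
    · omega
    · exact ⟨rfl, rfl⟩
    · omega
    · omega
  | node h1 h2 ihl ihr =>
    have hp := h.prune (.node h1 h2)
    rw [edge_node]
    rcases edge_node.1 hxy with h3 | h3 | h3
    · exact .inl h3
    · have b3 := h3.lt h.sorted.1
      exact .inr (.inl (ihl h.left h3 (vert_node_fst hp hx (by omega)) (vert_node_fst hp hy b3.2.2)
        b3 h.left.lt))
    · have b3 := h3.lt h.sorted.2
      have key : ∀ {z}, Vert a b _ z → _ ≤ f z → Vert _ b _ z := fun {z} hz hc =>
        hz.inside hp.inj (.right (.refl _ _ _)) hp.sorted hc (hp.sorted.vert hz).2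
      exact .inr (.inr (ihr h.right h3 (key hx b3.1) (key hy (by omega)) b3 h.right.lt))

theorem Good.isFullFan_iff (h : Good G f a b t) : IsFullFan a (toSub G a b t) U ↔
    ∃ q, Shape κ fanLeft q t ∧ U = toSub G a b q := by
  have key : ∀ q, Shape κ fanLeft q t → toSub G a b q =
      (toSub G a b t).induce (insert a ((toSub G a b t).neighborSet a)) := by
    intro q hq
    have hv : ∀ z, z ∈ insert a ((toSub G a b t).neighborSet a) ↔ Vert a b q z := fun z => by
      rw [Set.mem_insert_iff, mem_neighborSet_toSub h]
      constructor
      · rintro (rfl | h1)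
        · exact vert_fst
        · exact hq.fanLeft_vert h h1
      · intro hz
        exact (hq.fanLeft_edge hz).imp_right hq.prune.edge
    ext x y
    · exact (hv x).symm
    · rw [SimpleGraph.Subgraph.induce_adj, hv, hv, h.toSub_adj, (h.prune hq.prune).toSub_adj]
      constructor
      · rintro (h1 | h1)
        · exact ⟨h1.vert.1, h1.vert.2, .inl (hq.prune.edge h1)⟩
        · exact ⟨h1.vert.2, h1.vert.1, .inr (hq.prune.edge h1)⟩
      · rintro ⟨hx, hy, h1 | h1⟩
        · exact .inl (hq.prune.edge_of_vert h h1 hx hy)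
        · exact .inr (hq.prune.edge_of_vert h h1 hy hx)
  rw [IsFullFan]
  constructor
  · rintro rfl
    exact ⟨_, shape_best κ fanLeft t, (key _ (shape_best κ fanLeft t)).symm⟩
  · rintro ⟨q, hq, rfl⟩
    exact key q hq

end Tri

/-! ### Umbrellas and bonnets as shapes -/

namespace Tri
variable {V : Type u} {G : SimpleGraph V} {f g : V → ℕ} {a b c d x y z p q u v x' y' c' : V}
  {t t' l r s s' l' r' p₁ p₂ : Tri V} {κ : SystemKind} {m : Mode} {P F F₁ F₂ U T : G.Subgraph}

open Mode

theorem exists_shape_mirror : (∃ q, Shape κ m q t.mirror ∧ T = toSub G b a q) ↔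
    ∃ q, Shape κ m.mirror q t ∧ T = toSub G a b q := by
  constructor
  · rintro ⟨q, hq, rfl⟩
    refine ⟨q.mirror, by simpa using hq.mirror, ?_⟩
    rw [toSub_mirror]
  · rintro ⟨q, hq, rfl⟩
    refine ⟨q.mirror, ?_, toSub_mirror.symm⟩
    have := hq.mirror
    cases m <;> exact this

theorem fanUnion_leaf_mirror_iff (h : Good G g b a t.mirror) : FanUnion G b a t.mirror leaf T ↔
    ∃ q, Shape κ fanRight q t ∧ T = toSub G a b q := by
  rw [fanUnion_leaf_iff (κ := κ) h, exists_shape_mirror]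
  rfl

theorem fanUnion_handle_mirror_iff (h : Good G g b a t.mirror) :
    (∃ p, Shape κ handle p t ∧ FanUnion G b a t.mirror p.mirror T) ↔
      ∃ q, Shape κ partRight q t ∧ T = toSub G a b q := by
  have := fanUnion_handle_iff (κ := κ) (T := T) h
  rw [exists_shape_mirror] at this
  refine Iff.trans ?_ this
  constructor
  · rintro ⟨p, hp, hT⟩; exact ⟨p.mirror, hp.mirror, hT⟩
  · rintro ⟨p, hp, hT⟩; exact ⟨p.mirror, by simpa [Mode.mirror] using hp.mirror, by simpa using hT⟩

/-- The fan at a lives in the left part and the fan at b in the right part, so the requirements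
separate at the apex c. The right part is treated in the mirror image. -/
theorem Good.isUnionWithFans_iff (h : Good G f a b (node c l r))
    (hm : Good G g b a (node c l r).mirror) (h1 : Prune p₁ l) (h2 : Prune p₂ r) :
    IsUnionWithFans (toSub G a b (node c l r)) a b (toSub G a b (node c p₁ p₂)) U ↔
      ∃ T₁ T₂, FanUnion G a c l p₁ T₁ ∧ FanUnion G b c r.mirror p₂.mirror T₂ ∧
        U = toSub G a b leaf ⊔ (T₁ ⊔ T₂) := by
  have hp := h.prune (.node h1 h2)
  have hpm : Good G g b a (node c p₂.mirror p₁.mirror) := hm.prune (.node h2.mirror h1.mirror)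
  have fan_right : ∀ F, IsFan (toSub G a b (node c l r)) (toSub G a b (node c p₁ p₂)) b F ↔
      FanData G b c r.mirror (toSub G b c p₂.mirror) F := fun F => by
    rw [← toSub_mirror, isFan_iff hm, ← toSub_mirror (t := node c p₁ p₂)]
    exact fanData_node hm h2.mirror h1.mirror
  have nb_right : ∀ z, z ∈ (toSub G a b (node c l r)).neighborSet b ↔
      z = a ∨ Edge b c r.mirror b z := fun z => by
    rw [← toSub_mirror, mem_neighborSet_toSub hm]
    exact Good.edge_fst_node hm
  have vert_right : ∀ z, Vert b a (node c p₁ p₂).mirror z ↔ Vert a b (node c p₁ p₂) z :=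
    fun z => vert_mirror
  have lt_anti : ∀ z, Vert b c r.mirror z → f c ≤ f z := fun z hz =>
    (h.sorted.2.vert (vert_mirror.1 hz)).1
  have lt_anti' : ∀ z, Vert a c l z → g c ≤ g z := fun z hz =>
    (hm.sorted.2.vert (vert_mirror.2 hz)).1
  constructor
  · rintro ⟨F₁, F₂, hF₁, hF₂, -, rfl, hN₁, hN₂⟩
    rw [isFan_iff h, fanData_node h h1 h2] at hF₁
    rw [fan_right] at hF₂
    have v1 : ∀ z ∈ F₁.verts, Vert a c l z := fun z hz => by
      rcases hF₁ with rfl | ⟨y, q, s, x, rfl, hq, hsub, hpr, -⟩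
      · exact absurd hz (by simp)
      · exact hsub.vert (hpr.vert hz)
    have v2 : ∀ z ∈ F₂.verts, Vert b c r.mirror z := fun z hz => by
      rcases hF₂ with rfl | ⟨y, q, s, x, rfl, hq, hsub, hpr, -⟩
      · exact absurd hz (by simp)
      · exact hsub.vert (hpr.vert hz)
    refine ⟨_, _, ⟨F₁, hF₁, fun z hz => ?_, rfl⟩, ⟨F₂, hF₂, fun z hz => ?_, rfl⟩, ?_⟩
    · have b1 := hz.lt h.sorted.1
      rcases hN₁ ((mem_neighborSet_toSub h).2 (h.edge_fst_node.2 (.inr hz))) with (h3 | h3) | h3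
      · exact .inl (vert_node_fst hp h3 b1.2.2)
      · exact .inr h3
      -- A neighbour of a that is covered by the fan at b lies in both parts, hence is the apex c,
      -- which belongs to P anyway.
      · have := lt_anti z (v2 z h3)
        obtain rfl := h.inj (le_antisymm b1.2.2 this)
        exact .inl vert_snd
    · have b1 := hz.lt hm.sorted.1
      rcases hN₂ ((nb_right z).2 (.inr hz)) with (h3 | h3) | h3
      · exact .inl (vert_node_fst hpm ((vert_right z).2 h3) b1.2.2)
      · have := lt_anti' z (v1 z h3)
        obtain rfl := hm.inj (le_antisymm b1.2.2 this)
        exact .inl vert_snd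
      · exact .inr h3
    · rw [toSub_node, toSub_mirror]; ac_rfl
  · rintro ⟨T₁, T₂, ⟨F₁, hF₁, hN₁, rfl⟩, ⟨F₂, hF₂, hN₂, rfl⟩, rfl⟩
    refine ⟨F₁, F₂, (isFan_iff h).2 ((fanData_node h h1 h2).2 hF₁), (fan_right F₂).2 hF₂, ?_, ?_,
      fun z hz => ?_, fun z hz => ?_⟩
    -- The two fans have at most the vertex c in common, so they are edge-disjoint automatically.
    · rw [Set.disjoint_left]
      intro e
      induction e with | _ x y
      intro e1 e2
      have n := h.inj.ne (SimpleGraph.Subgraph.Adj.ne e1)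
      have b1 := hF₁.bounds h.left (SimpleGraph.Subgraph.Adj.fst_mem e1)
      have b2 := hF₁.bounds h.left (SimpleGraph.Subgraph.Adj.snd_mem e1)
      have v2 : ∀ z ∈ F₂.verts, Vert b c r.mirror z := fun z hz => by
        rcases hF₂ with rfl | ⟨y, q, s, x, rfl, hq, hsub, hpr, -⟩
        · exact absurd hz (by simp)
        · exact hsub.vert (hpr.vert hz)
      have b3 := lt_anti _ (v2 _ (SimpleGraph.Subgraph.Adj.fst_mem e2))
      have b4 := lt_anti _ (v2 _ (SimpleGraph.Subgraph.Adj.snd_mem e2))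
      omega
    · rw [toSub_node, toSub_mirror]; ac_rfl
    · rcases h.edge_fst_node.1 ((mem_neighborSet_toSub h).1 hz) with rfl | hz
      · exact .inl vert_snd
      · exact .inr (.inl (hN₁ z hz))
    · rcases (nb_right z).1 hz with rfl | hz
      · exact .inl vert_fst
      · exact .inr (.inr (hN₂ z hz))

/-- The umbrellas. -/
theorem Good.isUmbrella_iff [Finite V] (h : Good G f a b t) (ht : t ≠ leaf) :
    IsUmbrella (toSub G a b t) a b U ↔ ∃ q, Shape .umbrella root q t ∧ U = toSub G a b q := by
  rcases t with _ | ⟨c, l, r⟩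
  · exact absurd rfl ht
  obtain ⟨g, hm⟩ := h.mirror
  have hmr : Good G g b c r.mirror := hm.left
  simp only [shape_root_umbrella_node]
  constructor
  · rintro ⟨-, P, hP, hU⟩
    obtain ⟨p, rfl, hp⟩ := (h.isHandle_iff (κ := .umbrella) (by simp)).1 hP
    rcases shape_handle_node.1 hp with ⟨p₁, rfl, h1⟩ | ⟨p₂, rfl, h1⟩
    · obtain ⟨T₁, T₂, h2, h3, rfl⟩ := (h.isUnionWithFans_iff hm h1.prune (.leaf _)).1 hU
      obtain ⟨q₁, h4, rfl⟩ := (fanUnion_handle_iff h.left).1 ⟨p₁, h1, h2⟩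
      obtain ⟨q₂, h5, rfl⟩ := (fanUnion_leaf_mirror_iff (κ := .umbrella) hmr).1 h3
      exact ⟨_, ⟨q₁, q₂, rfl, .inl ⟨h4, h5⟩⟩, toSub_node.symm⟩
    · obtain ⟨T₁, T₂, h2, h3, rfl⟩ := (h.isUnionWithFans_iff hm (.leaf _) h1.prune).1 hU
      obtain ⟨q₁, h4, rfl⟩ := (fanUnion_leaf_iff (κ := .umbrella) h.left).1 h2
      obtain ⟨q₂, h5, rfl⟩ := (fanUnion_handle_mirror_iff (κ := .umbrella) hmr).1 ⟨p₂, h1, h3⟩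
      exact ⟨_, ⟨q₁, q₂, rfl, .inr ⟨h4, h5⟩⟩, toSub_node.symm⟩
  · rintro ⟨q, ⟨q₁, q₂, rfl, ⟨h4, h5⟩ | ⟨h4, h5⟩⟩, rfl⟩
    · obtain ⟨p₁, h1, h2⟩ := (fanUnion_handle_iff h.left).2 ⟨q₁, h4, rfl⟩
      have h3 := (fanUnion_leaf_mirror_iff (κ := .umbrella) hmr).2 ⟨q₂, h5, rfl⟩
      exact ⟨h.nonCutting_base, _, (h.isHandle_iff (by simp)).2
        ⟨_, rfl, shape_handle_node.2 (.inl ⟨p₁, rfl, h1⟩)⟩,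
        (h.isUnionWithFans_iff hm h1.prune (.leaf _)).2 ⟨_, _, h2, h3, toSub_node⟩⟩
    · have h2 := (fanUnion_leaf_iff (κ := .umbrella) h.left).2 ⟨q₁, h4, rfl⟩
      obtain ⟨p₂, h1, h3⟩ := (fanUnion_handle_mirror_iff (κ := .umbrella) hmr).2 ⟨q₂, h5, rfl⟩
      exact ⟨h.nonCutting_base, _, (h.isHandle_iff (by simp)).2
        ⟨_, rfl, shape_handle_node.2 (.inr ⟨p₂, rfl, h1⟩)⟩,
        (h.isUnionWithFans_iff hm (.leaf _) h1.prune).2 ⟨_, _, h2, h3, toSub_node⟩⟩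

theorem Shape.partRight_of_fanRight (h : Shape κ fanRight t' t) : Shape κ partRight t' t := by
  have := (Shape.partLeft_of_fanLeft (t' := t'.mirror) (t := t.mirror) h.mirror).mirror
  simpa [Mode.mirror] using this

/-- The bonnets. -/
theorem Good.isBonnet_iff [Finite V] (h : Good G f a b t) (ht : t ≠ leaf) :
    IsBonnet (toSub G a b t) a b U ↔ ∃ q, Shape .bonnet root q t ∧ U = toSub G a b q := by
  rcases t with _ | ⟨c, l, r⟩
  · exact absurd rfl ht
  obtain ⟨g, hm⟩ := h.mirror
  have hmr : Good G g b c r.mirror := hm.left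
  simp only [shape_root_bonnet_node]
  constructor
  · rintro ⟨-, P, hP, hU⟩
    obtain ⟨p₁, p₂, rfl, h1, h2⟩ := (h.isRibbon_iff (κ := .bonnet)).1 hP
    have pr1 : Prune p₁ l := by
      rcases h1 with h1 | ⟨rfl, -⟩
      · exact h1.prune
      · exact .leaf _
    have pr2 : Prune p₂ r := by
      rcases h2 with h2 | ⟨rfl, -⟩
      · exact h2.prune
      · exact .leaf _
    obtain ⟨T₁, T₂, h3, h4, rfl⟩ := (h.isUnionWithFans_iff hm pr1 pr2).1 hU
    have hl : ∃ q, Shape .bonnet partLeft q l ∧ T₁ = toSub G a c q := by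
      rcases h1 with h1 | ⟨rfl, -⟩
      · exact (fanUnion_handle_iff h.left).1 ⟨p₁, h1, h3⟩
      -- The ribbon does not enter this side. The full fan required there is a special partial
      -- umbrella, so bonnets need no additional rule.
      · obtain ⟨q, hq, e⟩ := (fanUnion_leaf_iff (κ := .bonnet) h.left).1 h3
        exact ⟨q, hq.partLeft_of_fanLeft, e⟩
    have hr : ∃ q, Shape .bonnet partRight q r ∧ T₂ = toSub G c b q := by
      rcases h2 with h2 | ⟨rfl, -⟩
      · exact (fanUnion_handle_mirror_iff hmr).1 ⟨p₂, h2, h4⟩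
      · obtain ⟨q, hq, e⟩ := (fanUnion_leaf_mirror_iff (κ := .bonnet) hmr).1 h4
        exact ⟨q, hq.partRight_of_fanRight, e⟩
    obtain ⟨q₁, h5, rfl⟩ := hl
    obtain ⟨q₂, h6, rfl⟩ := hr
    exact ⟨_, ⟨q₁, q₂, rfl, h5, h6⟩, toSub_node.symm⟩
  · rintro ⟨q, ⟨q₁, q₂, rfl, h5, h6⟩, rfl⟩
    obtain ⟨p₁, h1, h3⟩ := (fanUnion_handle_iff h.left).2 ⟨q₁, h5, rfl⟩
    obtain ⟨p₂, h2, h4⟩ := (fanUnion_handle_mirror_iff hmr).2 ⟨q₂, h6, rfl⟩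
    exact ⟨h.nonCutting_base, _, (h.isRibbon_iff).2 ⟨p₁, p₂, rfl, .inl h1, .inl h2⟩,
      (h.isUnionWithFans_iff hm h1.prune h2.prune).2 ⟨_, _, h3, h4, toSub_node⟩⟩

theorem Good.isRoot_iff [Finite V] (h : Good G f a b t) (ht : t ≠ leaf) :
    IsRoot κ (toSub G a b t) a b U ↔ ∃ q, Shape κ root q t ∧ U = toSub G a b q := by
  cases κ
  · exact h.isUmbrella_iff ht
  · exact h.isBonnet_iff ht

/-! ### The root-edge may be reversed -/

theorem isHandle_comm {H : G.Subgraph} : IsHandle H b a P ↔ IsHandle H a b P := by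
  rw [IsHandle, IsHandle, Sym2.eq_swap]

theorem isPartialUmbrella_comm {H : G.Subgraph} {w : V} :
    IsPartialUmbrella b a w H U ↔ IsPartialUmbrella a b w H U := by
  simp only [IsPartialUmbrella, isHandle_comm]

theorem Good.isFullFan_snd_iff [Finite V] (h : Good G f a b t) : IsFullFan b (toSub G a b t) U ↔
    ∃ q, Shape κ fanRight q t ∧ U = toSub G a b q := by
  obtain ⟨g, hm⟩ := h.mirror
  rw [← toSub_mirror, hm.isFullFan_iff (κ := κ), exists_shape_mirror]
  rfl

theorem Good.isPartialUmbrella_snd_iff [Finite V] (h : Good G f a b t) (ht : t ≠ leaf) :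
    IsPartialUmbrella a b b (toSub G a b t) U ↔
      ∃ q, Shape κ partRight q t ∧ U = toSub G a b q := by
  obtain ⟨g, hm⟩ := h.mirror
  rw [isPartialUmbrella_comm, ← toSub_mirror, hm.isPartialUmbrella_iff (κ := κ)
    (by cases t <;> simp_all [Tri.mirror]), exists_shape_mirror]
  rfl

end Tri

namespace Tri
variable {V : Type u} {G : SimpleGraph V} {f g : V → ℕ} {a b c d x y z p q u v x' y' c' : V}
  {t t' l r s s' l' r' p₁ p₂ : Tri V} {κ : SystemKind} {m : Mode} {P F F₁ F₂ U T H : G.Subgraph}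

open Mode

theorem isUnionWithFans_comm (h : IsUnionWithFans H u v P U) : IsUnionWithFans H v u P U := by
  obtain ⟨F₁, F₂, h1, h2, h3, rfl, h4, h5⟩ := h
  exact ⟨F₂, F₁, h2, h1, h3.symm, by ac_rfl, h5, h4⟩

theorem isRoot_comm (h : IsRoot κ H u v U) : IsRoot κ H v u U := by
  cases κ
  · obtain ⟨h1, P, h2, h3⟩ := h
    exact ⟨isNonCutting_comm.1 h1, P, isHandle_comm.1 h2, isUnionWithFans_comm h3⟩
  · obtain ⟨h1, P, ⟨h2, h3, h4, h5, c, hc, h6, h7⟩, h8⟩ := h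
    exact ⟨isNonCutting_comm.1 h1, P, ⟨h2, h3, h5, h4, c, hc, h7.symm, h6.symm⟩,
      isUnionWithFans_comm h8⟩

theorem isSystem_comm {𝒰 : Set G.Subgraph} {d : ℕ} (h : IsSystem κ H u v 𝒰 d) :
    IsSystem κ H v u 𝒰 d := by
  cases h with
  | mk _ _ _ U hU 𝒰 d m h hm =>
    exact .mk H v u U (isRoot_comm hU) 𝒰 d m
      (fun a b hab => by rw [hanging_comm_root]; exact h a b hab) hm

theorem rootedDepth_comm : rootedDepth κ H v u = rootedDepth κ H u v := by
  rw [rootedDepth, rootedDepth]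
  congr 1
  ext d
  exact ⟨fun ⟨𝒰, h⟩ => ⟨𝒰, isSystem_comm h⟩, fun ⟨𝒰, h⟩ => ⟨𝒰, isSystem_comm h⟩⟩

/-! ### Optimal systems and the rooted depth -/

/-- Apart from the base, an edge is cutting in a triangulation if and only if it has a triangle
below it; this is compared for t and for the pruned t'. -/
theorem Good.mem_anchorEdges (h : Good G f a b t) (hpr : Prune t' t) (ht' : t' ≠ leaf) {e : Sym2 V} :
    e ∈ anchorEdges (toSub G a b t) (toSub G a b t') ↔
      ∃ x y s, e = s(x, y) ∧ Sub a b t' x y leaf ∧ Sub a b t x y s ∧ s ≠ leaf := by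
  have hp := h.prune hpr
  constructor
  · rintro ⟨x, y, rfl, h1, h2, h3⟩
    have key : ∀ {x y}, f x < f y → (toSub G a b t').Adj x y → IsCutting (toSub G a b t) x y →
        ¬ IsCutting (toSub G a b t') x y → Sub a b t' x y leaf ∧ ∃ s, Sub a b t x y s ∧ s ≠ leaf := by
      intro x y hlt h1 h2 h3
      rw [h.cutting_iff hlt] at h2
      rw [hp.cutting_iff hlt] at h3
      obtain ⟨h2, s, hs, hs'⟩ := h2
      obtain ⟨s', h4⟩ := (hp.toSub_adj_lt hlt).1 h1
      have : s' = leaf := by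
        by_contra h5
        exact h3 ⟨h2, s', h5, h4⟩
      subst this
      exact ⟨h4, s, hs', hs⟩
    rcases lt_or_gt_of_ne (h.inj.ne h1.ne) with g | g
    · obtain ⟨h4, s, h5, h6⟩ := key g h1 h2 h3
      exact ⟨x, y, s, rfl, h4, h5, h6⟩
    · obtain ⟨h4, s, h5, h6⟩ := key g h1.symm (isCutting_comm.1 h2) (fun h => h3 (isCutting_comm.1 h))
      exact ⟨y, x, s, Sym2.eq_swap, h4, h5, h6⟩
  · rintro ⟨x, y, s, rfl, h1, h2, h3⟩
    have hlt := (h2.edge.lt h.sorted).2.1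
    refine ⟨x, y, rfl, hp.toSub_adj.2 (.inl h1.edge), (h.cutting_iff hlt).2 ⟨?_, s, h3, h2⟩, ?_⟩
    · rintro ⟨rfl, rfl⟩
      exact ht' (h1.eq_self hp.sorted).symm
    · rw [hp.cutting_iff hlt]
      rintro ⟨-, s', h4, h5⟩
      exact h4 (h5.unique h1 hp.sorted)

theorem Shape.ne_leaf (hm : m ≠ cut) (ht : t ≠ leaf) (h : Shape κ m t' t) : t' ≠ leaf := by
  rintro rfl
  exact ht (h.eq_leaf hm)

/-- The root of the system is a shape, and its cost is attained at some part that is cut off. Unless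
this part is a single edge, it hangs at an anchor-edge, and the system there is at least as deep by
induction. -/
theorem Good.val_le_of_isSystem [Finite V] {𝒰 : Set G.Subgraph} {d : ℕ} (hsys : IsSystem κ H a b 𝒰 d)
    (h : Good G f a b t) (ht : t ≠ leaf) (hH : H = toSub G a b t) : val κ cut t ≤ d := by
  induction hsys generalizing t with
  | mk H u v U hU 𝒰 d m hs hm ih =>
    subst hH
    obtain ⟨q, hq, rfl⟩ := (h.isRoot_iff ht).1 hU
    rcases t with _ | ⟨c, l, r⟩
    · exact absurd rfl ht
    rw [val_cut_node]
    refine Nat.add_le_add_left (hq.val_le_cost.trans ?_) 1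
    obtain ⟨x, y, s, h1, h2, h3⟩ := (hq.prune.isGreatest_cost h.sorted (val κ cut)).1
    rw [h3]
    by_cases hs' : s = leaf
    · subst hs'; simp [val]
    · have hmem : s(x, y) ∈ anchorEdges (toSub G u v (node c l r)) (toSub G u v q) :=
        (h.mem_anchorEdges hq.prune (hq.ne_leaf (by simp) ht)).2 ⟨x, y, s, rfl, h1, h2, hs'⟩
      exact (ih x y hmem (h.sub h2) hs' (h.hanging h2)).trans (hm.1 ⟨_, hmem, rfl⟩)

/-- The umbrellas or bonnets of an optimal system, as far as they start in a part of the graph that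
is covered in the given mode. -/
def system (G : SimpleGraph V) (κ : SystemKind) : Mode → V → V → Tri V → Set G.Subgraph
  | _, _, _, leaf => ∅
  | m, a, b, node c l r => {U | m = cut ∧ U = toSub G a b (best κ root (node c l r))} ∪
      (system G κ (choice κ m l r).1 a c l ∪ system G κ (choice κ m l r).2 c b r)

theorem choice_cut : choice κ cut l r = choice κ root l r := by
  cases κ <;> rfl

/-- `system` descends edge by edge, while `IsSystem` goes from one root to the anchor-edges. In
both, what follows starts anew in mode `cut` at the leaves of the optimal pruning. -/
theorem mem_system (hs : Sorted f a b t) : U ∈ system G κ m a b t ↔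
    ∃ x y s, Sub a b (best κ m t) x y leaf ∧ Sub a b t x y s ∧ U ∈ system G κ cut x y s := by
  induction t generalizing a b m with
  | leaf =>
    simp only [system, Set.mem_empty_iff_false, false_iff, not_exists]
    rintro x y s ⟨-, h2, h3⟩
    rw [(sub_leaf.1 h2).2.2] at h3
    exact h3
  | node c l r ihl ihr =>
    by_cases hm : m = cut
    · subst hm
      rw [best_cut]
      constructor
      · intro h; exact ⟨a, b, _, .refl _ _ _, .refl _ _ _, h⟩
      · rintro ⟨x, y, s, h1, h2, h3⟩
        obtain ⟨rfl, rfl, -⟩ := sub_leaf.1 h1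
        rwa [h2.eq_self hs] at h3
    · rw [system, Set.mem_union, Set.mem_union, ihl hs.1, ihr hs.2, best_node hm]
      simp only [hm, Set.mem_ofPred_eq, false_and, false_or]
      have hl := (shape_best κ (choice κ m l r).1 l).prune
      have hr := (shape_best κ (choice κ m l r).2 r).prune
      constructor
      · rintro (⟨x, y, s, h1, h2, h3⟩ | ⟨x, y, s, h1, h2, h3⟩)
        · exact ⟨x, y, s, .left h1, .left h2, h3⟩
        · exact ⟨x, y, s, .right h1, .right h2, h3⟩
      · rintro ⟨x, y, s, h1, h2, h3⟩
        rcases sub_node.1 h1 with ⟨-, -, e⟩ | h1 | h1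
        · cases e
        · obtain ⟨s', h4, -⟩ := hl.sub h1
          obtain rfl := h2.unique (.left h4) hs
          exact .inl ⟨x, y, _, h1, h4, h3⟩
        · obtain ⟨s', h4, -⟩ := hr.sub h1
          obtain rfl := h2.unique (.right h4) hs
          exact .inr ⟨x, y, _, h1, h4, h3⟩

theorem system_cut_node : system G κ cut a b (node c l r) =
    {toSub G a b (best κ root (node c l r))} ∪ system G κ root a b (node c l r) := by
  ext U
  simp [system, choice_cut]

theorem Sub.length_le (h : Sub a b t x y s) : s.inner.length ≤ t.inner.length := by
  induction h with
  | refl => exact le_rfl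
  | left _ ih => simp only [inner, List.length_append, List.length_cons]; omega
  | right _ ih => simp only [inner, List.length_append, List.length_cons]; omega

theorem Sub.length_lt (h : Sub a b t x y s) (hxy : ¬ (x = a ∧ y = b)) :
    s.inner.length < t.inner.length := by
  cases h with
  | refl => exact absurd ⟨rfl, rfl⟩ hxy
  | left h => have := h.length_le; simp only [inner, List.length_append, List.length_cons]; omega
  | right h => have := h.length_le; simp only [inner, List.length_append, List.length_cons]; omega

/-- Induction on the number of inner vertices: the optimal shape is the root, and the systems at its
anchor-edges are optimal by induction. -/
theorem Good.isSystem_system [Finite V] (h : Good G f a b t) (ht : t ≠ leaf) :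
    IsSystem κ (toSub G a b t) a b (system G κ cut a b t) (val κ cut t) := by
  induction hn : t.inner.length using Nat.strong_induction_on generalizing a b t with
  | _ n ih =>
  subst hn
  have hsh := shape_best κ root t
  have hne := hsh.ne_leaf (by simp) ht
  have hanch := fun e => h.mem_anchorEdges (e := e) hsh.prune hne
  -- The data of a system are indexed by unordered pairs. Only one orientation of a pair occurs in
  -- the tree, so the union and the infimum below are over a single candidate.
  let 𝒰 : Sym2 V → Set G.Subgraph := fun e =>
    {W | ∃ x y s, e = s(x, y) ∧ Sub a b t x y s ∧ W ∈ system G κ cut x y s}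
  let d : Sym2 V → ℕ := fun e =>
    sInf {k | ∃ x y s, e = s(x, y) ∧ Sub a b t x y s ∧ k = val κ cut s}
  have uniq : ∀ {x y s x' y' s'}, Sub a b t x y s → Sub a b t x' y' s' → s(x, y) = s(x', y') →
      x = x' ∧ y = y' ∧ s = s' := by
    intro x y s x' y' s' h1 h2 e
    have b1 := h1.edge.lt h.sorted
    have b2 := h2.edge.lt h.sorted
    rcases Sym2.eq_iff.1 e with ⟨rfl, rfl⟩ | ⟨rfl, rfl⟩
    · exact ⟨rfl, rfl, h1.unique h2 h.sorted⟩
    · omega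
  have h𝒰 : ∀ {x y s}, Sub a b t x y s → 𝒰 s(x, y) = system G κ cut x y s := by
    intro x y s h1
    ext W
    constructor
    · rintro ⟨x', y', s', e, h2, h3⟩
      obtain ⟨rfl, rfl, rfl⟩ := uniq h1 h2 e
      exact h3
    · intro hW; exact ⟨x, y, s, rfl, h1, hW⟩
  have hd : ∀ {x y s}, Sub a b t x y s → d s(x, y) = val κ cut s := by
    intro x y s h1
    have : {k | ∃ x' y' s', s(x, y) = s(x', y') ∧ Sub a b t x' y' s' ∧ k = val κ cut s'} =
        {val κ cut s} := by
      ext k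
      constructor
      · rintro ⟨x', y', s', e, h2, rfl⟩
        obtain ⟨rfl, rfl, rfl⟩ := uniq h1 h2 e
        rfl
      · rintro rfl; exact ⟨x, y, s, rfl, h1, rfl⟩
    change sInf _ = _
    rw [this, csInf_singleton]
  have hcost := hsh.prune.isGreatest_cost h.sorted (val κ cut)
  rw [cost_best] at hcost
  have key := IsSystem.mk (toSub G a b t) a b (toSub G a b (best κ root t))
    ((h.isRoot_iff ht).2 ⟨_, hsh, rfl⟩) 𝒰 d (val κ root t) (fun x y hxy => by
      obtain ⟨x', y', s, e, h1, h2, h3⟩ := (hanch _).1 hxy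
      have hlt : s.inner.length < t.inner.length := h2.length_lt fun e' => by
        obtain ⟨rfl, rfl⟩ := e'
        exact hne (h1.eq_self (h.prune hsh.prune).sorted).symm
      have := ih _ hlt (h.sub h2) h3 rfl
      rw [e, h𝒰 h2, hd h2]
      rcases Sym2.eq_iff.1 e with ⟨rfl, rfl⟩ | ⟨rfl, rfl⟩
      · rwa [h.hanging h2]
      · rw [hanging_comm, h.hanging h2]
        exact isSystem_comm this) (by
      constructor
      · rintro k ⟨e, he, rfl⟩
        obtain ⟨x', y', s, rfl, h1, h2, h3⟩ := (hanch _).1 he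
        rw [hd h2]
        exact hcost.2 ⟨x', y', s, h1, h2, rfl⟩
      · intro M hM
        obtain ⟨x, y, s, h1, h2, h3⟩ := hcost.1
        rw [h3]
        by_cases hs : s = leaf
        · subst hs; simp [val]
        · rw [← hd h2]
          exact hM ⟨_, (hanch _).2 ⟨x, y, s, rfl, h1, h2, hs⟩, rfl⟩)
  rcases t with _ | ⟨c, l, r⟩
  · exact absurd rfl ht
  rw [val_cut_node, system_cut_node]
  convert key using 2
  ext W
  rw [mem_system h.sorted]
  simp only [Set.mem_iUnion]
  constructor
  · rintro ⟨x, y, s, h1, h2, h3⟩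
    refine ⟨s(x, y), (hanch _).2 ⟨x, y, s, rfl, h1, h2, ?_⟩, by rwa [h𝒰 h2]⟩
    rintro rfl
    exact h3
  · rintro ⟨e, he, hW⟩
    obtain ⟨x, y, s, rfl, h1, h2, h3⟩ := (hanch _).1 he
    rw [h𝒰 h2] at hW
    exact ⟨x, y, s, h1, h2, hW⟩

theorem Good.rootedDepth_eq [Finite V] (h : Good G f a b t) (ht : t ≠ leaf) :
    rootedDepth κ (toSub G a b t) a b = val κ cut t := by
  refine IsLeast.csInf_eq ⟨⟨_, h.isSystem_system ht⟩, ?_⟩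
  rintro d ⟨𝒰, hs⟩
  exact h.val_le_of_isSystem hs ht rfl

/-! ### The recurrences -/

theorem Good.bd_eq [Finite V] (h : Good G f u v t) (htop : toSub G u v t = ⊤)
    (hs : Sub u v t a b s) : bd G u v a b = val .bonnet cut s := by
  rw [bd]
  split_ifs with h1
  · rw [(h.isSingleEdge_iff htop hs).1 h1]
    rfl
  · rw [← htop, h.hanging hs]
    exact (h.sub hs).rootedDepth_eq fun e => h1 ((h.isSingleEdge_iff htop hs).2 e)

theorem isSingleEdge_comm : IsSingleEdge G u v b a ↔ IsSingleEdge G u v a b := by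
  rw [IsSingleEdge, IsSingleEdge, hanging_comm, Sym2.eq_swap]

theorem bd_comm : bd G u v b a = bd G u v a b := by
  rw [bd, bd, hanging_comm, rootedDepth_comm, propext isSingleEdge_comm]

theorem isSingleEdge_comm_root : IsSingleEdge G v u a b ↔ IsSingleEdge G u v a b := by
  rw [IsSingleEdge, IsSingleEdge, hanging_comm_root]

theorem bd_comm_root : bd G v u a b = bd G u v a b := by
  rw [bd, bd, hanging_comm_root, propext isSingleEdge_comm_root]

theorem bdVariant_comm_root {Q : G.Subgraph → G.Subgraph → Prop} :
    bdVariant G v u a b Q = bdVariant G u v a b Q := by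
  rw [bdVariant, bdVariant, hanging_comm_root, propext isSingleEdge_comm_root]
  simp only [bd_comm_root]

/-- The non-cutting edges of a shape other than the base are its leaves, and bd at such an edge is
the depth of what is cut off there. So the inner maximum is `cost`, and its minimum over all shapes
is `val`. -/
theorem Good.bdVariant_eq [Finite V] (h : Good G f u v t) (htop : toSub G u v t = ⊤)
    (hs : Sub u v t a b s) (hm : m ≠ cut) {Q : G.Subgraph → G.Subgraph → Prop}
    (hQ : s ≠ leaf → ∀ U, Q (toSub G a b s) U ↔ ∃ q, Shape .bonnet m q s ∧ U = toSub G a b q) :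
    bdVariant G u v a b Q = 1 + val .bonnet m s := by
  have hg := h.sub hs
  rw [bdVariant]
  split_ifs with h1
  · rw [(h.isSingleEdge_iff htop hs).1 h1]
    rfl
  · have hne : s ≠ leaf := fun e => h1 ((h.isSingleEdge_iff htop hs).2 e)
    congr 1
    rw [← htop, h.hanging hs]
    have key : ∀ q, Shape .bonnet m q s → {d | ∃ x y, IsNonCutting (toSub G a b q) x y ∧
        s(x, y) ≠ s(a, b) ∧ d = bd G u v x y} =
        {d | ∃ x y s', Sub a b q x y leaf ∧ Sub a b s x y s' ∧ d = val .bonnet cut s'} := by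
      intro q hq
      have hgq := hg.prune hq.prune
      have hql := hq.ne_leaf hm hne
      ext d
      constructor
      · have : ∀ x y, f x < f y → IsNonCutting (toSub G a b q) x y → s(x, y) ≠ s(a, b) →
            ∃ x' y' s', Sub a b q x' y' leaf ∧ Sub a b s x' y' s' ∧
              bd G u v x y = val .bonnet cut s' := by
          intro x y hlt hc hxy
          rcases (hgq.nonCutting_iff hlt).1 hc with ⟨rfl, rfl⟩ | h2
          · exact absurd rfl hxy
          · obtain ⟨s', h3, -⟩ := hq.prune.sub h2
            exact ⟨x, y, s', h2, h3, h.bd_eq htop (hs.trans h3)⟩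
        rintro ⟨x, y, hc, hxy, rfl⟩
        rcases lt_or_gt_of_ne (h.inj.ne hc.1.ne) with g | g
        · exact this x y g hc hxy
        · rw [← bd_comm]
          exact this y x g (isNonCutting_comm.1 hc) (by rwa [Sym2.eq_swap])
      · rintro ⟨x, y, s', h2, h3, rfl⟩
        exact ⟨x, y, (hgq.nonCutting_iff (h2.edge.lt hgq.sorted).2.1).2 (.inr h2),
          Edge.not_of_eq hgq hql h2, (h.bd_eq htop (hs.trans h3)).symm⟩
    refine IsLeast.csInf_eq ⟨⟨_, (hQ hne _).2 ⟨_, shape_best _ m s, rfl⟩, ?_⟩, ?_⟩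
    · rw [key _ (shape_best _ m s), ← cost_best]
      exact (shape_best _ m s).prune.isGreatest_cost hg.sorted _
    · rintro k ⟨U, hU, hk⟩
      obtain ⟨q, hq, rfl⟩ := (hQ hne _).1 hU
      rw [key q hq] at hk
      rw [hk.unique (hq.prune.isGreatest_cost hg.sorted _)]
      exact hq.val_le_cost

/-- The depth variants at an edge are the optimal values. -/
theorem Good.variants_eq [Finite V] (h : Good G f u v t) (htop : toSub G u v t = ⊤)
    (hs : Sub u v t a b s) : bd G u v a b = val .bonnet cut s ∧
      bdHandle G u v a b = 1 + val .bonnet handle s ∧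
      bdFanLeft G u v a b = 1 + val .bonnet fanLeft s ∧
      bdFanRight G u v a b = 1 + val .bonnet fanRight s ∧
      bdPartialLeft G u v a b = 1 + val .bonnet partLeft s ∧
      bdPartialRight G u v a b = 1 + val .bonnet partRight s := by
  have hg := h.sub hs
  refine ⟨h.bd_eq htop hs, h.bdVariant_eq htop hs (by simp) fun ht U => ?_,
    h.bdVariant_eq htop hs (by simp) fun ht U => hg.isFullFan_iff,
    h.bdVariant_eq htop hs (by simp) fun ht U => hg.isFullFan_snd_iff,
    h.bdVariant_eq htop hs (by simp) fun ht U => hg.isPartialUmbrella_iff ht,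
    h.bdVariant_eq htop hs (by simp) fun ht U => hg.isPartialUmbrella_snd_iff ht⟩
  rw [hg.isHandle_iff (κ := .bonnet) ht]
  exact exists_congr fun _ => and_comm

end Tri

-- All six quantities are values of `val`, the five variants increased by 1; this agrees with the
-- conventions 0 and 1 for single edges. The common neighbour is the apex.
open Tri in
theorem recurrences_of_sub {V : Type u} {G : SimpleGraph V} {f : V → ℕ} {u v a b : V} [Finite V]
    {t s : Tri V} (h : Good G f u v t) (htop : toSub G u v t = ⊤) (hs : Sub u v t a b s) :
    (IsSingleEdge G u v a b →
      bd G u v a b = 0 ∧ bdHandle G u v a b = 1 ∧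
      bdFanLeft G u v a b = 1 ∧ bdFanRight G u v a b = 1 ∧
      bdPartialLeft G u v a b = 1 ∧ bdPartialRight G u v a b = 1) ∧
    (¬ IsSingleEdge G u v a b →
      (∃! c, (hanging (⊤ : G.Subgraph) u v a b).Adj a c ∧
        (hanging (⊤ : G.Subgraph) u v a b).Adj c b) ∧
      ∀ c, (hanging (⊤ : G.Subgraph) u v a b).Adj a c →
        (hanging (⊤ : G.Subgraph) u v a b).Adj c b →
        bd G u v a b = max (bdPartialLeft G u v a c) (bdPartialRight G u v c b) ∧
        bdHandle G u v a b =
          min (max (bdHandle G u v a c) (1 + bd G u v c b))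
            (max (1 + bd G u v a c) (bdHandle G u v c b)) ∧
        bdFanLeft G u v a b = max (bdFanLeft G u v a c) (1 + bd G u v c b) ∧
        bdFanRight G u v a b = max (1 + bd G u v a c) (bdFanRight G u v c b) ∧
        bdPartialLeft G u v a b =
          min (max (bdPartialLeft G u v a c) (1 + bd G u v c b))
            (max (bdFanLeft G u v a c) (bdHandle G u v c b)) ∧
        bdPartialRight G u v a b =
          min (max (1 + bd G u v a c) (bdPartialRight G u v c b))
            (max (bdHandle G u v a c) (bdFanRight G u v c b))) := by
  obtain ⟨e1, e2, e3, e4, e5, e6⟩ := h.variants_eq htop hs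
  rw [h.isSingleEdge_iff htop hs]
  refine ⟨fun e => ?_, fun hne => ?_⟩
  · subst e
    simp only [e1, e2, e3, e4, e5, e6, val]
    simp
  · have hg := h.sub hs
    rcases s with _ | ⟨c, l, r⟩
    · exact absurd rfl hne
    have e7 := h.hanging hs
    rw [htop] at e7
    rw [e7]
    have bl := hg.left.lt
    have br := hg.right.lt
    have huniq : ∀ c', (toSub G a b (node c l r)).Adj a c' → (toSub G a b (node c l r)).Adj c' b →
        c' = c := by
      intro c' h1 h2
      have b1 := hg.sorted.vert h1.snd_mem
      have n1 := h.inj.ne h1.ne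
      have n2 := h.inj.ne h2.ne
      rw [hg.toSub_adj_lt (by omega)] at h1 h2
      obtain ⟨l', r', e⟩ := (Sub.refl a b (node c l r)).triangle h.inj h1 h2 hg.sorted
      simp only [node.injEq] at e
      exact e.1.symm
    refine ⟨⟨c, ⟨hg.toSub_adj.2 (.inl (Sub.refl _ _ _).apex_edges.1),
      hg.toSub_adj.2 (.inl (Sub.refl _ _ _).apex_edges.2)⟩, fun c' hc' => huniq c' hc'.1 hc'.2⟩,
      fun c' h1 h2 => ?_⟩
    obtain rfl := huniq c' h1 h2
    obtain ⟨l1, l2, l3, l4, l5, l6⟩ := h.variants_eq htop (hs.trans (.left (.refl _ _ _)))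
    obtain ⟨r1, r2, r3, r4, r5, r6⟩ := h.variants_eq htop (hs.trans (.right (.refl _ _ _)))
    -- One unfolding of `val`; what remains is that adding 1 commutes with minima and maxima.
    simp only [e1, e2, e3, e4, e5, e6, l1, l2, l3, l5, r1, r2, r4, r6, val, Mode.fst, Mode.snd, Mode.bump]
    omega

theorem recurrences {V : Type u} {G : SimpleGraph V} {u v : V} (hG : IsMaximalOuterplanar G)
    (huv : IsNonCutting (⊤ : G.Subgraph) u v) :
    bd G u v u v = rootedDepth .bonnet (⊤ : G.Subgraph) u v ∧
    ∀ a b, G.Adj a b →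
      (IsSingleEdge G u v a b →
        bd G u v a b = 0 ∧ bdHandle G u v a b = 1 ∧
        bdFanLeft G u v a b = 1 ∧ bdFanRight G u v a b = 1 ∧
        bdPartialLeft G u v a b = 1 ∧ bdPartialRight G u v a b = 1) ∧
      (¬ IsSingleEdge G u v a b →
        (∃! c, (hanging (⊤ : G.Subgraph) u v a b).Adj a c ∧
          (hanging (⊤ : G.Subgraph) u v a b).Adj c b) ∧
        ∀ c, (hanging (⊤ : G.Subgraph) u v a b).Adj a c →
          (hanging (⊤ : G.Subgraph) u v a b).Adj c b →
          bd G u v a b = max (bdPartialLeft G u v a c) (bdPartialRight G u v c b) ∧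
          bdHandle G u v a b =
            min (max (bdHandle G u v a c) (1 + bd G u v c b))
              (max (1 + bd G u v a c) (bdHandle G u v c b)) ∧
          bdFanLeft G u v a b = max (bdFanLeft G u v a c) (1 + bd G u v c b) ∧
          bdFanRight G u v a b = max (1 + bd G u v a c) (bdFanRight G u v c b) ∧
          bdPartialLeft G u v a b =
            min (max (bdPartialLeft G u v a c) (1 + bd G u v c b))
              (max (bdFanLeft G u v a c) (bdHandle G u v c b)) ∧
          bdPartialRight G u v a b =
            min (max (1 + bd G u v a c) (bdPartialRight G u v c b))
              (max (bdHandle G u v a c) (bdFanRight G u v c b))) := by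
  have := hG.finite
  obtain ⟨f, t, h, htop⟩ := exists_good_of_nonCutting hG huv
  have ht : t ≠ .leaf := by
    rintro rfl
    have h1 := (Tri.vert_finite_ncard h.sorted).2
    have h2 : (Tri.toSub G u v .leaf).verts = Set.univ := by rw [htop]; rfl
    have h3 : {x | Tri.Vert u v .leaf x} = (Tri.toSub G u v .leaf).verts := rfl
    rw [h3, h2, Set.ncard_univ] at h1
    have := hG.1
    simp [Tri.inner] at h1
    omega
  refine ⟨?_, fun a b hab => ?_⟩
  · rw [h.bd_eq htop (.refl _ _ _), ← htop, h.rootedDepth_eq ht]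
  · have hadj : (Tri.toSub G u v t).Adj a b := by rw [htop]; exact hab
    -- The recurrences concern ordered pairs. If (a,b) runs against the orientation from u to v, the
    -- mirror image with base (v,u) is used.
    rcases h.toSub_adj.1 hadj with ⟨s, hs⟩ | ⟨s, hs⟩
    · exact recurrences_of_sub h htop hs
    · obtain ⟨g, hm⟩ := h.mirror
      have := recurrences_of_sub hm (by rw [Tri.toSub_mirror, htop]) hs.mirror
      simpa only [bdHandle, bdFanLeft, bdFanRight, bdPartialLeft, bdPartialRight,
        Tri.bdVariant_comm_root, Tri.bd_comm_root, Tri.isSingleEdge_comm_root,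
        Tri.hanging_comm_root] using this

namespace RAM

/-! ### A program logic -/

/-- Execution without a bound on the words. -/
inductive ExecF : Program → State → ℕ → State → Prop
  | skip (s : State) : ExecF .skip s 1 s
  | set (i : ℕ) (e : Expr) (s : State) :
      ExecF (.set i e) s (e.cost + 1) (s.setReg i (e.eval s))
  | store (k : ℕ) (e₁ e₂ : Expr) (s : State) :
      ExecF (.store k e₁ e₂) s (e₁.cost + e₂.cost + 1) (s.setMem k (e₁.eval s) (e₂.eval s))
  | seq (p q : Program) (s s' s'' : State) (t t' : ℕ) (hp : ExecF p s t s')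
      (hq : ExecF q s' t' s'') : ExecF (.seq p q) s (t + t') s''
  | ite_true (e : Expr) (p q : Program) (s s' : State) (t : ℕ)
      (he : e.eval s ≠ 0) (hp : ExecF p s t s') : ExecF (.ite e p q) s (e.cost + 1 + t) s'
  | ite_false (e : Expr) (p q : Program) (s s' : State) (t : ℕ)
      (he : e.eval s = 0) (hq : ExecF q s t s') : ExecF (.ite e p q) s (e.cost + 1 + t) s'
  | loop_done (e : Expr) (p : Program) (s : State) (he : e.eval s = 0) :
      ExecF (.loop e p) s (e.cost + 1) s
  | loop_step (e : Expr) (p : Program) (s s' s'' : State) (t t' : ℕ)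
      (he : e.eval s ≠ 0) (hp : ExecF p s t s') (hl : ExecF (.loop e p) s' t' s'') :
      ExecF (.loop e p) s (e.cost + 1 + t + t') s''

/-- Sums are formed with constants only. -/
def Expr.simple : Expr → Bool
  | .const _ => true
  | .reg _ => true
  | .cell _ e => e.simple
  | .add e (.const _) => e.simple
  | .add _ _ => false
  | .sub e₁ e₂ => e₁.simple && e₂.simple

/-- The sum of all constants of an expression. -/
def Expr.inc : Expr → ℕ
  | .const k => k
  | .reg _ => 0
  | .cell _ e => e.inc
  | .add e₁ e₂ => e₁.inc + e₂.inc
  | .sub e₁ e₂ => e₁.inc + e₂.inc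

/-- All expressions of the program are simple. -/
def Program.simple : Program → Bool
  | .skip => true
  | .set _ e => e.simple
  | .store _ e₁ e₂ => e₁.simple && e₂.simple
  | .seq p q => p.simple && q.simple
  | .ite e p q => e.simple && p.simple && q.simple
  | .loop e p => e.simple && p.simple

/-- The sum of all constants of a program. -/
def Program.inc : Program → ℕ
  | .skip => 0
  | .set _ e => e.inc
  | .store _ e₁ e₂ => e₁.inc + e₂.inc
  | .seq p q => p.inc + q.inc
  | .ite e p q => e.inc + p.inc + q.inc
  | .loop e p => e.inc + p.inc

/-- All words of the state are at most `B`. -/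
def State.Bounded (B : ℕ) (s : State) : Prop :=
  (∀ i, s.reg i ≤ B) ∧ ∀ k i, s.mem k i ≤ B

theorem State.Bounded.mono {B B' : ℕ} {s : State} (h : s.Bounded B) (hB : B ≤ B') :
    s.Bounded B' :=
  ⟨fun i => (h.1 i).trans hB, fun k i => (h.2 k i).trans hB⟩

theorem Expr.fits_of_simple {B : ℕ} {s : State} (hs : s.Bounded B) (e : Expr)
    (he : e.simple = true) :
    e.eval s ≤ B + e.inc ∧ ∀ W, B + e.inc ≤ W → e.Fits W s := by
  induction e with
  | const k => exact ⟨by simp [eval, inc], fun W h => by simp only [inc, Fits] at *; omega⟩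
  | reg i => exact ⟨(hs.1 i).trans (by simp), fun W h => (hs.1 i).trans (by simp [inc] at h; omega)⟩
  | cell k e ih =>
    simp only [simple] at he
    refine ⟨(hs.2 k _).trans (by simp), fun W h => ⟨(ih he).2 W h, (hs.2 k _).trans ?_⟩⟩
    simp only [inc] at h; omega
  | add e₁ e₂ ih₁ ih₂ =>
    cases e₂ with
    | const k =>
      simp only [simple] at he
      obtain ⟨h1, h2⟩ := ih₁ he
      refine ⟨by simp only [eval, inc]; omega, fun W h => ?_⟩
      simp only [inc] at h
      exact ⟨h2 W (by omega), by simp only [Fits]; omega, by simp only [eval]; omega⟩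
    | reg i => simp [simple] at he
    | cell k e => simp [simple] at he
    | add e e' => simp [simple] at he
    | sub e e' => simp [simple] at he
  | sub e₁ e₂ ih₁ ih₂ =>
    simp only [simple, Bool.and_eq_true] at he
    obtain ⟨h1, h2⟩ := ih₁ he.1
    obtain ⟨h3, h4⟩ := ih₂ he.2
    refine ⟨by simp only [eval, inc]; omega, fun W h => ?_⟩
    simp only [inc] at h
    exact ⟨h2 W (by omega), h4 W (by omega)⟩

theorem State.Bounded.setReg {B x i : ℕ} {s : State} (h : s.Bounded B) (hx : x ≤ B) :
    (s.setReg i x).Bounded B := by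
  refine ⟨fun j => ?_, h.2⟩
  simp only [State.setReg, Function.update_apply]
  split_ifs
  exacts [hx, h.1 j]

theorem State.Bounded.setMem {B x k i : ℕ} {s : State} (h : s.Bounded B) (hx : x ≤ B) :
    (s.setMem k i x).Bounded B := by
  refine ⟨h.1, fun j l => ?_⟩
  simp only [State.setMem, Function.update_apply]
  split_ifs
  · simp only [Function.update_apply]
    split_ifs
    exacts [hx, h.2 _ _]
  · exact h.2 _ _

/-- In a simple program every addition has a constant summand, so each command raises the largest
word by at most K. After t steps all words are at most B + K t, whence only the running time has to
be analysed. -/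
theorem ExecF.exec {p : Program} {s s' : State} {t K W : ℕ} (h : ExecF p s t s') :
    ∀ B, p.simple = true → p.inc ≤ K → s.Bounded B → B + K * t ≤ W →
      Exec W p s t s' ∧ s'.Bounded (B + K * t) := by
  induction h with
  | skip s => exact fun B _ _ hs _ => ⟨.skip s, hs.mono (by omega)⟩
  | set i e s =>
    intro B hp hK hs hW
    obtain ⟨h1, h2⟩ := e.fits_of_simple hs hp
    simp only [Program.inc] at hK
    have : K ≤ K * (e.cost + 1) := Nat.le_mul_of_pos_right _ (by omega)
    exact ⟨.set i e s (h2 W (by omega)), (hs.mono (by omega)).setReg (by omega)⟩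
  | store k e₁ e₂ s =>
    intro B hp hK hs hW
    simp only [Program.simple, Bool.and_eq_true] at hp
    obtain ⟨h1, h2⟩ := e₁.fits_of_simple hs hp.1
    obtain ⟨h3, h4⟩ := e₂.fits_of_simple hs hp.2
    simp only [Program.inc] at hK
    have : K ≤ K * (e₁.cost + e₂.cost + 1) := Nat.le_mul_of_pos_right _ (by omega)
    exact ⟨.store k e₁ e₂ s (h2 W (by omega)) (h4 W (by omega)),
      (hs.mono (by omega)).setMem (by omega)⟩
  | seq p q s s' s'' t t' hp hq ih₁ ih₂ =>
    intro B h hK hs hW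
    simp only [Program.simple, Bool.and_eq_true] at h
    simp only [Program.inc] at hK
    rw [mul_add] at hW ⊢
    obtain ⟨h1, h2⟩ := ih₁ B h.1 (by omega) hs (by omega)
    obtain ⟨h3, h4⟩ := ih₂ _ h.2 (by omega) h2 (by omega)
    exact ⟨.seq _ _ _ _ _ _ _ h1 h3, h4.mono (by omega)⟩
  | ite_true e p q s s' t he hp ih =>
    intro B h hK hs hW
    simp only [Program.simple, Bool.and_eq_true] at h
    simp only [Program.inc] at hK
    rw [mul_add] at hW ⊢
    have : K ≤ K * (e.cost + 1) := Nat.le_mul_of_pos_right _ (by omega)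
    obtain ⟨h1, h2⟩ := ih B h.1.2 (by omega) hs (by omega)
    exact ⟨.ite_true _ _ _ _ _ _ ((e.fits_of_simple hs h.1.1).2 W (by omega)) he h1,
      h2.mono (by omega)⟩
  | ite_false e p q s s' t he hp ih =>
    intro B h hK hs hW
    simp only [Program.simple, Bool.and_eq_true] at h
    simp only [Program.inc] at hK
    rw [mul_add] at hW ⊢
    have : K ≤ K * (e.cost + 1) := Nat.le_mul_of_pos_right _ (by omega)
    obtain ⟨h1, h2⟩ := ih B h.2 (by omega) hs (by omega)
    exact ⟨.ite_false _ _ _ _ _ _ ((e.fits_of_simple hs h.1.1).2 W (by omega)) he h1,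
      h2.mono (by omega)⟩
  | loop_done e p s he =>
    intro B h hK hs hW
    simp only [Program.simple, Bool.and_eq_true] at h
    simp only [Program.inc] at hK
    have : K ≤ K * (e.cost + 1) := Nat.le_mul_of_pos_right _ (by omega)
    exact ⟨.loop_done _ _ _ ((e.fits_of_simple hs h.1).2 W (by omega)) he, hs.mono (by omega)⟩
  | loop_step e p s s' s'' t t' he hp hl ih₁ ih₂ =>
    intro B h hK hs hW
    have h' := h
    have hK' := hK
    simp only [Program.simple, Bool.and_eq_true] at h
    simp only [Program.inc] at hK
    rw [mul_add, mul_add] at hW ⊢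
    have : K ≤ K * (e.cost + 1) := Nat.le_mul_of_pos_right _ (by omega)
    obtain ⟨h1, h2⟩ := ih₁ B h.2 (by omega) hs (by omega)
    obtain ⟨h3, h4⟩ := ih₂ _ h' hK' h2 (by omega)
    exact ⟨.loop_step _ _ _ _ _ _ _ ((e.fits_of_simple hs h.1).2 W (by omega)) he h1 h3,
      h4.mono (by omega)⟩

/-- Registers that a program may change. -/
def Program.setsReg (i : ℕ) : Program → Bool
  | .skip => false
  | .set j _ => i == j
  | .store _ _ _ => false
  | .seq p q => p.setsReg i || q.setsReg i
  | .ite _ p q => p.setsReg i || q.setsReg i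
  | .loop _ p => p.setsReg i

/-- Arrays that a program may change. -/
def Program.setsMem (k : ℕ) : Program → Bool
  | .skip => false
  | .set _ _ => false
  | .store j _ _ => k == j
  | .seq p q => p.setsMem k || q.setsMem k
  | .ite _ p q => p.setsMem k || q.setsMem k
  | .loop _ p => p.setsMem k

theorem ExecF.reg_eq {p : Program} {s s' : State} {t i : ℕ} (h : ExecF p s t s') :
    p.setsReg i = false → s'.reg i = s.reg i := by
  induction h with
  | set j e s => exact fun h => Function.update_of_ne (by simpa [Program.setsReg] using h) _ _
  | seq p q s s' s'' t t' hp hq ih₁ ih₂ =>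
    intro h
    simp only [Program.setsReg, Bool.or_eq_false_iff] at h
    rw [ih₂ h.2, ih₁ h.1]
  | ite_true e p q s s' t he hp ih =>
    intro h
    simp only [Program.setsReg, Bool.or_eq_false_iff] at h
    exact ih h.1
  | ite_false e p q s s' t he hp ih =>
    intro h
    simp only [Program.setsReg, Bool.or_eq_false_iff] at h
    exact ih h.2
  | loop_step e p s s' s'' t t' he hp hl ih₁ ih₂ => exact fun h => (ih₂ h).trans (ih₁ h)
  | _ => exact fun _ => rfl

theorem ExecF.mem_eq {p : Program} {s s' : State} {t i : ℕ} (h : ExecF p s t s') :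
    p.setsMem i = false → s'.mem i = s.mem i := by
  induction h with
  | store j e e' s => exact fun h => Function.update_of_ne (by simpa [Program.setsMem] using h) _ _
  | seq p q s s' s'' t t' hp hq ih₁ ih₂ =>
    intro h
    simp only [Program.setsMem, Bool.or_eq_false_iff] at h
    rw [ih₂ h.2, ih₁ h.1]
  | ite_true e p q s s' t he hp ih =>
    intro h
    simp only [Program.setsMem, Bool.or_eq_false_iff] at h
    exact ih h.1
  | ite_false e p q s s' t he hp ih =>
    intro h
    simp only [Program.setsMem, Bool.or_eq_false_iff] at h
    exact ih h.2
  | loop_step e p s s' s'' t t' he hp hl ih₁ ih₂ => exact fun h => (ih₂ h).trans (ih₁ h)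
  | _ => exact fun _ => rfl

/-- The program halts after at most `c` steps in a state with the property `Q`. -/
def Ends (p : Program) (s : State) (c : ℕ) (Q : State → Prop) : Prop :=
  ∃ t s', ExecF p s t s' ∧ t ≤ c ∧ Q s'

theorem Ends.mono {p : Program} {s : State} {c c' : ℕ} {Q Q' : State → Prop} (h : Ends p s c Q)
    (hc : c ≤ c') (hQ : ∀ s', Q s' → Q' s') : Ends p s c' Q' := by
  obtain ⟨t, s', h1, h2, h3⟩ := h
  exact ⟨t, s', h1, h2.trans hc, hQ _ h3⟩

/-- What a program does not change may be added to the postcondition. -/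
theorem Ends.frame {p : Program} {s : State} {c : ℕ} {Q Q' : State → Prop} (h : Ends p s c Q)
    (hQ : ∀ s', Q s' → (∀ i, p.setsReg i = false → s'.reg i = s.reg i) →
      (∀ k, p.setsMem k = false → s'.mem k = s.mem k) → Q' s') : Ends p s c Q' := by
  obtain ⟨t, s', h1, h2, h3⟩ := h
  exact ⟨t, s', h1, h2, hQ _ h3 (fun _ => h1.reg_eq) (fun _ => h1.mem_eq)⟩

theorem Ends.seq {p q : Program} {s : State} {c c' : ℕ} {Q Q' : State → Prop} (h : Ends p s c Q)
    (h' : ∀ s', Q s' → Ends q s' c' Q') : Ends (.seq p q) s (c + c') Q' := by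
  obtain ⟨t, s', h1, h2, h3⟩ := h
  obtain ⟨t', s'', h4, h5, h6⟩ := h' s' h3
  exact ⟨_, s'', .seq _ _ _ _ _ _ _ h1 h4, by omega, h6⟩

/-- The loop rule, with a potential `φ`: an iteration that takes at most `c * k` steps for some
`k ≥ 1` lowers the potential by at least `k`. -/
theorem Ends.loop {e : Expr} {p : Program} (I : State → Prop) (φ : State → ℕ) (c : ℕ)
    (h : ∀ s, I s → e.eval s ≠ 0 → ∃ k, 1 ≤ k ∧
      Ends p s (c * k) fun s' => I s' ∧ φ s' + k ≤ φ s)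
    {s : State} (hs : I s) :
    Ends (.loop e p) s ((c + e.cost + 1) * φ s + e.cost + 1) fun s' => I s' ∧ e.eval s' = 0 := by
  induction hN : φ s using Nat.strong_induction_on generalizing s with
  | _ N ih =>
    subst hN
    by_cases he : e.eval s = 0
    · exact ⟨_, s, .loop_done _ _ _ he, by omega, hs, he⟩
    · obtain ⟨k, hk, t, s', h1, h2, h3, h4⟩ := h s hs he
      obtain ⟨t', s'', h5, h6, h7⟩ := ih (φ s') (by omega) h3 rfl
      refine ⟨_, s'', .loop_step _ _ _ _ _ _ _ he h1 h5, ?_, h7⟩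
      have h8 : (c + e.cost + 1) * (φ s' + k) ≤ (c + e.cost + 1) * φ s :=
        Nat.mul_le_mul_left _ h4
      have h9 : e.cost + 1 ≤ (e.cost + 1) * k := Nat.le_mul_of_pos_right _ (by omega)
      have h10 : (c + e.cost + 1) * (φ s' + k)
          = (c + e.cost + 1) * φ s' + c * k + (e.cost + 1) * k := by ring
      omega

/-- The weakest precondition of a program without loops. -/
def wp : Program → (State → Prop) → State → Prop
  | .skip, Q, s => Q s
  | .set i e, Q, s => Q (s.setReg i (e.eval s))
  | .store k e₁ e₂, Q, s => Q (s.setMem k (e₁.eval s) (e₂.eval s))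
  | .seq p q, Q, s => wp p (wp q Q) s
  | .ite e p q, Q, s => (e.eval s ≠ 0 → wp p Q s) ∧ (e.eval s = 0 → wp q Q s)
  | .loop _ _, _, _ => False

/-- A bound on the running time of a program without loops. -/
def Program.time : Program → ℕ
  | .skip => 1
  | .set _ e => e.cost + 1
  | .store _ e₁ e₂ => e₁.cost + e₂.cost + 1
  | .seq p q => p.time + q.time
  | .ite e p q => e.cost + 1 + p.time + q.time
  -- This value is irrelevant, since `wp` is false for loops.
  | .loop _ _ => 0

theorem Ends.of_wp {p : Program} {s : State} {Q : State → Prop} (h : wp p Q s) :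
    Ends p s p.time Q := by
  induction p generalizing s Q with
  | skip => exact ⟨_, _, .skip s, le_rfl, h⟩
  | set i e => exact ⟨_, _, .set i e s, le_rfl, h⟩
  | store k e₁ e₂ => exact ⟨_, _, .store k e₁ e₂ s, le_rfl, h⟩
  | seq p q ih₁ ih₂ => exact (ih₁ h).seq fun s' hs' => ih₂ hs'
  | ite e p q ih₁ ih₂ =>
    by_cases he : e.eval s = 0
    · obtain ⟨t, s', h1, h2, h3⟩ := ih₂ (h.2 he)
      exact ⟨_, s', .ite_false _ _ _ _ _ _ he h1, by simp only [Program.time]; omega, h3⟩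
    · obtain ⟨t, s', h1, h2, h3⟩ := ih₁ (h.1 he)
      exact ⟨_, s', .ite_true _ _ _ _ _ _ he h1, by simp only [Program.time]; omega, h3⟩
  | loop e p => exact h.elim

/-- A loop without inner loops. -/
theorem Ends.loop_wp {e : Expr} {p : Program} (I : State → Prop) (φ : State → ℕ)
    (h : ∀ s, I s → e.eval s ≠ 0 → wp p (fun s' => I s' ∧ φ s' < φ s) s)
    {s : State} (hs : I s) :
    Ends (.loop e p) s ((p.time + e.cost + 1) * φ s + e.cost + 1)
      fun s' => I s' ∧ e.eval s' = 0 :=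
  Ends.loop I φ p.time (fun s hs he => ⟨1, le_rfl, (Ends.of_wp (h s hs he)).mono (by omega)
    fun _ h => ⟨h.1, h.2⟩⟩) hs

/-- Programs in sequence. -/
def seqs : List Program → Program
  | [] => .skip
  | [p] => p
  | p :: q :: l => .seq p (seqs (q :: l))

@[simp] theorem State.setReg_reg (s : State) (i x j : ℕ) :
    (s.setReg i x).reg j = if j = i then x else s.reg j := Function.update_apply ..

@[simp] theorem State.setReg_mem (s : State) (i x : ℕ) : (s.setReg i x).mem = s.mem := rfl

@[simp] theorem State.setMem_reg (s : State) (k i x : ℕ) : (s.setMem k i x).reg = s.reg := rfl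

@[simp] theorem State.setMem_mem (s : State) (k i x k' : ℕ) :
    (s.setMem k i x).mem k' = if k' = k then Function.update (s.mem k) i x else s.mem k' :=
  Function.update_apply ..

end RAM

namespace Tri
variable {V : Type u} {f : V → ℕ} {a b p q u v x y z p' q' : V} {t l r s : Tri V}

/-! ### Elimination of vertices of degree two -/

/-- `x` is the third vertex of the triangle below the edge `(p, q)`. -/
def Par (u v : V) (t : Tri V) (p q x : V) : Prop := ∃ l r, Sub u v t p q (node x l r)

theorem Par.lt (h : Par u v t p q x) (hs : Sorted f u v t) :
    f u ≤ f p ∧ f p < f x ∧ f x < f q ∧ f q ≤ f v := by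
  obtain ⟨l, r, h⟩ := h
  exact h.node_lt hs

theorem Par.edges (h : Par u v t p q x) : Edge u v t p q ∧ Edge u v t p x ∧ Edge u v t x q := by
  obtain ⟨l, r, h⟩ := h
  exact ⟨h.edge, h.apex_edges⟩

/-- Two triangles with the same apex below different edges would have crossing sides. So every
vertex off the base edge has a unique triangle whose base it was cut off from. -/
theorem Par.unique (hf : f.Injective) (hs : Sorted f u v t) (h : Par u v t p q x)
    (h' : Par u v t p' q' x) : p = p' ∧ q = q' := by
  have a1 := h.lt hs
  have a2 := h'.lt hs
  have b1 := h.edges.2.1.noncross h'.edges.1 hs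
  have b2 := h'.edges.2.1.noncross h.edges.1 hs
  have b3 := h.edges.1.noncross h'.edges.2.2 hs
  have b4 := h'.edges.1.noncross h.edges.2.2 hs
  exact ⟨hf (by omega), hf (by omega)⟩

theorem Edge.base_or_par (h : Edge u v t x y) :
    (x = u ∧ y = v) ∨ (∃ q, Par u v t x q y) ∨ ∃ p, Par u v t p y x := by
  obtain ⟨s, h⟩ := h
  rcases h.eq_or_parent with ⟨h1, h2, -⟩ | ⟨p, q, d, l, r, h1, ⟨rfl, rfl, -⟩ | ⟨rfl, rfl, -⟩⟩
  · exact .inl ⟨h1, h2⟩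
  · exact .inr (.inl ⟨q, l, r, h1⟩)
  · exact .inr (.inr ⟨p, l, r, h1⟩)

theorem Vert.eq_or_par (h : Vert u v t x) : x = u ∨ x = v ∨ ∃ p q, Par u v t p q x := by
  induction t generalizing u v with
  | leaf => rcases vert_leaf.1 h with h | h <;> simp [h]
  | node c l r ihl ihr =>
    have hc : ∃ p q, Par u v (node c l r) p q c := ⟨u, v, l, r, .refl _ _ _⟩
    rcases vert_node.1 h with h | h
    · rcases ihl h with rfl | rfl | ⟨p, q, l', r', h⟩
      exacts [.inl rfl, .inr (.inr hc), .inr (.inr ⟨p, q, l', r', .left h⟩)]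
    · rcases ihr h with rfl | rfl | ⟨p, q, l', r', h⟩
      exacts [.inr (.inr hc), .inr (.inl rfl), .inr (.inr ⟨p, q, l', r', .right h⟩)]

/-- The set `D` of deleted vertices contains with a vertex all vertices below it. -/
structure Lower (u v : V) (t : Tri V) (D : Set V) : Prop where
  fst : u ∉ D
  snd : v ∉ D
  par : ∀ p q x, Par u v t p q x → x ∉ D → p ∉ D ∧ q ∉ D

variable {G : SimpleGraph V} {D : Set V}

theorem Par.subset (hadj : ∀ x y, G.Adj x y ↔ Edge u v t x y ∨ Edge u v t y x)
    (hD : Lower u v t D) (h : Par u v t p q x) (hx : x ∉ D) : {p, q} ⊆ G.neighborSet x \ D := by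
  obtain ⟨h1, h2⟩ := hD.par _ _ _ h hx
  rintro y (rfl | rfl)
  · exact ⟨(hadj _ _).2 (.inr h.edges.2.1), h1⟩
  · exact ⟨(hadj _ _).2 (.inl h.edges.2.2), h2⟩

/-- If x were an end of the base of a triangle with a remaining apex y, then y would be a remaining
neighbour of x different from p and q. -/
theorem Lower.insert (hs : Sorted f u v t)
    (hadj : ∀ x y, G.Adj x y ↔ Edge u v t x y ∨ Edge u v t y x)
    (hD : Lower u v t D) (h : Par u v t p q x) (hN : G.neighborSet x \ D ⊆ {p, q}) :
    Lower u v t (Insert.insert x D) := by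
  have a1 := h.lt hs
  refine ⟨?_, ?_, fun p' q' y h' hy => ?_⟩
  · rintro (rfl | h2)
    · omega
    · exact hD.fst h2
  · rintro (rfl | h2)
    · omega
    · exact hD.snd h2
  · have hyD : y ∉ D := fun h => hy (.inr h)
    have a2 := h'.lt hs
    have key : x ≠ p' ∧ x ≠ q' := by
      constructor
      · rintro rfl
        rcases hN ⟨(hadj _ _).2 (.inl h'.edges.2.1), hyD⟩ with rfl | rfl
        · omega
        · have := h.edges.1.noncross h'.edges.1 hs; omega
      · rintro rfl
        rcases hN ⟨(hadj _ _).2 (.inr h'.edges.2.2), hyD⟩ with rfl | rfl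
        · have := h'.edges.1.noncross h.edges.1 hs; omega
        · omega
    obtain ⟨h3, h4⟩ := hD.par _ _ _ h' hyD
    exact ⟨fun h => h.elim (fun h => key.1 h.symm) h3, fun h => h.elim (fun h => key.2 h.symm) h4⟩

/-- Choose a remaining apex x with a smallest part below its edge. A further remaining neighbour of
x would be the apex of a smaller part. So the elimination does not get stuck before only u and v are
left. -/
theorem Lower.exists_par (hf : f.Injective) (hs : Sorted f u v t)
    (hadj : ∀ x y, G.Adj x y ↔ Edge u v t x y ∨ Edge u v t y x)
    (hz : Vert u v t z) (hu : z ≠ u) (hv : z ≠ v) (hzD : z ∉ D) :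
    ∃ p q x, Par u v t p q x ∧ x ∉ D ∧ G.neighborSet x \ D ⊆ {p, q} := by
  obtain ⟨p, q, l, r, h0⟩ := (hz.eq_or_par.resolve_left hu).resolve_left hv
  let P : ℕ → Prop := fun n => ∃ p q x l r, Sub u v t p q (node x l r) ∧ x ∉ D ∧
    (node x l r).inner.length = n
  have hP : ∃ n, P n := ⟨_, p, q, z, l, r, h0, hzD, rfl⟩
  classical
  obtain ⟨p, q, x, l, r, h, hx, hn⟩ := Nat.find_spec hP
  refine ⟨p, q, x, ⟨l, r, h⟩, hx, ?_⟩
  have hpx : Par u v t p q x := ⟨l, r, h⟩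
  have a1 := hpx.lt hs
  have low : ∀ p' q' y, Par u v t p' q' y → y ∉ D → f p ≤ f p' → f q' ≤ f q →
      ¬ (p' = p ∧ q' = q) → False := by
    rintro p' q' y ⟨l', r', h'⟩ hy h1 h2 h3
    have := (h.inside h' hs h1 h2).length_lt h3
    exact Nat.find_min hP (hn ▸ this) ⟨_, _, _, _, _, h', hy, rfl⟩
  rintro y ⟨hy, hyD⟩
  rcases (hadj _ _).1 hy with e | e
  · rcases e.base_or_par with ⟨rfl, rfl⟩ | ⟨q', h'⟩ | ⟨p', h'⟩
    · omega
    · have a2 := h'.lt hs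
      have := hpx.edges.1.noncross_right h'.edges.1 hs a1.2.1 a1.2.2.1
      exact (low _ _ _ h' hyD (by omega) this (by rintro ⟨rfl, rfl⟩; omega)).elim
    · exact .inr (h'.unique hf hs hpx).2
  · rcases e.base_or_par with ⟨rfl, rfl⟩ | ⟨q', h'⟩ | ⟨p', h'⟩
    · omega
    · exact .inl (h'.unique hf hs hpx).1
    · have a2 := h'.lt hs
      have := hpx.edges.1.noncross_left h'.edges.1 hs a1.2.1 a1.2.2.1
      exact (low _ _ _ h' hyD this (by omega) (by rintro ⟨rfl, rfl⟩; omega)).elim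

end Tri

/-! ### The program -/

namespace Mode

/-- All modes. -/
def all : List Mode := [cut, handle, fanLeft, fanRight, partLeft, partRight, root]

/-- The number of a mode in the list of all modes. -/
def code : Mode → ℕ
  | cut => 0
  | handle => 1
  | fanLeft => 2
  | fanRight => 3
  | partLeft => 4
  | partRight => 5
  | root => 6

theorem all_code (m : Mode) : all[m.code]? = some m := by cases m <;> rfl

theorem mem_all (m : Mode) : m ∈ all := List.mem_of_getElem? m.all_code

theorem code_le (m : Mode) : m.code ≤ 6 := by cases m <;> decide

theorem code_inj {m m' : Mode} : m.code = m'.code ↔ m = m' := by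
  refine ⟨fun h => ?_, fun h => h ▸ rfl⟩
  have := m.all_code
  rw [h, all_code] at this
  exact (Option.some.inj this).symm

theorem code_eq_zero {m : Mode} : m.code = 0 ↔ m = cut := code_inj (m' := cut)

end Mode

namespace RAM

open RAM.Program RAM.Expr Tri

/-- Array `5` gets the degrees of the vertices, increased by `2` for the ends of the root-edge. -/
def initDegrees : Program := seqs [
  set 3 (const 0),
  loop (sub (reg 0) (reg 3)) (seqs [
    store 5 (reg 3) (sub (cell 0 (add (reg 3) (const 1))) (cell 0 (reg 3))),
    set 3 (add (reg 3) (const 1))]),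
  -- The ends of the root-edge remain neighbours of each other, so with the surplus their counters
  -- stay at least 3 and they never enter the queue.
  store 5 (reg 1) (add (cell 5 (reg 1)) (const 2)),
  store 5 (reg 2) (add (cell 5 (reg 2)) (const 2))]

/-- Append the vertex in register `i` to the queue if its degree is at most `2`. -/
def push (i : ℕ) : Program :=
  -- The truncated difference is nonzero exactly for degrees at most 2.
  ite (sub (const 3) (cell 5 (reg i)))
    (seqs [store 6 (reg 4) (reg i), set 4 (add (reg 4) (const 1))]) skip

/-- The queue is in array `6`, from position `reg 5` to position `reg 4`. -/
def initQueue : Program := seqs [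
  set 3 (const 0),
  set 4 (const 0),
  loop (sub (reg 0) (reg 3)) (seqs [push 3, set 3 (add (reg 3) (const 1))])]

/-- Arrays `8` and `9` get the neighbours of `reg 6` that have not been eliminated. -/
def scan : Program :=
  loop (sub (reg 8) (reg 7)) (seqs [
    set 9 (cell 1 (reg 7)),
    ite (cell 7 (reg 9)) skip
      -- The two cells work as a shift register: they finally hold the last two remaining
      -- neighbours, which are all of them.
      (seqs [store 8 (reg 6) (cell 9 (reg 6)), store 9 (reg 6) (reg 9)]),
    set 7 (add (reg 7) (const 1))])

/-- Lower the degree of `reg 9`. -/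
def lower : Program := seqs [store 5 (reg 9) (sub (cell 5 (reg 9)) (const 1)), push 9]

/-- Eliminate the vertices of degree `2` one after the other. -/
def eliminate : Program := seqs [
  set 5 (const 0),
  loop (sub (reg 4) (reg 5)) (seqs [
    seqs [set 6 (cell 6 (reg 5)), set 5 (add (reg 5) (const 1)), set 7 (cell 0 (reg 6)),
      set 8 (cell 0 (add (reg 6) (const 1)))],
    scan,
    seqs [store 7 (reg 6) (const 1), set 9 (cell 8 (reg 6)), lower, set 9 (cell 9 (reg 6)),
      lower]])]

/-- Exchange the registers `8` and `9`. -/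
def swap : Program := seqs [set 7 (reg 8), set 8 (reg 9), set 9 (reg 7)]

/-- Insert the vertices in the reverse order. The edge number `e` has the ends `14[e]` and `15[e]`;
`12[e]` and `13[e]` are the numbers of the two other sides of the triangle below it (or `0`).
The vertex after `x` on the present polygon is `10[x]`, and the edge to it has number `11[x]`. The
number of edges is in register `10`. -/
def build : Program := seqs [
  -- The number n, which is not a vertex, marks the end of the polygon behind v.
  seqs [store 10 (reg 1) (reg 2), store 10 (reg 2) (reg 0), store 14 (const 0) (reg 1),
    store 15 (const 0) (reg 2), set 10 (const 1)],
  loop (reg 4) (seqs [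
    seqs [set 4 (sub (reg 4) (const 1)), set 6 (cell 6 (reg 4)), set 8 (cell 8 (reg 6)),
      set 9 (cell 9 (reg 6))],
    -- The two truncated differences test equality. If the vertex after `reg 8` is not `reg 9`, the
    -- neighbours have been stored in the reverse order.
    ite (sub (cell 10 (reg 8)) (reg 9)) swap
      (ite (sub (reg 9) (cell 10 (reg 8))) swap skip),
    seqs [set 11 (cell 11 (reg 8)),
      store 12 (reg 11) (reg 10), store 13 (reg 11) (add (reg 10) (const 1)),
      store 14 (reg 10) (reg 8), store 15 (reg 10) (reg 6),
      store 14 (add (reg 10) (const 1)) (reg 6), store 15 (add (reg 10) (const 1)) (reg 9),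
      store 11 (reg 8) (reg 10), store 11 (reg 6) (add (reg 10) (const 1)),
      store 10 (reg 8) (reg 6), store 10 (reg 6) (reg 9),
      set 10 (add (reg 10) (const 2))]])]

/-- Register `d` gets the maximum of the values for the modes `m` at the two sides below the edge
`reg 5`. -/
def maxInto (d : ℕ) (m : Mode × Mode) : Program := seqs [
  set d (cell (16 + m.1.code) (cell 12 (reg 5))),
  set 7 (cell (16 + m.2.code) (cell 13 (reg 5))),
  ite (sub (reg 7) (reg d)) (set d (reg 7)) skip]

/-- The value of the edge `reg 5` for the mode `m`. -/
def evaluate (κ : SystemKind) (m : Mode) : Program := seqs [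
  maxInto 8 (m.fst κ), maxInto 9 (m.snd κ),
  ite (sub (reg 8) (reg 9)) (set 8 (reg 9)) skip,
  store (16 + m.code) (reg 5) (add (reg 8) (const m.bump))]

/-- The values of the edge before `reg 5` for all modes. -/
def evaluateStep (κ : SystemKind) : Program := seqs [
  set 5 (sub (reg 5) (const 1)),
  -- Number 0 is the root-edge and never a side below another edge, so it can signal that there is
  -- no triangle. The values of such an edge keep their initial value 0.
  ite (cell 12 (reg 5)) (seqs (Mode.all.map (evaluate κ))) skip]

/-- The values of all edges for all modes. -/
def evaluateAll (κ : SystemKind) : Program := seqs [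
  set 5 (reg 10),
  loop (reg 5) (evaluateStep κ)]

/-- Output the edge `reg 5` as an edge of the subgraph number `e`. -/
def emit (e : Expr) : Program := seqs [
  store 2 (reg 2) e, store 3 (reg 2) (cell 14 (reg 5)), store 4 (reg 2) (cell 15 (reg 5)),
  set 2 (add (reg 2) (const 1))]

/-- Array `23` gets the modes of the two sides below the edge `reg 5`. -/
def setModes (m : Mode × Mode) : Program := seqs [
  store 23 (cell 12 (reg 5)) (const m.1.code), store 23 (cell 13 (reg 5)) (const m.2.code)]

/-- Choose the modes of the two sides below the edge `reg 5`, which has mode `m`. -/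
def select (κ : SystemKind) (m : Mode) : Program := seqs [
  maxInto 8 (m.fst κ), maxInto 9 (m.snd κ),
  ite (sub (reg 8) (reg 9)) (setModes (m.snd κ)) (setModes (m.fst κ))]

/-- Execute `select` for the mode with number `reg 3` in the list. -/
def dispatch (κ : SystemKind) : List Mode → Program
  | [] => skip
  | m :: l => ite (reg 3) (seqs [set 3 (sub (reg 3) (const 1)), dispatch κ l]) (select κ m)

/-- Output the edge `reg 5`, and pass on its subgraph and its mode to the two sides below it. The
edge `e` belongs to the subgraph number `24[e]` and has the mode `23[e]`. -/
def outputStep (κ : SystemKind) : Program := seqs [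
  emit (cell 24 (reg 5)),
  ite (cell 12 (reg 5))
    (seqs [
      ite (cell 23 (reg 5)) (set 6 (cell 24 (reg 5)))
        -- An edge of mode `cut` is a leaf of the subgraph above it and also the cap of a new
        -- subgraph, so it is listed twice.
        (seqs [set 6 (reg 1), set 1 (add (reg 1) (const 1)), emit (reg 6)]),
      set 3 (cell 23 (reg 5)),
      dispatch κ Mode.all,
      store 24 (cell 12 (reg 5)) (reg 6), store 24 (cell 13 (reg 5)) (reg 6)])
    skip,
  set 5 (add (reg 5) (const 1))]

/-- Output the subgraphs of an optimal system. -/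
def output (κ : SystemKind) : Program := seqs [
  seqs [set 1 (const 0), set 2 (const 0), set 5 (const 0)],
  loop (sub (reg 10) (reg 5)) (outputStep κ),
  -- Array 16 belongs to mode `cut`, and edge 0 is the root-edge.
  set 0 (cell 16 (const 0))]

/-- The algorithm. -/
def algorithm (κ : SystemKind) : Program :=
  seqs [initDegrees, initQueue, eliminate, build, evaluateAll κ, output κ]

theorem algorithm_simple (κ : SystemKind) : (algorithm κ).simple = true := by
  cases κ <;> decide

end RAM

/-! ### Correctness of the initialization and of the neighbour scan -/

namespace RAM

open RAM.Program RAM.Expr Tri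

/-- The array `arr` starts with the entries of `l`. -/
def Holds {n : ℕ} (arr : ℕ → ℕ) (l : List (Fin n)) : Prop :=
  ∀ i (h : i < l.length), arr i = l[i]

theorem Holds.push {n : ℕ} {arr : ℕ → ℕ} {l : List (Fin n)} (h : Holds arr l) (x : Fin n) :
    Holds (Function.update arr l.length x) (l ++ [x]) := by
  intro i hi
  simp only [List.length_append, List.length_singleton] at hi
  rw [Function.update_apply, List.getElem_append]
  split_ifs with h1 h2 h2
  · omega
  · simp
  · exact h i h2
  · omega

theorem initDegrees_ends {n u v : ℕ} {s : State} (h0 : s.reg 0 = n) (h1 : s.reg 1 = u)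
    (h2 : s.reg 2 = v) (huv : u ≠ v) :
    Ends initDegrees s (100 * n + 100) fun s' => ∀ x < n,
      s'.mem 5 x = s.mem 0 (x + 1) - s.mem 0 x + if x = u ∨ x = v then 2 else 0 := by
  refine ((Ends.of_wp (p := .set 3 (const 0)) (Q := fun s' => s'.reg 0 = n ∧ s'.reg 1 = u ∧
    s'.reg 2 = v ∧ s'.reg 3 = 0 ∧ s'.mem 0 = s.mem 0) ?_).seq fun s₁ hs₁ =>
    ((Ends.loop_wp (fun s' => s'.reg 0 = n ∧ s'.reg 1 = u ∧ s'.reg 2 = v ∧ s'.mem 0 = s.mem 0 ∧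
      ∀ x < s'.reg 3, s'.mem 5 x = s.mem 0 (x + 1) - s.mem 0 x) (fun s' => n - s'.reg 3) ?_ ?_).mono
      (c' := 50 * n + 50) ?_ fun _ h => h).seq
      fun s₂ hs₂ => Ends.of_wp ?_).mono ?_ (fun _ h => h)
  · simp [wp, h0, h1, h2, Expr.eval]
  · rintro s' ⟨a0, a1, a2, a3, a4⟩ he
    simp only [Expr.eval, a0] at he
    refine ⟨⟨?_, ?_, ?_, ?_, ?_⟩, ?_⟩ <;> simp [Expr.eval, a0, a1, a2, a3]
    · intro x hx
      rw [Function.update_apply]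
      split_ifs with h
      · rw [h]
      · exact a4 x (by omega)
    · omega
  · exact ⟨hs₁.1, hs₁.2.1, hs₁.2.2.1, hs₁.2.2.2.2, by simp [hs₁.2.2.2.1]⟩
  · simp [Program.time, seqs, Expr.cost, hs₁.2.2.2.1]; omega
  · obtain ⟨⟨a0, a1, a2, a3, a4⟩, a5⟩ := hs₂
    simp only [Expr.eval, a0] at a5
    intro x hx
    have := a4 x (by omega)
    by_cases hxu : x = u <;> by_cases hxv : x = v <;>
      simp_all [Expr.eval, Function.update_apply]
  · simp [Program.time, seqs, Expr.cost]; omega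

theorem initQueue_ends {n : ℕ} {s : State} (h0 : s.reg 0 = n) :
    Ends initQueue s (100 * n + 100) fun s' => ∃ k : List (Fin n), k.Nodup ∧
      (∀ x, x ∈ k ↔ s.mem 5 x ≤ 2) ∧ s'.reg 4 = k.length ∧ Holds (s'.mem 6) k := by
  refine ((Ends.of_wp (p := .set 3 (const 0)) (Q := fun s' => s'.reg 0 = n ∧
    s'.reg 3 = 0 ∧ s'.mem 5 = s.mem 5) ?_).seq fun s₁ hs₁ =>
    (Ends.of_wp (p := .set 4 (const 0)) (Q := fun s' => s'.reg 0 = n ∧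
    s'.reg 3 = 0 ∧ s'.mem 5 = s.mem 5 ∧ s'.reg 4 = 0) ?_).seq fun s₂ hs₂ =>
    ((Ends.loop_wp (fun s' => s'.reg 0 = n ∧ s'.mem 5 = s.mem 5 ∧ s'.reg 3 ≤ n ∧
      ∃ k : List (Fin n), k.Nodup ∧ (∀ x, x ∈ k ↔ (x : ℕ) < s'.reg 3 ∧ s.mem 5 x ≤ 2) ∧
      s'.reg 4 = k.length ∧ Holds (s'.mem 6) k) (fun s' => n - s'.reg 3) ?_ ?_).mono
      (c' := 50 * n + 50) ?_ fun _ h => h)).mono ?_ ?_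
  · simp [wp, h0, Expr.eval]
  · simp [wp, hs₁, Expr.eval]
  · rintro s' ⟨a0, a1, a2, k, a3, a4, a5, a6⟩ he
    simp only [Expr.eval, a0] at he
    have hlt : s'.reg 3 < n := by omega
    have hcong : ∀ x : Fin n, (x : ℕ) ≤ s'.reg 3 ↔ (x : ℕ) < s'.reg 3 ∨ x = ⟨s'.reg 3, hlt⟩ := by
      intro x; rw [Fin.ext_iff]; simp only; omega
    constructor
    · intro h
      simp only [Expr.eval, a1] at h
      refine ⟨⟨?_, ?_, ?_, k ++ [⟨s'.reg 3, hlt⟩], ?_, ?_, ?_, ?_⟩, ?_⟩ <;>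
        try simp [Expr.eval, a0, a1, a5]
      · omega
      · refine List.Nodup.append a3 (by simp) ?_
        simp only [List.disjoint_singleton]
        exact fun h => by have := ((a4 _).1 h).1; simp at this
      · intro x
        rw [a4, hcong]
        constructor
        · rintro (h1 | rfl)
          · exact ⟨.inl h1.1, h1.2⟩
          · exact ⟨.inr rfl, by simp only; omega⟩
        · rintro ⟨h1 | h1, h2⟩
          · exact .inl ⟨h1, h2⟩
          · exact .inr h1
      · exact a6.push ⟨s'.reg 3, hlt⟩
      · omega
    · intro h
      simp only [Expr.eval, a1] at h
      refine ⟨⟨?_, ?_, ?_, k, a3, ?_, ?_, ?_⟩, ?_⟩ <;> simp [Expr.eval, a0, a1, a5]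
      · omega
      · intro x
        rw [a4, hcong]
        constructor
        · exact fun h1 => ⟨.inl h1.1, h1.2⟩
        · rintro ⟨h1 | rfl, h2⟩
          · exact ⟨h1, h2⟩
          · simp only at h2; omega
      · exact a6
      · omega
  · exact ⟨hs₂.1, hs₂.2.2.1, by omega, [], by simp, by simp [hs₂], by simp [hs₂], by simp [Holds]⟩
  · simp [Program.time, seqs, push, Expr.cost, hs₂]; omega
  · simp [Program.time, Expr.cost]; omega
  · rintro s' ⟨⟨a0, a1, a2, k, a3, a4, a5, a6⟩, a7⟩
    simp only [Expr.eval, a0] at a7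
    exact ⟨k, a3, fun x => by rw [a4]; have := x.2; simp; omega, a5, a6⟩

/-- The loop invariant distinguishes how many of the positions i and j have been passed: after one
of them array 9 holds its neighbour, after both the two arrays hold both neighbours, in an unknown
order. -/
theorem scan_ends {s : State} {p q i j : ℕ} (hi : s.reg 7 ≤ i ∧ i < s.reg 8)
    (hj : s.reg 7 ≤ j ∧ j < s.reg 8) (hij : i ≠ j) (hp : s.mem 1 i = p) (hq : s.mem 1 j = q)
    (h : ∀ k, s.reg 7 ≤ k → k < s.reg 8 → (s.mem 7 (s.mem 1 k) = 0 ↔ k = i ∨ k = j)) :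
    Ends scan s (100 * (s.reg 8 - s.reg 7) + 100) fun s' =>
      s(s'.mem 8 (s.reg 6), s'.mem 9 (s.reg 6)) = s(p, q) ∧
      ∀ y, y ≠ s.reg 6 → s'.mem 8 y = s.mem 8 y ∧ s'.mem 9 y = s.mem 9 y := by
  refine (Ends.loop_wp (fun s' => s'.reg 6 = s.reg 6 ∧ s'.reg 8 = s.reg 8 ∧ s'.mem 1 = s.mem 1 ∧
    s'.mem 7 = s.mem 7 ∧ s.reg 7 ≤ s'.reg 7 ∧ s'.reg 7 ≤ s.reg 8 ∧
    (∀ y, y ≠ s.reg 6 → s'.mem 8 y = s.mem 8 y ∧ s'.mem 9 y = s.mem 9 y) ∧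
    (i < s'.reg 7 → j < s'.reg 7 → s(s'.mem 8 (s.reg 6), s'.mem 9 (s.reg 6)) = s(p, q)) ∧
    (i < s'.reg 7 → s'.reg 7 ≤ j → s'.mem 9 (s.reg 6) = p) ∧
    (j < s'.reg 7 → s'.reg 7 ≤ i → s'.mem 9 (s.reg 6) = q)) (fun s' => s.reg 8 - s'.reg 7)
    ?_ ?_).mono ?_ ?_
  · rintro s' ⟨a1, a2, a3, a4, a5, a6, a7, a8, a9, a10⟩ he
    simp only [Expr.eval, a2] at he
    have hk := h (s'.reg 7) a5 (by omega)
    constructor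
    · intro h
      simp [Expr.eval, a3, a4] at h
      have : s'.reg 7 ≠ i ∧ s'.reg 7 ≠ j := by
        rw [← not_or, ← hk]; exact h
      refine ⟨⟨?_, ?_, ?_, ?_, ?_, ?_, ?_, ?_, ?_, ?_⟩, ?_⟩ <;> simp [Expr.eval, *, -Sym2.eq, -Sym2.rel_iff']
      · omega
      · omega
      · exact a7
      · exact fun h1 h2 => a8 (by omega) (by omega)
      · exact fun h1 h2 => a9 (by omega) (by omega)
      · exact fun h1 h2 => a10 (by omega) (by omega)
      · omega
    · intro h
      simp [Expr.eval, a3, a4] at h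
      rw [hk] at h
      refine ⟨⟨?_, ?_, ?_, ?_, ?_, ?_, ?_, ?_, ?_, ?_⟩, ?_⟩ <;> simp [Expr.eval, *, -Sym2.eq, -Sym2.rel_iff']
      · omega
      · omega
      · intro y hy
        simp [Function.update_of_ne hy, a7 y hy]
      · intro h1 h2
        rcases h with h | h
        · rw [a10 (by omega) (by omega), h, hp, Sym2.eq_swap]
        · rw [a9 (by omega) (by omega), h, hq]
      · intro h1 h2
        rw [show s'.reg 7 = i by omega, hp]
      · intro h1 h2
        rw [show s'.reg 7 = j by omega, hq]
      · omega
  · exact ⟨rfl, rfl, rfl, rfl, le_rfl, by omega, fun _ _ => ⟨rfl, rfl⟩, by omega, by omega, by omega⟩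
  · simp [Program.time, seqs, Expr.cost]; omega
  · rintro s' ⟨⟨a1, a2, a3, a4, a5, a6, a7, a8, a9, a10⟩, he⟩
    simp only [Expr.eval, a2] at he
    exact ⟨a8 (by omega) (by omega), a7⟩

end RAM

/-! ### Size of the input, elimination orders and remaining degrees -/

namespace RAM

open RAM.Program RAM.Expr Tri

variable {n : ℕ} {G : SimpleGraph (Fin n)} {u v : Fin n} {t : Tri (Fin n)} {f : Fin n → ℕ}

theorem wp_lower {s : State} {Q : State → Prop} {l : List (Fin n)} {y : Fin n} (hy : s.reg 9 = y)
    (h4 : s.reg 4 = l.length) (hl : Holds (s.mem 6) l)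
    (h : ∀ s' : State, (∀ i, i ≠ 4 → s'.reg i = s.reg i) →
      (∀ k, k ≠ 5 → k ≠ 6 → s'.mem k = s.mem k) →
      s'.mem 5 = Function.update (s.mem 5) y (s.mem 5 y - 1) →
      s'.reg 4 = (l ++ if s.mem 5 y - 1 ≤ 2 then [y] else []).length →
      Holds (s'.mem 6) (l ++ if s.mem 5 y - 1 ≤ 2 then [y] else []) → Q s') :
    wp lower Q s := by
  refine ⟨fun h1 => ?_, fun h1 => ?_⟩ <;> simp [Expr.eval, hy] at h1
  · refine h _ ?_ ?_ ?_ ?_ ?_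
    · intro i hi; simp [hi]
    · intro k h5 h6; simp [h5, h6]
    · simp [Expr.eval, hy]
    · rw [if_pos (by omega)]; simp [Expr.eval, h4]
    · rw [if_pos (by omega)]; simpa [Expr.eval, h4, hy] using hl.push y
  · refine h _ ?_ ?_ ?_ ?_ ?_
    · intro i hi; simp
    · intro k h5 h6; simp [h5]
    · simp [Expr.eval, hy]
    · rw [if_neg (by omega)]; simp [h4]
    · rw [if_neg (by omega)]; simpa using hl

theorem IsInput.ncard_neighborSet {s : State} (h : IsInput G u v s) (x : Fin n) :
    (G.neighborSet x).ncard = s.mem 0 (x + 1) - s.mem 0 x := by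
  classical
  have h1 := (h.neighbors x).image_eq
  have h2 := (h.neighbors x).injOn.ncard_image
  rw [h1, Set.ncard_image_of_injective _ Fin.val_injective, Set.ncard_eq_toFinset_card'] at h2
  rw [Set.ncard_eq_toFinset_card', h2]
  simp

theorem IsInput.offset_mono {s : State} (h : IsInput G u v s) {x y : ℕ} (hxy : x ≤ y)
    (hy : y ≤ n) : s.mem 0 x ≤ s.mem 0 y := by
  induction y, hxy using Nat.le_induction with
  | base => exact le_rfl
  | succ y _ ih => exact (ih (by omega)).trans (h.offset_le y (by omega))

theorem IsInput.sum_eq {s : State} (h : IsInput G u v s) :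
    ∑ x : Fin n, (s.mem 0 (x + 1) - s.mem 0 x) = s.mem 0 n := by
  rw [Fin.sum_univ_eq_sum_range (fun x => s.mem 0 (x + 1) - s.mem 0 x)]
  have : ∀ m ≤ n, ∑ x ∈ Finset.range m, (s.mem 0 (x + 1) - s.mem 0 x) = s.mem 0 m := by
    intro m hm
    induction m with
    | zero => simp [h.offset_zero]
    | succ m ih =>
      rw [Finset.sum_range_succ, ih (by omega)]
      have := h.offset_le m (by omega)
      omega
  exact this n le_rfl

/-- The adjacency lists have total length twice the number of edges, that is 2(2n - 3). -/
theorem IsInput.offset_le_four {s : State} (h : IsInput G u v s) (hG : IsMaximalOuterplanar G) :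
    s.mem 0 n ≤ 4 * n := by
  classical
  have h1 := ncard_edgeSet_of_maximal (by have := hG.1; omega) hG.2
  rw [Nat.card_fin] at h1
  rw [← h.sum_eq]
  have h2 := G.sum_degrees_eq_twice_card_edges
  have h3 : ∀ x, G.degree x = s.mem 0 (x + 1) - s.mem 0 x := by
    intro x
    rw [← h.ncard_neighborSet, Set.ncard_eq_toFinset_card']
    rfl
  rw [Finset.sum_congr rfl fun x _ => h3 x] at h2
  rw [Set.ncard_eq_toFinset_card', ← SimpleGraph.edgeFinset] at h1
  omega

theorem IsInput.bounded {s : State} (h : IsInput G u v s) (hG : IsMaximalOuterplanar G) :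
    s.Bounded (4 * n) := by
  have h1 := h.offset_le_four hG
  constructor
  · rintro (_ | _ | _ | i)
    · rw [h.reg_zero]; omega
    · rw [h.reg_one]; omega
    · rw [h.reg_two]; omega
    · rw [h.reg_else _ (by omega)]; omega
  · rintro (_ | _ | k) i
    · by_cases hi : i ≤ n
      · exact (h.offset_mono hi le_rfl).trans h1
      · rw [h.offset_else i (by omega)]; omega
    · by_cases hi : s.mem 0 n ≤ i
      · rw [h.neighbors_else i hi]; omega
      -- The least offset exceeding i shows to which adjacency list position i belongs, so the entry
      -- is a vertex.
      · have : ∃ m, i < s.mem 0 m := ⟨n, by omega⟩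
        classical
        obtain ⟨m, hm⟩ : ∃ m, Nat.find this = m := ⟨_, rfl⟩
        have hm1 : i < s.mem 0 m := hm ▸ Nat.find_spec this
        have hm2 : m ≤ n := hm ▸ Nat.find_le (by omega)
        cases m with
        | zero => rw [h.offset_zero] at hm1; omega
        | succ m =>
          have hm3 : ¬ i < s.mem 0 m := Nat.find_min this (by omega)
          obtain ⟨y, -, hy⟩ := (h.neighbors ⟨m, by omega⟩).mapsTo ⟨not_lt.1 hm3, hm1⟩
          simp only at hy
          simp only [zero_add]
          rw [← hy]
          have := y.2
          omega
    · rw [h.mem_else _ (by omega)]; omega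

/-- The vertices of `d` can be eliminated in this order; when a vertex is eliminated, the
remaining neighbours are those given by `m` and `m'`. -/
inductive Elim (u v : Fin n) (t : Tri (Fin n)) (m m' : ℕ → ℕ) : List (Fin n) → Prop
  | nil : Elim u v t m m' []
  | snoc (d : List (Fin n)) (x p q : Fin n) (h : Elim u v t m m' d) (hx : x ∉ d)
      (hpar : Par u v t p q x) (hp : p ∉ d) (hq : q ∉ d)
      (hm : s(m x, m' x) = s((p : ℕ), (q : ℕ))) : Elim u v t m m' (d ++ [x])

theorem Elim.congr {m m' k k' : ℕ → ℕ} {d : List (Fin n)} (h : Elim u v t m m' d)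
    (hk : ∀ x ∈ d, k x = m x ∧ k' x = m' x) : Elim u v t k k' d := by
  induction h with
  | nil => exact .nil
  | snoc d x p q h hx hpar hp hq hm ih =>
    refine .snoc d x p q (ih fun y hy => hk y (by simp [hy])) hx hpar hp hq ?_
    rw [(hk x (by simp)).1, (hk x (by simp)).2, hm]

open Classical in
/-- The degree of a vertex after the deletion of `D`, increased by `2` for the ends of the
root-edge. -/
noncomputable def degreeOut (G : SimpleGraph (Fin n)) (u v : Fin n) (D : Set (Fin n)) (x : Fin n) :
    ℕ := (G.neighborSet x \ D).ncard + if x = u ∨ x = v then 2 else 0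

/-- The ends of the edge from which a remaining vertex was cut off remain too. Hence a vertex in the
queue has degree exactly 2. -/
theorem two_le_degreeOut (hs : Sorted f u v t)
    (hadj : ∀ x y, G.Adj x y ↔ Edge u v t x y ∨ Edge u v t y x)
    (hvert : ∀ x, Vert u v t x) {D : Set (Fin n)} (hD : Lower u v t D) {x : Fin n} (hx : x ∉ D) :
    2 ≤ degreeOut G u v D x := by
  rw [degreeOut]
  split_ifs with h
  · omega
  · rw [not_or] at h
    obtain ⟨p, q, hpq⟩ := ((hvert x).eq_or_par.resolve_left h.1).resolve_left h.2
    have hne : p ≠ q := by rintro rfl; have := hpq.lt hs; omega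
    have := Set.ncard_le_ncard (hpq.subset hadj hD hx) (Set.toFinite _)
    rw [Set.ncard_pair hne] at this
    omega

theorem degreeOut_insert {D : Set (Fin n)} {x z : Fin n} (hx : x ∉ D) :
    (G.Adj z x → degreeOut G u v (insert x D) z + 1 = degreeOut G u v D z) ∧
    (¬ G.Adj z x → degreeOut G u v (insert x D) z = degreeOut G u v D z) := by
  have h : G.neighborSet z \ insert x D = (G.neighborSet z \ D) \ {x} := by
    ext y; simp; tauto
  rw [degreeOut, degreeOut, h]
  constructor
  · intro hz
    have := Set.ncard_sdiff_singleton_add_one (s := G.neighborSet z \ D) (a := x) ⟨hz, hx⟩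
      (Set.toFinite _)
    omega
  · intro hz
    rw [Set.sdiff_singleton_eq_self fun h => hz h.1]

end RAM

/-! ### Correctness and running time of the elimination -/

namespace RAM

open RAM.Program RAM.Expr Tri

variable {n : ℕ} {G : SimpleGraph (Fin n)} {u v : Fin n} {t : Tri (Fin n)} {f : Fin n → ℕ}

/-- The vertices of `d` have been eliminated, those of `k` are in the queue. -/
structure ElimInv (G : SimpleGraph (Fin n)) (u v : Fin n) (t : Tri (Fin n)) (s₀ : State)
    (d k : List (Fin n)) (s : State) : Prop where
  mem_zero : s.mem 0 = s₀.mem 0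
  mem_one : s.mem 1 = s₀.mem 1
  nodup : (d ++ k).Nodup
  head : s.reg 5 = d.length
  tail : s.reg 4 = (d ++ k).length
  holds : Holds (s.mem 6) (d ++ k)
  lower : Lower u v t {x | x ∈ d}
  dead : ∀ x : Fin n, s.mem 7 x = 0 ↔ x ∉ d
  degree : ∀ x : Fin n, x ∉ d → s.mem 5 x = degreeOut G u v {x | x ∈ d} x
  queue : ∀ x, x ∈ k ↔ x ∉ d ∧ s.mem 5 x ≤ 2
  elim : Elim u v t (s.mem 8) (s.mem 9) d

/-- The potential: the work for the vertices that have not been eliminated. -/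
def work (n : ℕ) (s : State) : ℕ :=
  ∑ x : Fin n, if s.mem 7 x = 0 then s.mem 0 (x + 1) - s.mem 0 x + 1 else 0

theorem work_update {s s' : State} {x : Fin n} (h0 : s'.mem 0 = s.mem 0) (hx : s.mem 7 x = 0)
    (h7 : s'.mem 7 = Function.update (s.mem 7) x 1) :
    work n s' + (s.mem 0 (x + 1) - s.mem 0 x + 1) = work n s := by
  classical
  rw [work, work, ← Finset.add_sum_erase _ _ (Finset.mem_univ x),
    ← Finset.add_sum_erase Finset.univ (fun x : Fin n => if s.mem 7 x = 0 then _ else 0)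
      (Finset.mem_univ x), h7, h0, if_pos hx]
  simp only [Function.update_self, one_ne_zero, if_false, zero_add]
  rw [add_comm]
  congr 1
  refine Finset.sum_congr rfl fun y hy => ?_
  rw [Function.update_of_ne]
  exact fun h => (Finset.mem_erase.1 hy).1 (Fin.ext h)

/-- A vertex in the queue is not an end of the root-edge, since the other end would still be a
neighbour on top of the surplus 2. Its at most two remaining neighbours are therefore the two ends
of its edge. -/
theorem ElimInv.step {s₀ : State}
    (hs : Sorted f u v t) (hadj : ∀ x y, G.Adj x y ↔ Edge u v t x y ∨ Edge u v t y x)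
    (hvert : ∀ x, Vert u v t x) {d k : List (Fin n)} {x : Fin n} {s : State}
    (h : ElimInv G u v t s₀ d (x :: k) s) :
    ∃ p q, Par u v t p q x ∧ p ∉ d ∧ q ∉ d ∧ p ≠ q ∧ G.neighborSet x \ {x | x ∈ d} = {p, q} ∧
      Lower u v t {y | y ∈ d ++ [x]} := by
  have hx := (h.queue x).1 (by simp)
  have hdeg := hx.2
  rw [h.degree x hx.1, degreeOut] at hdeg
  have hne : x ≠ u ∧ x ≠ v := by
    rw [← not_or]
    intro hxuv
    rw [if_pos hxuv] at hdeg
    have h0 : (G.neighborSet x \ {x | x ∈ d}).ncard = 0 := by omega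
    rw [Set.ncard_eq_zero (Set.toFinite _)] at h0
    have h1 := edge_base u v t
    rcases hxuv with rfl | rfl
    · have : v ∈ G.neighborSet x \ {x | x ∈ d} := ⟨(hadj _ _).2 (.inl h1), h.lower.snd⟩
      simp [h0] at this
    · have : u ∈ G.neighborSet x \ {x | x ∈ d} := ⟨(hadj _ _).2 (.inr h1), h.lower.fst⟩
      simp [h0] at this
  rw [if_neg (by tauto), add_zero] at hdeg
  obtain ⟨p, q, hpq⟩ := ((hvert x).eq_or_par.resolve_left hne.1).resolve_left hne.2
  have hpq' : p ≠ q := by rintro rfl; have := hpq.lt hs; omega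
  have hN : G.neighborSet x \ {x | x ∈ d} = {p, q} :=
    (Set.eq_of_subset_of_ncard_le (hpq.subset hadj h.lower hx.1)
      (by rwa [Set.ncard_pair hpq']) (Set.toFinite _)).symm
  have hd := h.lower.par _ _ _ hpq hx.1
  refine ⟨p, q, hpq, hd.1, hd.2, hpq', hN, ?_⟩
  have := h.lower.insert hs hadj hpq hN.subset
  rwa [show {y | y ∈ d ++ [x]} = Insert.insert x {x | x ∈ d} by ext; simp [or_comm]]

/-- Only the degrees of p and q change. Neither of them is already waiting in the queue, so no
vertex is queued twice. -/
theorem ElimInv.next {s₀ : State}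
    (hs : Sorted f u v t) (hadj : ∀ x y, G.Adj x y ↔ Edge u v t x y ∨ Edge u v t y x)
    (hvert : ∀ x, Vert u v t x) {d k : List (Fin n)} {x p q : Fin n} {s s' : State}
    (h : ElimInv G u v t s₀ d (x :: k) s) (hpar : Par u v t p q x) (hp : p ∉ d) (hq : q ∉ d)
    (hpq : p ≠ q) (hN : G.neighborSet x \ {x | x ∈ d} = {p, q})
    (hlow : Lower u v t {y | y ∈ d ++ [x]})
    (h0 : s'.mem 0 = s.mem 0) (h1 : s'.mem 1 = s.mem 1) (h5 : s'.reg 5 = s.reg 5 + 1)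
    {y z : Fin n} (hm : s(s'.mem 8 x, s'.mem 9 x) = s((p : ℕ), (q : ℕ)))
    (hy : s'.mem 8 x = y) (hz : s'.mem 9 x = z)
    (hm' : ∀ y, y ≠ x.1 → s'.mem 8 y = s.mem 8 y ∧ s'.mem 9 y = s.mem 9 y)
    (h7 : s'.mem 7 = Function.update (s.mem 7) x 1)
    (hdeg : s'.mem 5 = Function.update (Function.update (s.mem 5) y (s.mem 5 y - 1)) z
      (s.mem 5 z - 1))
    (l : List (Fin n))
    (hl : l = (d ++ x :: k ++ if s.mem 5 y - 1 ≤ 2 then [y] else []) ++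
      if s.mem 5 z - 1 ≤ 2 then [z] else [])
    (ht : s'.reg 4 = l.length) (hh : Holds (s'.mem 6) l) :
    ∃ k', ElimInv G u v t s₀ (d ++ [x]) k' s' := by
  classical
  have hyz : (y = p ∧ z = q) ∨ (y = q ∧ z = p) := by
    rw [hy, hz] at hm
    rcases Sym2.eq_iff.1 hm with h | h
    · exact .inl ⟨Fin.ext h.1, Fin.ext h.2⟩
    · exact .inr ⟨Fin.ext h.1, Fin.ext h.2⟩
  have hyz' : y ≠ z := by rcases hyz with ⟨rfl, rfl⟩ | ⟨rfl, rfl⟩; exacts [hpq, hpq.symm]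
  have hmem : ∀ w, w ∉ d → (G.Adj w x ↔ w = y ∨ w = z) := by
    intro w hw
    have : w ∈ G.neighborSet x \ {x | x ∈ d} ↔ w = p ∨ w = q := by rw [hN]; simp
    simp only [Set.mem_sdiff, SimpleGraph.mem_neighborSet, Set.mem_ofPred_eq, hw,
      not_false_eq_true, and_true] at this
    rw [G.adj_comm, this]
    rcases hyz with ⟨rfl, rfl⟩ | ⟨rfl, rfl⟩
    exacts [Iff.rfl, or_comm]
  have hxd : x ∉ d := ((h.queue x).1 (by simp)).1
  have hset : {w | w ∈ d ++ [x]} = Insert.insert x {x | x ∈ d} := by ext; simp [or_comm]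
  have hdeg' : ∀ w : Fin n, w ∉ d ++ [x] → s'.mem 5 w = degreeOut G u v {w | w ∈ d ++ [x]} w := by
    intro w hw
    simp only [List.mem_append, List.mem_singleton, not_or] at hw
    have h1 := degreeOut_insert (G := G) (u := u) (v := v) (z := w) (D := {x | x ∈ d}) hxd
    rw [hmem w hw.1] at h1
    have h2 := h.degree w hw.1
    rw [hset, hdeg]
    simp only [Function.update_apply, Fin.val_inj]
    split_ifs with e1 e2
    · have := h1.1 (.inr e1); rw [← e1]; omega
    · have := h1.1 (.inl e2); rw [← e2]; omega
    · have := h1.2 (by tauto); omega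
  have hge : ∀ w : Fin n, w ∉ d ++ [x] → 2 ≤ s'.mem 5 w := by
    intro w hw
    rw [hdeg' w hw]
    exact two_le_degreeOut hs hadj hvert hlow hw
  have hyx : y ∉ d ++ [x] ∧ z ∉ d ++ [x] := by
    have hp' := hpar.lt hs
    have a1 : p ∉ d ++ [x] := by
      simp only [List.mem_append, List.mem_singleton, not_or]
      exact ⟨hp, by rintro rfl; omega⟩
    have a2 : q ∉ d ++ [x] := by
      simp only [List.mem_append, List.mem_singleton, not_or]
      exact ⟨hq, by rintro rfl; omega⟩
    rcases hyz with ⟨rfl, rfl⟩ | ⟨rfl, rfl⟩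
    exacts [⟨a1, a2⟩, ⟨a2, a1⟩]
  have d1 : s'.mem 5 y = s.mem 5 y - 1 := by
    rw [hdeg, Function.update_of_ne (by rwa [Ne, Fin.val_inj]), Function.update_self]
  have d2 : s'.mem 5 z = s.mem 5 z - 1 := by rw [hdeg, Function.update_self]
  have d3 : ∀ w : Fin n, w ≠ y → w ≠ z → s'.mem 5 w = s.mem 5 w := by
    intro w h1 h2
    rw [hdeg, Function.update_of_ne (by rwa [Ne, Fin.val_inj]),
      Function.update_of_ne (by rwa [Ne, Fin.val_inj])]
  -- If y were in the queue, its degree would now drop below 2, contrary to `two_le_degreeOut`.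
  have hyk : y ∉ k := fun hk => by
    have := ((h.queue y).1 (by simp [hk])).2
    have := hge y hyx.1
    omega
  have hzk : z ∉ k := fun hk => by
    have := ((h.queue z).1 (by simp [hk])).2
    have := hge z hyx.2
    omega
  have hnd := h.nodup
  let A : List (Fin n) := if s.mem 5 y - 1 ≤ 2 then [y] else []
  let B : List (Fin n) := if s.mem 5 z - 1 ≤ 2 then [z] else []
  have hA : ∀ w, w ∈ A ↔ w = y ∧ s.mem 5 y - 1 ≤ 2 := by
    intro w; simp only [A]; split_ifs with h <;> simp [h]
  have hB : ∀ w, w ∈ B ↔ w = z ∧ s.mem 5 z - 1 ≤ 2 := by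
    intro w; simp only [B]; split_ifs with h <;> simp [h]
  have hAn : A.Nodup := by simp only [A]; split_ifs <;> simp
  have hBn : B.Nodup := by simp only [B]; split_ifs <;> simp
  have hl' : l = (d ++ [x]) ++ (k ++ A ++ B) := by rw [hl]; simp [A, B]
  refine ⟨k ++ A ++ B, ?_, ?_, ?_, ?_, ?_, ?_, hlow, ?_, hdeg', ?_, ?_⟩
  · rw [h0, h.mem_zero]
  · rw [h1, h.mem_one]
  · have e1 : ((d ++ [x]) ++ k).Nodup := by simpa using hnd
    rw [← List.append_assoc, ← List.append_assoc]
    simp only [List.mem_append, List.mem_singleton, not_or] at hyx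
    refine (e1.append hAn ?_).append hBn ?_
    · intro w hw hwA
      obtain ⟨rfl, -⟩ := (hA w).1 hwA
      simp only [List.mem_append, List.mem_singleton] at hw
      tauto
    · intro w hw hwB
      obtain ⟨rfl, -⟩ := (hB w).1 hwB
      simp only [List.mem_append, List.mem_singleton, hA] at hw
      have := hyz'.symm
      tauto
  · rw [h5, h.head]; simp
  · rw [ht, hl']
  · rw [← hl']; exact hh
  · intro w
    rw [h7, Function.update_apply]
    simp only [List.mem_append, List.mem_singleton, not_or, Fin.val_inj]
    split_ifs with e
    · simp [e]
    · rw [h.dead]; tauto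
  · intro w
    simp only [List.mem_append, List.mem_singleton, not_or, hA, hB] at hyx ⊢
    by_cases e1 : w = y
    · subst e1; rw [d1]; tauto
    · by_cases e2 : w = z
      · subst e2; rw [d2]; tauto
      · rw [d3 w e1 e2]
        have := h.queue w
        rw [List.mem_cons] at this
        have hxk : x ∉ k := by
          intro hk
          have := (List.nodup_append.1 hnd).2.1
          simp [hk] at this
        by_cases e3 : w = x
        · subst e3; tauto
        · tauto
  · refine .snoc d x p q (h.elim.congr fun w hw => ?_) hxd hpar hp hq hm
    refine hm' w ?_
    rw [Ne, Fin.val_inj]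
    rintro rfl
    exact hxd hw

end RAM

namespace RAM

open RAM.Program RAM.Expr Tri

variable {n : ℕ} {G : SimpleGraph (Fin n)} {u v : Fin n} {t : Tri (Fin n)} {f : Fin n → ℕ}

/-- The elimination of x costs a constant multiple of the length of its adjacency list plus one, and
this is what x contributes to the potential `work`. -/
theorem ElimInv.body {s₀ : State} (hin : IsInput G u v s₀)
    (hs : Sorted f u v t) (hadj : ∀ x y, G.Adj x y ↔ Edge u v t x y ∨ Edge u v t y x)
    (hvert : ∀ x, Vert u v t x) {d k : List (Fin n)} {x : Fin n} {s : State}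
    (h : ElimInv G u v t s₀ d (x :: k) s) :
    Ends (seqs [
      seqs [set 6 (cell 6 (reg 5)), set 5 (add (reg 5) (const 1)), set 7 (cell 0 (reg 6)),
        set 8 (cell 0 (add (reg 6) (const 1)))],
      scan,
      seqs [store 7 (reg 6) (const 1), set 9 (cell 8 (reg 6)), RAM.lower, set 9 (cell 9 (reg 6)),
        RAM.lower]]) s (200 * (s.mem 0 (x + 1) - s.mem 0 x + 1)) fun s' =>
      (∃ k', ElimInv G u v t s₀ (d ++ [x]) k' s') ∧
      work n s' + (s.mem 0 (x + 1) - s.mem 0 x + 1) ≤ work n s := by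
  obtain ⟨p, q, hpar, hp, hq, hpq, hN, hlow⟩ := h.step hs hadj hvert
  have hx : x ∉ d := ((h.queue x).1 (by simp)).1
  have hbij := hin.neighbors x
  rw [← h.mem_zero, ← h.mem_one] at hbij
  have hadj' : ∀ w, w ∈ G.neighborSet x → ∃ i, (s.mem 0 x ≤ i ∧ i < s.mem 0 (x + 1)) ∧
      s.mem 1 i = w := fun w hw => by
    obtain ⟨i, hi, e⟩ := hbij.surjOn ⟨w, hw, rfl⟩
    exact ⟨i, hi, e⟩
  have hpN : p ∈ G.neighborSet x \ {x | x ∈ d} := by rw [hN]; simp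
  have hqN : q ∈ G.neighborSet x \ {x | x ∈ d} := by rw [hN]; simp
  obtain ⟨i, hi, hip⟩ := hadj' p hpN.1
  obtain ⟨j, hj, hjq⟩ := hadj' q hqN.1
  have hij : i ≠ j := by
    rintro rfl
    exact hpq (Fin.ext (hip.symm.trans hjq))
  have hscan : ∀ m, s.mem 0 x ≤ m → m < s.mem 0 (x + 1) →
      (s.mem 7 (s.mem 1 m) = 0 ↔ m = i ∨ m = j) := by
    intro m h1 h2
    obtain ⟨w, hw, hwm⟩ := hbij.mapsTo ⟨h1, h2⟩
    simp only at hwm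
    rw [← hwm, h.dead]
    have e1 : w ∉ d ↔ w ∈ G.neighborSet x \ {x | x ∈ d} := ⟨fun h => ⟨hw, h⟩, fun h => h.2⟩
    rw [e1, hN, Set.mem_insert_iff, Set.mem_singleton_iff, Fin.ext_iff, Fin.ext_iff, hwm, ← hip,
      ← hjq, hbij.injOn.eq_iff ⟨h1, h2⟩ hi, hbij.injOn.eq_iff ⟨h1, h2⟩ hj]
  have h6 : s.mem 6 (s.reg 5) = x := by
    rw [h.head, h.holds _ (by simp)]
    simp
  refine ((Ends.of_wp (Q := fun s' => s'.mem = s.mem ∧ s'.reg 4 = s.reg 4 ∧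
    s'.reg 5 = s.reg 5 + 1 ∧ s'.reg 6 = x ∧ s'.reg 7 = s.mem 0 x ∧
    s'.reg 8 = s.mem 0 (x + 1)) ?_).seq fun s₁ hs₁ => (((scan_ends (s := s₁) (p := p) (q := q) (i := i)
      (j := j) ?_ ?_ hij ?_ ?_ ?_).mono
      (c' := 100 * (s.mem 0 (x + 1) - s.mem 0 x) + 100) ?_ fun _ h => h).frame
      (Q' := fun s' => s(s'.mem 8 x, s'.mem 9 x) = s((p : ℕ), (q : ℕ)) ∧
        (∀ y, y ≠ x.1 → s'.mem 8 y = s.mem 8 y ∧ s'.mem 9 y = s.mem 9 y) ∧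
        (∀ k, k ≠ 8 → k ≠ 9 → s'.mem k = s.mem k) ∧ s'.reg 4 = s.reg 4 ∧
        s'.reg 5 = s.reg 5 + 1 ∧ s'.reg 6 = x) ?_).seq fun s₂ hs₂ =>
      Ends.of_wp ?_).mono ?_ fun _ h => h
  · simp [wp, seqs, Expr.eval, h6]
  · rw [hs₁.2.2.2.2.1, hs₁.2.2.2.2.2]; exact hi
  · rw [hs₁.2.2.2.2.1, hs₁.2.2.2.2.2]; exact hj
  · rw [hs₁.1, hip]
  · rw [hs₁.1, hjq]
  · rw [hs₁.2.2.2.2.1, hs₁.2.2.2.2.2, hs₁.1]; exact hscan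
  · rw [hs₁.2.2.2.2.1, hs₁.2.2.2.2.2]
  · intro s' h1 h2 h3
    obtain ⟨a1, a2, a3, a4, a5, a6⟩ := hs₁
    rw [a4, a1] at h1
    refine ⟨h1.1, h1.2, fun k hk8 hk9 => ?_, ?_, ?_, ?_⟩
    · rw [h3, a1]
      simp [scan, seqs, Program.setsMem, hk8, hk9]
    · rw [h2 4 rfl, a2]
    · rw [h2 5 rfl, a3]
    · rw [h2 6 rfl, a4]
  · obtain ⟨b1, b2, b3, b4, b5, b6⟩ := hs₂
    obtain ⟨y, z, hy, hz⟩ : ∃ y z : Fin n, s₂.mem 8 x = y ∧ s₂.mem 9 x = z := by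
      rcases Sym2.eq_iff.1 b1 with h | h
      exacts [⟨p, q, h⟩, ⟨q, p, h⟩]
    have hyz : y ≠ z := by
      rintro rfl
      rw [hy, hz] at b1
      rcases Sym2.eq_iff.1 b1 with h | h
      · exact hpq (Fin.ext (h.1.symm.trans h.2))
      · exact hpq (Fin.ext (h.2.symm.trans h.1))
    simp only [seqs, wp]
    refine wp_lower (l := d ++ x :: k) (y := y) ?_ ?_ ?_ fun s₃ c1 c2 c3 c4 c5 => ?_
    · simp [Expr.eval, b6, hy]
    · simp [Expr.eval, b4, h.tail]
    · simpa [Expr.eval, b3] using h.holds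
    have c6 : s₃.reg 6 = x := by rw [c1 6 (by decide)]; simp [Expr.eval, b6]
    have c7 : s₃.mem 9 x = z := by rw [c2 9 (by decide) (by decide)]; simp [Expr.eval, hz]
    replace c3 : s₃.mem 5 = Function.update (s.mem 5) y (s.mem 5 y - 1) := by
      simpa [Expr.eval, b3] using c3
    replace c4 : s₃.reg 4 = (d ++ x :: k ++ if s.mem 5 y - 1 ≤ 2 then [y] else []).length := by
      simpa [Expr.eval, b3] using c4
    replace c5 : Holds (s₃.mem 6) (d ++ x :: k ++ if s.mem 5 y - 1 ≤ 2 then [y] else []) := by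
      simpa [Expr.eval, b3] using c5
    refine wp_lower (y := z) ?_ c4 ?_ fun s₄ e1 e2 e3 e4 e5 => ?_
    · simp [Expr.eval, c6, c7]
    · simpa using c5
    simp only [State.setReg_mem, c3] at e3 e4 e5
    rw [Function.update_of_ne (by rw [Ne, Fin.val_inj]; exact hyz.symm)] at e3 e4 e5
    have g : ∀ k, k ≠ 5 → k ≠ 6 → s₄.mem k = (s₂.setMem 7 x 1).mem k := by
      intro k h5 h6
      rw [e2 k h5 h6, State.setReg_mem, c2 k h5 h6]
      simp [Expr.eval, b6]
    have g0 : s₄.mem 0 = s.mem 0 := by rw [g 0 (by decide) (by decide)]; simp [b3]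
    have g1 : s₄.mem 1 = s.mem 1 := by rw [g 1 (by decide) (by decide)]; simp [b3]
    have g8 : s₄.mem 8 = s₂.mem 8 := by rw [g 8 (by decide) (by decide)]; simp
    have g9 : s₄.mem 9 = s₂.mem 9 := by rw [g 9 (by decide) (by decide)]; simp
    have g7 : s₄.mem 7 = Function.update (s.mem 7) x 1 := by
      rw [g 7 (by decide) (by decide)]; simp [b3]
    refine ⟨h.next hs hadj hvert hpar hp hq hpq hN hlow g0 g1 ?_ (y := y) (z := z) ?_ ?_ ?_ ?_ g7
      e3 _ ?_ e4 e5, (work_update g0 ((h.dead x).2 hx) g7).le⟩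
    · rw [e1 5 (by decide)]; simp [Expr.eval]; rw [c1 5 (by decide)]; simp [Expr.eval, b5]
    · rw [g8, g9]; exact b1
    · rw [g8]; exact hy
    · rw [g9]; exact hz
    · rw [g8, g9]; exact b2
    · simp
  · simp [Program.time, seqs, RAM.lower, push, Expr.cost]; omega

theorem eliminate_ends {s₀ s : State} (hin : IsInput G u v s₀) (hG : IsMaximalOuterplanar G)
    (hf : f.Injective)
    (hs : Sorted f u v t) (hadj : ∀ x y, G.Adj x y ↔ Edge u v t x y ∨ Edge u v t y x)
    (hvert : ∀ x, Vert u v t x) (h0 : s.mem 0 = s₀.mem 0) (h1 : s.mem 1 = s₀.mem 1)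
    (h7 : ∀ i, s.mem 7 i = 0)
    (h5 : ∀ x : Fin n, s.mem 5 x = degreeOut G u v ∅ x) {k : List (Fin n)} (hk : k.Nodup)
    (hk' : ∀ x, x ∈ k ↔ s.mem 5 x ≤ 2) (h4 : s.reg 4 = k.length) (h6 : Holds (s.mem 6) k) :
    Ends eliminate s (2000 * n + 2000) fun s' => ∃ d : List (Fin n), d.Nodup ∧
      (∀ x, x ∈ d ↔ x ≠ u ∧ x ≠ v) ∧ s'.reg 4 = d.length ∧ Holds (s'.mem 6) d ∧
      Elim u v t (s'.mem 8) (s'.mem 9) d := by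
  -- The adjacency lists contribute at most 4n, the summand 1 for each vertex contributes n.
  have hwork : work n s ≤ 5 * n := by
    rw [work, Finset.sum_congr rfl fun x _ => by rw [if_pos (h7 x), h0], Finset.sum_add_distrib,
      hin.sum_eq]
    have := hin.offset_le_four hG
    simp
    omega
  have hI : ElimInv G u v t s₀ [] k (s.setReg 5 0) := by
    refine ⟨h0, h1, by simpa, by simp, by simp [h4], by simpa using h6, ⟨by simp, by simp, by simp⟩,
      by simp [h7], fun x _ => by simp [h5], by simp [hk'], .nil⟩
  refine ((Ends.of_wp (p := .set 5 (const 0)) (Q := fun s' => (∃ d k, ElimInv G u v t s₀ d k s') ∧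
    work n s' ≤ 5 * n) ⟨⟨[], k, hI⟩, hwork⟩).seq fun s₁ hs₁ =>
    (Ends.loop (fun s' => ∃ d k, ElimInv G u v t s₀ d k s') (work n) 200 ?_ hs₁.1).mono
      (c' := 1900 * n + 1900) ?_ fun _ h => h).mono ?_ ?_
  · rintro s' ⟨d, k, h⟩ he
    simp only [Expr.eval, h.head, h.tail, List.length_append] at he
    obtain ⟨x, k, rfl⟩ : ∃ x k', k = x :: k' := by
      cases k with
      | nil => simp at he
      | cons x k => exact ⟨x, k, rfl⟩
    exact ⟨s'.mem 0 (x + 1) - s'.mem 0 x + 1, Nat.le_add_left 1 _, (h.body hin hs hadj hvert).mono le_rfl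
      fun s'' h => ⟨⟨_, h.1⟩, h.2⟩⟩
  · have := hs₁.2
    simp only [Expr.cost]; omega
  · simp only [Program.time, Expr.cost]; omega
  · rintro s' ⟨⟨d, k, h⟩, he⟩
    simp only [Expr.eval, h.head, h.tail, List.length_append] at he
    have hk0 : k = [] := by rw [← List.length_eq_zero_iff]; omega
    subst hk0
    refine ⟨d, by simpa using h.nodup, fun x => ⟨fun hx => ?_, fun hx => ?_⟩,
      by simpa using h.tail, by simpa using h.holds, h.elim⟩
    · constructor
      · rintro rfl; exact h.lower.fst hx
      · rintro rfl; exact h.lower.snd hx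
    · by_contra hxd
      obtain ⟨p, q, y, hpar, hy, hN⟩ := Lower.exists_par (D := {x | x ∈ d}) hf hs hadj (hvert x)
        hx.1 hx.2 hxd
      -- As long as vertices other than u and v remain, one of them has degree at most 2 and is in
      -- the queue; so an empty queue means that all have been eliminated.
      have : y ∈ ([] : List (Fin n)) := by
        rw [h.queue]
        refine ⟨hy, ?_⟩
        have hlt := hpar.lt hs
        rw [h.degree y hy, degreeOut, if_neg, add_zero]
        · have := Set.ncard_le_ncard hN (Set.toFinite _)
          have h2 : p ≠ q := by rintro rfl; omega
          rwa [Set.ncard_pair h2] at this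
        · rintro (rfl | rfl) <;> omega
      simp at this

end RAM

/-! ### Correctness of the reconstruction of the tree -/

namespace RAM

open RAM.Program RAM.Expr Tri

variable {n : ℕ} {u v : Fin n} {t : Tri (Fin n)} {f : Fin n → ℕ}

/-- The edges of the triangulation `t` and the parts cut off by them are enumerated by `g`; the
arrays `12`, `13`, `14`, `15` hold the sides and ends of the edges. -/
structure Built (u v : Fin n) (t : Tri (Fin n)) (N : ℕ) (g : ℕ → Fin n × Fin n × Tri (Fin n))
    (s : State) : Prop where
  pos : 0 < N
  root : g 0 = (u, v, t)
  inj : Set.InjOn g (Set.Iio N)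
  sub : ∀ e < N, Sub u v t (g e).1 (g e).2.1 (g e).2.2
  complete : ∀ p q s', Sub u v t p q s' → ∃ e < N, g e = (p, q, s')
  ends : ∀ e < N, s.mem 14 e = (g e).1 ∧ s.mem 15 e = (g e).2.1
  node : ∀ e < N, (s.mem 12 e = 0 ∧ (g e).2.2 = .leaf) ∨
    ∃ c l r, (g e).2.2 = .node c l r ∧ e < s.mem 12 e ∧ s.mem 13 e = s.mem 12 e + 1 ∧
      s.mem 13 e < N ∧ g (s.mem 12 e) = ((g e).1, c, l) ∧ g (s.mem 13 e) = (c, (g e).2.1, r)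

/-- All vertices have been inserted except for those of `d`. -/
structure BuildInv (f : Fin n → ℕ) (u v : Fin n) (t : Tri (Fin n)) (N : ℕ) (d : List (Fin n))
    (g : ℕ → Fin n × Fin n × Tri (Fin n)) (s : State) : Prop where
  len : s.reg 4 = d.length
  holds : Holds (s.mem 6) d
  elim : Elim u v t (s.mem 8) (s.mem 9) d
  lower : Lower u v t {x | x ∈ d}
  count : s.reg 10 + 2 * d.length = N
  pos : 0 < s.reg 10
  root : g 0 = (u, v, t)
  inj : Set.InjOn g (Set.Iio (s.reg 10))
  sub : ∀ e < s.reg 10, Sub u v t (g e).1 (g e).2.1 (g e).2.2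
  ends : ∀ e < s.reg 10, s.mem 14 e = (g e).1 ∧ s.mem 15 e = (g e).2.1
  not_mem : ∀ e < s.reg 10, (g e).1 ∉ d ∧ (g e).2.1 ∉ d
  node : ∀ e < s.reg 10, (s.mem 12 e = 0 ∧ s.mem 10 (g e).1 = (g e).2.1 ∧
      s.mem 11 (g e).1 = e ∧ ∀ c l r, (g e).2.2 = .node c l r → c ∈ d) ∨
    ∃ c l r, (g e).2.2 = .node c l r ∧ e < s.mem 12 e ∧ s.mem 13 e = s.mem 12 e + 1 ∧
      s.mem 13 e < s.reg 10 ∧ g (s.mem 12 e) = ((g e).1, c, l) ∧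
      g (s.mem 13 e) = (c, (g e).2.1, r)
  complete : ∀ p q s', Sub u v t p q s' → p ∉ d → q ∉ d → ∃ e < s.reg 10, g e = (p, q, s')
  next : ∀ w : Fin n, w ∉ d → s.mem 10 w = n ∨ ∃ w' : Fin n, s.mem 10 w = w' ∧ f w < f w'
  zero : ∀ e, s.reg 10 ≤ e → s.mem 12 e = 0

theorem Elim.exists_of_append {m m' : ℕ → ℕ} {d : List (Fin n)} {x : Fin n}
    (h : Elim u v t m m' (d ++ [x])) : Elim u v t m m' d ∧ x ∉ d ∧ ∃ p q, Par u v t p q x ∧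
      p ∉ d ∧ q ∉ d ∧ s(m x, m' x) = s((p : ℕ), (q : ℕ)) := by
  generalize hl : d ++ [x] = l at h
  cases h with
  | nil => simp at hl
  | snoc d' x' p q h hx hpar hp hq hm =>
    obtain ⟨rfl, h2⟩ := List.append_inj' hl rfl
    obtain rfl : x = x' := by simpa using h2
    exact ⟨h, hx, p, q, hpar, hp, hq, hm⟩

/-- The polygon edge e = (p,q) receives its triangle with apex x, and its two sides get the next two
numbers. They replace e on the polygon. -/
theorem BuildInv.step {N : ℕ} {d : List (Fin n)} {x p q : Fin n} {l r : Tri (Fin n)}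
    {g : ℕ → Fin n × Fin n × Tri (Fin n)} {s s' : State} {e : ℕ} (hf : f.Injective)
    (hs : Sorted f u v t)
    (h : BuildInv f u v t N (d ++ [x]) g s) (hpar : Sub u v t p q (.node x l r))
    (hp : p ∉ d) (hq : q ∉ d) (hx : x ∉ d) (he : e < s.reg 10) (hge : g e = (p, q, .node x l r))
    (h4 : s'.reg 4 = d.length) (h10 : s'.reg 10 = s.reg 10 + 2)
    (m6 : s'.mem 6 = s.mem 6) (m8 : s'.mem 8 = s.mem 8) (m9 : s'.mem 9 = s.mem 9)
    (m12 : s'.mem 12 = Function.update (s.mem 12) e (s.reg 10))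
    (m13 : s'.mem 13 = Function.update (s.mem 13) e (s.reg 10 + 1))
    (m14 : s'.mem 14 = Function.update (Function.update (s.mem 14) (s.reg 10) p) (s.reg 10 + 1) x)
    (m15 : s'.mem 15 = Function.update (Function.update (s.mem 15) (s.reg 10) x) (s.reg 10 + 1) q)
    (m11 : s'.mem 11 = Function.update (Function.update (s.mem 11) p (s.reg 10)) x (s.reg 10 + 1))
    (m10 : s'.mem 10 = Function.update (Function.update (s.mem 10) p x) x q) :
    ∃ g', BuildInv f u v t N d g' s' := by
  have hlt := hpar.node_lt hs
  have hpx : p ≠ x := by rintro rfl; omega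
  have hqx : q ≠ x := by rintro rfl; omega
  have hpq : p ≠ q := by rintro rfl; omega
  have hpx' : (p : ℕ) ≠ x := by rwa [Ne, Fin.val_inj]
  have hsubl : Sub u v t p x l := hpar.trans (.left (.refl _ _ _))
  have hsubr : Sub u v t x q r := hpar.trans (.right (.refl _ _ _))
  have hnm : ∀ i < s.reg 10, (g i).1 ∉ d ∧ (g i).2.1 ∉ d ∧ (g i).1 ≠ x ∧ (g i).2.1 ≠ x := by
    intro i hi
    have := h.not_mem i hi
    simp only [List.mem_append, List.mem_singleton, not_or] at this
    tauto
  generalize hc : s.reg 10 = cnt at *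
  let g' : ℕ → Fin n × Fin n × Tri (Fin n) := fun i =>
    if i = cnt then (p, x, l) else if i = cnt + 1 then (x, q, r) else g i
  have g1 : g' cnt = (p, x, l) := by simp [g']
  have g2 : g' (cnt + 1) = (x, q, r) := by simp [g']
  have g3 : ∀ i < cnt, g' i = g i := fun i hi => by
    simp only [g']; rw [if_neg (by omega), if_neg (by omega)]
  have cases2 : ∀ i < cnt + 2, i < cnt ∨ i = cnt ∨ i = cnt + 1 := by omega
  have hpar' : ∀ p' q', Par u v t p' q' x → p' = p ∧ q' = q := fun p' q' h' =>
    h'.unique hf hs ⟨l, r, hpar⟩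
  have hlow : Lower u v t {y | y ∈ d} := by
    have h1 := h.lower.fst
    have h2 := h.lower.snd
    simp only [List.mem_append, List.mem_singleton, Set.mem_ofPred_eq, not_or] at h1 h2
    refine ⟨h1.1, h2.1, fun p' q' y h' hy => ?_⟩
    by_cases hyx : y = x
    · subst hyx
      obtain ⟨rfl, rfl⟩ := hpar' _ _ h'
      exact ⟨hp, hq⟩
    · have := h.lower.par p' q' y h' (by simp_all)
      simp only [List.mem_append, List.mem_singleton, Set.mem_ofPred_eq, not_or] at this
      exact ⟨this.1.1, this.2.1⟩
  refine ⟨g', h4, ?_, ?_, hlow, ?_, ?_, ?_, ?_, ?_, ?_, ?_, ?_, ?_, ?_, ?_⟩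
  · rw [m6]
    intro i hi
    rw [h.holds i (by simp; omega), List.getElem_append_left hi]
  · rw [m8, m9]; exact h.elim.exists_of_append.1
  · have := h.count
    simp only [List.length_append, List.length_singleton] at this
    omega
  · omega
  · rw [g3 0 (by omega), h.root]
  · rw [h10]
    have hinj := h.inj
    rw [hc] at hinj
    intro i hi j hj hij
    simp only [Set.mem_Iio] at hi hj
    rcases cases2 i hi with hi | rfl | rfl <;> rcases cases2 j hj with hj | rfl | rfl
    · rw [g3 i hi, g3 j hj] at hij
      exact hinj hi hj hij
    · rw [g3 i hi, g1] at hij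
      exact absurd (by rw [hij]) (hnm i hi).2.2.2
    · rw [g3 i hi, g2] at hij
      exact absurd (by rw [hij]) (hnm i hi).2.2.1
    · rw [g3 j hj, g1] at hij
      exact absurd (by rw [← hij]) (hnm j hj).2.2.2
    · rfl
    · rw [g1, g2] at hij
      exact absurd (congrArg Prod.fst hij) hpx
    · rw [g3 j hj, g2] at hij
      exact absurd (by rw [← hij]) (hnm j hj).2.2.1
    · rw [g1, g2] at hij
      exact absurd (congrArg Prod.fst hij).symm hpx
    · rfl
  · rw [h10]
    intro i hi
    rcases cases2 i hi with hi | rfl | rfl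
    · rw [g3 i hi]; exact h.sub i (by omega)
    · rw [g1]; exact hsubl
    · rw [g2]; exact hsubr
  · rw [h10]
    intro i hi
    rw [m14, m15]
    rcases cases2 i hi with hi | rfl | rfl
    · rw [g3 i hi, Function.update_of_ne (by omega), Function.update_of_ne (by omega),
        Function.update_of_ne (by omega), Function.update_of_ne (by omega)]
      exact h.ends i (by omega)
    · rw [g1, Function.update_of_ne (by omega), Function.update_self,
        Function.update_of_ne (by omega), Function.update_self]
      exact ⟨rfl, rfl⟩
    · rw [g2, Function.update_self, Function.update_self]
      exact ⟨rfl, rfl⟩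
  · rw [h10]
    intro i hi
    rcases cases2 i hi with hi | rfl | rfl
    · rw [g3 i hi]; exact ⟨(hnm i hi).1, (hnm i hi).2.1⟩
    · rw [g1]; exact ⟨hp, hx⟩
    · rw [g2]; exact ⟨hx, hq⟩
  · rw [h10]
    -- The apex below an edge at x has not been inserted yet: otherwise both ends of this edge, and
    -- so x, would have been present before.
    have apex : ∀ p' q' c l' r' , Sub u v t p' q' (.node c l' r') → (p' = x ∨ q' = x) → c ∈ d := by
      intro p' q' c l' r' h' hx'
      by_contra hcd
      have hcl := h'.node_lt hs
      have hcx : c ≠ x := by rintro rfl; rcases hx' with rfl | rfl <;> omega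
      have := h.lower.par p' q' c ⟨l', r', h'⟩ (by simp; tauto)
      simp only [List.mem_append, List.mem_singleton, Set.mem_ofPred_eq, not_or] at this
      tauto
    have hz := h.zero
    intro i hi
    rcases cases2 i hi with hi | rfl | rfl
    · rw [g3 i hi]
      have hn := h.node i (by omega)
      by_cases hie : i = e
      · subst hie
        right
        refine ⟨x, l, r, ?_, ?_, ?_, ?_, ?_, ?_⟩
        · rw [hge]
        · rw [m12, Function.update_self]; omega
        · rw [m13, m12, Function.update_self, Function.update_self]
        · rw [m13, Function.update_self]; omega
        · rw [m12, Function.update_self, g1, hge]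
        · rw [m13, Function.update_self, g2, hge]
      · rw [m12, m13, m10, m11, Function.update_of_ne hie, Function.update_of_ne hie]
        rcases hn with ⟨n1, n2, n3, n4⟩ | ⟨c, l', r', n1, n2, n3, n4, n5, n6⟩
        · left
          -- Array 11 records a single polygon edge starting at p, and this is e.
          have k1 : (g i).1 ≠ p := by
            intro k1
            have k2 := h.node e (by omega)
            rw [hge] at k2
            rcases k2 with ⟨k2, k3, k4, k5⟩ | ⟨c, l', r', k1, k2, k3, k4, k5, k6⟩
            · rw [k1] at n3
              exact hie (n3.symm.trans k4)
            · simp only [node.injEq] at k1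
              have := (hnm (s.mem 12 e) (by omega)).2.2.2
              rw [k5] at this
              exact this k1.1.symm
          have k2 := (hnm i hi).2.2.1
          rw [Ne, ← Fin.val_inj] at k1 k2
          rw [Function.update_of_ne k2, Function.update_of_ne k1, Function.update_of_ne k2,
            Function.update_of_ne k1]
          refine ⟨n1, n2, n3, fun c l' r' hclr => ?_⟩
          have := n4 c l' r' hclr
          simp only [List.mem_append, List.mem_singleton] at this
          refine this.resolve_right ?_
          rintro rfl
          have hsub := h.sub i (by omega)
          rw [hclr] at hsub
          have k3 := (hpar' _ _ ⟨_, _, hsub⟩).1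
          rw [k3] at k1
          exact k1 rfl
        · right
          refine ⟨c, l', r', n1, n2, n3, by omega, ?_, ?_⟩
          · rw [g3 _ (by omega), n5]
          · rw [g3 _ (by omega), n6]
    · left
      rw [g1, m12, m10, m11, Function.update_of_ne (by omega), Function.update_of_ne hpx',
        Function.update_of_ne hpx', Function.update_self, Function.update_self]
      refine ⟨hz _ (by omega), rfl, rfl, fun c l' r' h' => ?_⟩
      simp only at h'
      exact apex p x c l' r' (h' ▸ hsubl) (.inr rfl)
    · left
      rw [g2, m12, m10, m11, Function.update_of_ne (by omega), Function.update_self,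
        Function.update_self]
      refine ⟨hz _ (by omega), rfl, rfl, fun c l' r' h' => ?_⟩
      simp only at h'
      exact apex x q c l' r' (h' ▸ hsubr) (.inl rfl)
  · rw [h10]
    intro p' q' s₁ h' hp' hq'
    by_cases hx' : p' = x ∨ q' = x
    · rcases h'.eq_or_parent with ⟨rfl, rfl, -⟩ | ⟨a, b, c, l', r', h1, h2⟩
      · have h1 := h.lower.fst
        have h2 := h.lower.snd
        simp only [List.mem_append, List.mem_singleton, Set.mem_ofPred_eq, not_or] at h1 h2
        rcases hx' with rfl | rfl <;> tauto
      · have hcx : c = x := by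
          by_contra hcx
          have hcd : c ∉ d := by rcases h2 with ⟨-, rfl, -⟩ | ⟨rfl, -, -⟩ <;> assumption
          have := h.lower.par a b c ⟨l', r', h1⟩ (by simp; tauto)
          simp only [List.mem_append, List.mem_singleton, Set.mem_ofPred_eq, not_or] at this
          rcases h2 with ⟨rfl, rfl, -⟩ | ⟨rfl, rfl, -⟩ <;> tauto
        subst hcx
        obtain ⟨rfl, rfl⟩ := hpar' _ _ ⟨_, _, h1⟩
        have := h1.unique hpar hs
        simp only [node.injEq, true_and] at this
        obtain ⟨rfl, rfl⟩ := this
        rcases h2 with ⟨rfl, rfl, rfl⟩ | ⟨rfl, rfl, rfl⟩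
        · exact ⟨cnt, by omega, g1⟩
        · exact ⟨cnt + 1, by omega, g2⟩
    · rw [not_or] at hx'
      obtain ⟨i, hi, hgi⟩ := h.complete p' q' s₁ h' (by simp; tauto) (by simp; tauto)
      exact ⟨i, by omega, by rw [g3 i (by omega), hgi]⟩
  · intro w hw
    rw [m10]
    by_cases hwx : w = x
    · subst hwx
      rw [Function.update_self]
      exact .inr ⟨q, rfl, by omega⟩
    · rw [Function.update_of_ne (by rwa [Ne, Fin.val_inj])]
      by_cases hwp : w = p
      · subst hwp
        rw [Function.update_self]
        exact .inr ⟨x, rfl, by omega⟩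
      · rw [Function.update_of_ne (by rwa [Ne, Fin.val_inj])]
        exact h.next w (by simp; tauto)
  · rw [h10]
    intro i hi
    rw [m12, Function.update_of_ne (by omega)]
    exact h.zero i (by omega)

end RAM

namespace RAM

open RAM.Program RAM.Expr Tri

variable {n : ℕ} {u v : Fin n} {t : Tri (Fin n)} {f : Fin n → ℕ}

/-- The apex x of (p,q) is missing, so (p,q) is on the present polygon and arrays 10 and 11 point to
it. The vertex after q is later in position, so it is not p; thus array 10 reveals the orientation
of the pair. -/
theorem BuildInv.exists_edge {N : ℕ} {d : List (Fin n)} {x p q : Fin n} {l r : Tri (Fin n)}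
    {g : ℕ → Fin n × Fin n × Tri (Fin n)} {s : State}
    (hs : Sorted f u v t) (h : BuildInv f u v t N (d ++ [x]) g s)
    (hpar : Sub u v t p q (.node x l r)) (hp : p ∉ d) (hq : q ∉ d) :
    s.mem 10 p = q ∧ s.mem 10 q ≠ p ∧ s.mem 11 p < s.reg 10 ∧
      g (s.mem 11 p) = (p, q, .node x l r) := by
  have hlt := hpar.node_lt hs
  have hp' : p ∉ d ++ [x] := by
    simp only [List.mem_append, List.mem_singleton, not_or]
    exact ⟨hp, by rintro rfl; omega⟩
  have hq' : q ∉ d ++ [x] := by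
    simp only [List.mem_append, List.mem_singleton, not_or]
    exact ⟨hq, by rintro rfl; omega⟩
  obtain ⟨e, he, hge⟩ := h.complete p q _ hpar hp' hq'
  have hn := h.node e he
  rw [hge] at hn
  rcases hn with ⟨n1, n2, n3, n4⟩ | ⟨c, l', r', n1, n2, n3, n4, n5, n6⟩
  · simp only at n2 n3
    refine ⟨n2, fun h0 => ?_, by rwa [n3], by rwa [n3]⟩
    rcases h.next q hq' with h1 | ⟨w, h1, h2⟩
    · have := p.2; omega
    · have h3 : p = w := Fin.ext (h0.symm.trans h1)
      rw [← h3] at h2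
      omega
  · have := (h.not_mem _ (by omega : s.mem 12 e < s.reg 10)).2
    simp only [node.injEq] at n1
    rw [n5, ← n1.1] at this
    simp at this

theorem build_ends {s : State} (hf : f.Injective) (hs : Sorted f u v t) (h0 : s.reg 0 = n)
    (h1 : s.reg 1 = u) (h2 : s.reg 2 = v) (h12 : ∀ i, s.mem 12 i = 0) (h11 : ∀ i, s.mem 11 i = 0)
    {d : List (Fin n)} (hd : d.Nodup) (hd' : ∀ x, x ∈ d ↔ x ≠ u ∧ x ≠ v)
    (h4 : s.reg 4 = d.length) (h6 : Holds (s.mem 6) d) (he : Elim u v t (s.mem 8) (s.mem 9) d) :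
    Ends build s (1000 * n + 1000) fun s' => s'.reg 10 ≤ 2 * n + 1 ∧
      ∃ g, Built u v t (s'.reg 10) g s' := by
  have hlen : d.length ≤ n := by simpa using hd.length_le_card
  have huv := hs.lt
  have huv' : u ≠ v := by rintro rfl; omega
  have huv'' : (u : ℕ) ≠ v := by rwa [Ne, Fin.val_inj]
  refine (((Ends.of_wp (Q := fun s' => (s'.reg 4 ≤ n ∧ s'.reg 10 + 2 * s'.reg 4 ≤ 2 * n + 1) ∧
    ∃ d g, BuildInv f u v t (s'.reg 10 + 2 * s'.reg 4) d g s') ?_).mono (c' := 50) ?_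
      fun _ h => h).seq (c' := 900 * n + 900) fun s₁ hs₁ => ?_).mono (by omega) fun _ h => h
  · simp only [seqs, wp]
    refine ⟨by simp [Expr.eval, h4]; omega, d, fun _ => (u, v, t), ?_⟩
    refine ⟨?_, ?_, ?_, ⟨?_, ?_, ?_⟩, ?_, ?_, rfl, ?_, ?_, ?_, ?_, ?_, ?_, ?_, ?_⟩
    · simp [h4]
    · simpa [Expr.eval] using h6
    · simpa [Expr.eval] using he
    · simp [hd']
    · simp [hd']
    · intro p q x hpar hx
      have := hpar.lt hs
      simp only [Set.mem_ofPred_eq, hd', not_and_or, not_not] at hx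
      rcases hx with rfl | rfl <;> omega
    · simp [h4]
    · simp [Expr.eval]
    · intro i hi j hj _
      simp [Expr.eval] at hi hj
      omega
    · exact fun _ _ => .refl _ _ _
    · intro e he
      simp [Expr.eval] at he
      simp [Expr.eval, he, h1, h2]
    · exact fun _ _ => ⟨by simp [hd'], by simp [hd']⟩
    · intro e he
      simp [Expr.eval] at he
      left
      subst he
      refine ⟨by simp [Expr.eval, h12], ?_, by simp [Expr.eval, h11], ?_⟩
      · simp [Expr.eval, h0, h1, h2, Function.update_of_ne huv'']
      · rintro c l r rfl
        rw [hd']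
        have h1 := hs.1.lt
        have h2 := hs.2.lt
        exact ⟨by rintro rfl; omega, by rintro rfl; omega⟩
    · intro p q s' h hp hq
      have hlt := h.edge.lt hs
      simp only [hd', not_and_or, not_not] at hp hq
      obtain ⟨rfl, rfl⟩ : p = u ∧ q = v := by
        rcases hp with rfl | rfl <;> rcases hq with rfl | rfl <;> omega
      exact ⟨0, by simp [Expr.eval], by rw [h.eq_self hs]⟩
    · intro w hw
      simp only [hd', not_and_or, not_not] at hw
      rcases hw with rfl | rfl
      · right
        exact ⟨v, by simp [Expr.eval, h0, h1, h2, Function.update_of_ne huv''], huv⟩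
      · left
        simp [Expr.eval, h0, h1, h2]
    · intro e he
      simp [Expr.eval, h12]
  · simp [Program.time, seqs, Expr.cost]
  · obtain ⟨⟨hn, hn'⟩, d, g, hB⟩ := hs₁
    refine ((Ends.loop_wp (fun s' => ∃ d g, BuildInv f u v t (s₁.reg 10 + 2 * s₁.reg 4) d g s')
      (fun s' => s'.reg 4) ?_ ⟨d, g, hB⟩).mono (c' := 900 * n + 900) ?_ ?_)
    · rintro s' ⟨d, g, h⟩ he
      simp only [Expr.eval, h.len] at he
      obtain ⟨d, x, rfl⟩ : ∃ d' x, d = d' ++ [x] :=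
        ⟨d.dropLast, d.getLast (by rintro rfl; simp at he), (List.dropLast_append_getLast _).symm⟩
      obtain ⟨-, hx, p, q, ⟨l, r, hpar⟩, hp, hq, hm⟩ := h.elim.exists_of_append
      obtain ⟨k1, k2, k3, k4⟩ := h.exists_edge hs hpar hp hq
      have hlen := h.len
      simp only [List.length_append, List.length_singleton] at hlen
      have h6 : s'.mem 6 (s'.reg 4 - 1) = x := by
        rw [h.holds _ (by simp [hlen])]; simp [hlen]
      have hlt := hpar.node_lt hs
      have hpq : (p : ℕ) ≠ q := by rw [Ne, Fin.val_inj]; rintro rfl; omega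
      have hpx : (p : ℕ) ≠ x := by rw [Ne, Fin.val_inj]; rintro rfl; omega
      have fin : ∀ s'' : State, s''.mem = s'.mem → s''.reg 4 = d.length →
          s''.reg 6 = x → s''.reg 8 = p → s''.reg 9 = q → s''.reg 10 = s'.reg 10 →
          wp (seqs [set 11 (cell 11 (reg 8)),
            store 12 (reg 11) (reg 10), store 13 (reg 11) (add (reg 10) (const 1)),
            store 14 (reg 10) (reg 8), store 15 (reg 10) (reg 6),
            store 14 (add (reg 10) (const 1)) (reg 6), store 15 (add (reg 10) (const 1)) (reg 9),
            store 11 (reg 8) (reg 10), store 11 (reg 6) (add (reg 10) (const 1)),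
            store 10 (reg 8) (reg 6), store 10 (reg 6) (reg 9),
            set 10 (add (reg 10) (const 2))])
            (fun s₂ => (∃ d g, BuildInv f u v t (s₁.reg 10 + 2 * s₁.reg 4) d g s₂) ∧
              s₂.reg 4 < s'.reg 4) s'' := by
        intro s'' e1 e2 e3 e4 e5 e6
        simp only [seqs, wp]
        refine ⟨⟨d, h.step hf hs hpar hp hq hx k3 k4 ?_ ?_ ?_ ?_ ?_ ?_ ?_ ?_ ?_ ?_ ?_⟩, ?_⟩ <;>
          simp [Expr.eval, e1, e2, e3, e4, e5, e6, hlen]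
      -- Outcome of the equality test against the stored order of the two neighbours. By
      -- `exists_edge` inconsistent combinations are impossible; in all others registers 8 and 9 end
      -- up with p and q.
      refine ⟨fun c1 => ?_, fun c1 => ⟨fun c2 => ?_, fun c2 => ?_⟩⟩ <;>
        rcases Sym2.eq_iff.1 hm with ⟨e1, e2⟩ | ⟨e1, e2⟩
      · simp [Expr.eval, h6, e1, e2, k1] at c1
      · exact fin _ (by simp) (by simp [Expr.eval, hlen]) (by simp [Expr.eval, h6])
          (by simp [Expr.eval, h6, e2]) (by simp [Expr.eval, h6, e1]) (by simp)
      · simp [Expr.eval, h6, e1, e2, k1] at c2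
      · exact fin _ (by simp) (by simp [Expr.eval, hlen]) (by simp [Expr.eval, h6])
          (by simp [Expr.eval, h6, e2]) (by simp [Expr.eval, h6, e1]) (by simp)
      · exact fin _ (by simp) (by simp [Expr.eval, hlen]) (by simp [Expr.eval, h6])
          (by simp [Expr.eval, h6, e1]) (by simp [Expr.eval, h6, e2]) (by simp)
      · simp [Expr.eval, h6, e1, e2] at c1 c2
        omega
    · simp [Program.time, seqs, swap, Expr.cost]; omega
    · rintro s' ⟨⟨d, g, h⟩, he⟩
      simp only [Expr.eval, h.len] at he
      rw [List.length_eq_zero_iff] at he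
      subst he
      have hc := h.count
      have hc' := hB.count
      refine ⟨?_, g, h.pos, h.root, h.inj, h.sub,
        fun p q s' hs' => h.complete p q s' hs' (by simp) (by simp), h.ends, fun e he => ?_⟩
      · simp at hc; omega
      · rcases h.node e he with ⟨n1, n2, n3, n4⟩ | h
        · left
          refine ⟨n1, ?_⟩
          cases hl : (g e).2.2 with
          | leaf => rfl
          | node c l r => simpa using n4 c l r hl
        · exact .inr h

end RAM

/-! ### Correctness of the evaluation -/

namespace RAM

open RAM.Program RAM.Expr Tri

variable {n : ℕ} {u v : Fin n} {t : Tri (Fin n)} {κ : SystemKind}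

theorem Built.congr {N : ℕ} {g : ℕ → Fin n × Fin n × Tri (Fin n)} {s s' : State}
    (h : Built u v t N g s) (h12 : s'.mem 12 = s.mem 12) (h13 : s'.mem 13 = s.mem 13)
    (h14 : s'.mem 14 = s.mem 14) (h15 : s'.mem 15 = s.mem 15) : Built u v t N g s' :=
  ⟨h.pos, h.root, h.inj, h.sub, h.complete, by rw [h14, h15]; exact h.ends, by rw [h12, h13]; exact h.node⟩

theorem wp_maxInto {s : State} {Q : State → Prop} {d : ℕ} {m : Mode × Mode} (hd5 : d ≠ 5)
    (hd7 : d ≠ 7)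
    (h : ∀ s' : State, s'.mem = s.mem → (∀ i, i ≠ 7 → i ≠ d → s'.reg i = s.reg i) →
      s'.reg d = max (s.mem (16 + m.1.code) (s.mem 12 (s.reg 5)))
        (s.mem (16 + m.2.code) (s.mem 13 (s.reg 5))) → Q s') :
    wp (maxInto d m) Q s := by
  refine ⟨fun h1 => h _ ?_ ?_ ?_, fun h1 => h _ ?_ ?_ ?_⟩ <;>
    simp [Expr.eval, hd5.symm, hd7] at h1 ⊢
  · intro i h7 hd; simp [h7, hd]
  · omega
  · intro i h7 hd; simp [h7, hd]
  · omega

theorem wp_evaluate {s : State} {Q : State → Prop} {m : Mode} {c : Fin n} {l r : Tri (Fin n)}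
    (hl : ∀ m : Mode, s.mem (16 + m.code) (s.mem 12 (s.reg 5)) = val κ m l)
    (hr : ∀ m : Mode, s.mem (16 + m.code) (s.mem 13 (s.reg 5)) = val κ m r)
    (h : ∀ s' : State, s'.reg 5 = s.reg 5 → (∀ k, k ≠ 16 + m.code → s'.mem k = s.mem k) →
      s'.mem (16 + m.code) = Function.update (s.mem (16 + m.code)) (s.reg 5)
        (val κ m (.node c l r)) → Q s') :
    wp (evaluate κ m) Q s := by
  simp only [evaluate, seqs, wp]
  refine wp_maxInto (by decide) (by decide) fun s₁ a1 a2 a3 =>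
    wp_maxInto (by decide) (by decide) fun s₂ b1 b2 b3 => ?_
  have a5 := a2 5 (by decide) (by decide)
  have b5 := b2 5 (by decide) (by decide)
  have b8 := b2 8 (by decide) (by decide)
  rw [hl, hr] at a3
  rw [a1, a5, hl, hr] at b3
  rw [a1] at b1
  rw [a5] at b5
  rw [a3] at b8
  refine ⟨fun h1 => h _ ?_ ?_ ?_, fun h1 => h _ ?_ ?_ ?_⟩ <;>
    simp [Expr.eval, b1, b3, b5, b8] at h1 ⊢
  · intro k hk; simp [hk]
  · congr 1; rw [val]; omega
  · intro k hk; simp [hk]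
  · congr 1; rw [val]; omega

/-- The sides have numbers different from that of the edge itself, so the values stored for one mode
do not disturb the evaluation of the next. -/
theorem wp_evaluate_list {c : Fin n} {l r : Tri (Fin n)} (ms : List Mode) {s : State}
    {Q : State → Prop} (hne : s.mem 12 (s.reg 5) ≠ s.reg 5) (hne' : s.mem 13 (s.reg 5) ≠ s.reg 5)
    (hl : ∀ m : Mode, s.mem (16 + m.code) (s.mem 12 (s.reg 5)) = val κ m l)
    (hr : ∀ m : Mode, s.mem (16 + m.code) (s.mem 13 (s.reg 5)) = val κ m r)
    (h : ∀ s' : State, s'.reg 5 = s.reg 5 → (∀ k, k < 16 → s'.mem k = s.mem k) →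
      (∀ k i, i ≠ s.reg 5 → s'.mem k i = s.mem k i) →
      (∀ m : Mode, s'.mem (16 + m.code) (s.reg 5) = val κ m (.node c l r) ∨
        m ∉ ms ∧ s'.mem (16 + m.code) (s.reg 5) = s.mem (16 + m.code) (s.reg 5)) → Q s') :
    wp (seqs (ms.map (evaluate κ))) Q s := by
  have key : ∀ (m : Mode) (s s' : State), s'.reg 5 = s.reg 5 →
      (∀ k, k ≠ 16 + m.code → s'.mem k = s.mem k) →
      s'.mem (16 + m.code) = Function.update (s.mem (16 + m.code)) (s.reg 5)
        (val κ m (.node c l r)) → (∀ k, k < 16 → s'.mem k = s.mem k) ∧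
      (∀ k i, i ≠ s.reg 5 → s'.mem k i = s.mem k i) ∧
      (∀ m' : Mode, s'.mem (16 + m'.code) (s.reg 5) = val κ m' (.node c l r) ∨
        m' ≠ m ∧ s'.mem (16 + m'.code) (s.reg 5) = s.mem (16 + m'.code) (s.reg 5)) := by
    intro m s s' h5 h1 h2
    refine ⟨fun k hk => h1 k (by omega), fun k i hi => ?_, fun m' => ?_⟩
    · by_cases hk : k = 16 + m.code
      · rw [hk, h2, Function.update_of_ne hi]
      · rw [h1 k hk]
    · by_cases hm : m' = m
      · left; rw [hm, h2, Function.update_self]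
      · right
        refine ⟨hm, ?_⟩
        rw [h1]
        intro h3
        exact hm (Mode.code_inj.1 (by omega))
  induction ms generalizing s with
  | nil => exact h s rfl (fun _ _ => rfl) (fun _ _ _ => rfl) fun m => .inr ⟨by simp, rfl⟩
  | cons m ms ih =>
    cases ms with
    | nil =>
      refine wp_evaluate (c := c) hl hr fun s' h1 h2 h3 => ?_
      obtain ⟨k1, k2, k3⟩ := key m s s' h1 h2 h3
      exact h s' h1 k1 k2 (by simpa using k3)
    | cons m' ms =>
      refine wp_evaluate (c := c) hl hr fun s' h1 h2 h3 => ?_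
      obtain ⟨k1, k2, k3⟩ := key m s s' h1 h2 h3
      refine ih ?_ ?_ ?_ ?_ fun s'' l1 l2 l3 l4 => h s'' (l1.trans h1)
        (fun k hk => (l2 k hk).trans (k1 k hk))
        (fun k i hi => (l3 k i (by rwa [h1])).trans (k2 k i hi)) fun m₁ => ?_
      · rwa [h1, k1 12 (by decide)]
      · rwa [h1, k1 13 (by decide)]
      · rw [h1, k1 12 (by decide)]
        exact fun m => (k2 _ _ hne).trans (hl m)
      · rw [h1, k1 13 (by decide)]
        exact fun m => (k2 _ _ hne').trans (hr m)
      · have := l4 m₁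
        have := k3 m₁
        simp only [List.mem_cons, not_or] at *
        rw [h1] at *
        grind

/-- The sides below an edge have larger numbers, so in decreasing order their values are ready when
needed. The constant depends only on the kind of system. -/
theorem evaluateAll_ends (κ : SystemKind) : ∃ C, ∀ {n : ℕ} {u v : Fin n} {t : Tri (Fin n)} {s : State}
    {g : ℕ → Fin n × Fin n × Tri (Fin n)}, Built u v t (s.reg 10) g s →
    (∀ m : Mode, ∀ e, s.mem (16 + m.code) e = 0) →
    Ends (evaluateAll κ) s (C * s.reg 10 + C) fun s' =>
      ∀ m : Mode, ∀ e < s.reg 10, s'.mem (16 + m.code) e = val κ m (g e).2.2 := by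
  refine ⟨(evaluateStep κ).time + 10, fun {n u v t s g} hB h0 => ((Ends.of_wp (p := .set 5 (reg 10))
    (Q := fun s' => s'.mem = s.mem ∧ s'.reg 5 = s.reg 10) ⟨rfl, rfl⟩).seq fun s₁ hs₁ =>
    (Ends.loop_wp (fun s' => Built u v t (s.reg 10) g s' ∧ s'.reg 5 ≤ s.reg 10 ∧
      (∀ m : Mode, ∀ e, e < s.reg 10 → s'.reg 5 ≤ e →
        s'.mem (16 + m.code) e = val κ m (g e).2.2) ∧
      ∀ m : Mode, ∀ e < s'.reg 5, s'.mem (16 + m.code) e = 0) (fun s' => s'.reg 5) ?_ ?_).mono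
      (c' := ((evaluateStep κ).time + 2) * s.reg 10 + 2) (by rw [hs₁.2]; exact le_rfl) fun _ h => h).mono ?_ ?_⟩
  · rintro s' ⟨a1, a2, a3, a4⟩ he
    simp only [Expr.eval] at he
    have hn := a1.node (s'.reg 5 - 1) (by omega)
    refine ⟨fun h1 => ?_, fun h1 => ?_⟩
    · simp [Expr.eval] at h1
      rcases hn with ⟨hn, -⟩ | ⟨c, l, r, n1, n2, n3, n4, n5, n6⟩
      · exact absurd hn h1
      refine wp_evaluate_list (c := c) (l := l) (r := r) Mode.all ?_ ?_ ?_ ?_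
        fun s'' b1 b2 b3 b4 => ⟨⟨a1.congr (b2 _ (by decide)) (b2 _ (by decide)) (b2 _ (by decide))
          (b2 _ (by decide)), ?_, ?_, ?_⟩, ?_⟩
      · simp [Expr.eval]; omega
      · simp [Expr.eval]; omega
      · intro m
        simp only [Expr.eval, State.setReg_mem, State.setReg_reg, if_true]
        rw [a3 m _ (by omega) (by omega), n5]
      · intro m
        simp only [Expr.eval, State.setReg_mem, State.setReg_reg, if_true]
        rw [a3 m _ (by omega) (by omega), n6]
      · rw [b1]; simp [Expr.eval]; omega
      · intro m e he1 he2
        simp only [Expr.eval, State.setReg_mem, State.setReg_reg, if_true] at b1 b3 b4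
        rw [b1] at he2
        by_cases hee : e = s'.reg 5 - 1
        · rw [hee, n1]
          exact (b4 m).resolve_right fun h => h.1 m.mem_all
        · rw [b3 _ _ hee, a3 m e he1 (by omega)]
      · intro m e he1
        simp only [Expr.eval, State.setReg_mem, State.setReg_reg, if_true] at b1 b3
        rw [b1] at he1
        rw [b3 _ _ (by omega), a4 m e (by omega)]
      · rw [b1]; simp [Expr.eval]; omega
    · simp [Expr.eval] at h1
      refine ⟨⟨a1.congr rfl rfl rfl rfl, ?_, ?_, ?_⟩, ?_⟩
      · simp [Expr.eval]; omega
      · intro m e he1 he2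
        simp [Expr.eval] at he2 ⊢
        by_cases hee : e = s'.reg 5 - 1
        · rcases hn with ⟨-, hn⟩ | ⟨c, l, r, n1, n2, n3, n4, n5, n6⟩
          · rw [hee, hn, val]; exact a4 _ _ (by omega)
          · omega
        · exact a3 m e he1 (by omega)
      · intro m e he1
        simp [Expr.eval] at he1
        exact a4 m e (by omega)
      · simp [Expr.eval]; omega
  · refine ⟨hB.congr ?_ ?_ ?_ ?_, hs₁.2.le, fun m e h1 h2 => ?_, fun m e _ => ?_⟩
    all_goals rw [hs₁.1]
    · rw [hs₁.2] at h2; omega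
    · exact h0 m e
  · simp only [Program.time, Expr.cost]
    rw [add_mul, add_mul]
    omega
  · rintro s' ⟨⟨a1, a2, a3, a4⟩, he⟩ m e h1
    simp only [Expr.eval] at he
    exact a3 m e h1 (by omega)

end RAM

/-! ### Correctness of the output: invariant and steps -/

namespace RAM

open RAM.Program RAM.Expr Tri

variable {n : ℕ} {u v : Fin n} {t : Tri (Fin n)} {κ : SystemKind} {f : Fin n → ℕ} {N : ℕ}
  {g : ℕ → Fin n × Fin n × Tri (Fin n)} {s : State}

/-- The parent of an edge in the tree has a smaller number, which permits inductions from the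
root-edge downwards along the numbering. -/
theorem Built.parent (hB : Built u v t N g s) {i : ℕ} (hi : i < N) (h0 : i ≠ 0) :
    ∃ e < i, s.mem 12 e ≠ 0 ∧ (s.mem 12 e = i ∨ s.mem 13 e = i) := by
  have key : ∀ e, e < N → s.mem 12 e ≠ 0 → (s.mem 12 e = i ∨ s.mem 13 e = i) →
      ∃ e < i, s.mem 12 e ≠ 0 ∧ (s.mem 12 e = i ∨ s.mem 13 e = i) := by
    intro e he h1 h2
    have := hB.node e he
    refine ⟨e, ?_, h1, h2⟩
    rcases this with h | ⟨c, l, r, -, h3, h4, -⟩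
    · exact absurd h.1 h1
    · omega
  rcases (hB.sub i hi).eq_or_parent with ⟨h1, h2, h3⟩ | ⟨p, q, c, l, r, h1, h2⟩
  · refine absurd (hB.inj hi hB.pos ?_) h0
    rw [hB.root, ← h1, ← h2, ← h3]
  · obtain ⟨e, he, hge⟩ := hB.complete _ _ _ h1
    have hn := hB.node e he
    rw [hge] at hn
    rcases hn with hn | ⟨c', l', r', n1, n2, n3, n4, n5, n6⟩
    · simp at hn
    · simp only [node.injEq] at n1 n5 n6
      obtain ⟨rfl, rfl, rfl⟩ := n1
      refine key e he (by omega) ?_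
      rcases h2 with ⟨h3, h4, h5⟩ | ⟨h3, h4, h5⟩
      · left
        refine hB.inj (by simp only [Set.mem_Iio]; omega) hi ?_
        rw [n5, ← h3, ← h4, ← h5]
      · right
        refine hB.inj (by simp only [Set.mem_Iio]; omega) hi ?_
        rw [n6, ← h3, ← h4, ← h5]

/-- An edge is a lower side of only one triangle. So modes and subgraph numbers that are handed down
are not overwritten by another edge. -/
theorem Built.children_ne (hB : Built u v t N g s) (hf : f.Injective) (hs : Sorted f u v t)
    {i j : ℕ} (hi : i < N) (hj : j < N) (hij : i ≠ j) (h1 : s.mem 12 i ≠ 0)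
    (h2 : s.mem 12 j ≠ 0) : s.mem 12 i ≠ s.mem 12 j ∧ s.mem 12 i ≠ s.mem 13 j ∧
      s.mem 13 i ≠ s.mem 12 j ∧ s.mem 13 i ≠ s.mem 13 j := by
  have hsi := hB.sub i hi
  have hsj := hB.sub j hj
  rcases hB.node i hi with n | ⟨c, l, r, m1, m2, m3, m4, m5, m6⟩
  · exact absurd n.1 h1
  rcases hB.node j hj with n | ⟨c', l', r', n1, n2, n3, n4, n5, n6⟩
  · exact absurd n.1 h2
  rw [m1] at hsi
  rw [n1] at hsj
  have key : ∀ x y, ((x = (g i).1 ∧ y = c) ∨ (x = c ∧ y = (g i).2.1)) →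
      ((x = (g j).1 ∧ y = c') ∨ (x = c' ∧ y = (g j).2.1)) → False := by
    intro x y e1 e2
    obtain ⟨k1, rfl, k3⟩ := parent_unique hf hs hsi hsj e1 e2
    refine hij (hB.inj hi hj ?_)
    have hsj' := hsj
    rw [← k1, ← k3] at hsj'
    have := hsi.unique hsj' hs
    rw [← m1, ← n1] at this
    exact Prod.ext k1 (Prod.ext k3 this)
  refine ⟨fun h => ?_, fun h => ?_, fun h => ?_, fun h => ?_⟩
  · rw [h, n5] at m5
    exact key _ _ (.inl ⟨rfl, rfl⟩) (.inl ⟨(congrArg (·.1) m5).symm, (congrArg (·.2.1) m5).symm⟩)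
  · rw [h, n6] at m5
    exact key _ _ (.inl ⟨rfl, rfl⟩) (.inr ⟨(congrArg (·.1) m5).symm, (congrArg (·.2.1) m5).symm⟩)
  · rw [h, n5] at m6
    exact key _ _ (.inr ⟨rfl, rfl⟩) (.inl ⟨(congrArg (·.1) m6).symm, (congrArg (·.2.1) m6).symm⟩)
  · rw [h, n6] at m6
    exact key _ _ (.inr ⟨rfl, rfl⟩) (.inr ⟨(congrArg (·.1) m6).symm, (congrArg (·.2.1) m6).symm⟩)

/-- The output contains the edge with the ends `x` and `y` of the subgraph number `k`. -/
def HasEntry (s : State) (k x y : ℕ) : Prop :=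
  ∃ i < s.reg 2, s.mem 2 i = k ∧ s.mem 3 i = x ∧ s.mem 4 i = y

/-- The edges before `e` have been processed; the edge `i` has the mode `md i`, and `s.mem 24 i` is
the number of its subgraph. -/
structure OutInv (κ : SystemKind) (g : ℕ → Fin n × Fin n × Tri (Fin n)) (md : ℕ → Mode) (e : ℕ)
    (s : State) : Prop where
  mode : ∀ i, s.mem 23 i = (md i).code
  mode_zero : md 0 = .cut
  own_zero : s.mem 24 0 = 0
  start : e = 0 → s.reg 1 = 0
  first : 0 < e → s.mem 12 0 ≠ 0 → s.mem 24 (s.mem 12 0) = 0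
  modes : ∀ i < e, ∀ c l r, (g i).2.2 = .node c l r →
    md (s.mem 12 i) = (choice κ (md i) l r).1 ∧ md (s.mem 13 i) = (choice κ (md i) l r).2
  own_snd : ∀ i < e, s.mem 12 i ≠ 0 → s.mem 24 (s.mem 13 i) = s.mem 24 (s.mem 12 i)
  own_fst : ∀ i < e, s.mem 12 i ≠ 0 → md i ≠ .cut → s.mem 24 (s.mem 12 i) = s.mem 24 i
  own_lt : ∀ i < e, s.mem 12 i ≠ 0 → md i = .cut → s.mem 24 (s.mem 12 i) < s.reg 1
  own_inj : ∀ i < e, ∀ j < e, s.mem 12 i ≠ 0 → s.mem 12 j ≠ 0 → md i = .cut → md j = .cut →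
    s.mem 24 (s.mem 12 i) = s.mem 24 (s.mem 12 j) → i = j
  own_surj : ∀ k < s.reg 1, ∃ i < e, s.mem 12 i ≠ 0 ∧ md i = .cut ∧ s.mem 24 (s.mem 12 i) = k
  entries : ∀ k x y, HasEntry s k x y ↔
    ∃ i < e, s.mem 14 i = x ∧ s.mem 15 i = y ∧
      (s.mem 24 i = k ∨ s.mem 12 i ≠ 0 ∧ md i = .cut ∧ s.mem 24 (s.mem 12 i) = k)

theorem wp_select {s : State} {Q : State → Prop} {m : Mode} {l r : Tri (Fin n)}
    (hl : ∀ m : Mode, s.mem (16 + m.code) (s.mem 12 (s.reg 5)) = val κ m l)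
    (hr : ∀ m : Mode, s.mem (16 + m.code) (s.mem 13 (s.reg 5)) = val κ m r)
    (h : ∀ s' : State, (∀ i, i ≠ 7 → i ≠ 8 → i ≠ 9 → s'.reg i = s.reg i) →
      (∀ k, k ≠ 23 → s'.mem k = s.mem k) →
      s'.mem 23 = Function.update (Function.update (s.mem 23) (s.mem 12 (s.reg 5))
        (choice κ m l r).1.code) (s.mem 13 (s.reg 5)) (choice κ m l r).2.code → Q s') :
    wp (select κ m) Q s := by
  simp only [select, seqs, wp]
  refine wp_maxInto (by decide) (by decide) fun s₁ a1 a2 a3 =>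
    wp_maxInto (by decide) (by decide) fun s₂ b1 b2 b3 => ?_
  have a5 := a2 5 (by decide) (by decide)
  have b5 := b2 5 (by decide) (by decide)
  have b8 := b2 8 (by decide) (by decide)
  rw [hl, hr] at a3
  rw [a1, a5, hl, hr] at b3
  rw [a1] at b1
  rw [a5] at b5
  rw [a3] at b8
  have hreg : ∀ i, i ≠ 7 → i ≠ 8 → i ≠ 9 → s₂.reg i = s.reg i := fun i h7 h8 h9 => by
    rw [b2 i h7 h9, a2 i h7 h8]
  refine ⟨fun h1 => h _ ?_ ?_ ?_, fun h1 => h _ ?_ ?_ ?_⟩ <;>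
    simp [Expr.eval, b1, b3, b5, b8] at h1 ⊢
  · exact hreg
  · intro k hk; simp [hk]
  · rw [choice, if_neg (by rw [max_le_iff]; omega)]
  · exact hreg
  · intro k hk; simp [hk]
  · rw [choice, if_pos (by rw [max_le_iff]; omega)]

/-- Register 3 counts down to the position of the mode in the list; `select` runs when it has
reached 0. -/
theorem wp_dispatch {Q : State → Prop} {m : Mode} (ms : List Mode) {s : State}
    (hm : ms[s.reg 3]? = some m) (h : wp (select κ m) Q (s.setReg 3 0)) :
    wp (dispatch κ ms) Q s := by
  induction ms generalizing s with
  | nil => simp at hm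
  | cons m' ms ih =>
    refine ⟨fun h1 => ?_, fun h1 => ?_⟩ <;> simp only [Expr.eval] at h1
    · refine ih ?_ ?_
      · rw [← hm]
        obtain ⟨k, hk⟩ := Nat.exists_eq_succ_of_ne_zero h1
        simp [Expr.eval, hk]
      · simpa [State.setReg] using h
    · rw [h1] at hm
      have : s.setReg 3 0 = s := by
        rw [State.setReg, ← h1, Function.update_eq_self]
      rw [this] at h
      simp only [List.getElem?_cons_zero, Option.some.injEq] at hm
      rwa [hm]

end RAM

namespace RAM

open RAM.Program RAM.Expr Tri

variable {n : ℕ} {u v : Fin n} {t : Tri (Fin n)} {κ : SystemKind} {f : Fin n → ℕ} {N : ℕ}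
  {g : ℕ → Fin n × Fin n × Tri (Fin n)} {s s' : State} {md : ℕ → Mode} {e : ℕ}

theorem wp_emit {Q : State → Prop} {x : Expr}
    (h : ∀ s' : State, (∀ i, i ≠ 2 → s'.reg i = s.reg i) →
      (∀ k, k ≠ 2 → k ≠ 3 → k ≠ 4 → s'.mem k = s.mem k) →
      (∀ k y z, HasEntry s' k y z ↔ HasEntry s k y z ∨
        (k = x.eval s ∧ y = s.mem 14 (s.reg 5) ∧ z = s.mem 15 (s.reg 5))) → Q s') :
    wp (emit x) Q s := by
  refine h _ ?_ ?_ ?_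
  · intro i hi; simp [hi]
  · intro k h2 h3 h4; simp [h2, h3, h4]
  · intro k y z
    simp only [HasEntry, State.setReg_reg, State.setReg_mem, State.setMem_reg, State.setMem_mem,
      Expr.eval]
    constructor
    · rintro ⟨i, hi, h⟩
      simp [Function.update_apply] at hi h
      by_cases h1 : i = s.reg 2
      · simp [h1] at h
        exact .inr ⟨h.1.symm, h.2.1.symm, h.2.2.symm⟩
      · simp [h1] at h
        exact .inl ⟨i, by omega, h⟩
    · rintro (⟨i, hi, h⟩ | ⟨rfl, rfl, rfl⟩)
      · have : i ≠ s.reg 2 := by omega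
        exact ⟨i, by simp; omega, by simpa [Function.update_apply, this] using h⟩
      · exact ⟨s.reg 2, by simp, by simp⟩

theorem OutInv.next_leaf (h : OutInv κ g md e s) (hB : Built u v t N g s) (he : e < N)
    (h12 : s.mem 12 e = 0) (hm : ∀ k, k ≠ 2 → k ≠ 3 → k ≠ 4 → s'.mem k = s.mem k)
    (h1 : s'.reg 1 = s.reg 1)
    (hE : ∀ k y z, HasEntry s' k y z ↔ HasEntry s k y z ∨
        (k = s.mem 24 e ∧ y = s.mem 14 e ∧ z = s.mem 15 e)) : OutInv κ g md (e + 1) s' := by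
  have m12 := hm 12 (by decide) (by decide) (by decide)
  have m13 := hm 13 (by decide) (by decide) (by decide)
  have m14 := hm 14 (by decide) (by decide) (by decide)
  have m15 := hm 15 (by decide) (by decide) (by decide)
  have m23 := hm 23 (by decide) (by decide) (by decide)
  have m24 := hm 24 (by decide) (by decide) (by decide)
  have ne : ∀ i < e + 1, s.mem 12 i ≠ 0 → i < e := by
    intro i hi h0
    rcases Nat.lt_succ_iff_lt_or_eq.1 hi with h1 | rfl
    exacts [h1, absurd h12 h0]
  refine ⟨by rw [m23]; exact h.mode, h.mode_zero, by rw [m24]; exact h.own_zero, by omega,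
    ?_, ?_, ?_, ?_, ?_, ?_, ?_, ?_⟩
  · rw [m12, m24]
    intro _ h2
    exact h.first (ne 0 (by omega) h2) h2
  · rw [m12, m13]
    intro i hi c l r hclr
    refine h.modes i (ne i hi fun h0 => ?_) c l r hclr
    rcases hB.node i (by omega) with h1 | ⟨_, _, _, _, h1, _⟩
    · rw [h1.2] at hclr; simp at hclr
    · omega
  · rw [m12, m13, m24]
    exact fun i hi h2 => h.own_snd i (ne i hi h2) h2
  · rw [m12, m24]
    exact fun i hi h2 => h.own_fst i (ne i hi h2) h2
  · rw [m12, m24, h1]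
    exact fun i hi h2 => h.own_lt i (ne i hi h2) h2
  · rw [m12, m24]
    exact fun i hi j hj h2 h3 => h.own_inj i (ne i hi h2) j (ne j hj h3) h2 h3
  · rw [m12, m24, h1]
    intro k hk
    obtain ⟨i, hi, h2⟩ := h.own_surj k hk
    exact ⟨i, by omega, h2⟩
  · intro k x y
    rw [hE, h.entries, m12, m14, m15, m24]
    constructor
    · rintro (⟨i, hi, h2⟩ | ⟨rfl, rfl, rfl⟩)
      · exact ⟨i, by omega, h2⟩
      · exact ⟨e, by omega, rfl, rfl, .inl rfl⟩
    · rintro ⟨i, hi, h2, h3, h4⟩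
      rcases Nat.lt_succ_iff_lt_or_eq.1 hi with h5 | rfl
      · exact .inl ⟨i, h5, h2, h3, h4⟩
      · exact .inr ⟨(h4.resolve_right fun h => h.1 h12).symm, h2.symm, h3.symm⟩

/-- In mode `cut` the two sides get the fresh number `reg 1`, otherwise they inherit the number of
the edge. No other entry of arrays 23 and 24 changes, by `Built.children_ne`. -/
theorem OutInv.next_node (h : OutInv κ g md e s) (hB : Built u v t N g s) (hf : f.Injective)
    (hs : Sorted f u v t) (he : e < N) (h12 : s.mem 12 e ≠ 0) {c : Fin n} {l r : Tri (Fin n)}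
    (hclr : (g e).2.2 = .node c l r) {w : ℕ}
    (hm : ∀ k, k ≠ 2 → k ≠ 3 → k ≠ 4 → k ≠ 23 → k ≠ 24 → s'.mem k = s.mem k)
    (m23 : s'.mem 23 = Function.update (Function.update (s.mem 23) (s.mem 12 e)
        (choice κ (md e) l r).1.code) (s.mem 13 e) (choice κ (md e) l r).2.code)
    (m24 : s'.mem 24 = Function.update (Function.update (s.mem 24) (s.mem 12 e) w) (s.mem 13 e) w)
    (hw : (md e ≠ .cut ∧ w = s.mem 24 e ∧ s'.reg 1 = s.reg 1) ∨
      (md e = .cut ∧ w = s.reg 1 ∧ s'.reg 1 = s.reg 1 + 1))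
    (hE : ∀ k y z, HasEntry s' k y z ↔ HasEntry s k y z ∨
        ((k = s.mem 24 e ∨ (md e = .cut ∧ k = w)) ∧ y = s.mem 14 e ∧ z = s.mem 15 e)) :
    ∃ md', OutInv κ g md' (e + 1) s' := by
  have m12 := hm 12 (by decide) (by decide) (by decide) (by decide) (by decide)
  have m13 := hm 13 (by decide) (by decide) (by decide) (by decide) (by decide)
  have m14 := hm 14 (by decide) (by decide) (by decide) (by decide) (by decide)
  have m15 := hm 15 (by decide) (by decide) (by decide) (by decide) (by decide)
  have hgt : e < s.mem 12 e ∧ s.mem 13 e = s.mem 12 e + 1 := by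
    rcases hB.node e he with h1 | ⟨_, _, _, _, h1, h2, _⟩
    exacts [absurd h1.1 h12, ⟨h1, h2⟩]
  have cases1 : ∀ i < e + 1, i < e ∨ i = e := fun i hi => Nat.lt_succ_iff_lt_or_eq.1 hi
  let md' := Function.update (Function.update md (s.mem 12 e) (choice κ (md e) l r).1) (s.mem 13 e)
    (choice κ (md e) l r).2
  have md1 : ∀ i < e + 1, md' i = md i := fun i hi => by
    simp only [md']; rw [Function.update_of_ne (by omega), Function.update_of_ne (by omega)]
  have md2 : md' (s.mem 12 e) = (choice κ (md e) l r).1 := by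
    simp only [md']; rw [Function.update_of_ne (by omega), Function.update_self]
  have md3 : md' (s.mem 13 e) = (choice κ (md e) l r).2 := by
    simp only [md']; rw [Function.update_self]
  have md4 : ∀ i, i ≠ s.mem 12 e → i ≠ s.mem 13 e → md' i = md i := fun i h1 h2 => by
    simp only [md']; rw [Function.update_of_ne h2, Function.update_of_ne h1]
  have o1 : ∀ i < e + 1, s'.mem 24 i = s.mem 24 i := fun i hi => by
    rw [m24, Function.update_of_ne (by omega), Function.update_of_ne (by omega)]
  have o2 : s'.mem 24 (s.mem 12 e) = w := by
    rw [m24, Function.update_of_ne (by omega), Function.update_self]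
  have o3 : s'.mem 24 (s.mem 13 e) = w := by rw [m24, Function.update_self]
  have o4 : ∀ i, i ≠ s.mem 12 e → i ≠ s.mem 13 e → s'.mem 24 i = s.mem 24 i := fun i h1 h2 => by
    rw [m24, Function.update_of_ne h2, Function.update_of_ne h1]
  have hch : ∀ i < e, s.mem 12 i ≠ 0 → s'.mem 24 (s.mem 12 i) = s.mem 24 (s.mem 12 i) ∧
      s'.mem 24 (s.mem 13 i) = s.mem 24 (s.mem 13 i) ∧ md' (s.mem 12 i) = md (s.mem 12 i) ∧
      md' (s.mem 13 i) = md (s.mem 13 i) := by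
    intro i hi h0
    obtain ⟨c1, c2, c3, c4⟩ := hB.children_ne hf hs (by omega) he (by omega : i ≠ e) h0 h12
    exact ⟨o4 _ c1 c2, o4 _ c3 c4, md4 _ c1 c2, md4 _ c3 c4⟩
  refine ⟨md', ?_, ?_, ?_, by omega, ?_, ?_, ?_, ?_, ?_, ?_, ?_, ?_⟩
  · intro i
    simp only [m23, md', Function.update_apply]
    split_ifs
    · rfl
    · rfl
    · exact h.mode i
  · rw [md1 0 (by omega), h.mode_zero]
  · rw [o1 0 (by omega), h.own_zero]
  · rw [m12]
    intro _ h2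
    rcases Nat.eq_zero_or_pos e with rfl | h3
    · rw [o2]
      have := h.start rfl
      have := h.mode_zero
      rcases hw with hw | hw
      · exact absurd this hw.1
      · omega
    · rw [(hch 0 h3 h2).1]
      exact h.first h3 h2
  · rw [m12, m13]
    intro i hi c' l' r' h'
    rcases cases1 i hi with h1 | rfl
    · have h0 : s.mem 12 i ≠ 0 := by
        rcases hB.node i (by omega) with h1 | ⟨_, _, _, _, h1, _⟩
        · rw [h1.2] at h'; simp at h'
        · omega
      rw [(hch i h1 h0).2.2.1, (hch i h1 h0).2.2.2, md1 i hi]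
      exact h.modes i h1 c' l' r' h'
    · rw [h'] at hclr
      simp only [node.injEq] at hclr
      obtain ⟨rfl, rfl, rfl⟩ := hclr
      rw [md2, md3, md1 i hi]
      exact ⟨rfl, rfl⟩
  · rw [m12, m13]
    intro i hi h0
    rcases cases1 i hi with h1 | rfl
    · rw [(hch i h1 h0).1, (hch i h1 h0).2.1]
      exact h.own_snd i h1 h0
    · rw [o2, o3]
  · rw [m12]
    intro i hi h0
    rw [md1 i hi, o1 i hi]
    rcases cases1 i hi with h1 | rfl
    · rw [(hch i h1 h0).1]
      exact h.own_fst i h1 h0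
    · rw [o2]
      intro h2
      exact (hw.resolve_right fun h => h2 h.1).2.1
  · rw [m12]
    intro i hi h0
    rw [md1 i hi]
    intro h2
    rcases cases1 i hi with h1 | rfl
    · rw [(hch i h1 h0).1]
      have := h.own_lt i h1 h0 h2
      omega
    · rw [o2]
      have := hw.resolve_left fun h => h.1 h2
      omega
  · rw [m12]
    intro i hi j hj hi0 hj0
    rw [md1 i hi, md1 j hj]
    intro hi1 hj1
    rcases cases1 i hi with hi2 | rfl <;> rcases cases1 j hj with hj2 | rfl
    · rw [(hch i hi2 hi0).1, (hch j hj2 hj0).1]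
      exact h.own_inj i hi2 j hj2 hi0 hj0 hi1 hj1
    · rw [(hch i hi2 hi0).1, o2]
      have := h.own_lt i hi2 hi0 hi1
      have := hw.resolve_left fun h => h.1 hj1
      omega
    · rw [(hch j hj2 hj0).1, o2]
      have := h.own_lt j hj2 hj0 hj1
      have := hw.resolve_left fun h => h.1 hi1
      omega
    · exact fun _ => rfl
  · rw [m12]
    intro k hk
    by_cases hk' : k < s.reg 1
    · obtain ⟨i, hi, h1, h2, h3⟩ := h.own_surj k hk'
      exact ⟨i, by omega, h1, by rwa [md1 i (by omega)], by rw [(hch i hi h1).1, h3]⟩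
    · rcases hw with hw | hw
      · omega
      · exact ⟨e, by omega, h12, by rw [md1 e (by omega), hw.1], by rw [o2]; omega⟩
  · intro k x y
    rw [hE, h.entries, m12, m14, m15]
    constructor
    · rintro (⟨i, hi, h2, h3, h4⟩ | ⟨h4, rfl, rfl⟩)
      · refine ⟨i, by omega, h2, h3, ?_⟩
        rw [o1 i (by omega), md1 i (by omega)]
        refine h4.imp_right fun h5 => ⟨h5.1, h5.2.1, ?_⟩
        rw [(hch i hi h5.1).1, h5.2.2]
      · refine ⟨e, by omega, rfl, rfl, ?_⟩
        rw [o1 e (by omega), md1 e (by omega), o2]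
        exact h4.imp Eq.symm fun h5 => ⟨h12, h5.1, h5.2.symm⟩
    · rintro ⟨i, hi, h2, h3, h4⟩
      rw [o1 i hi, md1 i hi] at h4
      rcases cases1 i hi with h5 | rfl
      · left
        refine ⟨i, h5, h2, h3, h4.imp_right fun h6 => ⟨h6.1, h6.2.1, ?_⟩⟩
        rw [← (hch i h5 h6.1).1, h6.2.2]
      · right
        rw [o2] at h4
        exact ⟨h4.imp Eq.symm fun h6 => ⟨h6.2.1, h6.2.2.symm⟩, h2.symm, h3.symm⟩

end RAM

namespace RAM

open RAM.Program RAM.Expr Tri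

variable {n : ℕ} {u v : Fin n} {t : Tri (Fin n)} {κ : SystemKind} {f : Fin n → ℕ} {N : ℕ}
  {g : ℕ → Fin n × Fin n × Tri (Fin n)} {s s' : State} {md : ℕ → Mode} {e : ℕ}

theorem HasEntry.congr {k x y : ℕ} (h2 : s'.reg 2 = s.reg 2)
    (hm : ∀ k, 2 ≤ k → k ≤ 4 → s'.mem k = s.mem k) : HasEntry s' k x y ↔ HasEntry s k x y := by
  rw [HasEntry, HasEntry, h2, hm 2 (by decide) (by decide), hm 3 (by decide) (by decide),
    hm 4 (by decide) (by decide)]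

/-- The second half of the work for an edge with a triangle below it. -/
theorem OutInv.wp_node (h : OutInv κ g md e s) (hB : Built u v t N g s) (hf : f.Injective)
    (hs : Sorted f u v t) (he : e < N) (h12 : s.mem 12 e ≠ 0) {c : Fin n} {l r : Tri (Fin n)}
    (hclr : (g e).2.2 = .node c l r)
    (hv : ∀ m : Mode, ∀ i < N, s.mem (16 + m.code) i = val κ m (g i).2.2)
    {s₁ : State} (h5 : s₁.reg 5 = e)
    (hm : ∀ k, k ≠ 2 → k ≠ 3 → k ≠ 4 → s₁.mem k = s.mem k)
    (hw : (md e ≠ .cut ∧ s₁.reg 6 = s.mem 24 e ∧ s₁.reg 1 = s.reg 1) ∨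
      (md e = .cut ∧ s₁.reg 6 = s.reg 1 ∧ s₁.reg 1 = s.reg 1 + 1))
    (hE : ∀ k y z, HasEntry s₁ k y z ↔ HasEntry s k y z ∨
        ((k = s.mem 24 e ∨ (md e = .cut ∧ k = s₁.reg 6)) ∧ y = s.mem 14 e ∧ z = s.mem 15 e))
    {Q : State → Prop}
    (hQ : ∀ s' md', OutInv κ g md' (e + 1) s' →
      (∀ k, k ≠ 2 → k ≠ 3 → k ≠ 4 → k ≠ 23 → k ≠ 24 → s'.mem k = s.mem k) →
      s'.reg 5 = e → s'.reg 10 = s₁.reg 10 → Q s') :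
    wp (seqs [set 3 (cell 23 (reg 5)), dispatch κ Mode.all,
      store 24 (cell 12 (reg 5)) (reg 6), store 24 (cell 13 (reg 5)) (reg 6)]) Q s₁ := by
  have m12 := hm 12 (by decide) (by decide) (by decide)
  have m13 := hm 13 (by decide) (by decide) (by decide)
  have m23 := hm 23 (by decide) (by decide) (by decide)
  have m24 := hm 24 (by decide) (by decide) (by decide)
  rcases hB.node e he with hn | ⟨c', l', r', n1, n2, n3, n4, n5, n6⟩
  · exact absurd hn.1 h12
  rw [hclr] at n1
  simp only [node.injEq] at n1
  obtain ⟨rfl, rfl, rfl⟩ := n1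
  have hmc : ∀ m : Mode, 16 + m.code ≠ 2 ∧ 16 + m.code ≠ 3 ∧ 16 + m.code ≠ 4 := fun m => by omega
  simp only [seqs, wp]
  refine wp_dispatch (m := md e) Mode.all ?_ ?_
  · simp [Expr.eval, h5, m23, h.mode, Mode.all_code]
  refine wp_select (l := l) (r := r) ?_ ?_ fun s₂ a1 a2 a3 => ?_
  · intro m
    simp [h5, m12]
    rw [hm _ (hmc m).1 (hmc m).2.1 (hmc m).2.2, hv m _ (by omega), n5]
  · intro m
    simp [h5, m13]
    rw [hm _ (hmc m).1 (hmc m).2.1 (hmc m).2.2, hv m _ (by omega), n6]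
  simp [h5, m12, m13, m23] at a3
  have r5 : s₂.reg 5 = e := by rw [a1 5 (by decide) (by decide) (by decide)]; simp [h5]
  have r6 : s₂.reg 6 = s₁.reg 6 := by rw [a1 6 (by decide) (by decide) (by decide)]; simp
  have r1 : s₂.reg 1 = s₁.reg 1 := by rw [a1 1 (by decide) (by decide) (by decide)]; simp
  have r2 : s₂.reg 2 = s₁.reg 2 := by rw [a1 2 (by decide) (by decide) (by decide)]; simp
  have r10 : s₂.reg 10 = s₁.reg 10 := by rw [a1 10 (by decide) (by decide) (by decide)]; simp
  have b12 : s₂.mem 12 = s.mem 12 := by rw [a2 12 (by decide)]; simp [m12]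
  have b13 : s₂.mem 13 = s.mem 13 := by rw [a2 13 (by decide)]; simp [m13]
  have b24 : s₂.mem 24 = s.mem 24 := by rw [a2 24 (by decide)]; simp [m24]
  simp only [Expr.eval, State.setMem_reg, r5, r6, b12]
  have c13 : (s₂.setMem 24 (s.mem 12 e) (s₁.reg 6)).mem 13 = s.mem 13 := by simp [b13]
  rw [c13]
  have hmem : ∀ k, k ≠ 2 → k ≠ 3 → k ≠ 4 → k ≠ 23 → k ≠ 24 →
      ((s₂.setMem 24 (s.mem 12 e) (s₁.reg 6)).setMem 24 (s.mem 13 e) (s₁.reg 6)).mem k =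
        s.mem k := by
    intro k h2 h3 h4 h23 h24
    simp only [State.setMem_mem, h24, if_false]
    rw [a2 k h23, State.setReg_mem, State.setReg_mem, hm k h2 h3 h4]
  obtain ⟨md', hmd'⟩ := h.next_node hB hf hs he h12 hclr (w := s₁.reg 6)
    (s' := (s₂.setMem 24 (s.mem 12 e) (s₁.reg 6)).setMem 24 (s.mem 13 e) (s₁.reg 6))
    hmem (by simp [a3]) (by simp [b24]) (by simpa [r1] using hw) (by
      intro k y z
      rw [← hE]
      refine HasEntry.congr (by simp [r2]) fun k h2 h4 => ?_
      have : k ≠ 24 ∧ k ≠ 23 := by omega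
      simp only [State.setMem_mem, this.1, if_false]
      rw [a2 k this.2, State.setReg_mem, State.setReg_mem])
  exact hQ _ md' hmd' hmem (by simp [r5]) (by simp [r10])

theorem OutInv.wp_outputStep (h : OutInv κ g md e s) (hB : Built u v t N g s) (hf : f.Injective)
    (hs : Sorted f u v t) (he : e < N) (h5 : s.reg 5 = e)
    (hv : ∀ m : Mode, ∀ i < N, s.mem (16 + m.code) i = val κ m (g i).2.2) {Q : State → Prop}
    (hQ : ∀ s' md', OutInv κ g md' (e + 1) s' →
      (∀ k, k ≠ 2 → k ≠ 3 → k ≠ 4 → k ≠ 23 → k ≠ 24 → s'.mem k = s.mem k) →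
      s'.reg 5 = e + 1 → s'.reg 10 = s.reg 10 → Q s') :
    wp (outputStep κ) Q s := by
  have hlast : ∀ {s₂ : State} {md' : ℕ → Mode}, OutInv κ g md' (e + 1) s₂ →
      (∀ k, k ≠ 2 → k ≠ 3 → k ≠ 4 → k ≠ 23 → k ≠ 24 → s₂.mem k = s.mem k) →
      s₂.reg 5 = e → s₂.reg 10 = s.reg 10 → wp (set 5 (add (reg 5) (const 1))) Q s₂ := by
    intro s₂ md' h1 h2 h3 h4
    refine hQ _ md' ⟨h1.mode, h1.mode_zero, h1.own_zero, h1.start, h1.first, h1.modes, h1.own_snd,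
      h1.own_fst, h1.own_lt, h1.own_inj, h1.own_surj, h1.entries⟩ h2 ?_ ?_
    · simp [Expr.eval, h3]
    · simp [h4]
  simp only [outputStep]
  refine wp_emit fun s₁ a1 a2 a3 => ⟨fun h1 => ?_, fun h1 => ?_⟩
  all_goals
    have m12 := a2 12 (by decide) (by decide) (by decide)
    have m14 := a2 14 (by decide) (by decide) (by decide)
    have m15 := a2 15 (by decide) (by decide) (by decide)
    have m23 := a2 23 (by decide) (by decide) (by decide)
    have m24 := a2 24 (by decide) (by decide) (by decide)
    have r5 := a1 5 (by decide)
    have r1 := a1 1 (by decide)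
    have r10 := a1 10 (by decide)
    simp only [Expr.eval, r5, m12, h5] at h1 a3
  · rcases hB.node e he with hn | ⟨c, l, r, n1, -⟩
    · exact absurd hn.1 h1
    refine ⟨fun h2 => ?_, fun h2 => ?_⟩ <;> simp only [Expr.eval, r5, m23, h5, h.mode] at h2
    · have h2' : md e ≠ .cut := fun h3 => h2 (Mode.code_eq_zero.2 h3)
      refine h.wp_node hB hf hs he h1 n1 hv ?_ ?_ (.inl ⟨h2', ?_, ?_⟩) ?_ fun s₂ md' k1 k2 k3 k4 =>
        hlast k1 k2 k3 (k4.trans ?_)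
      · simp [r5, h5]
      · simpa using a2
      · simp [Expr.eval, r5, h5, m24]
      · simp [r1]
      · intro k y z
        rw [HasEntry.congr (s := s₁) (by simp) (by simp), a3]
        simp [h2']
      · simp [r10]
    · have h2' : md e = .cut := Mode.code_eq_zero.1 h2
      refine wp_emit fun s₂ b1 b2 b3 => ?_
      have q6 : s₂.reg 6 = s.reg 1 := by rw [b1 6 (by decide)]; simp [Expr.eval, r1]
      refine h.wp_node hB hf hs he h1 n1 hv ?_ ?_ (.inr ⟨h2', q6, ?_⟩) ?_
        fun s₃ md' k1 k2 k3 k4 => hlast k1 k2 k3 (k4.trans ?_)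
      · rw [b1 5 (by decide)]; simp [r5, h5]
      · intro k e2 e3 e4
        rw [b2 k e2 e3 e4]; simp [a2 k e2 e3 e4]
      · rw [b1 1 (by decide)]; simp [Expr.eval, r1]
      · intro k y z
        rw [b3, HasEntry.congr (s := s₁) (by simp) (by simp), a3, q6]
        simp [Expr.eval, r5, h5, m14, m15, r1, h2']
        tauto
      · rw [b1 10 (by decide)]; simp [r10]
  · have h3 := h.next_leaf (s' := s₁) hB he h1 a2 r1 a3
    exact hlast h3 (fun k e2 e3 e4 _ _ => a2 k e2 e3 e4) (r5.trans h5) r10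

theorem output_ends (κ : SystemKind) : ∃ C, ∀ {n : ℕ} {u v : Fin n} {t : Tri (Fin n)}
    {f : Fin n → ℕ} {s : State} {g : ℕ → Fin n × Fin n × Tri (Fin n)},
    f.Injective → Sorted f u v t → Built u v t (s.reg 10) g s →
    (∀ m : Mode, ∀ i < s.reg 10, s.mem (16 + m.code) i = val κ m (g i).2.2) →
    (∀ i, s.mem 23 i = 0) → s.mem 24 0 = 0 →
    Ends (output κ) s (C * s.reg 10 + C) fun s' =>
      ∃ md, OutInv κ g md (s.reg 10) s' ∧ Built u v t (s.reg 10) g s' ∧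
        s'.reg 0 = val κ .cut t := by
  refine ⟨(outputStep κ).time + 20, fun {n u v t f s g} hf hs hB hv h23 h24 =>
    ((Ends.of_wp (p := seqs [set 1 (const 0), set 2 (const 0), set 5 (const 0)])
    (Q := fun s' => s'.mem = s.mem ∧ s'.reg 5 = 0 ∧ s'.reg 1 = 0 ∧ s'.reg 2 = 0 ∧
      s'.reg 10 = s.reg 10) ?_).seq fun s₁ hs₁ =>
    ((Ends.loop_wp (fun s' => (∃ md, OutInv κ g md (s'.reg 5) s') ∧ s'.reg 5 ≤ s.reg 10 ∧
      s'.reg 10 = s.reg 10 ∧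
      ∀ k, k ≠ 2 → k ≠ 3 → k ≠ 4 → k ≠ 23 → k ≠ 24 → s'.mem k = s.mem k)
      (fun s' => s.reg 10 - s'.reg 5) ?_ ?_).mono
      (c' := ((outputStep κ).time + 4) * s.reg 10 + 4) ?_ fun _ h => h).seq fun s₂ hs₂ =>
      Ends.of_wp (p := .set 0 (cell 16 (const 0))) ?_).mono ?_ fun _ h => h⟩
  · simp [wp, seqs, Expr.eval]
  · rintro s' ⟨⟨md, h1⟩, h2, h3, h4⟩ he
    simp only [Expr.eval] at he
    have hB' : Built u v t (s.reg 10) g s' := by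
      refine hB.congr ?_ ?_ ?_ ?_ <;> exact h4 _ (by decide) (by decide) (by decide) (by decide) (by decide)
    refine h1.wp_outputStep hB' hf hs (by omega) rfl ?_ fun s'' md' k1 k2 k3 k4 =>
      ⟨⟨⟨md', by rwa [k3]⟩, by omega, by omega, fun k e2 e3 e4 e23 e24 => ?_⟩, by omega⟩
    · intro m i hi
      have := m.code_le
      rw [h4 _ (by omega) (by omega) (by omega) (by omega) (by omega)]
      exact hv m i hi
    · rw [k2 k e2 e3 e4 e23 e24, h4 k e2 e3 e4 e23 e24]
  · obtain ⟨a1, a2, a3, a4, a5⟩ := hs₁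
    refine ⟨⟨fun _ => .cut, ?_⟩, by omega, a5, fun k _ _ _ _ _ => by rw [a1]⟩
    rw [a2]
    refine ⟨fun i => by rw [a1, h23]; rfl, rfl, by rw [a1, h24], fun _ => a3, by simp, by simp,
      by simp, by simp, by simp, by simp, by simp [a3], by simp [HasEntry, a4]⟩
  · simp only [Expr.cost, hs₁.2.1]
    rw [Nat.sub_zero]
  · obtain ⟨⟨⟨md, h1⟩, h2, h3, h4⟩, he⟩ := hs₂
    simp only [Expr.eval] at he
    have hN : s₂.reg 5 = s.reg 10 := by omega
    rw [hN] at h1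
    have hB' : Built u v t (s.reg 10) g s₂ := by
      refine hB.congr ?_ ?_ ?_ ?_ <;> exact h4 _ (by decide) (by decide) (by decide) (by decide) (by decide)
    refine ⟨md, ⟨h1.mode, h1.mode_zero, h1.own_zero, h1.start, h1.first, h1.modes, h1.own_snd,
      h1.own_fst, h1.own_lt, h1.own_inj, h1.own_surj, h1.entries⟩, hB'.congr rfl rfl rfl rfl, ?_⟩
    have h5 := hv .cut 0 hB.pos
    rw [hB.root] at h5
    simp only [Expr.eval, State.setReg_reg, if_true]
    rw [h4 16 (by decide) (by decide) (by decide) (by decide) (by decide)]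
    exact h5
  · simp only [Program.time, seqs, Expr.cost]
    rw [add_mul, add_mul]
    omega

end RAM

/-! ### The output is the optimal system -/

namespace RAM

open RAM.Program RAM.Expr Tri

variable {n : ℕ} {G : SimpleGraph (Fin n)} {u v : Fin n} {t : Tri (Fin n)} {κ : SystemKind}
  {f : Fin n → ℕ} {N : ℕ}
  {g : ℕ → Fin n × Fin n × Tri (Fin n)} {s s' : State} {md : ℕ → Mode} {e : ℕ}

theorem Built.induction (hB : Built u v t N g s) {P : ℕ → Prop} (h0 : P 0)
    (h : ∀ e < N, ∀ c l r, (g e).2.2 = .node c l r → s.mem 12 e ≠ 0 → P e →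
      (g (s.mem 12 e) = ((g e).1, c, l) → P (s.mem 12 e)) ∧
      (g (s.mem 13 e) = (c, (g e).2.1, r) → P (s.mem 13 e))) {i : ℕ} (hi : i < N) : P i := by
  induction i using Nat.strong_induction_on with
  | _ i ih =>
    by_cases hi0 : i = 0
    · exact hi0 ▸ h0
    obtain ⟨e, he, h1, h2⟩ := hB.parent hi hi0
    have he' : e < N := by omega
    rcases hB.node e he' with hn | ⟨c, l, r, n1, n2, n3, n4, n5, n6⟩
    · exact absurd hn.1 h1
    obtain ⟨k1, k2⟩ := h e he' c l r n1 h1 (ih e he he')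
    rcases h2 with rfl | rfl
    exacts [k1 n5, k2 n6]

/-- Follow the edges upwards to the nearest proper ancestor r of mode `cut`, where the subgraph of
edge i was started. The part of this subgraph below i is the optimal pruning for the mode of i. Only
the root-edge has no such ancestor. -/
theorem OutInv.exists_root (hO : OutInv κ g md N s) (hB : Built u v t N g s) {i : ℕ} (hi : i < N) :
    i = 0 ∨ ∃ r < N, s.mem 12 r ≠ 0 ∧ md r = .cut ∧ s.mem 24 (s.mem 12 r) = s.mem 24 i ∧
      Sub (g r).1 (g r).2.1 (best κ .root (g r).2.2) (g i).1 (g i).2.1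
        (best κ (md i) (g i).2.2) := by
  refine hB.induction (P := fun i => i = 0 ∨ ∃ r < N, s.mem 12 r ≠ 0 ∧ md r = .cut ∧
    s.mem 24 (s.mem 12 r) = s.mem 24 i ∧ Sub (g r).1 (g r).2.1 (best κ .root (g r).2.2) (g i).1
      (g i).2.1 (best κ (md i) (g i).2.2)) (.inl rfl) (fun e he c l r hclr h12 ih => ?_) hi
  obtain ⟨k1, k2⟩ := hO.modes e he c l r hclr
  have k3 := hO.own_snd e he h12
  by_cases hm : md e = .cut
  · have hb : best κ .root (g e).2.2 = .node c (best κ (md (s.mem 12 e)) l)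
        (best κ (md (s.mem 13 e)) r) := by
      rw [k1, k2, hclr, best_node (by simp), hm, choice_cut]
    refine ⟨fun h => .inr ⟨e, he, h12, hm, rfl, ?_⟩, fun h => .inr ⟨e, he, h12, hm, k3.symm, ?_⟩⟩
    · rw [hb, h]; exact .left (.refl _ _ _)
    · rw [hb, h]; exact .right (.refl _ _ _)
  · obtain ⟨r', hr', h1, h2, h3, h4⟩ := ih.resolve_left (by rintro rfl; exact hm hO.mode_zero)
    have k4 := hO.own_fst e he h12 hm
    rw [hclr, best_node hm, ← k1, ← k2] at h4
    refine ⟨fun h => .inr ⟨r', hr', h1, h2, by rw [h3, k4], ?_⟩,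
      fun h => .inr ⟨r', hr', h1, h2, by rw [h3, k3, k4], ?_⟩⟩
    · rw [h]; exact h4.trans (.left (.refl _ _ _))
    · rw [h]; exact h4.trans (.right (.refl _ _ _))

/-- Converse to `exists_root`: within the optimal pruning below i the subgraph number is passed on
unchanged, down to its leaves. -/
theorem OutInv.exists_edge (hO : OutInv κ g md N s) (hB : Built u v t N g s) {i : ℕ} (hi : i < N)
    {s' : Tri (Fin n)} (hs' : (g i).2.2 = s') {x y : Fin n}
    (hxy : Edge (g i).1 (g i).2.1 (best κ (md i) s') x y) :
    ∃ j < N, s.mem 24 j = s.mem 24 i ∧ s.mem 14 j = x ∧ s.mem 15 j = y := by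
  have base : x = (g i).1 → y = (g i).2.1 →
      ∃ j < N, s.mem 24 j = s.mem 24 i ∧ s.mem 14 j = x ∧ s.mem 15 j = y := by
    rintro rfl rfl
    exact ⟨i, hi, rfl, (hB.ends i hi).1, (hB.ends i hi).2⟩
  induction s' generalizing i with
  | leaf =>
    rw [best_leaf, edge_leaf] at hxy
    exact base hxy.1 hxy.2
  | node c l r ihl ihr =>
    by_cases hm : md i = .cut
    · rw [hm, best_cut, edge_leaf] at hxy
      exact base hxy.1 hxy.2
    rcases hB.node i hi with hn | ⟨c', l', r', n1, n2, n3, n4, n5, n6⟩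
    · rw [hn.2] at hs'; simp at hs'
    rw [hs'] at n1
    simp only [node.injEq] at n1
    obtain ⟨rfl, rfl, rfl⟩ := n1
    have h12 : s.mem 12 i ≠ 0 := by omega
    obtain ⟨k1, k2⟩ := hO.modes i hi c l r hs'
    have k3 := hO.own_snd i hi h12
    have k4 := hO.own_fst i hi h12 hm
    rw [best_node hm, edge_node, ← k1, ← k2] at hxy
    have base' : ∀ j < N, x = (g j).1 → y = (g j).2.1 →
        ∃ j' < N, s.mem 24 j' = s.mem 24 j ∧ s.mem 14 j' = x ∧ s.mem 15 j' = y := by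
      rintro j hj rfl rfl
      exact ⟨j, hj, rfl, (hB.ends j hj).1, (hB.ends j hj).2⟩
    rcases hxy with h | h | h
    · exact base h.1 h.2
    · have := ihl (i := s.mem 12 i) (by omega) (by rw [n5]) (by rw [n5]; exact h)
        (base' _ (by omega))
      rwa [k4] at this
    · have := ihr (i := s.mem 13 i) (by omega) (by rw [n6]) (by rw [n6]; exact h)
        (base' _ (by omega))
      rwa [k3, k4] at this

theorem OutInv.system_subset (hO : OutInv κ g md N s) (hB : Built u v t N g s) {i : ℕ}
    (hi : i < N) : system G κ (md i) (g i).1 (g i).2.1 (g i).2.2 ⊆ system G κ .cut u v t := by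
  refine hB.induction (P := fun i => system G κ (md i) (g i).1 (g i).2.1 (g i).2.2 ⊆
    system G κ .cut u v t) ?_ (fun e he c l r hclr h12 ih => ?_) hi
  · rw [hB.root, hO.mode_zero]
  · obtain ⟨k1, k2⟩ := hO.modes e he c l r hclr
    rw [hclr, system, ← k1, ← k2] at ih
    refine ⟨fun h => ?_, fun h => ?_⟩
    · rw [h]
      exact fun W hW => ih (.inr (.inl hW))
    · rw [h]
      exact fun W hW => ih (.inr (.inr hW))

theorem OutInv.exists_of_mem_system (hO : OutInv κ g md N s) (hB : Built u v t N g s) {i : ℕ}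
    (hi : i < N) {s' : Tri (Fin n)} (hs' : (g i).2.2 = s') {W : G.Subgraph}
    (hW : W ∈ system G κ (md i) (g i).1 (g i).2.1 s') :
    ∃ r < N, s.mem 12 r ≠ 0 ∧ md r = .cut ∧
      W = toSub G (g r).1 (g r).2.1 (best κ .root (g r).2.2) := by
  induction s' generalizing i with
  | leaf => exact hW.elim
  | node c l r ihl ihr =>
    rcases hB.node i hi with hn | ⟨c', l', r', n1, n2, n3, n4, n5, n6⟩
    · rw [hn.2] at hs'; simp at hs'
    rw [hs'] at n1
    simp only [node.injEq] at n1
    obtain ⟨rfl, rfl, rfl⟩ := n1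
    obtain ⟨k1, k2⟩ := hO.modes i hi c l r hs'
    rw [system, ← k1, ← k2] at hW
    rcases hW with ⟨h1, h2⟩ | h | h
    · exact ⟨i, hi, by omega, h1, by rw [hs']; exact h2⟩
    · exact ihl (i := s.mem 12 i) (by omega) (by rw [n5]) (by rw [n5]; exact h)
    · exact ihr (i := s.mem 13 i) (by omega) (by rw [n6]) (by rw [n6]; exact h)

/-- The subgraphs correspond to the edges of mode `cut` with a triangle below them. `exists_root`
shows that each listed edge belongs to its subgraph, and `exists_edge` that no edge is missing. -/
theorem OutInv.holdsFamily (hO : OutInv κ g md N s) (hB : Built u v t N g s)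
    (hG : Good G f u v t) (ht : t ≠ .leaf) :
    ∃ (K : ℕ) (U : Fin K → G.Subgraph), HoldsFamily s U ∧
      Set.range U = system G κ .cut u v t := by
  -- `r k` is the edge at which subgraph number k starts, that is, its cap.
  choose! r hr h12 hcut hown using hO.own_surj
  let U : Fin (s.reg 1) → G.Subgraph := fun k =>
    toSub G (g (r k)).1 (g (r k)).2.1 (best κ .root (g (r k)).2.2)
  have hgood : ∀ i < N, Good G f (g i).1 (g i).2.1 (best κ .root (g i).2.2) := fun i hi =>
    (hG.sub (hB.sub i hi)).prune (shape_best κ _ _).prune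
  have hr' : ∀ i < N, s.mem 12 i ≠ 0 → md i = .cut →
      s.mem 24 (s.mem 12 i) < s.reg 1 ∧ r (s.mem 24 (s.mem 12 i)) = i := by
    intro i hi h1 h2
    have h3 := hO.own_lt i hi h1 h2
    exact ⟨h3, hO.own_inj _ (hr _ h3) _ hi (h12 _ h3) h1 (hcut _ h3) h2 (hown _ h3)⟩
  have adj : ∀ i < N, s.mem 12 i ≠ 0 → md i = .cut → ∀ x y,
      Edge (g i).1 (g i).2.1 (best κ .root (g i).2.2) x y → ∃ k : Fin (s.reg 1),
        (k : ℕ) = s.mem 24 (s.mem 12 i) ∧ (U k).Adj x y := by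
    intro i hi h1 h2 x y hxy
    obtain ⟨h3, h4⟩ := hr' i hi h1 h2
    refine ⟨⟨_, h3⟩, rfl, ?_⟩
    simp only [U, h4]
    exact (hgood i hi).toSub_adj.2 (.inl hxy)
  refine ⟨s.reg 1, U, ⟨rfl, ?_⟩, ?_⟩
  · ext ⟨k, q⟩
    have hent : (k, q) ∈ (fun i => (s.mem 2 i, s(s.mem 3 i, s.mem 4 i))) '' Set.Iio (s.reg 2) ↔
        ∃ x y, HasEntry s k x y ∧ q = s(x, y) := by
      constructor
      · rintro ⟨i, hi, h⟩
        simp only [Prod.mk.injEq] at h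
        exact ⟨_, _, ⟨i, hi, h.1, rfl, rfl⟩, h.2.symm⟩
      · rintro ⟨x, y, ⟨i, hi, h1, h2, h3⟩, rfl⟩
        exact ⟨i, hi, by simp only [h1, h2, h3]⟩
    rw [hent]
    constructor
    · rintro ⟨x, y, hxy, rfl⟩
      obtain ⟨i, hi, rfl, rfl, h⟩ := (hO.entries _ _ _).1 hxy
      clear hxy
      rw [(hB.ends i hi).1, (hB.ends i hi).2]
      have fin : ∀ (j : ℕ), j < N → s.mem 12 j ≠ 0 → md j = .cut → s.mem 24 (s.mem 12 j) = k →
          Edge (g j).1 (g j).2.1 (best κ .root (g j).2.2) (g i).1 (g i).2.1 →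
          (k, s(((g i).1 : ℕ), ((g i).2.1 : ℕ))) ∈ {q : ℕ × Sym2 ℕ | ∃ (k : Fin (s.reg 1))
            (x y : Fin n), (U k).Adj x y ∧ q = ((k : ℕ), s((x : ℕ), (y : ℕ)))} := by
        intro j hj h1 h2 h3 h4
        obtain ⟨k', hk', h5⟩ := adj j hj h1 h2 _ _ h4
        exact ⟨k', _, _, h5, by rw [hk', h3]⟩
      rcases h with h | ⟨h1, h2, h3⟩
      · rcases hO.exists_root hB hi with rfl | ⟨j, hj, h1, h2, h3, h4⟩
        -- The root-edge belongs to no earlier subgraph, but its initial number 0 is also that of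
        -- the first subgraph, whose cap it is; so the additional entry is correct.
        · have h1 : s.mem 12 0 ≠ 0 := by
            rcases hB.node 0 hB.pos with hn | ⟨_, _, _, _, hn, _⟩
            · rw [hB.root] at hn
              exact absurd hn.2 ht
            · omega
          exact fin 0 hi h1 hO.mode_zero (by rw [hO.first hi h1, ← h, hO.own_zero])
            (edge_base _ _ _)
        · exact fin j hj h1 h2 (h3.trans h) h4.edge
      · exact fin i hi h1 h2 h3 (edge_base _ _ _)
    · rintro ⟨k', x, y, h1, h2⟩
      simp only [Prod.mk.injEq] at h2
      obtain ⟨rfl, rfl⟩ := h2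
      have hk := k'.2
      have key : ∀ x y, Edge (g (r k')).1 (g (r k')).2.1 (best κ .root (g (r k')).2.2) x y →
          HasEntry s k' x y := by
        intro x y hxy
        rw [hO.entries]
        have hi := hr k' hk
        have hj := h12 k' hk
        rcases hB.node _ hi with hn | ⟨c, l, r', n1, n2, n3, n4, n5, n6⟩
        · exact absurd hn.1 hj
        obtain ⟨k1, k2⟩ := hO.modes _ hi c l r' n1
        have k3 := hO.own_snd _ hi hj
        rw [n1, best_node (by simp), edge_node, ← choice_cut, ← hcut k' hk, ← k1, ← k2] at hxy
        rcases hxy with ⟨rfl, rfl⟩ | hxy | hxy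
        · exact ⟨_, hi, (hB.ends _ hi).1, (hB.ends _ hi).2, .inr ⟨hj, hcut k' hk, hown k' hk⟩⟩
        · obtain ⟨j, hj, e1, e2, e3⟩ := hO.exists_edge hB (i := s.mem 12 (r k')) (by omega)
            (by rw [n5]) (by rw [n5]; exact hxy)
          exact ⟨j, hj, e2, e3, .inl (by rw [e1, hown k' hk])⟩
        · obtain ⟨j, hj, e1, e2, e3⟩ := hO.exists_edge hB (i := s.mem 13 (r k')) (by omega)
            (by rw [n6]) (by rw [n6]; exact hxy)
          exact ⟨j, hj, e2, e3, .inl (by rw [e1, k3, hown k' hk])⟩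
      rcases (hgood _ (hr k' hk)).toSub_adj.1 h1 with h | h
      · exact ⟨_, _, key _ _ h, rfl⟩
      · exact ⟨_, _, key _ _ h, Sym2.eq_swap⟩
  · ext W
    constructor
    · rintro ⟨k, rfl⟩
      have hi := hr k k.2
      refine hO.system_subset hB hi ?_
      rcases hB.node _ hi with hn | ⟨c, l, r', n1, -⟩
      · exact absurd hn.1 (h12 k k.2)
      · rw [hcut k k.2, n1]
        exact .inl ⟨rfl, by simp only [U, n1]⟩
    · intro hW
      have h0 : (g 0).2.2 = t := by rw [hB.root]
      obtain ⟨i, hi, h1, h2, h3⟩ := hO.exists_of_mem_system hB hB.pos h0 (W := W) (by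
        rw [hB.root, hO.mode_zero]; exact hW)
      obtain ⟨h4, h5⟩ := hr' i hi h1 h2
      exact ⟨⟨_, h4⟩, by simp only [U, h5, h3]⟩

end RAM

/-! ### The complete algorithm -/

namespace RAM

open RAM.Program RAM.Expr Tri

theorem algorithm_ends (κ : SystemKind) : ∃ C, ∀ (n : ℕ) (G : SimpleGraph (Fin n)) (u v : Fin n),
    IsMaximalOuterplanar G → IsNonCutting (⊤ : G.Subgraph) u v → ∀ s, IsInput G u v s →
    Ends (algorithm κ) s (C * n) fun s' => s'.reg 0 = rootedDepth κ (⊤ : G.Subgraph) u v ∧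
      ∃ (K : ℕ) (U : Fin K → G.Subgraph), HoldsFamily s' U ∧
        IsSystem κ (⊤ : G.Subgraph) u v (Set.range U)
          (rootedDepth κ (⊤ : G.Subgraph) u v) := by
  obtain ⟨C₁, hC₁⟩ := evaluateAll_ends κ
  obtain ⟨C₂, hC₂⟩ := output_ends κ
  refine ⟨6400 + 4 * C₁ + 4 * C₂, fun n G u v hG huv s hin => ?_⟩
  obtain ⟨f, t, hgood, htop⟩ := exists_good_of_nonCutting hG huv
  have hn : 3 ≤ n := by simpa using hG.1
  have hf := hgood.inj
  have hs := hgood.sorted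
  have hadj : ∀ x y, G.Adj x y ↔ Edge u v t x y ∨ Edge u v t y x := fun x y => by
    rw [← hgood.toSub_adj, htop, SimpleGraph.Subgraph.top_adj]
  have hvert : ∀ x, Vert u v t x := fun x => by
    rw [← mem_verts_toSub (G := G), htop]; trivial
  have huv' : u ≠ v := huv.1.ne
  have ht : t ≠ .leaf := by
    rintro rfl
    have h1 := (vert_finite_ncard hs).2
    rw [Set.eq_univ_of_forall (s := {x | Vert u v .leaf x}) hvert, Set.ncard_univ,
      Nat.card_fin] at h1
    simp [Tri.inner] at h1
    omega
  have hdepth := hgood.rootedDepth_eq (κ := κ) ht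
  have hsys := hgood.isSystem_system (κ := κ) ht
  rw [htop] at hdepth hsys
  rw [hdepth]
  have fr : ∀ {s' : State} (k : ℕ), 5 ≤ k → s'.mem k = s.mem k → ∀ i, s'.mem k i = 0 :=
    fun k hk h i => by rw [h, hin.mem_else k (by omega)]
  refine (((initDegrees_ends hin.reg_zero hin.reg_one hin.reg_two
      (by rwa [Ne, Fin.val_inj])).frame (Q' := fun s' =>
      (∀ x : Fin n, s'.mem 5 x = degreeOut G u v ∅ x) ∧ (∀ i < 3, s'.reg i = s.reg i) ∧
      ∀ k, k ≠ 5 → s'.mem k = s.mem k) ?_).seq fun s₁ hs₁ =>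
    ((initQueue_ends (s := s₁) (n := n) (by rw [hs₁.2.1 0 (by decide), hin.reg_zero])).frame
      (Q' := fun s' => (∃ k : List (Fin n), k.Nodup ∧ (∀ x, x ∈ k ↔ s'.mem 5 x ≤ 2) ∧
        s'.reg 4 = k.length ∧ Holds (s'.mem 6) k) ∧
      (∀ x : Fin n, s'.mem 5 x = degreeOut G u v ∅ x) ∧ (∀ i < 3, s'.reg i = s.reg i) ∧
      ∀ k, k ≠ 5 → k ≠ 6 → s'.mem k = s.mem k) ?_).seq fun s₂ hs₂ =>
    (Ends.frame (p := eliminate) (c := 2000 * n + 2000) (Q' := fun s' => (∃ d : List (Fin n), d.Nodup ∧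
      (∀ x, x ∈ d ↔ x ≠ u ∧ x ≠ v) ∧ s'.reg 4 = d.length ∧ Holds (s'.mem 6) d ∧
      Elim u v t (s'.mem 8) (s'.mem 9) d) ∧ (∀ i < 3, s'.reg i = s.reg i) ∧
      ∀ k, 10 ≤ k → s'.mem k = s.mem k) (by
        obtain ⟨⟨k, k1, k2, k3, k4⟩, k5, k6, k7⟩ := hs₂
        exact eliminate_ends hin hG hf hs hadj hvert (k7 0 (by decide) (by decide))
          (k7 1 (by decide) (by decide)) (fr 7 (by decide) (k7 7 (by decide) (by decide))) k5 k1 k2 k3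
          k4) ?_).seq fun s₃ hs₃ =>
    (Ends.frame (p := build) (c := 1000 * n + 1000) (Q' := fun s' => (s'.reg 10 ≤ 2 * n + 1 ∧
      ∃ g, Built u v t (s'.reg 10) g s') ∧ ∀ k, 16 ≤ k → s'.mem k = s.mem k) (by
        obtain ⟨⟨d, k1, k2, k3, k4, k5⟩, k6, k7⟩ := hs₃
        exact build_ends hf hs ((k6 0 (by decide)).trans hin.reg_zero)
          ((k6 1 (by decide)).trans hin.reg_one) ((k6 2 (by decide)).trans hin.reg_two)
          (fr 12 (by decide) (k7 12 (by decide))) (fr 11 (by decide) (k7 11 (by decide))) k1 k2 k3 k4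
          k5) ?_).seq fun s₄ hs₄ =>
    (Ends.frame (p := evaluateAll κ) (c := C₁ * (2 * n + 2))
      (Q := fun s' => ∃ g, Built u v t (s₄.reg 10) g s₄ ∧ ∀ m : Mode, ∀ e < s₄.reg 10,
        s'.mem (16 + m.code) e = val κ m (g e).2.2) (Q' := fun s' =>
      s'.reg 10 ≤ 2 * n + 1 ∧
      ∃ g, Built u v t (s'.reg 10) g s' ∧
        (∀ m : Mode, ∀ e < s'.reg 10, s'.mem (16 + m.code) e = val κ m (g e).2.2) ∧
        (∀ i, s'.mem 23 i = 0) ∧ s'.mem 24 0 = 0) (by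
        obtain ⟨⟨k1, g, hB⟩, k2⟩ := hs₄
        exact (hC₁ hB fun m => fr _ (by omega) (k2 _ (by omega))).mono
          (c' := C₁ * (2 * n + 2)) (by
            have := Nat.mul_le_mul_left C₁ (by omega : s₄.reg 10 + 1 ≤ 2 * n + 2)
            rw [mul_add] at this
            omega) fun _ h => ⟨g, hB, h⟩) ?_).seq
      (c' := C₂ * (2 * n + 2)) (Q' := fun s' => s'.reg 0 = val κ .cut t ∧
        ∃ (K : ℕ) (U : Fin K → G.Subgraph), HoldsFamily s' U ∧
        IsSystem κ (⊤ : G.Subgraph) u v (Set.range U) (val κ .cut t)) fun s₅ hs₅ => ?_).mono ?_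
      fun _ h => h
  · intro s' h1 h2 h3
    refine ⟨fun x => ?_, fun i hi => h2 i ?_, fun k hk => h3 k ?_⟩
    · rw [h1 x x.2, degreeOut, Set.sdiff_empty, hin.ncard_neighborSet]
      simp only [Fin.val_inj]
    · interval_cases i <;> rfl
    · simp [initDegrees, seqs, Program.setsMem, hk]
  · intro s' h1 h2 h3
    have h5 : s'.mem 5 = s₁.mem 5 := h3 5 rfl
    refine ⟨by rw [h5]; exact h1, by rw [h5]; exact hs₁.1, fun i hi => ?_, fun k hk hk' => ?_⟩
    · rw [← hs₁.2.1 i hi]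
      refine h2 i ?_
      interval_cases i <;> rfl
    · rw [← hs₁.2.2 k hk]
      exact h3 k (by simp [initQueue, push, seqs, Program.setsMem, hk'])
  · intro s' h1 h2 h3
    refine ⟨h1, fun i hi => ?_, fun k hk => ?_⟩
    · rw [← hs₂.2.2.1 i hi]
      refine h2 i ?_
      interval_cases i <;> rfl
    · rw [← hs₂.2.2.2 k (by omega) (by omega)]
      refine h3 k ?_
      simp [eliminate, scan, lower, push, seqs, Program.setsMem]
      omega
  · intro s' h1 h2 h3
    refine ⟨h1, fun k hk => ?_⟩
    rw [← hs₃.2.2 k (by omega)]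
    refine h3 k ?_
    simp [build, swap, seqs, Program.setsMem]
    omega
  · rintro s' ⟨g, hB, h1⟩ h2 h3
    have hreg : s'.reg 10 = s₄.reg 10 := h2 10 (by cases κ <;> rfl)
    have hmem : ∀ k, k < 16 ∨ 22 < k → s'.mem k = s₄.mem k := by
      intro k hk
      refine h3 k ?_
      simp [evaluateAll, evaluateStep, evaluate, maxInto, Mode.all, Mode.code, seqs,
        Program.setsMem]
      omega
    rw [hreg]
    refine ⟨hs₄.1.1, g, hB.congr (hmem _ (by decide)) (hmem _ (by decide)) (hmem _ (by decide))
      (hmem _ (by decide)), h1, fr 23 (by decide) ?_, fr 24 (by decide) ?_ 0⟩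
    · rw [hmem 23 (by decide), hs₄.2 23 (by decide)]
    · rw [hmem 24 (by decide), hs₄.2 24 (by decide)]
  · obtain ⟨k1, g, hB, k2, k3, k4⟩ := hs₅
    refine (hC₂ hf hs hB k2 k3 k4).mono ?_ ?_
    · have := Nat.mul_le_mul_left C₂ (by omega : s₅.reg 10 + 1 ≤ 2 * n + 2)
      rw [mul_add] at this
      omega
    · rintro s' ⟨md, hO, hB', h0⟩
      obtain ⟨K, U, h1, h2⟩ := hO.holdsFamily hB' hgood ht
      exact ⟨h0, K, U, h1, by rw [h2]; exact hsys⟩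
  -- The first four phases take at most 3200(n + 1) steps. All additive constants are absorbed
  -- because n is at least 3.
  · have e1 := Nat.mul_le_mul_left C₁ (by omega : 2 * n + 2 ≤ 4 * n)
    have e2 := Nat.mul_le_mul_left C₂ (by omega : 2 * n + 2 ≤ 4 * n)
    have e3 : (6400 + 4 * C₁ + 4 * C₂) * n = 6400 * n + C₁ * (4 * n) + C₂ * (4 * n) := by ring
    omega

theorem exists_algorithm (κ : SystemKind) : ∃ (p : Program) (C : ℕ),
    ∀ (n : ℕ) (G : SimpleGraph (Fin n)) (u v : Fin n), IsMaximalOuterplanar G →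
      IsNonCutting (⊤ : G.Subgraph) u v → ∀ s, IsInput G u v s →
        ∃ (t : ℕ) (s' : State), Exec (C * n) p s t s' ∧ t ≤ C * n ∧
          s'.reg 0 = rootedDepth κ (⊤ : G.Subgraph) u v ∧
          ∃ (K : ℕ) (U : Fin K → G.Subgraph), HoldsFamily s' U ∧
            IsSystem κ (⊤ : G.Subgraph) u v (Set.range U)
              (rootedDepth κ (⊤ : G.Subgraph) u v) := by
  obtain ⟨C, hC⟩ := algorithm_ends κ
  -- K is at least 1 so that the bound 4n + K C n on the words also bounds the running time; 4n
  -- bounds the words of the input.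
  obtain ⟨K, hK, hK'⟩ : ∃ K, (algorithm κ).inc ≤ K ∧ 1 ≤ K := ⟨_, Nat.le_succ _, by omega⟩
  refine ⟨algorithm κ, 4 + K * C, fun n G u v hG huv s hin => ?_⟩
  obtain ⟨t, s', h1, h2, h3⟩ := hC n G u v hG huv s hin
  have h4 : 4 * n + K * t ≤ (4 + K * C) * n := by
    rw [add_mul, mul_assoc]
    exact Nat.add_le_add_left (Nat.mul_le_mul_left K h2) _
  have h5 := Nat.le_mul_of_pos_left t hK'
  exact ⟨t, s', (h1.exec (4 * n) (algorithm_simple κ) hK (hin.bounded hG) h4).1, by omega, h3⟩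

end RAM

theorem mainTheorem3 :
    (∀ (V : Type u) (G : SimpleGraph V) (u v : V), IsMaximalOuterplanar G →
      IsNonCutting (⊤ : G.Subgraph) u v →
      bd G u v u v = rootedDepth .bonnet (⊤ : G.Subgraph) u v ∧
      ∀ a b, G.Adj a b →
        (IsSingleEdge G u v a b →
          bd G u v a b = 0 ∧ bdHandle G u v a b = 1 ∧
          bdFanLeft G u v a b = 1 ∧ bdFanRight G u v a b = 1 ∧
          bdPartialLeft G u v a b = 1 ∧ bdPartialRight G u v a b = 1) ∧
        (¬ IsSingleEdge G u v a b →
          (∃! c, (hanging (⊤ : G.Subgraph) u v a b).Adj a c ∧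
            (hanging (⊤ : G.Subgraph) u v a b).Adj c b) ∧
          ∀ c, (hanging (⊤ : G.Subgraph) u v a b).Adj a c →
            (hanging (⊤ : G.Subgraph) u v a b).Adj c b →
            bd G u v a b = max (bdPartialLeft G u v a c) (bdPartialRight G u v c b) ∧
            bdHandle G u v a b =
              min (max (bdHandle G u v a c) (1 + bd G u v c b))
                (max (1 + bd G u v a c) (bdHandle G u v c b)) ∧
            bdFanLeft G u v a b = max (bdFanLeft G u v a c) (1 + bd G u v c b) ∧
            bdFanRight G u v a b = max (1 + bd G u v a c) (bdFanRight G u v c b) ∧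
            bdPartialLeft G u v a b =
              min (max (bdPartialLeft G u v a c) (1 + bd G u v c b))
                (max (bdFanLeft G u v a c) (bdHandle G u v c b)) ∧
            bdPartialRight G u v a b =
              min (max (1 + bd G u v a c) (bdPartialRight G u v c b))
                (max (bdHandle G u v a c) (bdFanRight G u v c b)))) ∧
    (∀ κ : SystemKind, ∃ (p : RAM.Program) (C : ℕ),
      ∀ (n : ℕ) (G : SimpleGraph (Fin n)) (u v : Fin n), IsMaximalOuterplanar G →
        IsNonCutting (⊤ : G.Subgraph) u v →
        ∀ s, RAM.IsInput G u v s →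
          ∃ (t : ℕ) (s' : RAM.State), RAM.Exec (C * n) p s t s' ∧ t ≤ C * n ∧
            s'.reg 0 = rootedDepth κ (⊤ : G.Subgraph) u v ∧
            ∃ (K : ℕ) (U : Fin K → G.Subgraph), RAM.HoldsFamily s' U ∧
              IsSystem κ (⊤ : G.Subgraph) u v (Set.range U)
                (rootedDepth κ (⊤ : G.Subgraph) u v)) := by
  exact ⟨fun _ _ _ _ hG huv => recurrences hG huv, RAM.exists_algorithm⟩
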